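/- Let $n,T,D\ge 1$ be integers and let $f\in\mathbb C[x_1,\dots,x_n]$ have at most $T$ terms and total degree less than $D$, given by a black box $B_f$ that returns values of $f$. For $s\in\mathbb N^n$ put $f_s=f(x^{s_1},\dots,x^{s_n})\in\mathbb C[x]$. For integers $d\ge1$ and a prime $p$ let $s(d,p)=(d^{k-1}\bmod p)_{k=1}^n$, and let $s(d,p,k)$ be $s(d,p)$ with $p$ added to its $k$-th entry; write $f_{(d,p)}$, $f_{(d,p,k)}$ for the corresponding $f_s$, and $f^{\rm mod}_{(d,p)}=f_{(d,p)}\bmod(x^p-1)$. Write $\#g$ for the number of terms of $g$. **Algorithm MIPolyBase.** Input: $B_f,T,D$. For a term bound $T'$ put $\delta_1=(n-1)\max(T'-1,0)$, $\delta_2=(n-1)T'$, $N=\max(4\delta_1+1,\delta_1+\delta_2+1)$. Start with $T'=T$, $h=0$, and the smallest prime $p\ge\max(n,N,D)$. Interpolate $f_{(d,p)}$ for $d=1,\dots,N$. While some $(f-h)^{\rm mod}_{(d,p)}$, $1\le d\le N$, is nonzero: (a) let $d_0$ be the first $d\le N$ for which $\#(f-h)^{\rm mod}_{(d,p)}$ is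 maximal, interpolate $f_{(d_0,p,k)}$ for $k=1,\dots,n$ and subtract $h_{(d_0,p,k)}$; (b) for each term $a x^r$ of $(f-h)^{\rm mod}_{(d_0,p)}$ for which the parts with exponents $\equiv r \pmod p$ of $(f-h)_{(d_0,p)}$ and of all $(f-h)_{(d_0,p,k)}$ are single terms $ax^{\gamma}$ and $ax^{\beta_k}$, the numbers $e_k=(\beta_k-\gamma)/p$ are in $\mathbb N$, $\gamma=\sum_k e_k(d_0^{k-1}\bmod p)$ and $\sum_k e_k<D$, take $a x_1^{e_1}\cdots x_n^{e_n}$ as a candidate; (c) keep those candidates $u$ for which $\#(f-h-u)^{\rm mod}_{(d,p)}<\#(f-h)^{\rm mod}_{(d,p)}$ for at least $\delta_2+1$ of the $d\in\{1,\dots,\delta_1+\delta_2+1\}$; (d) add the kept terms to $h$, lower $T'$ by their number, recompute $\delta_1,\delta_2,N$, and update all polynomials. Return $h$. **Univariate interpolation** is by Ben-Or and Tiwari's algorithm: a polynomial $g=f_s$ with at most $T$ terms and $\deg g<G$ (with $G=Dp$ for $f_{(d,p)}$ and $G=2Dp$ for $f_{(d,p,k)}$) is found by querying $a_j=g(2^j)=f(2^{js_1},\dots,2^{js_n})$,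 $0\le j<2T$, taking the rank $t$ of the Hankel matrix $(a_{i+j})_{i,j<T}$, the monic auxiliary polynomial of degree $t$ from the Hankel system of size $t$, its roots $2^e$ with $0\le e<G$, and the coefficients from the transposed Vandermonde system. **Bit operations.** These are counted for coefficients in $\mathbb Q(i)$, represented by numerators and denominators in lowest terms. In MIPolyBase, integer and coefficient operations are charged as schoolbook arithmetic on bits. A query is charged the bit length of the exponents $js_1,\dots,js_n$ that describe the point, and of the value returned. The computation of the interpolant from the values $a_j$ is charged the cost of a fixed program $P$ over integers and pairs (with bounded loops), where a structural step costs $1$, addition, subtraction and comparison cost the bit length of the operands, and multiplication and division of operands of total bit length $L$ cost $L\log^2 L$ (fast integer arithmetic). $P$ is to compute, for all $T,G$ and every $g\in\mathbb Q(i)[x]$ with at most $T$ terms and degree less than $G$, the interpolant from $T$, $G$ and the values $a_0,\dots,a_{2T-1}$. **Claim.** (1) For every such $f\in\mathbb C[x_1,\dots,x_n]$ the algorithm terminates and returns the list of terms of $f$, each once, and it makes $O(nT^2)$ queries of $B_f$, with an absolute constant. (2) There is such a program $P$ with which, for coefficients of bit size $O(1)$, the algorithm costs $\tilde O(nT^3D\max(nT,D))$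 bit operations. That is, there is $k$ such that for every $H$ there is a constant $C$ with the following property: for all $n,T,D\ge1$ and all $f$ as above whose coefficients are in $\mathbb Q(i)$ and have bit size at most $H$, the number of bit operations is at most $C\,X\log^k(2+X)$, where $X=nT^3D\max(nT,D)$. -/

import Mathlib

/-!
Sparse interpolation of a black-box polynomial `f ∈ ℂ[x₁,…,xₙ]` by base changing Kronecker
substitutions, with Ben-Or and Tiwari's algorithm as univariate interpolation, together with the
cost measures (number of black-box queries, number of bit operations).
-/

namespace SparseInterp

noncomputable section

/-! ### Sizes -/

/-- Number of bits charged for handling the natural number `m`. -/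
def bitLen (m : ℕ) : ℕ := Nat.size m + 1

/-- Number of bits charged for handling the integer `z`. -/
def intLen (z : ℤ) : ℕ := Nat.size z.natAbs + 1

/-- Total bit length of numerator and denominator in lowest terms. -/
def ratSize (q : ℚ) : ℕ := Nat.size q.num.natAbs + Nat.size q.den

open Classical in
/-- The rational number that a real number is equal to (`0` for an irrational number). -/
def toRat (x : ℝ) : ℚ := if h : ∃ q : ℚ, (q : ℝ) = x then h.choose else 0

theorem toRat_cast (q : ℚ) : toRat (q : ℝ) = q := by
  have h : ∃ r : ℚ, (r : ℝ) = (q : ℝ) := ⟨q, rfl⟩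
  rw [toRat, dif_pos h]
  exact_mod_cast h.choose_spec

/-- `z` is a Gaussian rational, that is `z ∈ ℚ(i)`. -/
def IsGaussRat (z : ℂ) : Prop := (∃ q : ℚ, (q : ℝ) = z.re) ∧ ∃ q : ℚ, (q : ℝ) = z.im

/-- Bit size of a Gaussian rational (only meaningful for Gaussian rationals). -/
def bitSize (z : ℂ) : ℕ := ratSize (toRat z.re) + ratSize (toRat z.im)

/-! ### Programs with a bit cost

A small imperative language over integers and pairs (pointer structures).  It has bounded loops
only, so that every program terminates.  Structural operations cost `1`, additions, subtractions
and comparisons cost the length of the operands, multiplications and divisions with remainder of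
operands of total length `L` cost `L (log L)²`, which is the cost, up to a constant, of fast
integer arithmetic on bits. -/

/-- Data: integers and pairs.  A list is coded by `pair head tail`, ended by `int 0`. -/
inductive Data where
  | int (z : ℤ) : Data
  | pair (a b : Data) : Data

/-- Programs.  Each program maps one datum to one datum. -/
inductive Prog where
  | id : Prog
  | const (z : ℤ) : Prog
  | comp (p q : Prog) : Prog
  | pair (p q : Prog) : Prog
  | fst : Prog
  | snd : Prog
  | isPair : Prog
  | add : Prog
  | sub : Prog
  | mul : Prog
  | div : Prog
  | mod : Prog
  | le : Prog
  | ite (c p q : Prog) : Prog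
  | loop (p : Prog) : Prog

namespace Data

/-- The integer at a leaf; a pair counts as `0`. -/
def toInt : Data → ℤ
  | int z => z
  | pair _ _ => 0

/-- First component; an integer is left unchanged. -/
def left : Data → Data
  | int z => int z
  | pair a _ => a

/-- Second component; an integer is left unchanged. -/
def right : Data → Data
  | int z => int z
  | pair _ b => b

/-- `1` on pairs, `0` on integers. -/
def pairFlag : Data → ℤ
  | int _ => 0
  | pair _ _ => 1

end Data

/-- Total length of the two integers an arithmetic instruction is applied to. -/
def argLen (x : Data) : ℕ := intLen x.left.toInt + intLen x.right.toInt

/-- Bit cost of fast multiplication or division on operands of total length `L`. -/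
def softMul (L : ℕ) : ℕ := L * Nat.size L ^ 2

namespace Prog

/-- The value and the bit cost of running a program on a datum.  `comp p q` runs `p` first;
`loop p`, on the datum `pair (int m) x`, runs `p` `m` times, starting at `x`. -/
def run : Prog → Data → Data × ℕ
  | id, x => (x, 1)
  | const z, _ => (Data.int z, intLen z)
  | comp p q, x => ((q.run (p.run x).1).1, (p.run x).2 + (q.run (p.run x).1).2 + 1)
  | pair p q, x => (Data.pair (p.run x).1 (q.run x).1, (p.run x).2 + (q.run x).2 + 1)
  | fst, x => (x.left, 1)
  | snd, x => (x.right, 1)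
  | isPair, x => (Data.int x.pairFlag, 1)
  | add, x => (Data.int (x.left.toInt + x.right.toInt), argLen x)
  | sub, x => (Data.int (x.left.toInt - x.right.toInt), argLen x)
  | mul, x => (Data.int (x.left.toInt * x.right.toInt), softMul (argLen x))
  | div, x => (Data.int (x.left.toInt / x.right.toInt), softMul (argLen x))
  | mod, x => (Data.int (x.left.toInt % x.right.toInt), softMul (argLen x))
  | le, x => (Data.int (if x.left.toInt ≤ x.right.toInt then 1 else 0), argLen x)
  | ite c p q, x =>
      if (c.run x).1.toInt ≠ 0 then ((p.run x).1, (c.run x).2 + (p.run x).2 + 1)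
      else ((q.run x).1, (c.run x).2 + (q.run x).2 + 1)
  | loop p, x =>
      (fun s : Data × ℕ => ((p.run s.1).1, s.2 + (p.run s.1).2 + 1))^[x.left.toInt.toNat]
        (x.right, intLen x.left.toInt)

end Prog

/-! ### Sparse polynomials -/

/-- A sparse univariate polynomial: its terms `(exponent, coefficient)`, by increasing exponent. -/
abbrev UPoly : Type := List (ℕ × ℂ)

/-- A multivariate term: the list of its `n` exponents and its coefficient. -/
abbrev Term : Type := List ℕ × ℂ

/-- The exponent vector written as a list. -/
def expVec (n : ℕ) (l : List ℕ) : Fin n →₀ ℕ :=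
  Finsupp.equivFunOnFinite.symm fun i => l.getD i 0

/-- `L` is the exact sparse form of `f`: it lists every term of `f`, each of them once. -/
def IsSparseForm {n : ℕ} (L : List Term) (f : MvPolynomial (Fin n) ℂ) : Prop :=
  (L.map fun u => (expVec n u.1, u.2)).Perm (f.support.toList.map fun m => (m, f.coeff m))

/-- Coding of lists as data. -/
def encList : List Data → Data
  | [] => Data.int 0
  | x :: l => Data.pair x (encList l)

/-- Coding of rational numbers as data, in lowest terms. -/
def encRat (q : ℚ) : Data := Data.pair (Data.int q.num) (Data.int q.den)

/-- Coding of Gaussian rationals as data. -/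
def encComplex (z : ℂ) : Data := Data.pair (encRat (toRat z.re)) (encRat (toRat z.im))

/-- Coding of sparse univariate polynomials as data. -/
def encUPoly (g : UPoly) : Data :=
  encList (g.map fun t => Data.pair (Data.int t.1) (encComplex t.2))

/-! ### Ben-Or and Tiwari's algorithm

Input: a bound `T` on the number of terms of a univariate polynomial `g`, a bound `G > deg g`, and
the values `a j = g (2 ^ j)` for `j < 2 T`. -/

namespace BenOrTiwari

/-- The Hankel matrix of size `t` of the sequence of values. -/
def hankel (a : ℕ → ℂ) (t : ℕ) : Matrix (Fin t) (Fin t) ℂ :=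
  Matrix.of fun i j => a ((i : ℕ) + (j : ℕ))

/-- The number of terms. -/
def numTerms (a : ℕ → ℂ) (T : ℕ) : ℕ := (hankel a T).rank

/-- The lower coefficients of the auxiliary polynomial, from the Hankel system
`∑ j, a (i + j) * l j = - a (i + t)`, `i < t`. -/
def lowerCoeffs (a : ℕ → ℂ) (t : ℕ) : Fin t → ℂ :=
  Matrix.mulVec (hankel a t)⁻¹ fun i => - a ((i : ℕ) + t)

/-- The auxiliary polynomial, monic of degree `t`. -/
def auxPoly (a : ℕ → ℂ) (t : ℕ) : Polynomial ℂ :=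
  Polynomial.X ^ t + ∑ j : Fin t, Polynomial.C (lowerCoeffs a t j) * Polynomial.X ^ (j : ℕ)

/-- The exponents: the roots of the auxiliary polynomial are the powers `2 ^ e`. -/
def exponents (a : ℕ → ℂ) (t G : ℕ) : Finset ℕ :=
  (Finset.range G).filter fun e => (auxPoly a t).eval ((2 : ℂ) ^ e) = 0

/-- Position of `e` in the finite set `S`. -/
def position (S : Finset ℕ) (e : ℕ) : ℕ := (S.filter fun e' => e' < e).card

/-- The transposed Vandermonde matrix of the nodes `2 ^ e`, `e ∈ S`. -/
def vandermonde (S : Finset ℕ) : Matrix S S ℂ :=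
  Matrix.of fun r e => ((2 : ℂ) ^ (e : ℕ)) ^ position S (r : ℕ)

/-- The coefficients, from the system `∑ e ∈ S, c e * (2 ^ e) ^ j = a j`, `j < #S`. -/
def coeffs (a : ℕ → ℂ) (S : Finset ℕ) : S → ℂ :=
  Matrix.mulVec (vandermonde S)⁻¹ fun r => a (position S (r : ℕ))

/-- The terms with exponents in `S`, by increasing exponent. -/
def terms (a : ℕ → ℂ) (S : Finset ℕ) : UPoly :=
  (S.sort (fun x y => x ≤ y)).map fun e => (e, if h : e ∈ S then coeffs a S ⟨e, h⟩ else 0)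

/-- The interpolant that is computed from the list of values. -/
def interpolant (T G : ℕ) (values : List ℂ) : UPoly :=
  let a : ℕ → ℂ := fun j => values.getD j 0
  terms a (exponents a (numTerms a T) G)

/-- The coded input of a program for Ben-Or and Tiwari's algorithm. -/
def input (T G : ℕ) (values : List ℂ) : Data :=
  Data.pair (Data.int T) (Data.pair (Data.int G) (encList (values.map encComplex)))

/-- The program `P` carries out Ben-Or and Tiwari's algorithm: from the values of any polynomial
over `ℚ(i)` of degree less than `G` with at most `T` terms at `2 ^ 0, …, 2 ^ (2 T - 1)` it computes
the interpolant. -/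
def IsImplementation (P : Prog) : Prop :=
  ∀ (T G : ℕ) (g : Polynomial ℂ), g.natDegree < G → g.support.card ≤ T →
    (∀ i, IsGaussRat (g.coeff i)) →
    ∀ values : List ℂ, values = (List.range (2 * T)).map (fun j => g.eval ((2 : ℂ) ^ j)) →
      (P.run (input T G values)).1 = encUPoly (interpolant T G values)

end BenOrTiwari

/-! ### Computations with costs -/

/-- A computation: its result, its number of queries of the black box, its number of bit
operations. -/
structure Comp (α : Type) where
  val : α
  queries : ℕ
  bits : ℕ

namespace Comp

instance : Monad Comp where
  pure a := ⟨a, 0, 0⟩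
  bind x f := ⟨(f x.val).val, x.queries + (f x.val).queries, x.bits + (f x.val).bits⟩

/-- The value `v`, obtained with `b` bit operations and no query. -/
def charge {α : Type} (b : ℕ) (v : α) : Comp α := ⟨v, 0, b⟩

/-- Apply `f` to all elements of a list. -/
def mapList {α β : Type} (f : α → Comp β) : List α → Comp (List β)
  | [] => charge 1 []
  | x :: l => do
    let y ← f x
    let ys ← mapList f l
    charge 1 (y :: ys)

/-- Apply `f` to all elements of a list and keep the results that exist. -/
def filterMapList {α β : Type} (f : α → Comp (Option β)) : List α → Comp (List β)
  | [] => charge 1 []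
  | x :: l => do
    let y ← f x
    let ys ← filterMapList f l
    match y with
    | none => charge 1 ys
    | some y' => charge 1 (y' :: ys)

/-- The elements of a list that pass a test. -/
def filterList {α : Type} (f : α → Comp Bool) : List α → Comp (List α)
  | [] => charge 1 []
  | x :: l => do
    let b ← f x
    let ys ← filterList f l
    charge 1 (if b then x :: ys else ys)

/-- Run through a list from the left, updating a state. -/
def foldList {α β : Type} (f : β → α → Comp β) : β → List α → Comp β
  | s, [] => charge 1 s
  | s, x :: l => do
    let s' ← f s x
    let r ← foldList f s' l
    charge 1 r

/-- The first `m` elements of a list. -/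
def takeList {α : Type} (m : ℕ) (l : List α) : Comp (List α) := charge (m + 1) (l.take m)

/-- The length of a list. -/
def lengthList {α : Type} (l : List α) : Comp ℕ := charge (l.length + 1) l.length

end Comp

open SparseInterp.Comp

/-! Natural numbers, with the costs of schoolbook arithmetic. -/

def addN (a b : ℕ) : Comp ℕ := charge (bitLen a + bitLen b) (a + b)
def subN (a b : ℕ) : Comp ℕ := charge (bitLen a + bitLen b) (a - b)
def mulN (a b : ℕ) : Comp ℕ := charge (bitLen a * bitLen b) (a * b)
def divN (a b : ℕ) : Comp ℕ := charge (bitLen a * bitLen b) (a / b)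
def modN (a b : ℕ) : Comp ℕ := charge (bitLen a * bitLen b) (a % b)
def maxN (a b : ℕ) : Comp ℕ := charge (bitLen a + bitLen b) (max a b)
def ltN (a b : ℕ) : Comp Bool := charge (bitLen a + bitLen b) (decide (a < b))
def eqN (a b : ℕ) : Comp Bool := charge (bitLen a + bitLen b) (decide (a = b))

/-! Coefficients: one ring operation or comparison is charged the square of the bit size of its
operands. -/

def addC (a b : ℂ) : Comp ℂ := charge ((bitSize a + bitSize b + 1) ^ 2) (a + b)
def negC (a : ℂ) : Comp ℂ := charge ((bitSize a + 1) ^ 2) (-a)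
def eqC (a b : ℂ) : Comp Bool := charge ((bitSize a + bitSize b + 1) ^ 2) (decide (a = b))

/-- One query: the value of the black box at the point `(2 ^ E₁, …, 2 ^ Eₙ)`.  The point is passed
to the black box by its exponents; writing them and reading the value is charged. -/
def query {n : ℕ} (B : (Fin n → ℂ) → ℂ) (E : List ℕ) : Comp ℂ :=
  let v := B fun i => (2 : ℂ) ^ E.getD i 0
  ⟨v, 1, (E.map bitLen).sum + bitSize v + 1⟩

/-! ### Subroutines -/

/-- Trial division. -/
def isPrimeC (c : ℕ) : Comp Bool := do
  let divisors ← filterList (fun k => do eqN (← modN c k) 0) (List.range' 2 (c - 2))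
  eqN (← lengthList divisors) 0

/-- The first prime among `c, c + 1, …`; at most `fuel` numbers are tried. -/
def findPrime : ℕ → ℕ → Comp ℕ
  | 0, c => charge 1 c
  | fuel + 1, c => do
    if ← isPrimeC c then charge 1 c else findPrime fuel (← addN c 1)

/-- The smallest prime `p ≥ m` (there is one that is at most `2 max(m,2)`). -/
def primeAtLeast (m : ℕ) : Comp ℕ := do
  let c ← maxN m 2
  findPrime (c + 1) c

/-- `[c, c d mod p, c d² mod p, …]`, with `m` entries (for `c < p`). -/
def powersMod (d p : ℕ) : ℕ → ℕ → Comp (List ℕ)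
  | 0, _ => charge 1 []
  | m + 1, c => do
    let c' ← modN (← mulN c d) p
    let l ← powersMod d p m c'
    charge 1 (c :: l)

/-- The exponents `mod (d ^ (k - 1), p)`, `k = 1, …, n`, of the substitution `(d,p)`. -/
def substVector (n d p : ℕ) : Comp (List ℕ) := do
  powersMod d p n (← modN 1 p)

/-- Add `p` to the entry number `k` (counted from `0`): the substitution `(d,p,k+1)`. -/
def addAt (p : ℕ) : ℕ → List ℕ → Comp (List ℕ)
  | _, [] => charge 1 []
  | 0, x :: l => do charge 1 ((← addN x p) :: l)
  | k + 1, x :: l => do charge 1 (x :: (← addAt p k l))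

/-- `∑ eᵢ sᵢ`, the exponent of the monomial with exponents `e` after the substitution `s`. -/
def dot : List ℕ → List ℕ → Comp ℕ
  | e :: l, s :: l' => do
    let r ← dot l l'
    addN (← mulN e s) r
  | _, _ => charge 1 0

/-- Sum of a list. -/
def sumN (l : List ℕ) : Comp ℕ := foldList addN 0 l

/-- Add the term `c x ^ e` to a sparse polynomial. -/
def addTerm (e : ℕ) (c : ℂ) : UPoly → Comp UPoly
  | [] => do if ← eqC c 0 then charge 1 [] else charge 1 [(e, c)]
  | (e', c') :: g => do
    if ← eqN e e' then
      let b ← addC c' c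
      if ← eqC b 0 then charge 1 g else charge 1 ((e', b) :: g)
    else if ← ltN e e' then
      if ← eqC c 0 then charge 1 ((e', c') :: g) else charge 1 ((e, c) :: (e', c') :: g)
    else
      let g' ← addTerm e c g
      charge 1 ((e', c') :: g')

/-- `g mod (x ^ p - 1)`. -/
def reduceMod (p : ℕ) (g : UPoly) : Comp UPoly :=
  foldList (fun r t => do addTerm (← modN t.1 p) t.2 r) [] g

/-- `g - u_s`, where `u_s` is the term `u` after the substitution `s`. -/
def subTerm (s : List ℕ) (g : UPoly) (u : Term) : Comp UPoly := do
  addTerm (← dot u.1 s) (← negC u.2) g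

/-- `g - (u_s mod (x ^ p - 1))`. -/
def subTermMod (p : ℕ) (s : List ℕ) (g : UPoly) (u : Term) : Comp UPoly := do
  addTerm (← modN (← dot u.1 s) p) (← negC u.2) g

/-- Interpolation of `g (x) = f (x ^ s₁, …, x ^ sₙ)`, where `g` has at most `T` terms and degree
less than `G`: query the values at `x = 2 ^ 0, …, 2 ^ (2 T - 1)` and apply Ben-Or and Tiwari's
algorithm to them.  The second part is charged the cost of the program `P`. -/
def interpolate {n : ℕ} (P : Prog) (B : (Fin n → ℂ) → ℂ) (T G : ℕ) (s : List ℕ) : Comp UPoly := do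
  let values ← mapList (fun j => do query B (← mapList (mulN j) s)) (List.range (2 * T))
  charge (P.run (BenOrTiwari.input T G values)).2 (BenOrTiwari.interpolant T G values)

/-! ### The algorithm TSTerms -/

/-- If the part of `g` with exponents congruent to `r` modulo `p` is one term `a x ^ e`, then `e`. -/
def classTerm (p r : ℕ) (a : ℂ) (g : UPoly) : Comp (Option ℕ) := do
  let part ← filterList (fun t => do eqN (← modN t.1 p) r) g
  match part with
  | [(e, c)] => do if ← eqC c a then charge 1 (some e) else charge 1 none
  | _ => charge 1 none

/-- The exponents `(βₖ - γ) / p`, if all of them are natural numbers. -/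
def termExponents (p r : ℕ) (a : ℂ) (γ : ℕ) : List UPoly → Comp (Option (List ℕ))
  | [] => charge 1 (some [])
  | g :: gs => do
    match ← classTerm p r a g with
    | none => charge 1 none
    | some β =>
      if ← ltN β γ then charge 1 none
      else
        let δ ← subN β γ
        if ← eqN (← modN δ p) 0 then
          let e ← divN δ p
          match ← termExponents p r a γ gs with
          | none => charge 1 none
          | some l => charge 1 (some (e :: l))
        else charge 1 none

/-- The term found from the term `a x ^ r` of `f mod (x ^ p - 1)`, if there is one.  Here `g` is
the image of `f` under the substitution `s`, and `gs` are its images under the `n` shifted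
substitutions. -/
def tsTerm (p D : ℕ) (s : List ℕ) (g : UPoly) (gs : List UPoly) (t : ℕ × ℂ) :
    Comp (Option Term) := do
  match ← classTerm p t.1 t.2 g with
  | none => charge 1 none
  | some γ =>
    match ← termExponents p t.1 t.2 γ gs with
    | none => charge 1 none
    | some e =>
      if ← eqN (← dot e s) γ then
        if ← ltN (← sumN e) D then charge 1 (some (e, t.2)) else charge 1 none
      else charge 1 none

/-- The set `TS` of candidate terms. -/
def tsTerms (p D : ℕ) (s : List ℕ) (gMod g : UPoly) (gs : List UPoly) : Comp (List Term) :=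
  filterMapList (tsTerm p D s g gs) gMod

/-! ### The algorithm MIPolyBase -/

/-- What is kept for one base `d`: the exponents of the substitution `(d,p)`, the image of `f - h`
under it, and the image modulo `x ^ p - 1` (`h` is the sum of the terms of `f` found so far). -/
structure Row where
  vec : List ℕ
  poly : UPoly
  polyMod : UPoly

/-- `δ₁ = (n-1)(T-1)`, `δ₂ = (n-1)T` and `N = max(4δ₁+1, δ₁+δ₂+1)`. -/
def params (n T : ℕ) : Comp (ℕ × ℕ × ℕ) := do
  let m ← subN n 1
  let δ₁ ← mulN m (← subN T 1)
  let δ₂ ← mulN m T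
  let N ← maxN (← addN (← mulN 4 δ₁) 1) (← addN (← addN δ₁ δ₂) 1)
  charge 1 (δ₁, δ₂, N)

/-- The greatest number `α` of terms of `polyMod` in a list of rows, and the first row where it is
attained. -/
def bestRow (rows : List Row) : Comp (ℕ × Row) :=
  foldList (fun best row => do
    let m ← lengthList row.polyMod
    if ← ltN best.1 m then charge 1 (m, row) else charge 1 best) (0, ⟨[], [], []⟩) rows

/-- The test whether `u` is a term of `f - h`: subtracting `u` lowers the number of terms modulo
`x ^ p - 1` for at least `δ₂ + 1` of the bases `d = 1, …, δ₁ + δ₂ + 1`. -/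
def testTerm (p δ₁ δ₂ : ℕ) (rows : List Row) (u : Term) : Comp Bool := do
  let good ← filterList (fun row => do
      let g ← subTermMod p row.vec row.polyMod u
      ltN (← lengthList g) (← lengthList row.polyMod)) (← takeList (δ₁ + δ₂ + 1) rows)
  ltN δ₂ (← lengthList good)

/-- Subtract the terms of `s` from a row. -/
def updateRow (p : ℕ) (s : List Term) (row : Row) : Comp Row := do
  let g ← foldList (subTerm row.vec) row.poly s
  let gMod ← foldList (subTermMod p row.vec) row.polyMod s
  charge 1 ⟨row.vec, g, gMod⟩

/-- The main loop.  `T₀` is the term bound of `f`, `T` the current one of `f - h`.  The loop ends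
when `α = 0`.  The first argument bounds the number of passes; if it is exhausted before, the
result is `none`. -/
def mainLoop {n : ℕ} (P : Prog) (B : (Fin n → ℂ) → ℂ) (p D T₀ : ℕ) :
    ℕ → ℕ → List Row → List Term → Comp (Option (List Term))
  | fuel, T, rows, h => do
    let best ← bestRow rows
    if ← eqN best.1 0 then charge 1 (some h)
    else
      match fuel with
      | 0 => charge 1 none
      | fuel + 1 => do
        let row := best.2
        let G ← mulN (← mulN 2 D) p
        let gs ← mapList (fun k => do
            let v ← addAt p k row.vec
            let g ← interpolate P B T₀ G v
            foldList (subTerm v) g h) (List.range n)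
        let candidates ← tsTerms p D row.vec row.polyMod row.poly gs
        let (δ₁, δ₂, _) ← params n T
        let s ← filterList (testTerm p δ₁ δ₂ rows) candidates
        let h' ← charge (h.length + 1) (h ++ s)
        let T' ← subN T (← lengthList s)
        let (_, _, N) ← params n T'
        let rows' ← mapList (updateRow p s) (← takeList N rows)
        mainLoop P B p D T₀ fuel T' rows' h'

/-- The algorithm MIPolyBase with Ben-Or and Tiwari's algorithm (carried out by the program `P`)
as univariate interpolation.  Input: the black box `B` of a polynomial in `n` indeterminates,
a bound `T` on its number of terms and a bound `D` that is greater than its degree. -/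
def miPolyBase {n : ℕ} (P : Prog) (B : (Fin n → ℂ) → ℂ) (T D : ℕ) :
    Comp (Option (List Term)) := do
  let (_, _, N) ← params n T
  let p ← primeAtLeast (← maxN n (← maxN N D))
  let G ← mulN D p
  let rows ← mapList (fun d => do
      let v ← substVector n d p
      let g ← interpolate P B T G v
      let gMod ← reduceMod p g
      charge 1 (⟨v, g, gMod⟩ : Row)) (List.range' 1 N)
  mainLoop P B p D T T T rows []

/-- The quantity `n T³ D max(nT, D)`. -/
def mainBound (n T D : ℕ) : ℕ := n * T ^ 3 * D * max (n * T) D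

end

end SparseInterp

namespace SparseInterp

noncomputable section

open Function (Injective comp_apply iterate_succ_apply iterate_succ_apply')
open List (Forall₂ append_nil countP_map drop_eq_getElem_cons ext_getElem flatMap_cons foldl_cons foldr_cons getD_eq_getElem getElem_mem length_append length_cons length_eq_zero_iff length_map length_range length_range' length_reverse map_append map_congr_left map_cons map_map map_nil map_reverse map_take mem_cons mem_filterMap mem_map mem_range'_1 mem_toFinset pairwise_cons pairwise_map range range' reverse_reverse sum_cons)
open Finset (Icc card_erase_of_mem card_filter card_le_card card_lt_card card_pos card_range coe_filter mem_Icc mem_coe mem_erase mem_filter mem_image mem_range mem_sdiff mem_univ mul_sum sum_add_distrib sum_coe_sort sum_comm sum_congr sum_const sum_div sum_eq_single sum_eq_zero sum_filter sum_le_card_nsmul sum_le_sum sum_mul sum_range_succ sum_range_succ' sum_sub_distrib)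
open Finsupp (mapDomain mapDomain_add mapDomain_single mapDomain_support mem_support_iff onFinset single single_apply single_eq_same single_neg)
open Nat (abs_cast cast_mul clog le_mul_of_pos_left le_mul_of_pos_right le_of_dvd le_pow_clog le_succ lt_size_self lt_two_pow_self mod_eq_of_lt mod_le mod_lt one_le_two_pow pow_le_pow_left pow_le_pow_right size size_le size_le_size size_pos sub_le succ_le_succ succ_pos two_pow_pos)
open MvPolynomial (eval eval_eq')
open Complex (add_im add_re ext_iff im_mul_ofReal im_sum intCast_im intCast_re mul_im mul_re re_mul_ofReal re_sum sub_im sub_re)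

section

open Polynomial

/-! ### Power sums with nodes `2 ^ e` -/

/-- The power sums `∑ e, g e * (2 ^ e) ^ j`. -/
def powerSum (g : ℕ →₀ ℂ) (j : ℕ) : ℂ := g.sum fun e c => c * ((2 : ℂ) ^ e) ^ j

lemma two_pow_injective : Injective fun e : ℕ => (2 : ℂ) ^ e := by
  intro a b h
  have h' : ((2 ^ a : ℕ) : ℂ) = ((2 ^ b : ℕ) : ℂ) := by push_cast; exact h
  exact Nat.pow_right_injective le_rfl (Nat.cast_injective h')

lemma sum_coeff_mul_powerSum (g : ℕ →₀ ℂ) (q : ℂ[X]) (i : ℕ) {d : ℕ} (hd : q.natDegree < d) :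
    ∑ j ∈ Finset.range d, q.coeff j * powerSum g (i + j) =
      g.sum fun e c => c * ((2 : ℂ) ^ e) ^ i * q.eval ((2 : ℂ) ^ e) := by
  simp only [powerSum, Finsupp.sum, mul_sum]
  rw [sum_comm]
  refine sum_congr rfl fun e _ => ?_
  rw [Polynomial.eval_eq_sum_range' hd, mul_sum]
  refine sum_congr rfl fun j _ => ?_
  ring

/-- The polynomial with the simple roots `2 ^ e`, `e ∈ S`. -/
def nodePoly (S : Finset ℕ) : ℂ[X] := ∏ e ∈ S, (X - C ((2 : ℂ) ^ e))

lemma nodePoly_monic (S : Finset ℕ) : (nodePoly S).Monic :=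
  monic_prod_of_monic _ _ fun _ _ => monic_X_sub_C _

lemma natDegree_nodePoly (S : Finset ℕ) : (nodePoly S).natDegree = S.card := by
  rw [nodePoly, natDegree_prod_of_monic _ _ fun _ _ => monic_X_sub_C _]
  simp only [natDegree_X_sub_C, sum_const, smul_eq_mul, mul_one]

lemma eval_nodePoly_eq_zero (S : Finset ℕ) (e : ℕ) :
    (nodePoly S).eval ((2 : ℂ) ^ e) = 0 ↔ e ∈ S := by
  rw [nodePoly, eval_prod, Finset.prod_eq_zero_iff]
  constructor
  · rintro ⟨a, ha, h⟩
    simp only [eval_sub, eval_X, eval_C, sub_eq_zero] at h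
    rwa [two_pow_injective h]
  · exact fun h => ⟨e, h, by simp⟩

lemma sum_mul_eval_eq_zero {S : Finset ℕ} {c : ℕ → ℂ} {k : ℕ}
    (h : ∀ j < k, ∑ e ∈ S, c e * ((2 : ℂ) ^ e) ^ j = 0) (q : ℂ[X]) (hq : q.natDegree < k) :
    ∑ e ∈ S, c e * q.eval ((2 : ℂ) ^ e) = 0 := by
  have : ∀ e, c e * q.eval ((2 : ℂ) ^ e) =
      ∑ j ∈ Finset.range k, q.coeff j * (c e * ((2 : ℂ) ^ e) ^ j) := by
    intro e
    rw [Polynomial.eval_eq_sum_range' hq, mul_sum]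
    grind
  simp only [this]
  rw [sum_comm]
  refine sum_eq_zero fun j hj => ?_
  rw [← mul_sum, h j (mem_range.1 hj), mul_zero]

lemma eq_zero_of_powerSums {S : Finset ℕ} {c : ℕ → ℂ}
    (h : ∀ j < S.card, ∑ e ∈ S, c e * ((2 : ℂ) ^ e) ^ j = 0) : ∀ e ∈ S, c e = 0 := by
  intro e he
  have hc : 0 < S.card := card_pos.2 ⟨e, he⟩
  have hlt : (nodePoly (S.erase e)).natDegree < S.card := by
    rw [natDegree_nodePoly, card_erase_of_mem he]; omega
  have h0 := sum_mul_eval_eq_zero h _ hlt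
  rw [Finset.sum_eq_single_of_mem e he] at h0
  · rcases mul_eq_zero.1 h0 with h1 | h1
    · exact h1
    · rw [eval_nodePoly_eq_zero] at h1
      simp at h1
  · intro b hb hbe
    rw [(eval_nodePoly_eq_zero _ b).2 (mem_erase.2 ⟨hbe, hb⟩), mul_zero]

/-- Two sparse polynomials with at most `T` terms that agree at `2 ^ 0, …, 2 ^ (2 T - 1)` are
equal. -/
lemma eq_of_powerSum_eq {g h : ℕ →₀ ℂ} {T : ℕ} (hg : g.support.card ≤ T)
    (hh : h.support.card ≤ T) (H : ∀ j < 2 * T, powerSum g j = powerSum h j) : g = h := by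
  classical
  have hsub : (g - h).support ⊆ g.support ∪ h.support := Finsupp.support_sub
  have hcard : (g - h).support.card ≤ 2 * T :=
    (card_le_card hsub).trans ((Finset.card_union_le _ _).trans (by omega))
  have key : ∀ e ∈ (g - h).support, (g - h) e = 0 := by
    apply eq_zero_of_powerSums
    intro j hj
    have h1 := H j (by omega)
    have : powerSum (g - h) j = 0 := by
      rw [powerSum, Finsupp.sum_sub_index (by intros; ring)]
      simp_all [powerSum, sub_self]
    simpa [powerSum, Finsupp.sum] using this
  have h0 : (g - h).support = ∅ := by
    by_contra hne
    grind
  exact sub_eq_zero.1 (Finsupp.support_eq_empty.1 h0)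

namespace BenOrTiwari

variable {g : ℕ →₀ ℂ} {a : ℕ → ℂ} {T t : ℕ}

lemma hankel_mulVec_injective (ht : g.support.card = t) (hT : t ≤ T)
    (ha : ∀ j < 2 * T, a j = powerSum g j) :
    Injective (hankel a t).mulVec := by
  have key : ∀ v : Fin t → ℂ, (hankel a t).mulVec v = 0 → v = 0 := by
    intro v hv
    set q : ℂ[X] := ∑ j : Fin t, C (v j) * X ^ (j : ℕ) with hq
    have hqc : ∀ j : Fin t, q.coeff j = v j := by
      intro j
      simp only [hq, finsetSum_coeff, coeff_C_mul, coeff_X_pow, mul_ite, mul_one, mul_zero]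
      rw [sum_eq_single j]
      · simp
      · grind
      · simp
    rcases Nat.eq_zero_or_pos t with h0 | hpos
    · subst h0; exact Subsingleton.elim _ _
    have hqd : q.natDegree < t := by
      have : q.degree < t := by
        refine lt_of_le_of_lt (degree_sum_le _ _) ?_
        rw [Finset.sup_lt_iff (WithBot.bot_lt_coe _)]
        intro j _
        exact lt_of_le_of_lt (degree_C_mul_X_pow_le _ _) (by exact_mod_cast j.2)
      by_cases hq0 : q = 0
      · rw [hq0]; simpa using hpos
      · exact (natDegree_lt_iff_degree_lt hq0).2 this
    have h1 : ∀ i < t, ∑ e ∈ g.support, (g e * q.eval ((2 : ℂ) ^ e)) * ((2 : ℂ) ^ e) ^ i = 0 := by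
      intro i hi
      have := congrFun hv ⟨i, hi⟩
      simp only [Matrix.mulVec, dotProduct, hankel, Matrix.of_apply, Pi.zero_apply] at this
      have h2 := sum_coeff_mul_powerSum g q i hqd
      rw [← Fin.sum_univ_eq_sum_range (fun j => q.coeff j * powerSum g (i + j))] at h2
      rw [sum_congr rfl (g := fun x : Fin t => a (i + x) * v x)] at h2
      · rw [this] at h2
        rw [h2, Finsupp.sum]
        refine sum_congr rfl fun e _ => by ring
      · intro j _
        rw [hqc, ha _ (by have := j.2; omega), mul_comm]
    have h3 := eq_zero_of_powerSums (c := fun e => g e * q.eval ((2 : ℂ) ^ e)) (by rwa [ht])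
    have hq0 : q = 0 := by
      refine Polynomial.eq_zero_of_natDegree_lt_card_of_eval_eq_zero' q
        (g.support.image fun e => (2 : ℂ) ^ e) ?_ ?_
      · intro x hx
        obtain ⟨e, he, rfl⟩ := mem_image.1 hx
        rcases mul_eq_zero.1 (h3 e he) with h | h
        · exact absurd h (Finsupp.mem_support_iff.1 he)
        · exact h
      · rw [Finset.card_image_of_injective _ two_pow_injective, ht]; exact hqd
    ext j
    rw [← hqc, hq0]; simp
  intro v w hvw
  have := key (v - w) (by rw [Matrix.mulVec_sub, hvw, sub_self])
  exact sub_eq_zero.1 this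

lemma isUnit_det_hankel (ht : g.support.card = t) (hT : t ≤ T)
    (ha : ∀ j < 2 * T, a j = powerSum g j) : IsUnit (hankel a t).det :=
  (Matrix.isUnit_iff_isUnit_det _).1
    (Matrix.mulVec_injective_iff_isUnit.1 (hankel_mulVec_injective ht hT ha))

lemma numTerms_eq (hT : g.support.card ≤ T)
    (ha : ∀ j < 2 * T, a j = powerSum g j) : numTerms a T = g.support.card := by
  classical
  apply le_antisymm
  · set V : Matrix (Fin T) g.support ℂ := Matrix.of fun i e => ((2 : ℂ) ^ (e : ℕ)) ^ (i : ℕ)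
    set W : Matrix g.support (Fin T) ℂ := Matrix.of fun e j => g e * ((2 : ℂ) ^ (e : ℕ)) ^ (j : ℕ)
    have : hankel a T = V * W := by
      ext i j
      simp only [hankel, Matrix.of_apply, Matrix.mul_apply, V, W]
      grind [powerSum, Finsupp.sum, sum_coe_sort, sum_congr]
    rw [numTerms, this]
    refine (Matrix.rank_mul_le_left _ _).trans ((Matrix.rank_le_card_width _).trans ?_)
    simp
  · have hu := isUnit_det_hankel rfl hT ha
    have hr : (hankel a g.support.card).rank = g.support.card := by
      rw [Matrix.rank_of_isUnit _ ((Matrix.isUnit_iff_isUnit_det _).2 hu)]; simp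
    set E : Matrix (Fin g.support.card) (Fin T) ℂ :=
      Matrix.of fun i j => if (i : ℕ) = j then 1 else 0 with hE
    have hsel : ∀ (i : Fin g.support.card) (F : Fin T → ℂ),
        ∑ x : Fin T, E i x * F x = F (Fin.castLE hT i) := by
      intro i F
      rw [sum_eq_single (Fin.castLE hT i)]
      · simp [hE]
      · intro b _ hb
        simp only [hE, Matrix.of_apply]
        grind
      · simp
    have : hankel a g.support.card = E * hankel a T * E.transpose := by
      ext i j
      simp_all [Matrix.mul_apply, Matrix.transpose_apply, hankel]
    calc g.support.card = (E * hankel a T * E.transpose).rank := by rw [← this, hr]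
      _ ≤ (E * hankel a T).rank := Matrix.rank_mul_le_left _ _
      _ ≤ numTerms a T := Matrix.rank_mul_le_right _ _

lemma auxPoly_eq (ht : g.support.card = t) (hT : t ≤ T)
    (ha : ∀ j < 2 * T, a j = powerSum g j) : auxPoly a t = nodePoly g.support := by
  have hdeg : (nodePoly g.support).natDegree = t := by rw [natDegree_nodePoly, ht]
  have hlow : lowerCoeffs a t = fun j : Fin t => (nodePoly g.support).coeff j := by
    have h1 : (hankel a t).mulVec (fun j : Fin t => (nodePoly g.support).coeff j) =
        fun i : Fin t => - a ((i : ℕ) + t) := by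
      ext i
      simp only [Matrix.mulVec, dotProduct, hankel, Matrix.of_apply]
      have h2 := sum_coeff_mul_powerSum g (nodePoly g.support) i (d := t + 1) (by omega)
      rw [sum_range_succ] at h2
      have hlead : (nodePoly g.support).coeff t = 1 := by
        rw [← hdeg]; exact nodePoly_monic _
      rw [hlead, one_mul] at h2
      have h3 : (g.sum fun e c => c * ((2 : ℂ) ^ e) ^ (i : ℕ) *
          (nodePoly g.support).eval ((2 : ℂ) ^ e)) = 0 := by
        refine sum_eq_zero fun e he => ?_
        grind [mul_zero, eval_nodePoly_eq_zero]
      rw [h3, ← Fin.sum_univ_eq_sum_range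
        (fun j => (nodePoly g.support).coeff j * powerSum g (i + j))] at h2
      grind
    rw [lowerCoeffs, ← h1, Matrix.mulVec_mulVec,
      Matrix.nonsing_inv_mul _ (isUnit_det_hankel ht hT ha), Matrix.one_mulVec]
  rw [auxPoly, hlow]
  conv_rhs => rw [(nodePoly_monic g.support).as_sum, hdeg]
  rw [← Fin.sum_univ_eq_sum_range (fun j => C ((nodePoly g.support).coeff j) * X ^ j)]

lemma exponents_eq {G : ℕ} (hG : ∀ e ∈ g.support, e < G) (hT : g.support.card ≤ T)
    (ha : ∀ j < 2 * T, a j = powerSum g j) : exponents a (numTerms a T) G = g.support := by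
  ext e
  rw [exponents, mem_filter, numTerms_eq hT ha, auxPoly_eq rfl hT ha,
    eval_nodePoly_eq_zero, mem_range]
  exact ⟨fun h => h.2, fun h => ⟨hG e h, h⟩⟩

lemma exists_position_eq (S : Finset ℕ) : ∀ k < S.card, ∃ e ∈ S, position S e = k := by
  have hinj : Set.InjOn (position S) S := by
    have mono : ∀ a ∈ S, ∀ b ∈ S, a < b → position S a < position S b := by
      intro a ha b hb hab
      refine card_lt_card ?_
      rw [Finset.ssubset_iff_of_subset]
      · exact ⟨a, by simp [ha, hab], by simp⟩
      · grind
    intro a ha b hb hab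
    grind
  have hsub : S.image (position S) = Finset.range S.card := by
    apply Finset.eq_of_subset_of_card_le
    · intro k hk
      obtain ⟨e, he, rfl⟩ := mem_image.1 hk
      rw [mem_range]
      refine card_lt_card ?_
      grind
    · grind
  intro k hk
  have : k ∈ S.image (position S) := by rw [hsub]; exact mem_range.2 hk
  grind

lemma position_lt {S : Finset ℕ} {e : ℕ} (he : e ∈ S) : position S e < S.card := by
  refine card_lt_card ?_
  grind

lemma coeffs_eq (hT : g.support.card ≤ T)
    (ha : ∀ j < 2 * T, a j = powerSum g j) (e : g.support) :
    coeffs a g.support e = g e := by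
  classical
  have hinj : Injective (vandermonde g.support).mulVec := by
    have key : ∀ v : g.support → ℂ, (vandermonde g.support).mulVec v = 0 → v = 0 := by
      intro v hv
      have h := eq_zero_of_powerSums (S := g.support)
        (c := fun e => if h : e ∈ g.support then v ⟨e, h⟩ else 0) ?_
      · ext e
        have := h e e.2
        simpa using this
      · intro j hj
        obtain ⟨r, hr, rfl⟩ := exists_position_eq _ j hj
        have := congrFun hv ⟨r, hr⟩
        simp only [Matrix.mulVec, dotProduct, vandermonde, Matrix.of_apply, Pi.zero_apply] at this
        rw [← this, ← sum_coe_sort]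
        grind
    intro v w hvw
    exact sub_eq_zero.1 (key (v - w) (by rw [Matrix.mulVec_sub, hvw, sub_self]))
  have hu := (Matrix.isUnit_iff_isUnit_det _).1 (Matrix.mulVec_injective_iff_isUnit.1 hinj)
  have h1 : (vandermonde g.support).mulVec (fun e => g e) =
      fun r : g.support => a (position g.support (r : ℕ)) := by
    ext r
    simp only [Matrix.mulVec, dotProduct, vandermonde, Matrix.of_apply]
    have := position_lt r.2
    rw [ha _ (by omega), powerSum, Finsupp.sum, ← sum_coe_sort g.support]
    grind
  rw [coeffs, ← h1, Matrix.mulVec_mulVec, Matrix.nonsing_inv_mul _ hu, Matrix.one_mulVec]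

end BenOrTiwari

/-- The sparse form of a univariate polynomial, given by its coefficient function. -/
def sparseList (g : ℕ →₀ ℂ) : UPoly := (g.support.sort (fun x y => x ≤ y)).map fun e => (e, g e)

lemma BenOrTiwari.interpolant_eq {g : ℕ →₀ ℂ} {T G : ℕ} (hG : ∀ e ∈ g.support, e < G)
    (hT : g.support.card ≤ T) :
    interpolant T G ((range (2 * T)).map (powerSum g)) = sparseList g := by
  have ha : ∀ j < 2 * T, ((range (2 * T)).map (powerSum g)).getD j 0 = powerSum g j := by
    simp_all
  rw [interpolant]
  rw [exponents_eq hG hT ha, terms, sparseList]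
  refine map_congr_left fun e he => ?_
  rw [Finset.mem_sort] at he
  rw [dif_pos he, coeffs_eq hT ha ⟨e, he⟩]

end

section

open Comp

/-! ### Values of computations -/

namespace Comp

variable {α β : Type}

@[simp] lemma val_bind (x : Comp α) (f : α → Comp β) : (x >>= f).val = (f x.val).val := rfl
@[simp] lemma queries_bind (x : Comp α) (f : α → Comp β) :
    (x >>= f).queries = x.queries + (f x.val).queries := rfl
@[simp] lemma bits_bind (x : Comp α) (f : α → Comp β) :
    (x >>= f).bits = x.bits + (f x.val).bits := rfl
@[simp] lemma val_pure (a : α) : (pure a : Comp α).val = a := rfl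
@[simp] lemma queries_pure (a : α) : (pure a : Comp α).queries = 0 := rfl
@[simp] lemma bits_pure (a : α) : (pure a : Comp α).bits = 0 := rfl
@[simp] lemma val_charge (b : ℕ) (a : α) : (charge b a).val = a := rfl
@[simp] lemma queries_charge (b : ℕ) (a : α) : (charge b a).queries = 0 := rfl
@[simp] lemma bits_charge (b : ℕ) (a : α) : (charge b a).bits = b := rfl

@[simp] lemma val_mapList (f : α → Comp β) (l : List α) :
    (mapList f l).val = l.map fun x => (f x).val := by
  induction l with
  | nil => rfl
  | cons x l ih => simp [mapList, ih]

lemma queries_mapList_le (f : α → Comp β) (l : List α) (q : ℕ)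
    (h : ∀ x ∈ l, (f x).queries ≤ q) : (mapList f l).queries ≤ l.length * q := by
  induction l with
  | nil => simp [mapList]
  | cons x l ih =>
    grind [mapList, queries_bind, queries_charge, length_cons, add_mul]

lemma queries_mapList_eq_zero {f : α → Comp β} {l : List α}
    (h : ∀ x ∈ l, (f x).queries = 0) : (mapList f l).queries = 0 := by
  simpa using queries_mapList_le f l 0 fun x hx => (h x hx).le

lemma val_filterMapList (f : α → Comp (Option β)) (l : List α) :
    (filterMapList f l).val = l.filterMap fun x => (f x).val := by
  induction l with
  | nil => rfl
  | cons x l ih =>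
    simp only [filterMapList, val_bind, List.filterMap_cons]
    cases (f x).val <;> simp [ih]

lemma queries_filterMapList {f : α → Comp (Option β)} {l : List α}
    (h : ∀ x, (f x).queries = 0) : (filterMapList f l).queries = 0 := by
  induction l with
  | nil => rfl
  | cons x l ih =>
    simp only [filterMapList, queries_bind, h, ih]
    cases (f x).val <;> simp

@[simp] lemma val_filterList (f : α → Comp Bool) (l : List α) :
    (filterList f l).val = l.filter fun x => (f x).val := by
  induction l with
  | nil => rfl
  | cons x l ih => simp [filterList, ih, List.filter_cons]

lemma queries_filterList {f : α → Comp Bool} {l : List α}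
    (h : ∀ x, (f x).queries = 0) : (filterList f l).queries = 0 := by
  induction l with
  | nil => rfl
  | cons x l ih => simp [filterList, h, ih]

@[simp] lemma val_foldList (f : β → α → Comp β) (s : β) (l : List α) :
    (foldList f s l).val = l.foldl (fun s x => (f s x).val) s := by
  induction l generalizing s with
  | nil => rfl
  | cons x l ih => simp [foldList, ih]

lemma queries_foldList {f : β → α → Comp β} {s : β} {l : List α}
    (h : ∀ s x, (f s x).queries = 0) : (foldList f s l).queries = 0 := by
  induction l generalizing s with
  | nil => rfl
  | cons x l ih => simp [foldList, h, ih]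

@[simp] lemma val_takeList (m : ℕ) (l : List α) : (takeList m l).val = l.take m := rfl
@[simp] lemma queries_takeList (m : ℕ) (l : List α) : (takeList m l).queries = 0 := rfl
@[simp] lemma val_lengthList (l : List α) : (lengthList l).val = l.length := rfl
@[simp] lemma queries_lengthList (l : List α) : (lengthList l).queries = 0 := rfl

end Comp

@[simp] lemma val_addN (a b : ℕ) : (addN a b).val = a + b := rfl
@[simp] lemma val_subN (a b : ℕ) : (subN a b).val = a - b := rfl
@[simp] lemma val_mulN (a b : ℕ) : (mulN a b).val = a * b := rfl
@[simp] lemma val_divN (a b : ℕ) : (divN a b).val = a / b := rfl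
@[simp] lemma val_modN (a b : ℕ) : (modN a b).val = a % b := rfl
@[simp] lemma val_maxN (a b : ℕ) : (maxN a b).val = max a b := rfl
@[simp] lemma val_ltN (a b : ℕ) : (ltN a b).val = decide (a < b) := rfl
@[simp] lemma val_eqN (a b : ℕ) : (eqN a b).val = decide (a = b) := rfl
@[simp] lemma val_addC (a b : ℂ) : (addC a b).val = a + b := rfl
@[simp] lemma val_negC (a : ℂ) : (negC a).val = -a := rfl
@[simp] lemma val_eqC (a b : ℂ) : (eqC a b).val = decide (a = b) := rfl
@[simp] lemma queries_addN (a b : ℕ) : (addN a b).queries = 0 := rfl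
@[simp] lemma queries_subN (a b : ℕ) : (subN a b).queries = 0 := rfl
@[simp] lemma queries_mulN (a b : ℕ) : (mulN a b).queries = 0 := rfl
@[simp] lemma queries_divN (a b : ℕ) : (divN a b).queries = 0 := rfl
@[simp] lemma queries_modN (a b : ℕ) : (modN a b).queries = 0 := rfl
@[simp] lemma queries_maxN (a b : ℕ) : (maxN a b).queries = 0 := rfl
@[simp] lemma queries_ltN (a b : ℕ) : (ltN a b).queries = 0 := rfl
@[simp] lemma queries_eqN (a b : ℕ) : (eqN a b).queries = 0 := rfl
@[simp] lemma queries_addC (a b : ℂ) : (addC a b).queries = 0 := rfl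
@[simp] lemma queries_negC (a : ℂ) : (negC a).queries = 0 := rfl
@[simp] lemma queries_eqC (a b : ℂ) : (eqC a b).queries = 0 := rfl

/-! ### Primes -/

lemma val_isPrimeC {c : ℕ} (hc : 2 ≤ c) : (isPrimeC c).val = true ↔ c.Prime := by
  simp only [isPrimeC, val_bind, val_filterList, val_modN, val_eqN, val_lengthList,
    decide_eq_true_eq, length_eq_zero_iff, List.filter_eq_nil_iff, mem_range'_1]
  rw [Nat.prime_def_lt']
  constructor
  · grind [Nat.mod_eq_zero_of_dvd]
  · rintro ⟨-, h⟩ m ⟨h2, hm⟩ h0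
    grind [Nat.dvd_of_mod_eq_zero]

lemma queries_isPrimeC (c : ℕ) : (isPrimeC c).queries = 0 := by
  simp [isPrimeC, queries_filterList]

lemma val_findPrime {fuel c q : ℕ} (hc : 2 ≤ c) (hq : q.Prime) (hcq : c ≤ q)
    (hqf : q < c + fuel) :
    (findPrime fuel c).val.Prime ∧ c ≤ (findPrime fuel c).val ∧ (findPrime fuel c).val ≤ q := by
  induction fuel generalizing c with
  | zero => omega
  | succ fuel ih =>
    simp only [findPrime, val_bind]
    by_cases hp : (isPrimeC c).val = true
    · rw [if_pos hp]
      exact ⟨(val_isPrimeC hc).1 hp, le_rfl, hcq⟩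
    · grind [val_bind, val_addN, val_isPrimeC]

lemma queries_findPrime (fuel c : ℕ) : (findPrime fuel c).queries = 0 := by
  induction fuel generalizing c with
  | zero => rfl
  | succ fuel ih =>
    simp only [findPrime, queries_bind, queries_isPrimeC]
    split <;> simp [ih]

lemma val_primeAtLeast (m : ℕ) : (primeAtLeast m).val.Prime ∧ m ≤ (primeAtLeast m).val ∧
    (primeAtLeast m).val ≤ 2 * max m 2 := by
  obtain ⟨q, hq, h1, h2⟩ := Nat.exists_prime_lt_and_le_two_mul (max m 2 - 1) (by omega)
  have := val_findPrime (fuel := max m 2 + 1) (c := max m 2) (by omega) hq (by omega) (by omega)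
  grind [primeAtLeast, val_bind, val_maxN]

lemma queries_primeAtLeast (m : ℕ) : (primeAtLeast m).queries = 0 := by
  simp [primeAtLeast, queries_findPrime]

/-! ### Substitution vectors -/

/-- The exponents `d ^ k mod p`, `k < n`. -/
def baseVec (n p d : ℕ) : List ℕ := (range n).map fun k => d ^ k % p

lemma val_powersMod {d p m c : ℕ} (hc : c < p) :
    (powersMod d p m c).val = (range m).map fun k => c * d ^ k % p := by
  induction m generalizing c with
  | zero => rfl
  | succ m ih =>
    have hp : 0 < p := by omega
    simp only [powersMod, val_bind, val_mulN, val_modN, val_charge, ih (mod_lt _ hp),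
      List.range_succ_eq_map, map_cons, map_map, pow_zero, mul_one]
    rw [mod_eq_of_lt hc]
    congr 1
    refine map_congr_left fun k _ => ?_
    simp only [comp_apply, pow_succ]
    rw [Nat.mod_mul_mod]
    congr 1
    ring

lemma val_substVector {n d p : ℕ} (hp : 1 < p) : (substVector n d p).val = baseVec n p d := by
  simp only [substVector, val_bind, val_modN]
  rw [val_powersMod (mod_lt _ (by omega)), baseVec]
  simp [mod_eq_of_lt hp]

lemma queries_powersMod (d p m c : ℕ) : (powersMod d p m c).queries = 0 := by
  induction m generalizing c with
  | zero => rfl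
  | succ m ih => simp [powersMod, ih]

lemma queries_substVector (n d p : ℕ) : (substVector n d p).queries = 0 := by
  simp [substVector, queries_powersMod]

lemma val_addAt (p k : ℕ) (l : List ℕ) : (addAt p k l).val = l.modify k (· + p) := by
  induction l generalizing k with
  | nil => cases k <;> rfl
  | cons x l ih => cases k <;> simp [addAt, ih]

lemma queries_addAt (p k : ℕ) (l : List ℕ) : (addAt p k l).queries = 0 := by
  induction l generalizing k with
  | nil => cases k <;> rfl
  | cons x l ih => cases k <;> simp [addAt, ih]

/-- The exponent of the monomial `m` after the substitution `s`. -/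
def weight {n : ℕ} (s : List ℕ) (m : Fin n →₀ ℕ) : ℕ := ∑ i, m i * s.getD i 0

lemma val_dot {n : ℕ} (l s : List ℕ) (hl : l.length = n) :
    (dot l s).val = weight s (expVec n l) := by
  simp only [weight, expVec, Finsupp.equivFunOnFinite_symm_apply_apply]
  induction l generalizing n s with
  | nil =>
    subst hl
    cases s <;> simp [dot]
  | cons e l ih =>
    subst hl
    cases s with
    | nil => simp [dot]
    | cons x s =>
      simp_all [dot, val_bind, val_mulN, val_addN, length_cons, Fin.sum_univ_succ]

lemma queries_dot (l s : List ℕ) : (dot l s).queries = 0 := by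
  induction l generalizing s with
  | nil => cases s <;> rfl
  | cons e l ih => cases s <;> simp [dot, ih]

lemma val_sumN (l : List ℕ) : (sumN l).val = l.sum := by
  simp [sumN, List.sum_eq_foldl]

lemma queries_sumN (l : List ℕ) : (sumN l).queries = 0 :=
  queries_foldList fun _ _ => rfl

lemma weight_modify {n : ℕ} (p k : ℕ) (hk : k < n) (s : List ℕ) (hs : s.length = n)
    (m : Fin n →₀ ℕ) :
    weight (s.modify k (· + p)) m = weight s m + m ⟨k, hk⟩ * p := by
  have : ∀ i : Fin n, m i * (s.modify k (· + p)).getD i 0 =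
      m i * s.getD i 0 + if i = ⟨k, hk⟩ then m ⟨k, hk⟩ * p else 0 := by
    grind
  simp only [weight, this, sum_add_distrib]
  simp

/-! ### Sparse univariate polynomials -/

/-- The polynomial given by a list of terms. -/
def ofList (l : UPoly) : ℕ →₀ ℂ := (l.map fun t => single t.1 t.2).sum

@[simp] lemma ofList_nil : ofList [] = 0 := rfl
@[simp] lemma ofList_cons (t : ℕ × ℂ) (l : UPoly) :
    ofList (t :: l) = single t.1 t.2 + ofList l := by simp [ofList]

/-- `l` is the list of terms of `g`, by increasing exponent. -/
structure Rep (l : UPoly) (g : ℕ →₀ ℂ) : Prop where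
  sorted : l.Pairwise fun a b => a.1 < b.1
  ne_zero : ∀ t ∈ l, t.2 ≠ 0
  eq : ofList l = g

lemma ofList_apply_eq_zero {l : UPoly} {e : ℕ} (h : ∀ t ∈ l, t.1 ≠ e) : ofList l e = 0 := by
  induction l with
  | nil => rfl
  | cons t l ih =>
    simp_all

namespace Rep

variable {l : UPoly} {g : ℕ →₀ ℂ}

lemma nil : Rep [] 0 := ⟨List.Pairwise.nil, by simp, rfl⟩

lemma mem_iff (h : Rep l g) (e : ℕ) (c : ℂ) : (e, c) ∈ l ↔ c ≠ 0 ∧ g e = c := by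
  obtain ⟨h1, h2, rfl⟩ := h
  induction l with
  | nil => simp; tauto
  | cons t l ih =>
    grind [pairwise_cons, ofList_cons, Finsupp.add_apply, add_zero, single_eq_same, zero_add, ofList_apply_eq_zero]

lemma nodup_fst (h : Rep l g) : (l.map Prod.fst).Nodup :=
  (pairwise_map.2 (h.sorted.imp fun h => h.ne))

lemma toFinset_fst (h : Rep l g) : (l.map Prod.fst).toFinset = g.support := by
  ext e
  simp only [mem_toFinset, mem_map, mem_support_iff]
  constructor
  · rintro ⟨⟨e', c⟩, hm, rfl⟩
    have := (h.mem_iff e' c).1 hm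
    simp only [this.2]
    exact this.1
  · intro hne
    exact ⟨(e, g e), (h.mem_iff _ _).2 ⟨hne, rfl⟩, rfl⟩

lemma length_eq (h : Rep l g) : l.length = g.support.card := by
  rw [← h.toFinset_fst, List.toFinset_card_of_nodup h.nodup_fst, length_map]

lemma unique {l' : UPoly} (h : Rep l g) (h' : Rep l' g) : l = l' := by
  have hp : l.Perm l' := by
    rw [List.perm_ext_iff_of_nodup (List.Nodup.of_map _ h.nodup_fst)
      (List.Nodup.of_map _ h'.nodup_fst)]
    rintro ⟨e, c⟩
    rw [h.mem_iff, h'.mem_iff]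
  exact hp.eq_of_pairwise (fun a b _ _ h1 h2 => absurd h1 (by omega)) h.sorted h'.sorted

lemma sparseList (g : ℕ →₀ ℂ) : Rep (sparseList g) g := by
  have hs : (g.support.sort (fun x y => x ≤ y)).Pairwise (· < ·) := Finset.sortedLT_sort _ |>.pairwise
  refine ⟨?_, ?_, ?_⟩
  · exact pairwise_map.2 hs
  · intro t ht
    obtain ⟨e, he, rfl⟩ := mem_map.1 ht
    simp_all
  · rw [ofList, SparseInterp.sparseList, map_map]
    conv_rhs => rw [← Finsupp.sum_single g, Finsupp.sum]
    rw [← Finset.sum_map_toList]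
    exact ((Finset.sort_perm_toList _ _).map _).sum_eq

end Rep

/-! ### Operations on sparse univariate polynomials -/

lemma addTerm_exponent_mem (e : ℕ) (c : ℂ) (l : UPoly) :
    ∀ t ∈ (addTerm e c l).val, t.1 = e ∨ ∃ t' ∈ l, t'.1 = t.1 := by
  induction l with
  | nil =>
    intro t ht
    simp only [addTerm, val_bind, val_eqC, decide_eq_true_eq] at ht
    split at ht <;> simp_all
  | cons a l ih =>
    obtain ⟨e', c'⟩ := a
    intro t ht
    simp only [addTerm, val_bind, val_eqN, decide_eq_true_eq] at ht
    split at ht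
    · simp only [val_bind, val_addC, val_eqC, decide_eq_true_eq] at ht
      grind [val_charge]
    · simp only [val_bind, val_ltN, decide_eq_true_eq] at ht
      split at ht
      · simp only [val_bind, val_eqC, decide_eq_true_eq] at ht
        grind [val_charge]
      grind [val_bind, val_charge]

lemma Rep.addTerm {l : UPoly} {g : ℕ →₀ ℂ} (h : Rep l g) (e : ℕ) (c : ℂ) :
    Rep (addTerm e c l).val (g + single e c) := by
  obtain ⟨h1, h2, rfl⟩ := h
  induction l with
  | nil =>
    simp only [SparseInterp.addTerm, val_bind, val_eqC, decide_eq_true_eq]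
    split
    · rename_i h; subst h; simpa using Rep.nil
    · rename_i h
      exact ⟨by simp, by simpa using h, by simp⟩
  | cons a l ih =>
    obtain ⟨e', c'⟩ := a
    have h2' : ∀ t ∈ l, t.2 ≠ 0 := fun t ht => h2 t (by simp [ht])
    have hc' : c' ≠ 0 := h2 (e', c') (by simp)
    have h1' := pairwise_cons.1 h1
    have ih' := ih h1'.2 h2'
    simp only [SparseInterp.addTerm, val_bind, val_eqN, decide_eq_true_eq]
    split
    · rename_i he
      subst he
      simp only [val_bind, val_addC, val_eqC, decide_eq_true_eq]
      have hsum : ∀ k, ofList ((e, c') :: l) + single e c =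
          single e (c' + c) + ofList l + k - k := by
        intro k; rw [ofList_cons, Finsupp.single_add]; simp only; abel
      split
      · rename_i h0
        refine ⟨h1'.2, h2', ?_⟩
        rw [hsum 0, h0]; simp
      · rename_i h0
        refine ⟨pairwise_cons.2 ⟨h1'.1, h1'.2⟩, ?_, ?_⟩
        · intro t ht
          rcases mem_cons.1 ht with rfl | ht
          · exact h0
          · exact h2' t ht
        · rw [hsum 0]; simp
    · rename_i hne
      simp only [val_bind, val_ltN, decide_eq_true_eq]
      split
      · rename_i hlt
        simp only [val_bind, val_eqC, decide_eq_true_eq]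
        split
        · rename_i h0
          subst h0
          exact ⟨h1, h2, by simp⟩
        · rename_i h0
          refine ⟨pairwise_cons.2 ⟨?_, h1⟩, ?_, ?_⟩
          · intro t ht
            rcases mem_cons.1 ht with rfl | ht
            · exact hlt
            · have := h1'.1 t ht; simp only at this ⊢; omega
          · intro t ht
            rcases mem_cons.1 ht with rfl | ht
            · exact h0
            · exact h2 t ht
          · simp only [val_charge, ofList_cons]; abel
      · rename_i hlt
        simp only [val_bind, val_charge]
        refine ⟨pairwise_cons.2 ⟨?_, ih'.sorted⟩, ?_, ?_⟩
        · intro t ht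
          rcases addTerm_exponent_mem e c l t ht with h | ⟨t', ht', h⟩
          · simp only; omega
          · have := h1'.1 t' ht'; simp only at this ⊢; omega
        · intro t ht
          rcases mem_cons.1 ht with rfl | ht
          · exact hc'
          · exact ih'.ne_zero t ht
        · rw [ofList_cons, ih'.eq, ofList_cons]; abel

lemma queries_addTerm (e : ℕ) (c : ℂ) (l : UPoly) : (addTerm e c l).queries = 0 := by
  induction l with
  | nil =>
    simp only [addTerm, queries_bind]
    split <;> simp
  | cons a l ih =>
    obtain ⟨e', c'⟩ := a
    simp only [addTerm, queries_bind]
    split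
    · simp only [queries_bind]; split <;> simp
    · simp only [queries_bind]
      split
      · simp only [queries_bind]; split <;> simp
      · simp [ih]

lemma Rep.reduceMod {l : UPoly} {g : ℕ →₀ ℂ} (h : Rep l g) (p : ℕ) :
    Rep (reduceMod p l).val (mapDomain (· % p) g) := by
  obtain ⟨-, -, rfl⟩ := h
  have key : ∀ (l r : UPoly) (g' : ℕ →₀ ℂ), Rep r g' →
      Rep (l.foldl (fun r t => (SparseInterp.addTerm (t.1 % p) t.2 r).val) r)
        (g' + mapDomain (· % p) (ofList l)) := by
    intro l
    induction l with
    | nil => intro r g' h; simpa using h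
    | cons t l ih =>
      intro r g' h
      have := ih _ _ (h.addTerm (t.1 % p) t.2)
      grind [ofList_cons, mapDomain_add, mapDomain_single, add_assoc]
  have := key l [] 0 Rep.nil
  simpa [SparseInterp.reduceMod] using this

lemma queries_reduceMod (p : ℕ) (l : UPoly) : (reduceMod p l).queries = 0 :=
  queries_foldList fun s t => by simp [queries_addTerm]

/-- The monomial of a term, with its coefficient. -/
def termSingle (n : ℕ) (u : Term) : (Fin n →₀ ℕ) →₀ ℂ := single (expVec n u.1) u.2

lemma Rep.subTerm {n : ℕ} {l : UPoly} {F : (Fin n →₀ ℕ) →₀ ℂ} {s : List ℕ}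
    (h : Rep l (mapDomain (weight s) F)) (u : Term) (hu : u.1.length = n) :
    Rep (subTerm s l u).val (mapDomain (weight s) (F - termSingle n u)) := by
  have := h.addTerm (weight s (expVec n u.1)) (-u.2)
  simp only [SparseInterp.subTerm, val_bind, val_negC, val_dot _ _ hu]
  rw [sub_eq_add_neg, mapDomain_add, termSingle, ← single_neg,
    mapDomain_single]
  exact this

lemma Rep.subTermMod {n : ℕ} {l : UPoly} {F : (Fin n →₀ ℕ) →₀ ℂ} {s : List ℕ} {p : ℕ}
    (h : Rep l (mapDomain (fun m => weight s m % p) F)) (u : Term) (hu : u.1.length = n) :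
    Rep (subTermMod p s l u).val
      (mapDomain (fun m => weight s m % p) (F - termSingle n u)) := by
  have := h.addTerm (weight s (expVec n u.1) % p) (-u.2)
  simp only [SparseInterp.subTermMod, val_bind, val_negC, val_modN, val_dot _ _ hu]
  rw [sub_eq_add_neg, mapDomain_add, termSingle, ← single_neg,
    mapDomain_single]
  exact this

lemma queries_subTerm (s : List ℕ) (g : UPoly) (u : Term) : (subTerm s g u).queries = 0 := by
  simp [subTerm, queries_dot, queries_addTerm]

lemma queries_subTermMod (p : ℕ) (s : List ℕ) (g : UPoly) (u : Term) :
    (subTermMod p s g u).queries = 0 := by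
  simp [subTermMod, queries_dot, queries_addTerm]

/-- The sum of a list of terms. -/
def termSum (n : ℕ) (h : List Term) : (Fin n →₀ ℕ) →₀ ℂ := (h.map (termSingle n)).sum

lemma Rep.foldl_subTerm {n : ℕ} {s : List ℕ} (h : List Term) (hh : ∀ u ∈ h, u.1.length = n)
    {l : UPoly} {F : (Fin n →₀ ℕ) →₀ ℂ} (hl : Rep l (mapDomain (weight s) F)) :
    Rep (h.foldl (fun g u => (SparseInterp.subTerm s g u).val) l)
      (mapDomain (weight s) (F - termSum n h)) := by
  induction h generalizing l F with
  | nil => simpa [termSum] using hl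
  | cons u h ih =>
    have := ih (fun u hu => hh u (by simp [hu])) (hl.subTerm u (hh u (by simp)))
    grind [sub_sub, termSum]

lemma Rep.foldl_subTermMod {n p : ℕ} {s : List ℕ} (h : List Term)
    (hh : ∀ u ∈ h, u.1.length = n) {l : UPoly} {F : (Fin n →₀ ℕ) →₀ ℂ}
    (hl : Rep l (mapDomain (fun m => weight s m % p) F)) :
    Rep (h.foldl (fun g u => (SparseInterp.subTermMod p s g u).val) l)
      (mapDomain (fun m => weight s m % p) (F - termSum n h)) := by
  induction h generalizing l F with
  | nil => simpa [termSum] using hl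
  | cons u h ih =>
    have := ih (fun u hu => hh u (by simp [hu])) (hl.subTermMod u (hh u (by simp)))
    grind [sub_sub, termSum]

/-! ### Univariate interpolation of a substitution -/

/-- The coefficient function of a polynomial. -/
def coeffFun {n : ℕ} (f : MvPolynomial (Fin n) ℂ) : (Fin n →₀ ℕ) →₀ ℂ :=
  onFinset f.support (fun m => f.coeff m) fun _ hm => MvPolynomial.mem_support_iff.2 hm

@[simp] lemma coeffFun_apply {n : ℕ} (f : MvPolynomial (Fin n) ℂ) (m : Fin n →₀ ℕ) :
    coeffFun f m = f.coeff m := rfl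

lemma support_coeffFun {n : ℕ} (f : MvPolynomial (Fin n) ℂ) :
    (coeffFun f).support = f.support := by
  ext m; simp [MvPolynomial.mem_support_iff]

lemma eval_two_pow {n : ℕ} (f : MvPolynomial (Fin n) ℂ) (s : List ℕ) (j : ℕ) :
    eval (fun i : Fin n => (2 : ℂ) ^ (s.map (j * ·)).getD i 0) f =
      powerSum (mapDomain (weight s) (coeffFun f)) j := by
  rw [powerSum, Finsupp.sum_mapDomain_index (by simp) (by intros; ring), eval_eq',
    Finsupp.sum, support_coeffFun]
  refine sum_congr rfl fun m _ => ?_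
  rw [coeffFun_apply, weight, ← pow_mul, sum_mul, ← Finset.prod_pow_eq_pow_sum]
  congr 1
  refine Finset.prod_congr rfl fun i _ => ?_
  rw [← pow_mul]
  grind

lemma val_interpolate {n : ℕ} (P : Prog) (f : MvPolynomial (Fin n) ℂ) {T G : ℕ} (s : List ℕ)
    (hT : f.support.card ≤ T) (hG : ∀ m ∈ f.support, weight s m < G) :
    (interpolate P (fun x => eval x f) T G s).val =
      sparseList (mapDomain (weight s) (coeffFun f)) := by
  classical
  simp only [interpolate, val_bind, val_mapList, val_charge, query, val_mulN, eval_two_pow]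
  refine BenOrTiwari.interpolant_eq ?_ ?_
  · intro e he
    obtain ⟨m, hm, rfl⟩ := mem_image.1 (mapDomain_support he)
    grind [support_coeffFun]
  · refine (card_le_card mapDomain_support).trans (Finset.card_image_le.trans ?_)
    rwa [support_coeffFun]

lemma queries_interpolate {n : ℕ} (P : Prog) (B : (Fin n → ℂ) → ℂ) (T G : ℕ) (s : List ℕ) :
    (interpolate P B T G s).queries ≤ 2 * T := by
  simp only [interpolate, queries_bind, queries_charge, add_zero]
  refine (queries_mapList_le _ _ 1 ?_).trans (by simp)
  intro j _
  simp only [queries_bind]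
  rw [queries_mapList_eq_zero (fun x _ => rfl)]
  simp [query]

/-! ### Finding terms -/

lemma val_classTerm {p r γ : ℕ} {a : ℂ} {l : UPoly} (ha : l.filter (fun t => t.1 % p = r) = [(γ, a)]) :
    (classTerm p r a l).val = some γ := by
  simp [classTerm, val_bind, val_filterList, val_modN, val_eqN, ha]

lemma classTerm_eq_some {p r γ : ℕ} {a : ℂ} {l : UPoly}
    (h : (classTerm p r a l).val = some γ) : γ % p = r := by
  simp only [classTerm, val_bind, val_filterList, val_modN, val_eqN] at h
  split at h
  · rename_i e c heq
    simp only [val_bind, val_eqC, decide_eq_true_eq] at h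
    split at h
    · simp only [val_charge, Option.some.injEq] at h
      have : (e, c) ∈ l.filter (fun t => decide (t.1 % p = r)) := by rw [heq]; simp
      grind
    · simp at h
  · simp at h

lemma queries_classTerm (p r : ℕ) (a : ℂ) (l : UPoly) : (classTerm p r a l).queries = 0 := by
  simp only [classTerm, queries_bind]
  rw [queries_filterList (fun t => by simp)]
  split
  · simp only [queries_bind]; split <;> simp
  · simp

lemma val_termExponents {ι : Type} {p r γ : ℕ} {a : ℂ} (hp : 0 < p) (m : ι → ℕ) (G : ι → UPoly) (ks : List ι)
    (h : ∀ k ∈ ks, (classTerm p r a (G k)).val = some (γ + m k * p)) :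
    (termExponents p r a γ (ks.map G)).val = some (ks.map m) := by
  induction ks with
  | nil => rfl
  | cons k ks ih =>
    have h1 := h k (by simp)
    have h2 := ih fun k hk => h k (by simp [hk])
    simp [termExponents, h1, h2, hp]

lemma length_of_termExponents {p r γ : ℕ} {a : ℂ} (gs : List UPoly) (e : List ℕ)
    (h : (termExponents p r a γ gs).val = some e) : e.length = gs.length := by
  induction gs generalizing e with
  | nil => simp [termExponents] at h; subst h; rfl
  | cons g gs ih =>
    simp only [termExponents, val_bind] at h
    split at h
    · simp at h
    · simp only [val_bind] at h
      split at h
      · simp at h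
      · simp only [val_bind] at h
        split at h
        · simp only [val_bind] at h
          split at h
          · simp at h
          · rename_i heq
            grind [val_charge, Option.some.injEq]
        · simp at h

lemma queries_termExponents (p r γ : ℕ) (a : ℂ) (gs : List UPoly) :
    (termExponents p r a γ gs).queries = 0 := by
  induction gs with
  | nil => rfl
  | cons g gs ih =>
    simp only [termExponents, queries_bind, queries_classTerm]
    split
    · simp
    · simp only [queries_bind]
      split
      · simp
      · simp only [queries_bind]
        split
        · simp only [queries_bind, ih]
          split <;> simp
        · simp

lemma tsTerm_eq_some {n p D : ℕ} {s : List ℕ} {g : UPoly} {gs : List UPoly} {t : ℕ × ℂ} {u : Term}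
    (hgs : gs.length = n) (h : (tsTerm p D s g gs t).val = some u) :
    u.1.length = n ∧ u.2 = t.2 ∧ weight s (expVec n u.1) % p = t.1 ∧ u.1.sum < D := by
  simp only [tsTerm, val_bind] at h
  split at h
  · simp at h
  · rename_i γ hγ
    simp only [val_bind] at h
    split at h
    · simp at h
    · rename_i e he
      have hlen := (length_of_termExponents _ _ he).trans hgs
      simp only [val_bind, val_dot _ _ hlen, val_eqN, decide_eq_true_eq] at h
      split at h
      · rename_i hw
        simp only [val_bind, val_sumN, val_ltN, decide_eq_true_eq] at h
        split at h
        · rename_i hD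
          simp only [val_charge, Option.some.injEq] at h
          subst h
          exact ⟨hlen, rfl, by rw [hw]; exact classTerm_eq_some hγ, hD⟩
        · simp at h
      · simp at h

lemma queries_tsTerm (p D : ℕ) (s : List ℕ) (g : UPoly) (gs : List UPoly) (t : ℕ × ℂ) :
    (tsTerm p D s g gs t).queries = 0 := by
  simp only [tsTerm, queries_bind, queries_classTerm]
  split
  · simp
  · simp only [queries_bind, queries_termExponents]
    split
    · simp
    · simp only [queries_bind, queries_dot]
      split
      · simp only [queries_bind, queries_sumN]
        split <;> simp
      · simp

/-- The monomial `m` is not identified with another monomial of `F` by `φ`. -/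
def Separated {M : Type*} (φ : M → ℕ) (F : M →₀ ℂ) (m : M) : Prop :=
  ∀ m' ∈ F.support, φ m' = φ m → m' = m

lemma Separated.mapDomain_apply {M : Type*} {φ : M → ℕ} {F : M →₀ ℂ} {m : M}
    (h : Separated φ F m) : mapDomain φ F (φ m) = F m := by
  classical
  rw [mapDomain, Finsupp.sum_apply, Finsupp.sum]
  rw [sum_eq_single m]
  · simp
  · intro b hb hbm
    rw [single_apply, if_neg fun h' => hbm (h b hb h')]
  · simp

lemma Rep.filter_eq {M : Type*} {w : M → ℕ} {p : ℕ} {l : UPoly} {F : M →₀ ℂ} {m : M}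
    (h : Rep l (mapDomain w F)) (hm : m ∈ F.support)
    (hsep : Separated (fun m => w m % p) F m) :
    l.filter (fun t => t.1 % p = w m % p) = [(w m, F m)] := by
  classical
  have hsep' : Separated w F m := fun m' hm' h' => hsep m' hm' (by simp only [h'])
  have hmem : ∀ t, t ∈ l.filter (fun t => decide (t.1 % p = w m % p)) ↔ t ∈ [(w m, F m)] := by
    rintro ⟨e, c⟩
    rw [List.mem_filter, h.mem_iff, List.mem_singleton]
    simp only [decide_eq_true_eq]
    constructor
    · rintro ⟨⟨hc, he⟩, hmod⟩
      have hes : e ∈ (mapDomain w F).support := by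
        rw [mem_support_iff, he]; exact hc
      obtain ⟨m', hm', rfl⟩ := mem_image.1 (mapDomain_support hes)
      have : m' = m := hsep m' hm' hmod
      subst this
      rw [hsep'.mapDomain_apply] at he
      rw [he]
    · intro heq
      simp only [Prod.mk.injEq] at heq
      obtain ⟨rfl, rfl⟩ := heq
      exact ⟨⟨mem_support_iff.1 hm, hsep'.mapDomain_apply⟩, rfl⟩
  refine List.Perm.eq_singleton ?_
  rw [List.perm_ext_iff_of_nodup _ (List.nodup_singleton _)]
  · exact hmem
  · exact (List.Nodup.of_map _ h.nodup_fst).filter _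

/-! ### Collisions of monomials under the base changing substitutions -/

section Collisions

variable {n p : ℕ}

/-- The exponent modulo `p` of the monomial `m` after the substitution of base `d`. -/
def resid (n p d : ℕ) (m : Fin n →₀ ℕ) : ℕ := weight (baseVec n p d) m % p

lemma getD_baseVec (d : ℕ) {i : ℕ} (hi : i < n) : (baseVec n p d).getD i 0 = d ^ i % p := by
  simp_all [baseVec, List.getD_eq_getElem?_getD]

lemma length_baseVec (d : ℕ) : (baseVec n p d).length = n := by simp [baseVec]

lemma natCast_weight_baseVec (d : ℕ) (m : Fin n →₀ ℕ) :
    ((weight (baseVec n p d) m : ℕ) : ZMod p) = ∑ i : Fin n, (m i : ZMod p) * (d : ZMod p) ^ (i : ℕ) := by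
  rw [weight]
  push_cast
  refine sum_congr rfl fun i _ => ?_
  rw [getD_baseVec d i.2, ZMod.natCast_mod]
  push_cast
  rfl

lemma card_collisions_le (hp : p.Prime) {m m' : Fin n →₀ ℕ} (hm : ∀ i, m i < p)
    (hm' : ∀ i, m' i < p) (hne : m ≠ m') {N : ℕ} (hN : N ≤ p) :
    ((Icc 1 N).filter fun d => resid n p d m = resid n p d m').card ≤ n - 1 := by
  classical
  have := Fact.mk hp
  set q : Polynomial (ZMod p) :=
    ∑ i : Fin n, Polynomial.C ((m i : ZMod p) - (m' i : ZMod p)) * Polynomial.X ^ (i : ℕ) with hq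
  have hcoef : ∀ i : Fin n, q.coeff i = (m i : ZMod p) - (m' i : ZMod p) := by
    intro i
    simp only [hq, Polynomial.finsetSum_coeff, Polynomial.coeff_C_mul, Polynomial.coeff_X_pow,
      mul_ite, mul_one, mul_zero]
    rw [sum_eq_single i]
    · simp
    · grind
    · simp
  have hq0 : q ≠ 0 := by
    intro h0
    apply hne
    ext i
    have h1 := hcoef i
    rw [h0, Polynomial.coeff_zero, eq_comm, sub_eq_zero, ZMod.natCast_eq_natCast_iff'] at h1
    rwa [mod_eq_of_lt (hm i), mod_eq_of_lt (hm' i)] at h1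
  have hn : 0 < n := by
    rcases Nat.eq_zero_or_pos n with h | h
    · subst h; exact absurd (Subsingleton.elim m m') hne
    · exact h
  have hdeg : q.natDegree ≤ n - 1 := by
    rw [hq]
    refine Polynomial.natDegree_sum_le_of_forall_le _ _ fun i _ => ?_
    refine (Polynomial.natDegree_C_mul_X_pow_le _ _).trans ?_
    have := i.2; omega
  refine le_trans ?_ hdeg
  refine le_trans ?_ (Polynomial.card_roots' q)
  refine le_trans ?_ (Multiset.toFinset_card_le q.roots)
  refine Finset.card_le_card_of_injOn (fun d => ((d : ℕ) : ZMod p)) ?_ ?_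
  · intro d hd
    simp only [coe_filter, mem_Icc, Set.mem_ofPred_eq] at hd
    simp only [mem_coe, Multiset.mem_toFinset]
    rw [Polynomial.mem_roots hq0, Polynomial.IsRoot, hq, Polynomial.eval_finsetSum]
    have h1 : ((weight (baseVec n p d) m : ℕ) : ZMod p) = (weight (baseVec n p d) m' : ℕ) :=
      (ZMod.natCast_eq_natCast_iff' _ _ _).2 hd.2
    rw [natCast_weight_baseVec, natCast_weight_baseVec, ← sub_eq_zero,
      ← sum_sub_distrib] at h1
    rw [← h1]
    refine sum_congr rfl fun i _ => ?_
    simp only [Polynomial.eval_mul, Polynomial.eval_C, Polynomial.eval_pow, Polynomial.eval_X]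
    ring
  · intro a ha b hb hab
    simp only [coe_filter, mem_Icc, Set.mem_ofPred_eq] at ha hb
    have h1 := (ZMod.natCast_eq_natCast_iff' _ _ _).1 hab
    by_cases hap : a = p
    · by_cases hbp : b = p
      · rw [hap, hbp]
      · rw [hap, Nat.mod_self, mod_eq_of_lt (by omega)] at h1; omega
    · by_cases hbp : b = p
      · rw [hbp, Nat.mod_self, mod_eq_of_lt (by omega)] at h1; omega
      · rwa [mod_eq_of_lt (by omega), mod_eq_of_lt (by omega)] at h1

open Classical in
lemma card_not_separated_le (hp : p.Prime) {F : (Fin n →₀ ℕ) →₀ ℂ}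
    (hF : ∀ m ∈ F.support, ∀ i, m i < p) {m : Fin n →₀ ℕ} (hm : ∀ i, m i < p) {N : ℕ}
    (hN : N ≤ p) :
    ((Icc 1 N).filter fun d => ¬ Separated (resid n p d) F m).card ≤
      (n - 1) * (F.support.erase m).card := by
  have hsub : ((Icc 1 N).filter fun d => ¬ Separated (resid n p d) F m) ⊆
      (F.support.erase m).biUnion fun m' =>
        (Icc 1 N).filter fun d => resid n p d m' = resid n p d m := by
    intro d hd
    simp only [mem_filter, Separated, not_forall] at hd
    obtain ⟨h1, m', hm', he, hne⟩ := hd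
    simp only [Finset.mem_biUnion, mem_filter]
    grind
  refine (card_le_card hsub).trans ?_
  rw [mul_comm]
  refine Finset.card_biUnion_le_card_mul _ _ _ fun m' hm' => ?_
  rw [mem_erase] at hm'
  exact card_collisions_le hp (hF m' hm'.2) hm hm'.1 hN

open Classical in
lemma card_separated_le {M : Type*} (φ : M → ℕ) (F : M →₀ ℂ) :
    (F.support.filter (Separated φ F)).card ≤ (mapDomain φ F).support.card := by
  refine Finset.card_le_card_of_injOn φ ?_ ?_
  · intro m hm
    simp only [coe_filter, Set.mem_ofPred_eq] at hm
    simp_all [mem_support_iff, hm.2.mapDomain_apply]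
  · intro a ha b hb hab
    simp only [coe_filter, Set.mem_ofPred_eq] at ha hb
    exact hb.2 a ha.1 hab

lemma two_mul_card_support_mapDomain_le {M : Type*} {φ : M → ℕ} {F : M →₀ ℂ}
    (h : ∀ m ∈ F.support, ¬ Separated φ F m) :
    2 * (mapDomain φ F).support.card ≤ F.support.card := by
  classical
  have hsub : (mapDomain φ F).support ⊆ F.support.image φ := mapDomain_support
  refine le_trans (Nat.mul_le_mul_left 2 (card_le_card hsub)) ?_
  refine Finset.mul_card_image_le_card F.support 2 fun r hr => ?_
  obtain ⟨m, hm, rfl⟩ := mem_image.1 hr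
  have h1 := h m hm
  simp only [Separated, not_forall] at h1
  obtain ⟨m', hm', he, hne⟩ := h1
  refine Finset.one_lt_card.2 ⟨m, ?_, m', ?_, fun h' => hne h'.symm⟩
  · simp [mem_support_iff.1 hm]
  · simp [mem_support_iff.1 hm', he]

open Classical in
lemma exists_separated_half (hp : p.Prime) {F : (Fin n →₀ ℕ) →₀ ℂ} (hF0 : F ≠ 0)
    (hF : ∀ m ∈ F.support, ∀ i, m i < p) {N : ℕ} (hN : N ≤ p)
    (hN' : 4 * ((n - 1) * (F.support.card - 1)) + 1 ≤ N) :
    ∃ d ∈ Icc 1 N,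
      F.support.card < 2 * (F.support.filter (Separated (resid n p d) F)).card := by
  by_contra! hcon
  set t := F.support.card with ht
  have ht0 : 0 < t := card_pos.2 (Finsupp.support_nonempty_iff.2 hF0)
  have h1 : ∑ d ∈ Icc 1 N, (F.support.filter fun m => ¬ Separated (resid n p d) F m).card ≤
      t * ((n - 1) * (t - 1)) := by
    simp only [card_filter]
    rw [sum_comm, ht, ← smul_eq_mul]
    refine sum_le_card_nsmul _ _ _ fun m hm => ?_
    rw [← card_filter, ← card_erase_of_mem hm]
    exact card_not_separated_le hp hF (hF m hm) hN
  have h2 : ∀ d ∈ Icc 1 N,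
      t ≤ 2 * (F.support.filter fun m => ¬ Separated (resid n p d) F m).card := by
    intro d hd
    have := hcon d hd
    have h3 := Finset.card_filter_add_card_filter_not (s := F.support) (Separated (resid n p d) F)
    omega
  have h4 : N * t ≤ 2 * (t * ((n - 1) * (t - 1))) := by
    refine le_trans ?_ (Nat.mul_le_mul_left 2 h1)
    rw [mul_sum]
    refine le_trans ?_ (sum_le_sum h2)
    simp
  have h5 : N ≤ 2 * ((n - 1) * (t - 1)) := by
    have : N * t ≤ 2 * ((n - 1) * (t - 1)) * t := by
      rw [mul_assoc, mul_comm ((n - 1) * (t - 1)) t]; exact h4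
    exact Nat.le_of_mul_le_mul_right this ht0
  omega

lemma exists_separated_of_max (hp : p.Prime) {F : (Fin n →₀ ℕ) →₀ ℂ} (hF0 : F ≠ 0)
    (hF : ∀ m ∈ F.support, ∀ i, m i < p) {N : ℕ} (hN : N ≤ p)
    (hN' : 4 * ((n - 1) * (F.support.card - 1)) + 1 ≤ N) {d0 : ℕ}
    (hmax : ∀ d ∈ Icc 1 N, (mapDomain (resid n p d) F).support.card ≤
      (mapDomain (resid n p d0) F).support.card) :
    ∃ m ∈ F.support, Separated (resid n p d0) F m := by
  classical
  by_contra! hcon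
  obtain ⟨d, hd, h1⟩ := exists_separated_half hp hF0 hF hN hN'
  have h2 := card_separated_le (resid n p d) F
  have h3 := two_mul_card_support_mapDomain_le hcon
  have h4 := hmax d hd
  omega

/-- Subtracting a wrong term does not lower the number of terms of a separated image. -/
lemma card_support_le_of_ne {M : Type*} {φ : M → ℕ} {F : M →₀ ℂ} {m : M} {a : ℂ}
    (h : Separated φ F m) (ha : F m ≠ a) :
    (mapDomain φ F).support.card ≤
      (mapDomain φ (F - single m a)).support.card := by
  refine card_le_card fun r hr => ?_
  rw [mem_support_iff] at hr ⊢
  have : mapDomain φ (F - single m a) r =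
      mapDomain φ F r - single (φ m) a r := by
    rw [sub_eq_add_neg, mapDomain_add, ← single_neg, mapDomain_single,
      Finsupp.add_apply, single_neg, Finsupp.neg_apply, sub_eq_add_neg]
  rw [this]
  by_cases hrm : r = φ m
  · simp_all [h.mapDomain_apply, single_eq_same, sub_ne_zero]
  · simp_all

lemma card_support_lt_of_eq {M : Type*} {φ : M → ℕ} {F : M →₀ ℂ} {m : M}
    (h : Separated φ F m) (hm : m ∈ F.support) :
    (mapDomain φ (F - single m (F m))).support.card <
      (mapDomain φ F).support.card := by
  have key : ∀ r, mapDomain φ (F - single m (F m)) r =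
      mapDomain φ F r - single (φ m) (F m) r := by
    intro r
    rw [sub_eq_add_neg, mapDomain_add, ← single_neg, mapDomain_single,
      Finsupp.add_apply, single_neg, Finsupp.neg_apply, sub_eq_add_neg]
  refine card_lt_card ?_
  rw [Finset.ssubset_iff_of_subset]
  · refine ⟨φ m, ?_, ?_⟩
    · rw [mem_support_iff, h.mapDomain_apply]; exact mem_support_iff.1 hm
    · rw [Finsupp.notMem_support_iff, key, h.mapDomain_apply, single_eq_same, sub_self]
  · intro r hr
    rw [mem_support_iff, key] at hr
    rw [mem_support_iff]
    by_cases hrm : r = φ m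
    · subst hrm
      rw [h.mapDomain_apply, single_eq_same, sub_self] at hr
      exact absurd rfl hr
    · rwa [Finsupp.single_eq_of_ne hrm, sub_zero] at hr

end Collisions

namespace Comp

protected lemma bind_assoc {α β γ : Type} (x : Comp α) (f : α → Comp β) (g : β → Comp γ) :
    (x >>= f) >>= g = x >>= fun a => f a >>= g := by
  show Comp.mk _ _ _ = Comp.mk _ _ _
  simp [add_assoc]

protected lemma pure_bind {α β : Type} (a : α) (f : α → Comp β) : (pure a : Comp α) >>= f = f a := by
  show Comp.mk _ _ _ = _
  simp

end Comp

/-! ### The parameters -/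

/-- The number of bases for the term bound `T`. -/
def numBases (n T : ℕ) : ℕ :=
  max (4 * ((n - 1) * (T - 1)) + 1) ((n - 1) * (T - 1) + (n - 1) * T + 1)

@[simp] lemma val_params (n T : ℕ) :
    (params n T).val = ((n - 1) * (T - 1), (n - 1) * T, numBases n T) := rfl

lemma numBases_mono (n : ℕ) {T T' : ℕ} (h : T ≤ T') : numBases n T ≤ numBases n T' := by
  have h1 : (n - 1) * (T - 1) ≤ (n - 1) * (T' - 1) := Nat.mul_le_mul_left _ (by omega)
  have h2 : (n - 1) * T ≤ (n - 1) * T' := Nat.mul_le_mul_left _ h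
  unfold numBases; omega

lemma numBases_le {n T : ℕ} (hn : 1 ≤ n) (hT : 1 ≤ T) : numBases n T ≤ 4 * (n * T) := by
  obtain ⟨n, rfl⟩ := Nat.exists_eq_add_of_le' hn
  obtain ⟨T, rfl⟩ := Nat.exists_eq_add_of_le' hT
  simp only [numBases, Nat.add_sub_cancel]
  grind

lemma queries_params (n T : ℕ) : (params n T).queries = 0 := rfl

/-! ### The best row -/

lemma bestRow_spec (rows : List Row) :
    (∀ row ∈ rows, row.polyMod.length ≤ (bestRow rows).val.1) ∧
    ((bestRow rows).val.1 = 0 ∨ ((bestRow rows).val.2 ∈ rows ∧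
      (bestRow rows).val.2.polyMod.length = (bestRow rows).val.1)) := by
  have key : ∀ (rows : List Row) (b : ℕ × Row),
      let r := rows.foldl (fun s x => ((do
        let m ← lengthList x.polyMod
        if ← ltN s.1 m then charge 1 (m, x) else charge 1 s) : Comp (ℕ × Row)).val) b
      b.1 ≤ r.1 ∧ (∀ row ∈ rows, row.polyMod.length ≤ r.1) ∧
        (r = b ∨ (r.2 ∈ rows ∧ r.2.polyMod.length = r.1)) := by
    intro rows
    induction rows with
    | nil => intro b; simp
    | cons a rows ih =>
      intro b
      simp only [foldl_cons, val_bind, val_lengthList, val_ltN, decide_eq_true_eq]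
      split
      · rename_i hlt
        obtain ⟨h1, h2, h3⟩ := ih (charge 1 (a.polyMod.length, a)).val
        simp only [val_charge, val_bind, val_lengthList, val_ltN, decide_eq_true_eq] at h1 h2 h3 ⊢
        refine ⟨by omega, ?_, ?_⟩
        · intro row hrow
          rcases mem_cons.1 hrow with rfl | hrow
          · exact h1
          · exact h2 row hrow
        · right
          rcases h3 with h3 | h3
          · rw [h3]; simp
          · exact ⟨by simp [h3.1], h3.2⟩
      · rename_i hlt
        obtain ⟨h1, h2, h3⟩ := ih (charge 1 b).val
        simp only [val_charge, val_bind, val_lengthList, val_ltN, decide_eq_true_eq] at h1 h2 h3 ⊢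
        refine ⟨h1, ?_, ?_⟩
        · intro row hrow
          rcases mem_cons.1 hrow with rfl | hrow
          · omega
          · exact h2 row hrow
        · rcases h3 with h3 | h3
          · exact Or.inl h3
          · exact Or.inr ⟨by simp [h3.1], h3.2⟩
  obtain ⟨-, h2, h3⟩ := key rows (0, ⟨[], [], []⟩)
  rw [bestRow, val_foldList]
  refine ⟨h2, ?_⟩
  rcases h3 with h3 | h3
  · left; rw [h3]
  · right; exact h3

lemma queries_bestRow (rows : List Row) : (bestRow rows).queries = 0 :=
  queries_foldList fun s x => by
    simp only [queries_bind]; split <;> simp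

lemma queries_testTerm (p δ₁ δ₂ : ℕ) (rows : List Row) (u : Term) :
    (testTerm p δ₁ δ₂ rows u).queries = 0 := by
  simp only [testTerm, queries_bind]
  rw [queries_filterList fun row => by simp [queries_subTermMod]]
  simp

lemma queries_updateRow (p : ℕ) (s : List Term) (row : Row) :
    (updateRow p s row).queries = 0 := by
  simp only [updateRow, queries_bind]
  rw [queries_foldList fun _ _ => queries_subTerm _ _ _,
    queries_foldList fun _ _ => queries_subTermMod _ _ _ _]
  simp

/-! ### One pass of the main loop -/

/-- One pass of the main loop, starting from the best row. -/
def pass {n : ℕ} (P : Prog) (B : (Fin n → ℂ) → ℂ) (p D T0 T : ℕ) (rows : List Row)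
    (h : List Term) (row : Row) : Comp (ℕ × List Row × List Term) := do
  let G ← mulN (← mulN 2 D) p
  let gs ← mapList (fun k => do
      let v ← addAt p k row.vec
      let g ← interpolate P B T0 G v
      foldList (subTerm v) g h) (range n)
  let candidates ← tsTerms p D row.vec row.polyMod row.poly gs
  let (δ₁, δ₂, _) ← params n T
  let s ← filterList (testTerm p δ₁ δ₂ rows) candidates
  let h' ← charge (h.length + 1) (h ++ s)
  let T' ← subN T (← lengthList s)
  let (_, _, N) ← params n T'
  let rows' ← mapList (updateRow p s) (← takeList N rows)
  pure (T', rows', h')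

lemma mainLoop_succ {n : ℕ} (P : Prog) (B : (Fin n → ℂ) → ℂ) (p D T0 fuel T : ℕ)
    (rows : List Row) (h : List Term) :
    mainLoop P B p D T0 (fuel + 1) T rows h = bestRow rows >>= fun best =>
      eqN best.1 0 >>= fun b => if b then charge 1 (some h) else
        pass P B p D T0 T rows h best.2 >>= fun q =>
          mainLoop P B p D T0 fuel q.1 q.2.1 q.2.2 := by
  rw [mainLoop]
  simp only [pass, Comp.bind_assoc, Comp.pure_bind]

lemma mainLoop_zero {n : ℕ} (P : Prog) (B : (Fin n → ℂ) → ℂ) (p D T0 T : ℕ)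
    (rows : List Row) (h : List Term) :
    mainLoop P B p D T0 0 T rows h = bestRow rows >>= fun best =>
      eqN best.1 0 >>= fun b => if b then charge 1 (some h) else charge 1 none := rfl

/-- The rows hold the images of `F` for the bases `1, …, N`. -/
structure RowsOK (n p N : ℕ) (F : (Fin n →₀ ℕ) →₀ ℂ) (rows : List Row) : Prop where
  vecs : rows.map Row.vec = (range' 1 N).map (baseVec n p)
  poly : ∀ row ∈ rows, Rep row.poly (mapDomain (weight row.vec) F)
  polyMod : ∀ row ∈ rows, Rep row.polyMod (mapDomain (fun m => weight row.vec m % p) F)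

lemma RowsOK.exists_base {n p N : ℕ} {F : (Fin n →₀ ℕ) →₀ ℂ} {rows : List Row}
    (h : RowsOK n p N F rows) {row : Row} (hrow : row ∈ rows) :
    ∃ d ∈ Icc 1 N, row.vec = baseVec n p d := by
  grind [h.vecs, List.mem_map_of_mem]

lemma RowsOK.exists_row {n p N : ℕ} {F : (Fin n →₀ ℕ) →₀ ℂ} {rows : List Row}
    (h : RowsOK n p N F rows) {d : ℕ} (hd : d ∈ Icc 1 N) :
    ∃ row ∈ rows, row.vec = baseVec n p d := by
  have : baseVec n p d ∈ rows.map Row.vec := by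
    grind [h.vecs, List.mem_map_of_mem]
  simp_all

lemma RowsOK.length_eq {n p N : ℕ} {F : (Fin n →₀ ℕ) →₀ ℂ} {rows : List Row}
    (h : RowsOK n p N F rows) : rows.length = N := by
  simpa using congrArg List.length h.vecs

lemma RowsOK.take {n p N K : ℕ} {F : (Fin n →₀ ℕ) →₀ ℂ} {rows : List Row}
    (h : RowsOK n p N F rows) (hK : K ≤ N) : RowsOK n p K F (rows.take K) := by
  refine ⟨?_, fun row hr => h.poly row (List.mem_of_mem_take hr),
    fun row hr => h.polyMod row (List.mem_of_mem_take hr)⟩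
  rw [map_take, h.vecs, ← map_take]
  simp_all

lemma countP_range' (K : ℕ) (q : ℕ → Prop) [DecidablePred q] :
    (range' 1 K).countP (fun d => decide (q d)) = ((Icc 1 K).filter q).card := by
  rw [Finset.card, Finset.filter_val, ← Multiset.countP_eq_card_filter]
  have : (Icc 1 K).val = (range' 1 K : Multiset ℕ) := rfl
  rw [this, Multiset.coe_countP]

lemma val_testTerm {n p N : ℕ} {F : (Fin n →₀ ℕ) →₀ ℂ} {rows : List Row}
    (h : RowsOK n p N F rows) {δ₁ δ₂ : ℕ} (hK : δ₁ + δ₂ + 1 ≤ N) {u : Term}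
    (hu : u.1.length = n) :
    (testTerm p δ₁ δ₂ rows u).val = true ↔ δ₂ < ((Icc 1 (δ₁ + δ₂ + 1)).filter fun d =>
      (mapDomain (resid n p d) (F - termSingle n u)).support.card <
        (mapDomain (resid n p d) F).support.card).card := by
  have hK' := h.take hK
  simp only [testTerm, val_bind, val_takeList, val_filterList, val_lengthList, val_ltN,
    decide_eq_true_eq]
  rw [← List.countP_eq_length_filter]
  let q : List ℕ → Bool := fun v => decide
    ((mapDomain (fun m => weight v m % p) (F - termSingle n u)).support.card <
      (mapDomain (fun m => weight v m % p) F).support.card)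
  have h1 : (rows.take (δ₁ + δ₂ + 1)).countP (fun row => decide
      ((subTermMod p row.vec row.polyMod u).val.length < row.polyMod.length)) =
      (rows.take (δ₁ + δ₂ + 1)).countP (q ∘ Row.vec) := by
    refine List.countP_congr fun row hrow => ?_
    have h2 := hK'.polyMod row hrow
    simp only [q, comp_apply, decide_eq_true_eq]
    rw [h2.length_eq, (h2.subTermMod u hu).length_eq]
  rw [h1, ← countP_map, hK'.vecs, countP_map]
  exact iff_of_eq (congrArg (δ₂ < ·) (countP_range' (δ₁ + δ₂ + 1) fun d =>
    (mapDomain (resid n p d) (F - termSingle n u)).support.card <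
      (mapDomain (resid n p d) F).support.card))

/-- The terms in the list `h` are distinct terms of `F`. -/
structure Found {n : ℕ} (F : (Fin n →₀ ℕ) →₀ ℂ) (h : List Term) : Prop where
  nodup : (h.map fun u => expVec n u.1).Nodup
  length : ∀ u ∈ h, u.1.length = n
  coeff : ∀ u ∈ h, F (expVec n u.1) = u.2
  ne_zero : ∀ u ∈ h, u.2 ≠ 0

lemma Found.sub_apply {n : ℕ} {F : (Fin n →₀ ℕ) →₀ ℂ} {h : List Term} (hf : Found F h)
    (m : Fin n →₀ ℕ) : (F - termSum n h) m =
      if m ∈ h.map (fun u => expVec n u.1) then 0 else F m := by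
  obtain ⟨h1, -, h2, -⟩ := hf
  induction h with
  | nil => simp [termSum]
  | cons u h ih =>
    rw [map_cons, List.nodup_cons] at h1
    have ih' := ih h1.2 fun u hu => h2 u (by simp [hu])
    rw [termSum, map_cons, sum_cons, ← termSum, add_comm, ← sub_sub, Finsupp.sub_apply,
      ih', termSingle, map_cons]
    by_cases hm : m = expVec n u.1
    · grind
    · grind

lemma Found.support_sub {n : ℕ} {F : (Fin n →₀ ℕ) →₀ ℂ} {h : List Term} (hf : Found F h) :
    (F - termSum n h).support = F.support \ (h.map fun u => expVec n u.1).toFinset := by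
  ext m
  rw [mem_support_iff, hf.sub_apply, mem_sdiff, mem_toFinset,
    mem_support_iff]
  by_cases hm : m ∈ h.map (fun u => expVec n u.1) <;> simp [hm]

lemma Found.card_support_sub {n : ℕ} {F : (Fin n →₀ ℕ) →₀ ℂ} {h : List Term}
    (hf : Found F h) : (F - termSum n h).support.card + h.length = F.support.card := by
  rw [hf.support_sub, Finset.card_sdiff_of_subset]
  · have : (h.map fun u => expVec n u.1).toFinset ⊆ F.support := by
      intro m hm
      rw [mem_toFinset, mem_map] at hm
      obtain ⟨u, hu, rfl⟩ := hm
      rw [mem_support_iff, hf.coeff u hu]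
      exact hf.ne_zero u hu
    have h1 := card_le_card this
    rw [List.toFinset_card_of_nodup hf.nodup, length_map] at h1 ⊢
    omega
  · intro m hm
    rw [mem_toFinset, mem_map] at hm
    obtain ⟨u, hu, rfl⟩ := hm
    rw [mem_support_iff, hf.coeff u hu]
    exact hf.ne_zero u hu

lemma Found.append {n : ℕ} {F : (Fin n →₀ ℕ) →₀ ℂ} {h s : List Term} (hf : Found F h)
    (hs : Found (F - termSum n h) s) : Found F (h ++ s) := by
  have key : ∀ u ∈ s, expVec n u.1 ∉ h.map (fun u => expVec n u.1) ∧ F (expVec n u.1) = u.2 := by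
    intro u hu
    have h1 := hs.coeff u hu
    grind [hf.sub_apply, hs.ne_zero]
  refine ⟨?_, ?_, ?_, ?_⟩
  · rw [map_append, List.nodup_append']
    refine ⟨hf.nodup, hs.nodup, ?_⟩
    intro m h1 h2
    grind
  all_goals
    intro u hu
    rcases List.mem_append.1 hu with hu | hu
  · exact hf.length u hu
  · exact hs.length u hu
  · exact hf.coeff u hu
  · exact (key u hu).2
  · exact hf.ne_zero u hu
  · exact hs.ne_zero u hu

lemma termSum_append {n : ℕ} (h s : List Term) :
    termSum n (h ++ s) = termSum n h + termSum n s := by simp [termSum]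

lemma Found.isSparseForm {n : ℕ} {f : MvPolynomial (Fin n) ℂ} {h : List Term}
    (hf : Found (coeffFun f) h) (h0 : coeffFun f - termSum n h = 0) : IsSparseForm h f := by
  have hmem : ∀ m, m ∈ h.map (fun u => expVec n u.1) ↔ m ∈ f.support := by
    intro m
    have h1 := hf.sub_apply m
    rw [h0, Finsupp.zero_apply] at h1
    rw [MvPolynomial.mem_support_iff]
    constructor
    · intro hm
      obtain ⟨u, hu, rfl⟩ := mem_map.1 hm
      have := hf.coeff u hu
      rw [coeffFun_apply] at this
      rw [this]
      exact hf.ne_zero u hu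
    · intro hm
      by_contra hcon
      rw [if_neg hcon] at h1
      exact hm h1.symm
  have h1 : h.map (fun u => (expVec n u.1, u.2)) =
      (h.map fun u => expVec n u.1).map fun m => (m, f.coeff m) := by
    rw [map_map]
    refine map_congr_left fun u hu => ?_
    simp only [comp_apply]
    rw [← hf.coeff u hu, coeffFun_apply]
  rw [IsSparseForm, h1]
  refine List.Perm.map _ ?_
  rw [List.perm_ext_iff_of_nodup hf.nodup (Finset.nodup_toList _)]
  intro m
  rw [hmem, Finset.mem_toList]

/-! ### Candidates -/

lemma sum_expVec {n : ℕ} {l : List ℕ} (hl : l.length = n) : ∑ i, expVec n l i = l.sum := by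
  subst hl
  simp [expVec, Finsupp.equivFunOnFinite_symm_apply_apply, List.getD_eq_getElem?_getD]

lemma expVec_map_range {n : ℕ} (m : Fin n →₀ ℕ) :
    expVec n ((range n).map fun k => if h : k < n then m ⟨k, h⟩ else 0) = m := by
  ext i
  simp [expVec, List.getD_eq_getElem?_getD]

section Candidates

variable {n p D : ℕ} {F : (Fin n →₀ ℕ) →₀ ℂ} {s : List ℕ} {g gMod : UPoly} {G : ℕ → UPoly}

lemma nodup_tsTerms (hmod : gMod.Pairwise fun a b => a.1 < b.1) {gs : List UPoly}
    (hgs : gs.length = n) :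
    ((tsTerms p D s gMod g gs).val.map fun u => expVec n u.1).Nodup := by
  rw [tsTerms, val_filterMapList, List.Nodup, pairwise_map, List.pairwise_filterMap]
  refine hmod.imp fun {a b} hab u hu v hv huv => ?_
  have h1 := (tsTerm_eq_some hgs hu).2.2.1
  have h2 := (tsTerm_eq_some hgs hv).2.2.1
  rw [huv] at h1
  omega

lemma mem_tsTerms {gs : List UPoly} (hgs : gs.length = n) {u : Term}
    (hu : u ∈ (tsTerms p D s gMod g gs).val) :
    u.1.length = n ∧ u.1.sum < D ∧ ∃ t ∈ gMod, u.2 = t.2 := by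
  rw [tsTerms, val_filterMapList, mem_filterMap] at hu
  obtain ⟨t, ht, h⟩ := hu
  have := tsTerm_eq_some hgs h
  exact ⟨this.1, this.2.2.2, t, ht, this.2.1⟩

lemma exists_mem_tsTerms (hp : 0 < p) (hs : s.length = n)
    (hg : Rep g (mapDomain (weight s) F))
    (hMod : Rep gMod (mapDomain (fun m => weight s m % p) F))
    (hG : ∀ k < n, Rep (G k) (mapDomain (weight (s.modify k (· + p))) F))
    {m : Fin n →₀ ℕ} (hm : m ∈ F.support) (hD : ∑ i, m i < D)
    (hsep : Separated (fun m => weight s m % p) F m) :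
    ∃ u ∈ (tsTerms p D s gMod g ((range n).map G)).val,
      u.1.length = n ∧ expVec n u.1 = m ∧ u.2 = F m := by
  set e := (range n).map fun k => if h : k < n then m ⟨k, h⟩ else 0 with he
  have hlen : e.length = n := by simp [he]
  refine ⟨(e, F m), ?_, hlen, expVec_map_range m, rfl⟩
  rw [tsTerms, val_filterMapList, mem_filterMap]
  refine ⟨(weight s m % p, F m), ?_, ?_⟩
  · rw [hMod.mem_iff]
    exact ⟨mem_support_iff.1 hm, hsep.mapDomain_apply⟩
  · have h1 : (classTerm p (weight s m % p) (F m) g).val = some (weight s m) :=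
      val_classTerm (hg.filter_eq hm hsep)
    have h2 : (termExponents p (weight s m % p) (F m) (weight s m) ((range n).map G)).val =
        some e := by
      refine val_termExponents hp (fun k => if h : k < n then m ⟨k, h⟩ else 0) G _ ?_
      intro k hk
      have hk' : k < n := List.mem_range.1 hk
      rw [dif_pos hk']
      have hw : ∀ m', weight (s.modify k (· + p)) m' % p = weight s m' % p := fun m' => by
        rw [weight_modify p k hk' s hs m', Nat.add_mul_mod_self_right]
      have hsep' : Separated (fun m => weight (s.modify k (· + p)) m % p) F m := by
        intro m' hm' h'
        simp only [hw] at h'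
        exact hsep m' hm' h'
      have := (hG k hk').filter_eq hm hsep'
      rw [hw, weight_modify p k hk' s hs m] at this
      exact val_classTerm this
    have h3 : (dot e s).val = weight s m := by rw [val_dot _ _ hlen, expVec_map_range]
    have h4 : (sumN e).val < D := by
      rw [val_sumN, ← sum_expVec hlen, expVec_map_range]; exact hD
    have h4' : e.sum < D := by rwa [val_sumN] at h4
    simp [tsTerm, h1, h2, h3, h4', val_sumN]

end Candidates

/-! ### The test of the candidates -/

section Test

variable {n p N T : ℕ} {F : (Fin n →₀ ℕ) →₀ ℂ} {rows : List Row}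

lemma le_numBases (n T : ℕ) : (n - 1) * (T - 1) + (n - 1) * T + 1 ≤ numBases n T :=
  le_max_right _ _

lemma le_numBases' (n T : ℕ) : 4 * ((n - 1) * (T - 1)) + 1 ≤ numBases n T :=
  le_max_left _ _

lemma coeff_of_testTerm (hp : p.Prime) (h : RowsOK n p (numBases n T) F rows)
    (hNp : numBases n T ≤ p)
    (hF : ∀ m ∈ F.support, ∀ i, m i < p) (hT : F.support.card ≤ T) {u : Term}
    (hu : u.1.length = n) (hup : ∀ i, expVec n u.1 i < p)
    (htest : (testTerm p ((n - 1) * (T - 1)) ((n - 1) * T) rows u).val = true) :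
    F (expVec n u.1) = u.2 := by
  classical
  by_contra hne
  rw [val_testTerm h (le_numBases n T) hu] at htest
  have hsub := card_not_separated_le hp hF hup (N := (n - 1) * (T - 1) + (n - 1) * T + 1)
    ((le_numBases n T).trans hNp)
  have h1 : ((Icc 1 ((n - 1) * (T - 1) + (n - 1) * T + 1)).filter fun d =>
      (mapDomain (resid n p d) (F - termSingle n u)).support.card <
        (mapDomain (resid n p d) F).support.card).card ≤
      ((Icc 1 ((n - 1) * (T - 1) + (n - 1) * T + 1)).filter fun d =>
        ¬ Separated (resid n p d) F (expVec n u.1)).card := by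
    refine card_le_card fun d hd => ?_
    grind [termSingle, card_support_le_of_ne]
  have h2 : (n - 1) * (F.support.erase (expVec n u.1)).card ≤ (n - 1) * T :=
    Nat.mul_le_mul_left _ ((card_le_card (Finset.erase_subset _ _)).trans hT)
  omega

lemma testTerm_of_coeff (hp : p.Prime) (h : RowsOK n p (numBases n T) F rows)
    (hNp : numBases n T ≤ p)
    (hF : ∀ m ∈ F.support, ∀ i, m i < p) (hT : F.support.card ≤ T) {u : Term}
    (hu : u.1.length = n) (hum : expVec n u.1 ∈ F.support) (hc : u.2 = F (expVec n u.1)) :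
    (testTerm p ((n - 1) * (T - 1)) ((n - 1) * T) rows u).val = true := by
  classical
  rw [val_testTerm h (le_numBases n T) hu]
  have hsub := card_not_separated_le hp hF (hF _ hum) (N := (n - 1) * (T - 1) + (n - 1) * T + 1)
    ((le_numBases n T).trans hNp)
  rw [card_erase_of_mem hum] at hsub
  have h1 : ((Icc 1 ((n - 1) * (T - 1) + (n - 1) * T + 1)).filter fun d =>
        Separated (resid n p d) F (expVec n u.1)).card ≤
      ((Icc 1 ((n - 1) * (T - 1) + (n - 1) * T + 1)).filter fun d =>
      (mapDomain (resid n p d) (F - termSingle n u)).support.card <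
        (mapDomain (resid n p d) F).support.card).card := by
    refine card_le_card fun d hd => ?_
    rw [mem_filter] at hd ⊢
    refine ⟨hd.1, ?_⟩
    rw [termSingle, hc]
    exact card_support_lt_of_eq hd.2 hum
  have h2 := Finset.card_filter_add_card_filter_not
    (s := Icc 1 ((n - 1) * (T - 1) + (n - 1) * T + 1))
    (fun d => Separated (resid n p d) F (expVec n u.1))
  rw [Nat.card_Icc] at h2
  have h3 : (n - 1) * (F.support.card - 1) ≤ (n - 1) * (T - 1) :=
    Nat.mul_le_mul_left _ (by omega)
  omega

end Test

/-! ### Correctness of the main loop -/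

/-- The data of a run: the polynomial `f`, its bounds, and the prime. -/
structure Setup {n : ℕ} (f : MvPolynomial (Fin n) ℂ) (T0 D p : ℕ) : Prop where
  prime : p.Prime
  le_prime : D ≤ p
  degree : ∀ m ∈ f.support, ∑ i, m i < D
  card : f.support.card ≤ T0
  bases : numBases n T0 ≤ p

/-- The invariant of the main loop. -/
structure LoopInv {n : ℕ} (f : MvPolynomial (Fin n) ℂ) (p T : ℕ) (rows : List Row)
    (h : List Term) : Prop where
  found : Found (coeffFun f) h
  card : (coeffFun f - termSum n h).support.card ≤ T
  rows : RowsOK n p (numBases n T) (coeffFun f - termSum n h) rows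

section MainLoop

variable {n T0 D p T : ℕ} {f : MvPolynomial (Fin n) ℂ} {rows : List Row} {h : List Term}

lemma weight_le {n : ℕ} {s : List ℕ} {b : ℕ} (hs : ∀ x ∈ s, x ≤ b) (m : Fin n →₀ ℕ) :
    weight s m ≤ (∑ i, m i) * b := by
  rw [weight, sum_mul]
  refine sum_le_sum fun i _ => Nat.mul_le_mul_left _ ?_
  rw [List.getD_eq_getElem?_getD]
  rcases lt_or_ge (i : ℕ) s.length with h | h
  · simp_all
  · rw [List.getElem?_eq_none h]; simp

lemma le_of_mem_baseVec {d x : ℕ} (hp : 0 < p) (hx : x ∈ baseVec n p d) : x ≤ p := by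
  obtain ⟨k, -, rfl⟩ := mem_map.1 hx
  exact (mod_lt _ hp).le

lemma le_of_mem_modify {l : List ℕ} {k x : ℕ} (hl : ∀ x ∈ l, x ≤ p)
    (hx : x ∈ l.modify k (· + p)) : x ≤ 2 * p := by
  obtain ⟨i, hi, rfl⟩ := List.mem_iff_getElem.1 hx
  grind [List.length_modify, getElem_mem]

lemma Setup.weight_lt (hS : Setup f T0 D p) {s : List ℕ} {b : ℕ} (hb : 0 < b)
    (hs : ∀ x ∈ s, x ≤ b) {m : Fin n →₀ ℕ} (hm : m ∈ f.support) : weight s m < D * b :=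
  (weight_le hs m).trans_lt (Nat.mul_lt_mul_of_pos_right (hS.degree m hm) hb)

/-- The images of `f - h` under the shifted substitutions. -/
def shiftedImage {n : ℕ} (P : Prog) (f : MvPolynomial (Fin n) ℂ) (p D T0 : ℕ) (h : List Term)
    (vec : List ℕ) (k : ℕ) : UPoly :=
  h.foldl (fun g u => (subTerm (vec.modify k (· + p)) g u).val)
    (interpolate P (fun x => eval x f) T0 (2 * D * p) (vec.modify k (· + p))).val

lemma Setup.rep_shiftedImage (hS : Setup f T0 D p) (P : Prog) {vec : List ℕ}
    (hvec : ∀ x ∈ vec, x ≤ p) (hh : ∀ u ∈ h, u.1.length = n) (k : ℕ) :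
    Rep (shiftedImage P f p D T0 h vec k)
      (mapDomain (weight (vec.modify k (· + p))) (coeffFun f - termSum n h)) := by
  refine Rep.foldl_subTerm h hh ?_
  rw [val_interpolate _ _ _ hS.card]
  · exact Rep.sparseList _
  · intro m hm
    have := hS.weight_lt (b := 2 * p) (by have := hS.prime.pos; omega)
      (fun x hx => le_of_mem_modify (k := k) hvec hx) hm
    rw [mul_assoc, mul_left_comm]
    exact this

/-- The terms kept in a pass. -/
def keptTerms {n : ℕ} (P : Prog) (f : MvPolynomial (Fin n) ℂ) (p D T0 T : ℕ) (rows : List Row)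
    (h : List Term) (row : Row) : List Term :=
  (tsTerms p D row.vec row.polyMod row.poly
    ((range n).map (shiftedImage P f p D T0 h row.vec))).val.filter
    fun u => (testTerm p ((n - 1) * (T - 1)) ((n - 1) * T) rows u).val

lemma val_pass (P : Prog) (f : MvPolynomial (Fin n) ℂ) (row : Row) :
    (pass P (fun x => eval x f) p D T0 T rows h row).val =
      (T - (keptTerms P f p D T0 T rows h row).length,
       (rows.take (numBases n (T - (keptTerms P f p D T0 T rows h row).length))).map
         (fun r => (updateRow p (keptTerms P f p D T0 T rows h row) r).val),
       h ++ keptTerms P f p D T0 T rows h row) := by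
  simp only [pass, val_bind, val_mulN, val_mapList, val_params, val_filterList, val_charge,
    val_subN, val_lengthList, val_takeList, val_pure, val_addAt, val_foldList]
  rfl

lemma RowsOK.update {N : ℕ} {F : (Fin n →₀ ℕ) →₀ ℂ} (hr : RowsOK n p N F rows)
    {s : List Term} (hs : ∀ u ∈ s, u.1.length = n) :
    RowsOK n p N (F - termSum n s) (rows.map fun r => (updateRow p s r).val) := by
  refine ⟨?_, ?_, ?_⟩
  · rw [← hr.vecs, map_map]; rfl
  · grind [updateRow, val_bind, val_foldList, val_charge, Rep.foldl_subTerm, hr.poly]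
  · intro row hrow
    obtain ⟨r, h1, rfl⟩ := mem_map.1 hrow
    simp only [updateRow, val_bind, val_foldList, val_charge]
    exact Rep.foldl_subTermMod s hs (hr.polyMod r h1)

lemma LoopInv.lt_prime (hS : Setup f T0 D p) (hI : LoopInv f p T rows h) :
    ∀ m ∈ (coeffFun f - termSum n h).support, ∑ i, m i < D ∧ ∀ i, m i < p := by
  intro m hm
  rw [hI.found.support_sub, mem_sdiff, support_coeffFun] at hm
  have := hS.degree m hm.1
  refine ⟨this, fun i => ?_⟩
  have h1 := Finset.single_le_sum (f := fun i => m i) (fun i _ => Nat.zero_le _)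
    (mem_univ i)
  have := hS.le_prime
  omega

lemma found_keptTerms (hS : Setup f T0 D p) (hI : LoopInv f p T rows h) (hT : T ≤ T0)
    (P : Prog) {row : Row} (hrow : row ∈ rows) :
    Found (coeffFun f - termSum n h) (keptTerms P f p D T0 T rows h row) := by
  have hgs : ((range n).map (shiftedImage P f p D T0 h row.vec)).length = n := by simp
  have hmem : ∀ u ∈ keptTerms P f p D T0 T rows h row, u.1.length = n ∧
      (coeffFun f - termSum n h) (expVec n u.1) = u.2 ∧ u.2 ≠ 0 := by
    intro u hu
    obtain ⟨h1, h2⟩ := List.mem_filter.1 hu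
    obtain ⟨h3, h4, t, ht, h5⟩ := mem_tsTerms hgs h1
    refine ⟨h3, ?_, ?_⟩
    · refine coeff_of_testTerm hS.prime hI.rows ((numBases_mono n hT).trans hS.bases)
        (fun m hm => (hI.lt_prime hS m hm).2) hI.card h3 ?_ h2
      intro i
      have h6 := Finset.single_le_sum (f := fun i => expVec n u.1 i) (fun i _ => Nat.zero_le _)
        (mem_univ i)
      rw [sum_expVec h3] at h6
      have := hS.le_prime
      omega
    · rw [h5]; exact (hI.rows.polyMod row hrow).ne_zero t ht
  refine ⟨?_, fun u hu => (hmem u hu).1, fun u hu => (hmem u hu).2.1,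
    fun u hu => (hmem u hu).2.2⟩
  exact (nodup_tsTerms (hI.rows.polyMod row hrow).sorted hgs).sublist
    (List.filter_sublist.map _)

lemma keptTerms_ne_nil (hS : Setup f T0 D p) (hI : LoopInv f p T rows h) (hT : T ≤ T0)
    (P : Prog) (h0 : (bestRow rows).val.1 ≠ 0) :
    keptTerms P f p D T0 T rows h (bestRow rows).val.2 ≠ [] := by
  obtain ⟨hb1, hb2⟩ := bestRow_spec rows
  obtain ⟨hmem, hlen⟩ := hb2.resolve_left h0
  set row := (bestRow rows).val.2 with hrow
  set F := coeffFun f - termSum n h with hF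
  obtain ⟨d0, hd0, hvec⟩ := hI.rows.exists_base hmem
  have hNp : numBases n T ≤ p := (numBases_mono n hT).trans hS.bases
  have hmod := hI.rows.polyMod row hmem
  have hF0 : F ≠ 0 := by
    intro hF0
    rw [← hF, hF0] at hmod
    grind [Finsupp.mapDomain_zero, Finsupp.support_zero, Finset.card_empty, hmod.length_eq]
  have hmax : ∀ d ∈ Icc 1 (numBases n T),
      (mapDomain (resid n p d) F).support.card ≤
        (mapDomain (resid n p d0) F).support.card := by
    intro d hd
    obtain ⟨r, hr, hrv⟩ := hI.rows.exists_row hd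
    have h1 := hb1 r hr
    rw [← hlen, (hI.rows.polyMod r hr).length_eq, hmod.length_eq, hrv, hvec] at h1
    exact h1
  have hN' : 4 * ((n - 1) * (F.support.card - 1)) + 1 ≤ numBases n T := by
    refine le_trans ?_ (le_numBases' n T)
    have : (n - 1) * (F.support.card - 1) ≤ (n - 1) * (T - 1) :=
      Nat.mul_le_mul_left _ (Nat.sub_le_sub_right hI.card 1)
    omega
  obtain ⟨m, hm, hsep⟩ := exists_separated_of_max hS.prime hF0
    (fun m hm => (hI.lt_prime hS m hm).2) hNp hN' hmax
  have hvp : ∀ x ∈ row.vec, x ≤ p := by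
    rw [hvec]; exact fun x hx => le_of_mem_baseVec hS.prime.pos hx
  have hsep' : Separated (fun m => weight row.vec m % p) F m := by
    rw [hvec]; exact hsep
  obtain ⟨u, hu, h1, h2, h3⟩ := exists_mem_tsTerms (D := D) hS.prime.pos
    (by rw [hvec, length_baseVec]) (hI.rows.poly row hmem) hmod
    (fun k _ => hS.rep_shiftedImage P hvp hI.found.length k) hm (hI.lt_prime hS m hm).1 hsep'
  refine List.ne_nil_of_mem (a := u) (List.mem_filter.2 ⟨hu, ?_⟩)
  refine testTerm_of_coeff hS.prime hI.rows hNp (fun m hm => (hI.lt_prime hS m hm).2) hI.card h1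
    ?_ ?_
  · rw [h2]; exact hm
  · rw [h3, h2]

lemma LoopInv.pass (hS : Setup f T0 D p) (hI : LoopInv f p T rows h) (hT : T ≤ T0)
    (P : Prog) (h0 : (bestRow rows).val.1 ≠ 0) :
    let q := (pass P (fun x => eval x f) p D T0 T rows h (bestRow rows).val.2).val
    LoopInv f p q.1 q.2.1 q.2.2 ∧ q.1 < T := by
  obtain ⟨hmem, -⟩ := (bestRow_spec rows).2.resolve_left h0
  rw [val_pass]
  have hf := found_keptTerms hS hI hT P hmem
  have hne := keptTerms_ne_nil hS hI hT P h0
  set s := keptTerms P f p D T0 T rows h (bestRow rows).val.2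
  have hcard := hf.card_support_sub
  have hpos : 0 < s.length := List.length_pos_iff.2 hne
  have h1 := hI.card
  simp only
  refine ⟨⟨hI.found.append hf, ?_, ?_⟩, by omega⟩
  · rw [termSum_append, ← sub_sub]; omega
  · rw [termSum_append, ← sub_sub]
    exact (hI.rows.take (numBases_mono n (sub_le _ _))).update hf.length

lemma queries_pass (P : Prog) (B : (Fin n → ℂ) → ℂ) (row : Row) :
    (pass P B p D T0 T rows h row).queries ≤ n * (2 * T0) := by
  simp only [pass, queries_bind, queries_mulN, queries_params, queries_charge, queries_subN,
    queries_lengthList, queries_takeList, queries_pure]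
  rw [tsTerms, queries_filterMapList fun _ => queries_tsTerm _ _ _ _ _ _,
    queries_filterList fun _ => queries_testTerm _ _ _ _ _,
    queries_mapList_eq_zero fun _ _ => queries_updateRow _ _ _]
  have := queries_mapList_le (fun k => do
      let v ← addAt p k row.vec
      let g ← interpolate P B T0 (2 * D * p) v
      foldList (subTerm v) g h) (range n) (2 * T0) ?_
  · simpa using this
  · intro k _
    simp only [queries_bind, queries_addAt]
    rw [queries_foldList fun _ _ => queries_subTerm _ _ _]
    simpa using queries_interpolate P B T0 (2 * D * p) _

lemma bestRow_eq_zero (hI : LoopInv f p T rows h) (hS : Setup f T0 D p) (hT : T ≤ T0)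
    (h0 : (bestRow rows).val.1 = 0) : coeffFun f - termSum n h = 0 := by
  classical
  by_contra hF0
  have hN' : 4 * ((n - 1) * ((coeffFun f - termSum n h).support.card - 1)) + 1 ≤
      numBases n T := by
    refine le_trans ?_ (le_numBases' n T)
    have : (n - 1) * ((coeffFun f - termSum n h).support.card - 1) ≤ (n - 1) * (T - 1) :=
      Nat.mul_le_mul_left _ (by have := hI.card; omega)
    omega
  obtain ⟨d, hd, h1⟩ := exists_separated_half hS.prime hF0
    (fun m hm => (hI.lt_prime hS m hm).2) ((numBases_mono n hT).trans hS.bases) hN'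
  have h2 := card_separated_le (resid n p d) (coeffFun f - termSum n h)
  obtain ⟨r, hr, hrv⟩ := hI.rows.exists_row hd
  have h3 := (bestRow_spec rows).1 r hr
  rw [h0, (hI.rows.polyMod r hr).length_eq, hrv] at h3
  have h4 : (mapDomain (resid n p d) (coeffFun f - termSum n h)).support.card = 0 :=
    Nat.le_zero.1 h3
  omega

lemma mainLoop_spec (hS : Setup f T0 D p) (P : Prog) {fuel : ℕ}
    (hI : LoopInv f p T rows h) (hT : T ≤ T0) (hfuel : T ≤ fuel) :
    (∃ L, (mainLoop P (fun x => eval x f) p D T0 fuel T rows h).val = some L ∧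
      IsSparseForm L f) ∧
    (mainLoop P (fun x => eval x f) p D T0 fuel T rows h).queries ≤
      fuel * (n * (2 * T0)) := by
  induction fuel generalizing T rows h with
  | zero =>
    have h0 : (bestRow rows).val.1 = 0 := by
      by_contra h0
      have := (hI.pass hS hT P h0).2
      omega
    rw [mainLoop_zero]
    simp only [val_bind, queries_bind, val_eqN, h0, queries_bestRow]
    simp only [decide_true, if_true, val_charge, Option.some.injEq, exists_eq_left', queries_eqN,
      queries_charge]
    exact ⟨hI.found.isSparseForm (bestRow_eq_zero hI hS hT h0), by simp⟩
  | succ fuel ih =>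
    rw [mainLoop_succ]
    simp only [val_bind, queries_bind, val_eqN, queries_bestRow, queries_eqN, decide_eq_true_eq]
    by_cases h0 : (bestRow rows).val.1 = 0
    · simp only [h0, if_true, val_charge, Option.some.injEq, exists_eq_left', queries_charge]
      exact ⟨hI.found.isSparseForm (bestRow_eq_zero hI hS hT h0), by simp⟩
    · rw [if_neg h0]
      obtain ⟨h1, h2⟩ := hI.pass hS hT P h0
      have h3 := ih h1 (by omega) (by omega)
      refine ⟨h3.1, ?_⟩
      grind [queries_bind, add_mul, queries_pass]

end MainLoop

/-! ### The initialization -/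

/-- The prime of the algorithm. -/
def thePrime (n T D : ℕ) : ℕ := (primeAtLeast (max n (max (numBases n T) D))).val

/-- The first rows. -/
def initRow {n : ℕ} (P : Prog) (B : (Fin n → ℂ) → ℂ) (T G p d : ℕ) : Comp Row := do
  let v ← substVector n d p
  let g ← interpolate P B T G v
  let gMod ← reduceMod p g
  charge 1 (⟨v, g, gMod⟩ : Row)

lemma sum_lt_of_totalDegree_lt {n D : ℕ} {f : MvPolynomial (Fin n) ℂ} (hD : f.totalDegree < D) :
    ∀ m ∈ f.support, ∑ i, m i < D := by
  intro m hm
  have := MvPolynomial.le_totalDegree hm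
  rw [Finsupp.sum_fintype _ _ fun _ => rfl] at this
  omega

lemma setup_thePrime {n T D : ℕ} {f : MvPolynomial (Fin n) ℂ} (hD : f.totalDegree < D)
    (hT : f.support.card ≤ T) : Setup f T D (thePrime n T D) := by
  obtain ⟨h1, h2, -⟩ := val_primeAtLeast (max n (max (numBases n T) D))
  rw [thePrime]
  exact ⟨h1, by omega, sum_lt_of_totalDegree_lt hD, hT, by omega⟩

section Init

variable {n T D p : ℕ} {f : MvPolynomial (Fin n) ℂ}

lemma val_interpolate_baseVec (hS : Setup f T D p) (P : Prog) (d : ℕ) :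
    (interpolate P (fun x => eval x f) T (D * p) (baseVec n p d)).val =
      sparseList (mapDomain (weight (baseVec n p d)) (coeffFun f)) :=
  val_interpolate _ _ _ hS.card fun _ hm =>
    hS.weight_lt hS.prime.pos (fun _ hx => le_of_mem_baseVec hS.prime.pos hx) hm

lemma loopInv_init (hS : Setup f T D p) (P : Prog) :
    LoopInv f p T ((range' 1 (numBases n T)).map fun d =>
      (initRow P (fun x => eval x f) T (D * p) p d).val) [] := by
  have hrow : ∀ d, (initRow P (fun x => eval x f) T (D * p) p d).val =
      ⟨baseVec n p d, sparseList (mapDomain (weight (baseVec n p d)) (coeffFun f)),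
        (reduceMod p (sparseList (mapDomain (weight (baseVec n p d))
          (coeffFun f)))).val⟩ := by
    intro d
    simp only [initRow, val_bind, val_charge, val_substVector hS.prime.one_lt,
      val_interpolate_baseVec hS]
  refine ⟨⟨by simp, by simp, by simp, by simp⟩, ?_, ?_⟩
  · simpa [termSum, support_coeffFun] using hS.card
  · simp only [hrow]
    refine ⟨by simp [Function.comp_def], ?_, ?_⟩
    · intro row hr
      obtain ⟨d, -, rfl⟩ := mem_map.1 hr
      simpa [termSum] using Rep.sparseList _
    · intro row hr
      obtain ⟨d, -, rfl⟩ := mem_map.1 hr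
      have := (Rep.sparseList (mapDomain (weight (baseVec n p d))
        (coeffFun f))).reduceMod p
      rw [← Finsupp.mapDomain_comp] at this
      simp only [termSum, map_nil, List.sum_nil, sub_zero]
      exact this

lemma queries_initRow (P : Prog) (B : (Fin n → ℂ) → ℂ) (G d : ℕ) :
    (initRow P B T G p d).queries ≤ 2 * T := by
  grind [initRow, queries_bind, queries_substVector, queries_reduceMod, queries_charge, zero_add, add_zero, queries_interpolate]

end Init

lemma miPolyBase_eq {n : ℕ} (P : Prog) (B : (Fin n → ℂ) → ℂ) (T D : ℕ) :
    miPolyBase P B T D = params n T >>= fun q => maxN q.2.2 D >>= fun a => maxN n a >>= fun b =>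
      primeAtLeast b >>= fun p => mulN D p >>= fun G =>
        mapList (initRow P B T G p) (range' 1 q.2.2) >>= fun rows =>
          mainLoop P B p D T T T rows [] := rfl

lemma miPolyBase_correct (P : Prog) {n T D : ℕ} {f : MvPolynomial (Fin n) ℂ} (hn : 1 ≤ n)
    (hT : 1 ≤ T) (hD : f.totalDegree < D) (hcard : f.support.card ≤ T) :
    (∃ L : List Term,
      (miPolyBase P (fun x => eval x f) T D).val = some L ∧ IsSparseForm L f) ∧
    (miPolyBase P (fun x => eval x f) T D).queries ≤ 10 * (n * T ^ 2) := by
  have hS := setup_thePrime hD hcard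
  have hspec := mainLoop_spec hS P (loopInv_init hS P) le_rfl le_rfl
  rw [miPolyBase_eq]
  simp only [val_bind, val_params, val_maxN, val_mulN, val_mapList, queries_bind, queries_params,
    queries_maxN, queries_primeAtLeast, queries_mulN]
  refine ⟨hspec.1, ?_⟩
  have h1 := queries_mapList_le (initRow P (fun x => eval x f) T
    (D * (thePrime n T D)) (thePrime n T D)) (range' 1 (numBases n T)) (2 * T)
    fun d _ => queries_initRow _ _ _ _
  have h2 := hspec.2
  rw [length_range'] at h1
  have h3 : numBases n T * (2 * T) ≤ 8 * (n * T ^ 2) := by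
    calc numBases n T * (2 * T) ≤ 4 * (n * T) * (2 * T) := Nat.mul_le_mul_right _ (numBases_le hn hT)
      _ = 8 * (n * T ^ 2) := by ring
  have h4 : T * (n * (2 * T)) = 2 * (n * T ^ 2) := by ring
  rw [thePrime] at h1 h2
  omega

end

section

open Prog

/-! ### Lengths of integers -/

lemma intLen_pos (z : ℤ) : 1 ≤ intLen z := by simp [intLen]

lemma size_add_le (a b : ℕ) : size (a + b) ≤ max (size a) (size b) + 1 := by
  rw [size_le, pow_succ, mul_two]
  refine add_lt_add ?_ ?_
  · exact (lt_size_self a).trans_le (pow_le_pow_right (by norm_num) (le_max_left _ _))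
  · exact (lt_size_self b).trans_le (pow_le_pow_right (by norm_num) (le_max_right _ _))

lemma size_mul_le (a b : ℕ) : size (a * b) ≤ size a + size b := by
  rw [size_le, pow_add]
  exact Nat.mul_lt_mul'' (lt_size_self a) (lt_size_self b)

lemma intLen_add_le (a b : ℤ) : intLen (a + b) ≤ max (intLen a) (intLen b) + 1 := by
  have h := size_le_size (Int.natAbs_add_le a b)
  have := size_add_le a.natAbs b.natAbs
  simp only [intLen] at *
  omega

lemma intLen_neg (a : ℤ) : intLen (-a) = intLen a := by simp [intLen]

lemma intLen_sub_le (a b : ℤ) : intLen (a - b) ≤ max (intLen a) (intLen b) + 1 := by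
  have := intLen_add_le a (-b)
  rwa [intLen_neg, ← sub_eq_add_neg] at this

lemma intLen_mul_le (a b : ℤ) : intLen (a * b) ≤ intLen a + intLen b := by
  have := size_mul_le a.natAbs b.natAbs
  simp only [intLen, Int.natAbs_mul] at *
  omega

lemma intLen_div_le (a b : ℤ) : intLen (a / b) ≤ intLen a := by
  have := size_le_size (Int.natAbs_ediv_le_natAbs a b)
  simp only [intLen]; omega

lemma intLen_mod_le (a b : ℤ) : intLen (a % b) ≤ max (intLen a) (intLen b) := by
  by_cases hb : b = 0
  · subst hb; simp
  · have h1 := Int.emod_nonneg a hb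
    have h2 := Int.emod_lt_abs a hb
    have h3 : (a % b).natAbs ≤ b.natAbs := by
      zify; rw [abs_of_nonneg h1]; exact h2.le
    have := size_le_size h3
    simp only [intLen]; omega

lemma intLen_le_of_natAbs_le {a b : ℤ} (h : a.natAbs ≤ b.natAbs) : intLen a ≤ intLen b := by
  have := size_le_size h
  simp only [intLen]; omega

lemma intLen_le_of_lt_two_pow {a : ℤ} {k : ℕ} (h : |a| < 2 ^ k) : intLen a ≤ k + 1 := by
  have : a.natAbs < 2 ^ k := by zify; exact h
  have := size_le.2 this
  simp only [intLen]; omega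

lemma softMul_mono {a b : ℕ} (h : a ≤ b) : softMul a ≤ softMul b :=
  Nat.mul_le_mul h (pow_le_pow_left (size_le_size h) 2)

lemma le_softMul {S : ℕ} (hS : 1 ≤ S) : S ≤ softMul S := by
  have : 1 ≤ size S := size_pos.2 hS
  exact le_mul_of_pos_right _ (by positivity)

lemma softMul_mul_le (c : ℕ) {S : ℕ} (hS : 1 ≤ S) :
    softMul (c * S) ≤ c * (size c + 1) ^ 2 * softMul S := by
  have h1 : 1 ≤ size S := size_pos.2 hS
  have h2 : size (c * S) ≤ (size c + 1) * size S := by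
    have := size_mul_le c S; nlinarith
  calc softMul (c * S) ≤ c * S * ((size c + 1) * size S) ^ 2 :=
        Nat.mul_le_mul_left _ (pow_le_pow_left h2 2)
    _ = c * (size c + 1) ^ 2 * softMul S := by rw [softMul]; ring

/-- Pairs of data. -/
infixr:67 " & " => Data.pair

namespace Data

/-- All integers in the datum have length at most `S`. -/
def Bdd (S : ℕ) : Data → Prop
  | int z => intLen z ≤ S
  | pair a b => Bdd S a ∧ Bdd S b

lemma Bdd.mono {S S' : ℕ} (h : S ≤ S') : ∀ {x : Data}, x.Bdd S → x.Bdd S'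
  | int _, hx => le_trans hx h
  | pair _ _, hx => ⟨Bdd.mono h hx.1, Bdd.mono h hx.2⟩

lemma Bdd.left {S : ℕ} : ∀ {x : Data}, x.Bdd S → x.left.Bdd S
  | int _, hx => hx
  | pair _ _, hx => hx.1

lemma Bdd.right {S : ℕ} : ∀ {x : Data}, x.Bdd S → x.right.Bdd S
  | int _, hx => hx
  | pair _ _, hx => hx.2

lemma Bdd.pos {S : ℕ} : ∀ {x : Data}, x.Bdd S → 1 ≤ S
  | int z, hx => (intLen_pos z).trans hx
  | pair _ _, hx => Bdd.pos hx.1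

lemma Bdd.toInt {S : ℕ} : ∀ {x : Data}, x.Bdd S → intLen x.toInt ≤ S
  | int _, hx => hx
  | pair _ _, hx => by
    have := hx.1.pos
    simpa [Data.toInt, intLen] using this

@[simp] lemma bdd_int (S : ℕ) (z : ℤ) : (int z).Bdd S ↔ intLen z ≤ S := Iff.rfl
@[simp] lemma bdd_pair (S : ℕ) (a b : Data) : (pair a b).Bdd S ↔ a.Bdd S ∧ b.Bdd S := Iff.rfl

@[simp] lemma left_pair (a b : Data) : (pair a b).left = a := rfl
@[simp] lemma right_pair (a b : Data) : (pair a b).right = b := rfl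
@[simp] lemma left_int (z : ℤ) : (int z).left = int z := rfl
@[simp] lemma right_int (z : ℤ) : (int z).right = int z := rfl
@[simp] lemma toInt_int (z : ℤ) : (int z).toInt = z := rfl
@[simp] lemma toInt_pair (a b : Data) : (pair a b).toInt = 0 := rfl
@[simp] lemma pairFlag_int (z : ℤ) : (int z).pairFlag = 0 := rfl
@[simp] lemma pairFlag_pair (a b : Data) : (pair a b).pairFlag = 1 := rfl

end Data

@[simp] lemma encList_nil : encList [] = Data.int 0 := rfl
@[simp] lemma encList_cons (x : Data) (l : List Data) :
    encList (x :: l) = x & encList l := rfl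

lemma bdd_encList {S : ℕ} (hS : 1 ≤ S) {l : List Data} :
    (encList l).Bdd S ↔ ∀ x ∈ l, x.Bdd S := by
  induction l with
  | nil => simp [intLen]; omega
  | cons a l ih => simp [ih]

namespace Prog

/-- Pairing and composition of programs. -/
infixr:68 " △ " => Prog.pair
infixl:69 " ▷ " => Prog.comp

/-- The value of a program. -/
def val (P : Prog) (x : Data) : Data := (P.run x).1

/-- The cost of a program. -/
def cost (P : Prog) (x : Data) : ℕ := (P.run x).2

variable (p q c : Prog) (x : Data)

@[simp] lemma val_id : id.val x = x := rfl
@[simp] lemma val_const (z : ℤ) : (const z).val x = Data.int z := rfl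
@[simp] lemma val_comp : (comp p q).val x = q.val (p.val x) := rfl
@[simp] lemma val_pair : (pair p q).val x = p.val x & q.val x := rfl
@[simp] lemma val_fst : fst.val x = x.left := rfl
@[simp] lemma val_snd : snd.val x = x.right := rfl
@[simp] lemma val_isPair : isPair.val x = Data.int x.pairFlag := rfl
@[simp] lemma val_add : add.val x = Data.int (x.left.toInt + x.right.toInt) := rfl
@[simp] lemma val_sub : sub.val x = Data.int (x.left.toInt - x.right.toInt) := rfl
@[simp] lemma val_mul : mul.val x = Data.int (x.left.toInt * x.right.toInt) := rfl
@[simp] lemma val_div : div.val x = Data.int (x.left.toInt / x.right.toInt) := rfl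
@[simp] lemma val_mod : mod.val x = Data.int (x.left.toInt % x.right.toInt) := rfl
@[simp] lemma val_le :
    le.val x = Data.int (if x.left.toInt ≤ x.right.toInt then 1 else 0) := rfl

@[simp] lemma val_ite :
    (ite c p q).val x = if (c.val x).toInt ≠ 0 then p.val x else q.val x := by
  by_cases h : (c.run x).1.toInt = 0 <;> simp [val, run, h]

lemma cost_ite : (ite c p q).cost x =
    if (c.val x).toInt ≠ 0 then c.cost x + p.cost x + 1 else c.cost x + q.cost x + 1 := by
  by_cases h : (c.run x).1.toInt = 0 <;> simp [val, cost, run, h]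

lemma cost_comp : (comp p q).cost x = p.cost x + q.cost (p.val x) + 1 := rfl
lemma cost_pair : (pair p q).cost x = p.cost x + q.cost x + 1 := rfl

lemma run_loop (m : ℕ) (s : Data × ℕ) :
    (fun s : Data × ℕ => ((p.run s.1).1, s.2 + (p.run s.1).2 + 1))^[m] s =
      (p.val^[m] s.1, s.2 + ∑ i ∈ Finset.range m, (p.cost (p.val^[i] s.1) + 1)) := by
  induction m with
  | zero => simp
  | succ m ih =>
    rw [iterate_succ_apply', ih, iterate_succ_apply', sum_range_succ]
    simp only [val, cost, Prod.mk.injEq, true_and]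
    ring

@[simp] lemma val_loop : (loop p).val x = p.val^[x.left.toInt.toNat] x.right := by
  rw [val, run, run_loop]

lemma cost_loop : (loop p).cost x = intLen x.left.toInt +
    ∑ i ∈ Finset.range x.left.toInt.toNat, (p.cost (p.val^[i] x.right) + 1) := by
  rw [cost, run, run_loop]

/-- All loops that are run on the datum `x` have at most `m` passes. -/
def LoopB (m : ℕ) : Prog → Data → Prop
  | comp p q, x => LoopB m p x ∧ LoopB m q (p.val x)
  | pair p q, x => LoopB m p x ∧ LoopB m q x
  | ite c p q, x =>
      LoopB m c x ∧ ((c.val x).toInt ≠ 0 → LoopB m p x) ∧ ((c.val x).toInt = 0 → LoopB m q x)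
  | loop p, x => x.left.toInt.toNat ≤ m ∧
      ∀ i < x.left.toInt.toNat, LoopB m p (p.val^[i] x.right)
  | _, _ => True

/-- A program without loops. -/
def LoopFree : Prog → Bool
  | comp p q => LoopFree p && LoopFree q
  | pair p q => LoopFree p && LoopFree q
  | ite c p q => LoopFree c && LoopFree p && LoopFree q
  | loop _ => false
  | _ => true

lemma LoopFree.loopB {P : Prog} (h : P.LoopFree = true) (m : ℕ) (x : Data) : LoopB m P x := by
  induction P generalizing x with
  | comp p q ihp ihq =>
    simp only [LoopFree, Bool.and_eq_true] at h; exact ⟨ihp h.1 _, ihq h.2 _⟩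
  | pair p q ihp ihq =>
    simp only [LoopFree, Bool.and_eq_true] at h; exact ⟨ihp h.1 _, ihq h.2 _⟩
  | ite c p q ihc ihp ihq =>
    simp only [LoopFree, Bool.and_eq_true] at h
    exact ⟨ihc h.1.1 _, fun _ => ihp h.1.2 _, fun _ => ihq h.2 _⟩
  | loop p ih => simp [LoopFree] at h
  | _ => trivial

/-- The bound on values and costs of a program whose loops have boundedly many passes. -/
def CostBound (m c : ℕ) (P : Prog) : Prop :=
  ∀ S x, x.Bdd S → P.LoopB m x → (P.val x).Bdd (c * S) ∧ P.cost x ≤ c * softMul S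

lemma CostBound.mono {m c c' : ℕ} {P : Prog} (h : CostBound m c P) (hc : c ≤ c') :
    CostBound m c' P := fun S x hx hl =>
  ⟨(h S x hx hl).1.mono (Nat.mul_le_mul_right _ hc),
    (h S x hx hl).2.trans (Nat.mul_le_mul_right _ hc)⟩

lemma argLen_le {S : ℕ} {x : Data} (hx : x.Bdd S) : argLen x ≤ 2 * S := by
  have h1 := hx.left.toInt
  have h2 := hx.right.toInt
  rw [argLen]; omega

lemma lt_argLen (x : Data) : max (intLen x.left.toInt) (intLen x.right.toInt) < argLen x := by
  have := intLen_pos x.left.toInt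
  have := intLen_pos x.right.toInt
  rw [argLen]; omega

lemma exists_costBound_of_const {m : ℕ} {P : Prog} (c : ℕ)
    (h : ∀ S x, x.Bdd S → (P.val x).Bdd (c * S) ∧ P.cost x ≤ c) : ∃ c, CostBound m c P :=
  ⟨c, fun S x hx _ => ⟨(h S x hx).1, (h S x hx).2.trans
    (le_mul_of_pos_right _ (hx.pos.trans (le_softMul hx.pos)))⟩⟩

lemma exists_costBound_of_arith {m : ℕ} {P : Prog} (h : ∀ x, ∃ z, P.val x = .int z ∧
    intLen z ≤ argLen x ∧ P.cost x ≤ softMul (argLen x)) : ∃ c, CostBound m c P := by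
  refine ⟨2 * (size 2 + 1) ^ 2, fun S x hx _ => ?_⟩
  obtain ⟨z, h1, h2, h3⟩ := h x
  have h4 := argLen_le hx
  rw [h1]
  exact ⟨h2.trans (h4.trans (Nat.mul_le_mul_right S (by decide))),
    h3.trans ((softMul_mono h4).trans (softMul_mul_le 2 hx.pos))⟩

lemma exists_costBound (P : Prog) (m : ℕ) : ∃ c, CostBound m c P := by
  have hs : ∀ x, argLen x ≤ softMul (argLen x) := fun x => le_softMul (by have := lt_argLen x; omega)
  induction P with
  | id => exact exists_costBound_of_const 1 fun S x hx => ⟨by simpa using hx, le_rfl⟩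
  | const z => exact exists_costBound_of_const (intLen z) fun S x hx =>
      ⟨le_mul_of_pos_right _ hx.pos, le_rfl⟩
  | fst => exact exists_costBound_of_const 1 fun S x hx => ⟨by simpa using hx.left, le_rfl⟩
  | snd => exact exists_costBound_of_const 1 fun S x hx => ⟨by simpa using hx.right, le_rfl⟩
  | isPair => exact exists_costBound_of_const 2 fun S x hx => ⟨by
      have := hx.pos
      cases x <;> simp [intLen, Data.pairFlag] <;> omega, one_le_two⟩
  | add => exact exists_costBound_of_arith fun x =>
      ⟨_, rfl, (intLen_add_le _ _).trans (lt_argLen x), hs x⟩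
  | sub => exact exists_costBound_of_arith fun x =>
      ⟨_, rfl, (intLen_sub_le _ _).trans (lt_argLen x), hs x⟩
  | mul => exact exists_costBound_of_arith fun x => ⟨_, rfl, intLen_mul_le _ _, le_rfl⟩
  | div => exact exists_costBound_of_arith fun x =>
      ⟨_, rfl, (intLen_div_le _ _).trans (Nat.le_add_right _ _), le_rfl⟩
  | mod => exact exists_costBound_of_arith fun x =>
      ⟨_, rfl, (intLen_mod_le _ _).trans (lt_argLen x).le, le_rfl⟩
  | le => exact exists_costBound_of_arith fun x =>
      ⟨_, rfl, (show _ ≤ 2 by split <;> decide).trans (by have := lt_argLen x; grind [intLen_pos]), hs x⟩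
  | comp p q ihp ihq =>
    obtain ⟨a, ha⟩ := ihp
    obtain ⟨b, hb⟩ := ihq
    refine ⟨b * a + a + b * (a * (size a + 1) ^ 2) + 1, fun S x hx hl => ?_⟩
    obtain ⟨h1, h2⟩ := ha S x hx hl.1
    obtain ⟨h3, h4⟩ := hb _ _ h1 hl.2
    have hS := hx.pos
    have h5 := le_softMul hS
    refine ⟨h3.mono ?_, ?_⟩
    · rw [← mul_assoc]; exact Nat.mul_le_mul_right _ (by omega)
    · rw [cost_comp]
      have h6 := Nat.mul_le_mul_left b (softMul_mul_le a hS)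
      nlinarith
  | pair p q ihp ihq =>
    obtain ⟨a, ha⟩ := ihp
    obtain ⟨b, hb⟩ := ihq
    refine ⟨a + b + 1, fun S x hx hl => ?_⟩
    obtain ⟨h1, h2⟩ := ha S x hx hl.1
    obtain ⟨h3, h4⟩ := hb S x hx hl.2
    have h5 := le_softMul hx.pos
    have h6 := hx.pos
    refine ⟨⟨h1.mono (Nat.mul_le_mul_right _ (by omega)),
      h3.mono (Nat.mul_le_mul_right _ (by omega))⟩, ?_⟩
    rw [cost_pair]; nlinarith
  | ite c p q ihc ihp ihq =>
    obtain ⟨d, hd⟩ := ihc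
    obtain ⟨a, ha⟩ := ihp
    obtain ⟨b, hb⟩ := ihq
    refine ⟨d + a + b + 1, fun S x hx hl => ?_⟩
    obtain ⟨h1, h2⟩ := hd S x hx hl.1
    have h5 := le_softMul hx.pos
    have h6 := hx.pos
    rw [val_ite, cost_ite]
    split
    · rename_i hc
      obtain ⟨h3, h4⟩ := ha S x hx (hl.2.1 hc)
      exact ⟨h3.mono (Nat.mul_le_mul_right _ (by omega)), by nlinarith⟩
    · rename_i hc
      obtain ⟨h3, h4⟩ := hb S x hx (hl.2.2 (not_not.1 hc))
      exact ⟨h3.mono (Nat.mul_le_mul_right _ (by omega)), by nlinarith⟩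
  | loop p ih =>
    obtain ⟨a', ha'⟩ := ih
    obtain ⟨a, ha1, ha⟩ : ∃ a, 1 ≤ a ∧ CostBound m a p :=
      ⟨max a' 1, le_max_right _ _, ha'.mono (le_max_left _ _)⟩
    refine ⟨a ^ m + 1 + m * (a * (a ^ m * (size (a ^ m) + 1) ^ 2) + 1), fun S x hx hl => ?_⟩
    obtain ⟨hm, hl⟩ := hl
    set k := x.left.toInt.toNat
    have hS := hx.pos
    have key : ∀ i ≤ k, (p.val^[i] x.right).Bdd (a ^ i * S) := by
      intro i
      induction i with
      | zero => intro _; simpa using hx.right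
      | succ i ih =>
        intro hi
        rw [iterate_succ_apply', pow_succ', mul_assoc]
        exact (ha _ _ (ih (by omega)) (hl i (by omega))).1
    have hpow : ∀ i ≤ k, a ^ i * S ≤ a ^ m * S := fun i hi =>
      Nat.mul_le_mul_right _ (pow_le_pow_right ha1 (by omega))
    have h5 := le_softMul hS
    have hcost : ∀ i ∈ Finset.range k, p.cost (p.val^[i] x.right) + 1 ≤
        (a * (a ^ m * (size (a ^ m) + 1) ^ 2) + 1) * softMul S := by
      intro i hi
      rw [mem_range] at hi
      have h1 := (ha _ _ (key i hi.le) (hl i hi)).2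
      have h2 := (softMul_mono (hpow i hi.le)).trans (softMul_mul_le (a ^ m) hS)
      have h3 := Nat.mul_le_mul_left a h2
      rw [add_mul, one_mul, mul_assoc a]
      omega
    refine ⟨?_, ?_⟩
    · rw [val_loop]
      exact (key k le_rfl).mono ((hpow k le_rfl).trans (Nat.mul_le_mul_right _ (by omega)))
    · rw [cost_loop]
      change _ + ∑ i ∈ Finset.range k, _ ≤ _
      have h1 := sum_le_card_nsmul _ _ _ hcost
      rw [card_range, smul_eq_mul] at h1
      have h2 := Nat.mul_le_mul_right
        ((a * (a ^ m * (size (a ^ m) + 1) ^ 2) + 1) * softMul S) hm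
      have h3 := hx.left.toInt
      have h4 : (a ^ m + 1) * softMul S ≥ S := by nlinarith [Nat.zero_le (a ^ m * softMul S)]
      rw [add_mul _ _ (softMul S), mul_assoc m]
      omega

lemma exists_cost_le_of_loopFree {P : Prog} (h : P.LoopFree = true) :
    ∃ c, ∀ S x, x.Bdd S → P.cost x ≤ c * softMul S := by
  obtain ⟨c, hc⟩ := exists_costBound P 0
  exact ⟨c, fun S x hx => (hc S x hx (LoopFree.loopB h 0 x)).2⟩

/-! ### Folding over coded lists -/

/-- The body of `foldP`. -/
def foldBody (step : Prog) : Prog :=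
  ite (comp fst isPair) (pair (comp fst snd) (comp (pair (comp fst fst) snd) step)) id

/-- On the datum `pair (int c) (pair l s)`, fold the list `l` with `step`, from the left, starting
with `s`. The number `c` bounds the length of the list. -/
def foldP (step : Prog) : Prog := comp (loop (foldBody step)) snd

lemma val_foldBody_cons (step : Prog) (x l s : Data) :
    (foldBody step).val ((x & l) & s) = l & step.val (x & s) := by
  simp [foldBody]

lemma val_foldBody_nil (step : Prog) (z : ℤ) (s : Data) :
    (foldBody step).val (Data.int z & s) = Data.int z & s := by
  simp [foldBody]

lemma iterate_foldBody_nil (step : Prog) (s : Data) (i : ℕ) :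
    (foldBody step).val^[i] (Data.int 0 & s) = Data.int 0 & s := by
  induction i with
  | zero => rfl
  | succ i ih => rw [iterate_succ_apply, val_foldBody_nil, ih]

/-- The state of a fold. -/
def foldState (step : Prog) (l : List Data) (s : Data) : Data :=
  l.foldl (fun s x => step.val (x & s)) s

lemma iterate_foldBody (step : Prog) (l : List Data) (s : Data) (i : ℕ) :
    (foldBody step).val^[i] (encList l & s) =
      encList (l.drop i) & foldState step (l.take i) s := by
  induction l generalizing s i with
  | nil => simpa [foldState] using iterate_foldBody_nil step s i
  | cons x l ih =>
    cases i with
    | zero => rfl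
    | succ i =>
      rw [iterate_succ_apply, encList_cons, val_foldBody_cons, ih]
      rfl

lemma val_foldP (step : Prog) {l : List Data} {c : ℕ} (hc : l.length ≤ c) (s : Data) :
    (foldP step).val (Data.int c & encList l & s) = foldState step l s := by
  rw [foldP, val_comp, val_loop]
  simp only [Data.left_pair, Data.toInt_int, Data.right_pair, Int.toNat_natCast]
  rw [iterate_foldBody, List.take_of_length_le hc]
  rfl

lemma cost_foldBody_cons (step : Prog) (x l s : Data) :
    (foldBody step).cost ((x & l) & s) = step.cost (x & s) + 14 := by
  have h1 : fst.cost = fun _ => 1 := rfl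
  have h2 : snd.cost = fun _ => 1 := rfl
  have h3 : isPair.cost = fun _ => 1 := rfl
  simp [foldBody, cost_ite, cost_comp, cost_pair, h1, h2, h3]
  omega

lemma cost_foldBody_nil (step : Prog) (z : ℤ) (s : Data) :
    (foldBody step).cost (Data.int z & s) = 5 := by
  have h1 : fst.cost = fun _ => 1 := rfl
  have h3 : isPair.cost = fun _ => 1 := rfl
  have h4 : id.cost = fun _ => 1 := rfl
  simp [foldBody, cost_ite, cost_comp, h1, h3, h4]

lemma loopB_foldP {step : Prog} {m c : ℕ} (hcm : c ≤ m) {l : List Data} {s : Data}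
    (h : ∀ l1 x l2, l = l1 ++ x :: l2 → LoopB m step (x & foldState step l1 s)) :
    LoopB m (foldP step) (Data.int c & encList l & s) := by
  refine ⟨⟨by simpa using hcm, fun i _ => ?_⟩, trivial⟩
  simp only [Data.right_pair]
  rw [iterate_foldBody]
  refine ⟨⟨trivial, trivial⟩, fun hne => ?_, fun _ => trivial⟩
  rcases lt_or_ge i l.length with hi | hi
  · rw [drop_eq_getElem_cons hi, encList_cons]
    refine ⟨⟨trivial, trivial⟩, ⟨⟨trivial, trivial⟩, trivial⟩, ?_⟩
    exact h (l.take i) l[i] (l.drop (i + 1)) (by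
        rw [← drop_eq_getElem_cons hi, List.take_append_drop])
  · rw [List.drop_eq_nil_of_le hi] at hne
    simp at hne

/-! ### Program abbreviations -/

/-- Entry number `k` of a tuple coded by right nested pairs. -/
def var : ℕ → Prog
  | 0 => fst
  | k + 1 => snd ▷ var k

/-- A tuple without its first `k` entries. -/
def rest : ℕ → Prog
  | 0 => id
  | k + 1 => snd ▷ rest k

@[simp] lemma val_var_zero (x : Data) : (var 0).val x = x.left := rfl
@[simp] lemma val_var_succ (k : ℕ) (x : Data) : (var (k + 1)).val x = (var k).val x.right := rfl
@[simp] lemma val_rest_zero (x : Data) : (rest 0).val x = x := rfl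
@[simp] lemma val_rest_succ (k : ℕ) (x : Data) : (rest (k + 1)).val x = (rest k).val x.right := rfl

/-- Arithmetic instructions applied to the results of two programs. -/
def addP (p q : Prog) : Prog := pair p q ▷ add
def subP (p q : Prog) : Prog := pair p q ▷ sub
def mulP (p q : Prog) : Prog := pair p q ▷ mul
def divP (p q : Prog) : Prog := pair p q ▷ div
def modP (p q : Prog) : Prog := pair p q ▷ mod
def leP (p q : Prog) : Prog := pair p q ▷ le

section

variable (p q : Prog) (x : Data)

@[simp] lemma val_addP : (addP p q).val x = .int ((p.val x).toInt + (q.val x).toInt) := rfl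
@[simp] lemma val_subP : (subP p q).val x = .int ((p.val x).toInt - (q.val x).toInt) := rfl
@[simp] lemma val_mulP : (mulP p q).val x = .int ((p.val x).toInt * (q.val x).toInt) := rfl
@[simp] lemma val_divP : (divP p q).val x = .int ((p.val x).toInt / (q.val x).toInt) := rfl
@[simp] lemma val_modP : (modP p q).val x = .int ((p.val x).toInt % (q.val x).toInt) := rfl
@[simp] lemma val_leP :
    (leP p q).val x = .int (if (p.val x).toInt ≤ (q.val x).toInt then 1 else 0) := rfl

end

/-- Fold the list `lst`, of length at most `cnt`, starting with `init`. -/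
def foldE (cnt lst init step : Prog) : Prog := (cnt △ lst △ init) ▷ foldP step

lemma val_foldE {cnt lst init step : Prog} {x : Data} {c : ℕ} {l : List Data}
    (hc : cnt.val x = .int c) (hl : lst.val x = encList l) (hlc : l.length ≤ c) :
    (foldE cnt lst init step).val x = foldState step l (init.val x) := by
  rw [foldE, val_comp, val_pair, val_pair, hc, hl, val_foldP step hlc]

lemma loopB_foldE {m : ℕ} {cnt lst init step : Prog} {x : Data} {c : ℕ} {l : List Data}
    (hc : cnt.val x = .int c) (hl : lst.val x = encList l) (hcm : c ≤ m)
    (h1 : LoopB m cnt x) (h2 : LoopB m lst x) (h3 : LoopB m init x)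
    (h : ∀ l1 y l2, l = l1 ++ y :: l2 →
      LoopB m step (y & foldState step l1 (init.val x))) :
    LoopB m (foldE cnt lst init step) x := by
  refine ⟨⟨h1, h2, h3⟩, ?_⟩
  rw [val_pair, val_pair, hc, hl]
  exact loopB_foldP hcm h

lemma foldState_nil (step : Prog) (s : Data) : foldState step [] s = s := rfl

lemma foldState_cons (step : Prog) (x : Data) (l : List Data) (s : Data) :
    foldState step (x :: l) s = foldState step l (step.val (x & s)) := rfl

lemma foldState_append (step : Prog) (l l' : List Data) (s : Data) :
    foldState step (l ++ l') s = foldState step l' (foldState step l s) := by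
  simp [foldState]

lemma foldState_id (l acc : List Data) :
    foldState id l (encList acc) = encList (l.reverse ++ acc) := by
  induction l generalizing acc with
  | nil => rfl
  | cons x l ih =>
    rw [foldState_cons, val_id, ← encList_cons, ih]
    simp

/-- Reverse the list `lst`, of length at most `cnt`. -/
def revE (cnt lst : Prog) : Prog := foldE cnt lst (const 0) id

lemma val_revE {cnt lst : Prog} {x : Data} {c : ℕ} {l : List Data}
    (hc : cnt.val x = .int c) (hl : lst.val x = encList l) (hlc : l.length ≤ c) :
    (revE cnt lst).val x = encList l.reverse := by
  rw [revE, val_foldE hc hl hlc]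
  simpa using foldState_id l []

/-! ### The exponent of the size -/

/-- From `G`, the least `m` with `G ≤ 2 ^ m`, and `2 ^ m`. -/
def sizeBody : Prog := ite (leP (var 0) (rest 2)) id
  (var 0 △ addP (var 1) (const 1) △ mulP (const 2) (rest 2))

def sizeP : Prog :=
  (id △ id △ const 0 △ const 1) ▷ (loop sizeBody ▷ snd)

lemma iterate_sizeBody (G i : ℕ) :
    sizeBody.val^[i] (.int G & .int 0 & .int 1) =
      .int G & .int (min i (clog 2 G) : ℕ) & .int (2 ^ min i (clog 2 G) : ℕ) := by
  induction i with
  | zero => simp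
  | succ i ih =>
    rw [iterate_succ_apply', ih]
    rcases lt_or_ge i (clog 2 G) with h | h
    · have h1 : ¬ G ≤ 2 ^ i := fun h' => absurd (Nat.clog_le_of_le_pow h') (by omega)
      rw [min_eq_left h.le, min_eq_left (by omega : i + 1 ≤ clog 2 G)]
      have h2 : ¬ ((G : ℤ) ≤ 2 ^ i) := by exact_mod_cast h1
      simp [sizeBody, h2, pow_succ, mul_comm]
    · have h1 : (G : ℤ) ≤ 2 ^ clog 2 G := by exact_mod_cast le_pow_clog (by norm_num) G
      rw [min_eq_right h, min_eq_right (by omega : clog 2 G ≤ i + 1)]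
      simp [sizeBody, h1]

lemma clog_two_le (G : ℕ) : clog 2 G ≤ G :=
  Nat.clog_le_of_le_pow lt_two_pow_self.le

lemma val_sizeP (G : ℕ) :
    sizeP.val (.int G) = .int (clog 2 G : ℕ) & .int (2 ^ clog 2 G : ℕ) := by
  grind [sizeP, val_comp, val_pair, val_id, val_const, val_loop, val_snd, Data.left_pair, Data.toInt_int, Data.right_pair, Int.toNat_natCast, iterate_sizeBody, clog_two_le]

/-! ### A factorial that is at most `T` -/

def factBody : Prog := ite (leP (mulP (rest 2) (addP (var 1) (const 1))) (var 0))
  (var 0 △ addP (var 1) (const 1) △ mulP (rest 2) (addP (var 1) (const 1))) id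

def factP : Prog :=
  (id △ id △ const 0 △ const 1) ▷ (loop factBody ▷ rest 2)

lemma iterate_factBody (T i : ℕ) : ∃ k : ℕ,
    factBody.val^[i] (.int T & .int 0 & .int 1) =
      .int T & .int k & .int k.factorial ∧ k.factorial ≤ max T 1 ∧
      k ≤ i ∧ (i = k ∨ T < (k + 1).factorial) := by
  induction i with
  | zero => exact ⟨0, by simp, by simp, le_rfl, Or.inl rfl⟩
  | succ i ih =>
    obtain ⟨k, h1, h2, h3, h4⟩ := ih
    rw [iterate_succ_apply', h1]
    have hf : ((k.factorial : ℤ) * ((k : ℤ) + 1)) = ((k + 1).factorial : ℕ) := by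
      rw [Nat.factorial_succ]; push_cast; ring
    by_cases h : (k + 1).factorial ≤ T
    · have hc : (k.factorial : ℤ) * ((k : ℤ) + 1) ≤ T := by rw [hf]; exact_mod_cast h
      refine ⟨k + 1, ?_, h.trans (le_max_left _ _), by omega, ?_⟩
      · simp [factBody, hc, ← hf]
      · rcases h4 with h4 | h4
        · left; omega
        · omega
    · have hc : ¬ (k.factorial : ℤ) * ((k : ℤ) + 1) ≤ T := by rw [hf]; exact_mod_cast h
      refine ⟨k, ?_, h2, by omega, Or.inr (by omega)⟩
      simp [factBody, hc]

lemma val_factP (T : ℕ) : ∃ L : ℕ, factP.val (.int T) = .int L ∧ 0 < L ∧ L ≤ max T 1 ∧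
    ∀ j, 0 < j → j.factorial ≤ T → j ∣ L := by
  obtain ⟨k, h1, h2, -, h3⟩ := iterate_factBody T T
  refine ⟨k.factorial, ?_, Nat.factorial_pos k, h2, ?_⟩
  · simp [factP, val_comp, val_pair, val_id, val_const, val_loop, Data.left_pair, Data.toInt_int, Data.right_pair, Int.toNat_natCast, val_rest_succ, val_rest_zero, h1]
  · intro j h0 hj
    have hjT : j ≤ T := (Nat.self_le_factorial j).trans hj
    have hjk : j ≤ k := by
      rcases h3 with h3 | h3
      · omega
      · by_contra hcon
        have := Nat.factorial_le (show k + 1 ≤ j by omega)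
        omega
    exact Nat.dvd_factorial h0 hjk

/-! ### Powers -/

/-- `2 ^ c`, by doubling. -/
def powP (cnt : Prog) : Prog := (cnt △ const 1) ▷ loop (addP id id)

lemma iterate_double (i : ℕ) (z : ℤ) : (addP id id).val^[i] (.int z) = .int (z * 2 ^ i) := by
  induction i with
  | zero => simp
  | succ i ih =>
    rw [iterate_succ_apply', ih]
    grind [val_addP, val_id, Data.toInt_int, Data.int.injEq]

lemma val_powP {cnt : Prog} {x : Data} {z : ℤ} (h : cnt.val x = .int z) :
    (powP cnt).val x = .int (2 ^ z.toNat) := by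
  simp [powP, val_comp, val_pair, val_const, val_loop, h, Data.left_pair, Data.toInt_int, Data.right_pair, iterate_double, one_mul]

/-- `2 ^ e`, by repeated squaring, from `m` and `e`, where `e < 2 ^ m`. -/
def binPowBody : Prog := divP (var 0) (const 2) △ mulP (var 1) (var 1) △ ite (modP (var 0) (const 2)) (mulP (rest 2) (var 1)) (rest 2)

def binPowP : Prog :=
  (fst △ snd △ const 2 △ const 1) ▷ (loop binPowBody ▷ rest 2)

lemma iterate_binPowBody (m e : ℕ) (b r : ℤ) :
    binPowBody.val^[m] (.int e & .int b & .int r) =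
      .int (e / 2 ^ m : ℕ) & .int (b ^ 2 ^ m) & .int (r * b ^ (e % 2 ^ m)) := by
  induction m generalizing e b r with
  | zero => simp [Nat.mod_one]
  | succ m ih =>
    rw [iterate_succ_apply]
    have hstep : binPowBody.val (.int e & .int b & .int r) =
        .int (e / 2 : ℕ) & .int (b * b) & .int (r * b ^ (e % 2)) := by
      rcases Nat.mod_two_eq_zero_or_one e with h | h
      · have : (e : ℤ) % 2 = 0 := by exact_mod_cast h
        simp [binPowBody, this, h]
      · have : (e : ℤ) % 2 = 1 := by exact_mod_cast h
        simp [binPowBody, this, h]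
    rw [hstep, ih]
    have h1 : e % 2 ^ (m + 1) = e % 2 + 2 * (e / 2 % 2 ^ m) := by
      rw [pow_succ', Nat.mod_mul]
    have h2 : e / 2 / 2 ^ m = e / 2 ^ (m + 1) := by rw [Nat.div_div_eq_div_mul, pow_succ']
    have h3 : (b * b) ^ 2 ^ m = b ^ 2 ^ (m + 1) := by rw [← pow_two, ← pow_mul, pow_succ']
    have h4 : r * b ^ (e % 2) * (b * b) ^ (e / 2 % 2 ^ m) = r * b ^ (e % 2 ^ (m + 1)) := by
      rw [h1, pow_add, pow_mul, mul_assoc, pow_two]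
    rw [h2, h3, h4]

lemma val_binPowP {m e : ℕ} (h : e < 2 ^ m) :
    binPowP.val (.int m & .int e) = .int (2 ^ e) := by
  simp only [binPowP, val_comp, val_pair, val_const, val_loop, val_fst, val_snd, Data.left_pair,
    Data.toInt_int, Data.right_pair, Int.toNat_natCast, val_rest_succ, val_rest_zero]
  rw [iterate_binPowBody, mod_eq_of_lt h]
  simp

/-! ### Lists of digits -/

/-- Coding of a list of integers. -/
def encInts (l : List ℤ) : Data := encList (l.map Data.int)

/-- The value at `y` of the polynomial with the coefficients `l`. -/
def polyEval (y : ℤ) (l : List ℤ) : ℤ := l.foldr (fun d s => d + y * s) 0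

/-- Combine neighbouring digits. -/
def pairUp (y : ℤ) : List ℤ → List ℤ
  | a :: b :: l => (a + y * b) :: pairUp y l
  | l => l

/-- Combine neighbouring digits `m` times. -/
def pairUpAll : ℤ → ℕ → List ℤ → List ℤ
  | _, 0, l => l
  | y, m + 1, l => pairUpAll (y * y) m (pairUp y l)

/-- The numbers `y, y ^ 2, y ^ 4, …`, `m` of them, in decreasing order. -/
def squares : ℤ → ℕ → List ℤ
  | _, 0 => []
  | y, m + 1 => squares (y * y) m ++ [y]

/-- Split each number in two digits in base `y`, the lower one between `-h` and `y - h`. -/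
def splitPass (y h : ℤ) (l : List ℤ) : List ℤ :=
  l.flatMap fun x => [(x + h) % y - h, (x + h) / y]

/-- Split repeatedly. -/
def splitAll (ε : ℤ) (ys l : List ℤ) : List ℤ :=
  ys.foldl (fun l y => splitPass y (ε * y / 2) l) l

lemma length_splitPass (y h : ℤ) (l : List ℤ) :
    (splitPass y h l).length = 2 * l.length := by
  induction l with
  | nil => rfl
  | cons a l ih =>
    simp [splitPass, flatMap_cons, length_cons, List.length_nil]; omega

lemma length_pairUp (y : ℤ) : ∀ (k : ℕ) (l : List ℤ), l.length = 2 * k →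
    (pairUp y l).length = k
  | 0, l, h => by
    have : l = [] := length_eq_zero_iff.1 h
    subst this; rfl
  | k + 1, a :: b :: l, h => by
    have := length_pairUp y k l (by simp at h; omega)
    simp [pairUp, this]
  | k + 1, [a], h => by simp at h; omega
  | k + 1, [], h => by simp at h

lemma polyEval_pairUp (y : ℤ) : ∀ l : List ℤ, Even l.length →
    polyEval (y * y) (pairUp y l) = polyEval y l
  | [], _ => rfl
  | [_], h => by simp at h
  | a :: b :: l, h => by
    have ih := polyEval_pairUp y l (by simpa [Nat.even_add_one] using h)
    simp only [polyEval, pairUp, foldr_cons] at ih ⊢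
    rw [ih]; ring

lemma pairUpAll_eq (m : ℕ) (y : ℤ) (l : List ℤ) (h : l.length = 2 ^ m) :
    pairUpAll y m l = [polyEval y l] := by
  induction m generalizing y l with
  | zero =>
    obtain ⟨a, rfl⟩ := List.length_eq_one_iff.1 (by simpa using h)
    simp [pairUpAll, polyEval]
  | succ m ih =>
    have hl : l.length = 2 * 2 ^ m := by rw [h, pow_succ']
    rw [pairUpAll, ih _ _ (length_pairUp y _ _ hl), polyEval_pairUp _ _ (by rw [hl]; simp)]

lemma splitPass_pairUp {y h : ℤ} (hy : 0 < y) : ∀ l : List ℤ, Even l.length →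
    (∀ x ∈ l, -h ≤ x ∧ x < y - h) → splitPass y h (pairUp y l) = l
  | [], _, _ => rfl
  | [_], h, _ => by simp at h
  | a :: b :: l, he, hx => by
    have ih := splitPass_pairUp hy l (by simpa [Nat.even_add_one] using he)
      fun x hx' => hx x (by simp [hx'])
    have ha := hx a (by simp)
    rw [pairUp, splitPass, flatMap_cons, ← splitPass, ih]
    have h1 : a + y * b + h = (a + h) + y * b := by ring
    have h2 : (a + y * b + h) % y = a + h := by
      rw [h1, Int.add_mul_emod_self_left, Int.emod_eq_of_lt (by omega) (by omega)]
    have h3 : (a + y * b + h) / y = b := by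
      rw [h1, Int.add_mul_ediv_left _ _ hy.ne', Int.ediv_eq_zero_of_lt (by omega) (by omega),
        zero_add]
    rw [h2, h3]; simp

/-- The splitting recovers digits that satisfy a suitable bound `R`. -/
lemma splitAll_pairUpAll {ε : ℤ} {R : ℤ → ℤ → Prop}
    (hR : ∀ y a b, R y a → R y b → R (y * y) (a + y * b))
    (hR' : ∀ y x, R y x → 0 < y ∧ -(ε * y / 2) ≤ x ∧ x < y - ε * y / 2) (m : ℕ) (y : ℤ)
    (l : List ℤ) (hl : l.length = 2 ^ m) (h : ∀ x ∈ l, R y x) :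
    splitAll ε (squares y m) (pairUpAll y m l) = l := by
  have hRp : ∀ (y : ℤ) (l : List ℤ), Even l.length → (∀ x ∈ l, R y x) →
      ∀ x ∈ pairUp y l, R (y * y) x := by
    intro y l
    induction l using pairUp.induct with
    | case1 a b l ih =>
      intro he hx x hm
      rw [pairUp, mem_cons] at hm
      rcases hm with rfl | hm
      · exact hR _ _ _ (hx a (by simp)) (hx b (by simp))
      · exact ih (by simpa [Nat.even_add_one] using he) (fun x h' => hx x (by simp [h'])) x hm
    | case2 l hne =>
      intro he
      match l, hne, he with
      | [], _, _ => simp [pairUp]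
      | [a], _, he => simp at he
      | a :: b :: l, hne, _ => exact absurd rfl (hne a b l)
  induction m generalizing y l with
  | zero => rfl
  | succ m ih =>
    have hl' : l.length = 2 * 2 ^ m := by rw [hl, pow_succ']
    have he : Even l.length := by rw [hl']; simp
    have h1 : ∀ l', splitAll ε (squares (y * y) m ++ [y]) l' =
        splitPass y (ε * y / 2) (splitAll ε (squares (y * y) m) l') := fun l' => by
      simp [splitAll]
    rw [squares, h1, pairUpAll, ih _ _ (length_pairUp y _ _ hl') (hRp y l he h)]
    have hne : l ≠ [] := by
      intro h0; rw [h0] at hl; simp at hl; have := two_pow_pos (m + 1); omega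
    obtain ⟨a, ha⟩ := List.exists_mem_of_ne_nil l hne
    exact splitPass_pairUp (hR' y a (h a ha)).1 l he fun x hx => (hR' y x (h x hx)).2

/-! ### Programs for digits -/

/-- From `m` and `y`, the list `squares y m`. -/
def squaresP : Prog :=
  (fst △ snd △ const 0) ▷ (loop (mulP fst fst △ id) ▷ snd)

lemma iterate_squares (m : ℕ) (y : ℤ) (acc : List ℤ) :
    (mulP fst fst △ id).val^[m] (.int y & encInts acc) =
      .int (y ^ 2 ^ m) & encInts (squares y m ++ acc) := by
  induction m generalizing y acc with
  | zero => simp [squares]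
  | succ m ih =>
    rw [iterate_succ_apply]
    have : (mulP fst fst △ id).val (.int y & encInts acc) =
        .int (y * y) & encInts (y :: acc) := by simp [encInts]
    simp [this, ih, squares, List.append_assoc, pow_mul, pow_succ']

lemma val_squaresP (m : ℕ) (y : ℤ) :
    squaresP.val (.int m & .int y) = encInts (squares y m) := by
  simp only [squaresP, val_comp, val_pair, val_const, val_loop, val_fst, val_snd, Data.left_pair,
    Data.toInt_int, Data.right_pair, Int.toNat_natCast]
  have := iterate_squares m y []
  simp_all [encInts, map_nil, encList_nil, append_nil, Data.right_pair]

def splitStep : Prog :=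
  var 1 △ divP (addP (var 0) (var 1 ▷ snd)) (var 1 ▷ fst) △ subP (modP (addP (var 0) (var 1 ▷ snd)) (var 1 ▷ fst)) (var 1 ▷ snd) △ rest 2

/-- On `(pw, ((y, h), l))`, the list `splitPass y h l`. -/
def splitPassP : Prog :=
  revE (var 0) (foldE (var 0) (rest 2) (var 1 △ const 0) splitStep ▷ rest 1)

lemma foldState_splitStep (y h : ℤ) (l acc : List ℤ) :
    foldState splitStep (l.map Data.int) ((.int y & .int h) & encInts acc) =
      (.int y & .int h) & encInts ((splitPass y h l).reverse ++ acc) := by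
  induction l generalizing acc with
  | nil => rfl
  | cons x l ih =>
    rw [map_cons, foldState_cons]
    have : splitStep.val (.int x & (.int y & .int h) & encInts acc) =
        (.int y & .int h) & encInts ((x + h) / y :: ((x + h) % y - h) :: acc) := by simp [splitStep, encInts]
    simp [this, ih, splitPass, flatMap_cons]

lemma val_splitPassP {pw : ℕ} {y h : ℤ} {l : List ℤ} (hl : 2 * l.length ≤ pw) :
    splitPassP.val (.int pw & (.int y & .int h) & encInts l) =
      encInts (splitPass y h l) := by
  have h1 : (foldE (var 0) (rest 2) (var 1 △ const 0) splitStep).val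
      (.int pw & (.int y & .int h) & encInts l) =
      (.int y & .int h) & encInts (splitPass y h l).reverse := by
    rw [val_foldE (c := pw) (l := l.map Data.int) rfl rfl (by simp; omega)]
    simpa [encInts] using foldState_splitStep y h l []
  rw [splitPassP, val_revE (c := pw) (l := (splitPass y h l).reverse.map Data.int) rfl]
  · rw [encInts, map_reverse, reverse_reverse]
  · rw [val_comp, h1]; rfl
  · grind [length_map, length_reverse, length_splitPass]

def splitAllStep : Prog := var 1 △ var 2 △ (var 1 △ (var 0 △ divP (mulP (var 2) (var 0)) (const 2)) △ rest 3) ▷ splitPassP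

/-- On `(m, (pw, (ε, (ys, l))))`, the list `splitAll ε ys l`. -/
def splitAllP : Prog :=
  foldE (var 0) (var 3) (var 1 △ var 2 △ rest 4) splitAllStep ▷ rest 2

lemma foldState_splitAllStep {pw : ℕ} {ε : ℤ} (ys l : List ℤ)
    (h : 2 ^ ys.length * l.length ≤ pw) :
    foldState splitAllStep (ys.map Data.int) (.int pw & .int ε & encInts l) =
      .int pw & .int ε & encInts (splitAll ε ys l) := by
  induction ys generalizing l with
  | nil => rfl
  | cons y ys ih =>
    have h1 : 2 ^ ys.length * (2 * l.length) ≤ pw := by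
      grind
    have h2 : 2 * l.length ≤ pw :=
      (le_mul_of_pos_left _ (two_pow_pos _)).trans h1
    rw [map_cons, foldState_cons]
    have : splitAllStep.val (.int y & .int pw & .int ε & encInts l) =
        .int pw & .int ε & encInts (splitPass y (ε * y / 2) l) := by
      have := val_splitPassP (y := y) (h := ε * y / 2) h2
      simp [splitAllStep, this]
    rw [this, ih _ (by rwa [length_splitPass])]
    rfl

lemma length_squares (y : ℤ) (m : ℕ) : (squares y m).length = m := by
  induction m generalizing y with
  | zero => rfl
  | succ m ih => simp [squares, ih]

lemma val_splitAllP {m pw : ℕ} {ε : ℤ} {ys l : List ℤ} (hm : ys.length ≤ m)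
    (h : 2 ^ ys.length * l.length ≤ pw) :
    splitAllP.val (.int m & .int pw & .int ε & encInts ys & encInts l) = encInts (splitAll ε ys l) := by
  rw [splitAllP, val_comp, val_foldE (c := m) (l := ys.map Data.int) rfl rfl (by simpa using hm)]
  have := foldState_splitAllStep (ε := ε) ys l h
  simp [this]

def pairUpStep : Prog := ite (var 2 ▷ isPair)
  (var 1 △ const 0 △ addP (var 2 ▷ fst) (mulP (var 1) (var 0)) △ rest 3)
  (var 1 △ (var 0 △ const 0) △ rest 3)

/-- On `(y, (pw, l))`, the list `pairUp y l`. -/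
def pairUpP : Prog :=
  revE (var 1) (foldE (var 1) (rest 2) (var 0 △ const 0 △ const 0) pairUpStep ▷ rest 2)

lemma foldState_pairUpStep (y : ℤ) : ∀ l acc : List ℤ, Even l.length →
    foldState pairUpStep (l.map Data.int) (.int y & .int 0 & encInts acc) =
      .int y & .int 0 & encInts ((pairUp y l).reverse ++ acc)
  | [], _, _ => rfl
  | [_], _, h => by simp at h
  | a :: b :: l, acc, h => by
    have ih := foldState_pairUpStep y l ((a + y * b) :: acc)
      (by simpa [Nat.even_add_one] using h)
    simp_all [pairUpStep, encInts, map_cons, foldState_cons, pairUp]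

lemma val_pairUpP {pw k : ℕ} {y : ℤ} {l : List ℤ} (hl : l.length = 2 * k) (hpw : l.length ≤ pw) :
    pairUpP.val (.int y & .int pw & encInts l) = encInts (pairUp y l) := by
  have h1 : (foldE (var 1) (rest 2) (var 0 △ const 0 △ const 0) pairUpStep).val
      (.int y & .int pw & encInts l) =
      .int y & .int 0 & encInts (pairUp y l).reverse := by
    rw [val_foldE (c := pw) (l := l.map Data.int) rfl rfl (by simpa using hpw)]
    simpa [encInts] using foldState_pairUpStep y l [] (by rw [hl]; simp)
  rw [pairUpP, val_revE (c := pw) (l := (pairUp y l).reverse.map Data.int) rfl]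
  · rw [encInts, map_reverse, reverse_reverse]
  · rw [val_comp, h1]; rfl
  · rw [length_map, length_reverse, length_pairUp y k l hl]; omega

def evalBody : Prog := mulP (var 0) (var 0) △ var 1 △ pairUpP

/-- On `(m, (y, (pw, l)))`, where `l` has length `2 ^ m`, the value `polyEval y l`. -/
def evalP : Prog := loop evalBody ▷ (rest 2 ▷ fst)

lemma iterate_evalBody {pw : ℕ} (i k : ℕ) (y : ℤ) (l : List ℤ) (hl : l.length = 2 ^ i * k)
    (hpw : l.length ≤ pw) :
    evalBody.val^[i] (.int y & .int pw & encInts l) =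
      .int (y ^ 2 ^ i) & .int pw & encInts (pairUpAll y i l) := by
  induction i generalizing y l with
  | zero => simp [pairUpAll]
  | succ i ih =>
    have hl' : l.length = 2 * (2 ^ i * k) := by rw [hl, pow_succ]; ring
    have h1 : evalBody.val (.int y & .int pw & encInts l) =
        .int (y * y) & .int pw & encInts (pairUp y l) := by
      have := val_pairUpP (y := y) hl' hpw
      simp [evalBody, this]
    have h2 := length_pairUp y _ l hl'
    rw [iterate_succ_apply, h1, ih _ _ h2 (by omega), ← pow_two, ← pow_mul, ← pow_succ']
    simp [pairUpAll, pow_two]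

lemma val_evalP {m pw : ℕ} {y : ℤ} {l : List ℤ} (hl : l.length = 2 ^ m) (hpw : l.length ≤ pw) :
    evalP.val (.int m & .int y & .int pw & encInts l) =
      .int (polyEval y l) := by
  simp only [evalP, val_comp, val_loop, Data.left_pair, Data.toInt_int, Data.right_pair,
    Int.toNat_natCast]
  rw [iterate_evalBody m 1 y l (by simpa using hl) hpw, pairUpAll_eq m y l hl]
  rfl

end Prog

/-- Coding of a Gaussian rational given by its parts. -/
def encGauss (v : ℚ × ℚ) : Data := encRat v.1 & encRat v.2

/-- The complex number with rational parts. -/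
def toComplex (v : ℚ × ℚ) : ℂ := ⟨(v.1 : ℝ), (v.2 : ℝ)⟩

lemma encComplex_toComplex (v : ℚ × ℚ) : encComplex (toComplex v) = encGauss v := by
  simp only [encComplex, toComplex, toRat_cast, encGauss]

lemma toComplex_inj {v w : ℚ × ℚ} : toComplex v = toComplex w ↔ v = w := by
  grind [toComplex, Rat.cast_inj, Prod.ext]

lemma toComplex_eq_zero {v : ℚ × ℚ} : toComplex v = 0 ↔ v = 0 := by
  rw [← toComplex_inj]
  have : toComplex 0 = 0 := by apply Complex.ext <;> simp [toComplex]
  rw [this]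

lemma IsGaussRat.exists_toComplex {z : ℂ} (h : IsGaussRat z) : ∃ v, toComplex v = z := by
  obtain ⟨⟨a, ha⟩, ⟨b, hb⟩⟩ := h
  exact ⟨(a, b), Complex.ext ha hb⟩

/-! ### Fractions in lowest terms -/

lemma den_div_dvd_iff {N D : ℤ} (hD : D ≠ 0) (d : ℕ) :
    D ∣ d * N ↔ ((N : ℚ) / D).den ∣ d := by
  set q : ℚ := (N : ℚ) / D with hq
  have hDq : (D : ℚ) ≠ 0 := by exact_mod_cast hD
  have h1 : q.num * D = N * q.den := by
    have h2 : q * D = N := by rw [hq]; field_simp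
    have h3 : (q.num : ℚ) = q * q.den := (Rat.mul_den_eq_num q).symm
    have : ((q.num * D : ℤ) : ℚ) = ((N * q.den : ℤ) : ℚ) := by
      push_cast; rw [h3, ← h2]; ring
    exact_mod_cast this
  constructor
  · rintro ⟨k, hk⟩
    have h2 : (d : ℤ) * q.num = q.den * k := by
      apply mul_right_cancel₀ hD
      calc (d : ℤ) * q.num * D = d * (q.num * D) := by ring
        _ = d * N * q.den := by rw [h1]; ring
        _ = q.den * k * D := by rw [hk]; ring
    have h3 : (q.den : ℤ) ∣ d * q.num := ⟨k, h2⟩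
    have h4 : IsCoprime (q.den : ℤ) q.num := by
      rw [Int.isCoprime_iff_gcd_eq_one, Int.gcd_comm]
      exact q.reduced
    exact_mod_cast h4.dvd_of_dvd_mul_right h3
  · rintro ⟨c, rfl⟩
    refine ⟨c * q.num, ?_⟩
    grind

lemma den_div_mul_div {N D : ℤ} (hD : D ≠ 0) :
    ((((N : ℚ) / D).den : ℤ) * N) / D = ((N : ℚ) / D).num := by
  set q : ℚ := (N : ℚ) / D with hq
  have hDq : (D : ℚ) ≠ 0 := by exact_mod_cast hD
  apply Int.ediv_eq_of_eq_mul_left hD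
  have h2 : q * D = N := by rw [hq]; field_simp
  have h3 : (q.num : ℚ) = q * q.den := (Rat.mul_den_eq_num q).symm
  have : ((q.den * N : ℤ) : ℚ) = ((q.num * D : ℤ) : ℚ) := by
    push_cast; rw [h3, ← h2]; ring
  exact_mod_cast this

lemma den_div_le {N D : ℤ} (hD : D ≠ 0) : ((N : ℚ) / D).den ≤ D.natAbs := by
  have : ((N : ℚ) / D).den ∣ D.natAbs := by
    rw [← den_div_dvd_iff hD]
    exact (Int.dvd_natAbs_self).mul_right N
  exact le_of_dvd (Int.natAbs_pos.2 hD) this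

namespace Prog

/-- Search for the denominator: on `(flag, (d, (N, D)))`, if no denominator has been found and `D`
does not divide `d N`, increase `d`. -/
def redBody : Prog := ite (var 0) id (ite (modP (mulP (var 1) (var 2)) (rest 3))
  (const 0 △ addP (var 1) (const 1) △ rest 2) (const 1 △ rest 1))

/-- On `(c, (N, D))`, the result `(flag, (d, (N, D)))` of trying the denominators up to `c`. -/
def redP : Prog := (fst △ const 0 △ const 1 △ snd) ▷ loop redBody

/-- The fraction `d N / D` with denominator `d`. -/
def redOut : Prog := divP (mulP (var 1) (var 2)) (rest 3) △ var 1

lemma iterate_redBody {N D : ℤ} (hD : D ≠ 0) (i : ℕ) :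
    redBody.val^[i] (.int 0 & .int 1 & .int N & .int D) =
      if i < ((N : ℚ) / D).den then
        .int 0 & .int (i + 1 : ℕ) & .int N & .int D
      else .int 1 & .int ((N : ℚ) / D).den & .int N & .int D := by
  set q : ℚ := (N : ℚ) / D with hq
  induction i with
  | zero => rw [if_pos q.den_pos]; simp
  | succ i ih =>
    rw [iterate_succ_apply', ih]
    have hmod : ∀ d : ℕ, (d * N) % D = 0 ↔ q.den ∣ d := fun d => (Int.dvd_iff_emod_eq_zero (a := D) (b := d * N)).symm.trans
      (den_div_dvd_iff hD d)
    rcases lt_trichotomy (i + 1) q.den with h | h | h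
    · rw [if_pos (by omega), if_pos h]
      have h1 : ¬ ((i + 1 : ℕ) : ℤ) * N % D = 0 := by
        rw [hmod]; exact fun h' => absurd (le_of_dvd (by omega) h') (by omega)
      push_cast at h1 ⊢
      simp [redBody, h1]
    · rw [if_pos (by omega), if_neg (show ¬ i + 1 < q.den by omega), ← h]
      simp [hmod, h, redBody]
    · rw [if_neg (by omega), if_neg (by omega)]
      simp [redBody]

lemma val_redP {N D : ℤ} (hD : D ≠ 0) (c : ℕ) :
    redP.val (.int c & .int N & .int D) = if c < ((N : ℚ) / D).den then
        .int 0 & .int (c + 1 : ℕ) & .int N & .int D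
      else .int 1 & .int ((N : ℚ) / D).den & .int N & .int D := by
  grind [redP, val_comp, val_pair, val_const, val_loop, val_fst, val_snd, Data.left_pair, Data.toInt_int, Data.right_pair, Int.toNat_natCast, iterate_redBody]

lemma val_redOut {N D : ℤ} (hD : D ≠ 0) (z : ℤ) :
    redOut.val (.int z & .int ((N : ℚ) / D).den & .int N & .int D) =
      encRat ((N : ℚ) / D) := by
  simp [redOut, encRat, den_div_mul_div hD]

/-! ### Evaluating and printing digits -/

/-- Coding of a of △ integers. -/
def encPair (z : ℤ × ℤ) : Data := .int z.1 & .int z.2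

def zipStep : Prog := var 1 ▷ snd △ (var 0 △ var 1 ▷ fst) △ rest 2

lemma foldState_zipStep (a b : List ℤ) (h : a.length = b.length) (acc : List (ℤ × ℤ)) :
    foldState zipStep (a.map Data.int) (encInts b & encList (acc.map encPair)) =
      .int 0 & encList (((a.zip b).reverse ++ acc).map encPair) := by
  induction a generalizing b acc with
  | nil =>
    obtain rfl : b = [] := length_eq_zero_iff.1 h.symm
    rfl
  | cons x a ih =>
    cases b with
    | nil => simp at h
    | cons y b =>
      rw [map_cons, foldState_cons]
      have : zipStep.val (.int x & encInts (y :: b) & encList (acc.map encPair)) =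
          encInts b & encList (((x, y) :: acc).map encPair) := by
        simp [zipStep, encInts, encPair]
      rw [this, ih b (by simpa using h)]
      simp

def countStep : Prog := ite (fst ▷ fst) (addP snd (const 1))
  (ite (fst ▷ snd) (addP snd (const 1)) snd)

lemma foldState_countStep (l : List (ℤ × ℤ)) (z : ℤ) :
    foldState countStep (l.map encPair) (.int z) =
      .int (z + (l.countP fun z => z ≠ 0 : ℕ)) := by
  induction l generalizing z with
  | nil => simp [foldState]
  | cons a l ih =>
    rw [map_cons, foldState_cons]
    have : countStep.val (encPair a & .int z) = .int (if a ≠ 0 then z + 1 else z) := by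
      obtain ⟨a, b⟩ := a
      by_cases ha : a = 0 <;> by_cases hb : b = 0 <;>
        simp [countStep, encPair, ha, hb, Prod.ext_iff]
    grind

/-- From `N`, in the environment `(z, (i, (L, acc)))`, the fraction `N / L` in lowest terms. -/
def ratP (p : Prog) : Prog := (var 2 △ pair p (var 2)) ▷ redP ▷ redOut

lemma val_ratP {p : Prog} {x : Data} {N : ℤ} {L : ℕ} (hL : 0 < L) (hp : p.val x = .int N)
    (hx : (var 2).val x = .int L) : (ratP p).val x = encRat ((N : ℚ) / (L : ℤ)) := by
  have hL' : (L : ℤ) ≠ 0 := by omega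
  simp only [ratP, val_comp, val_pair, hp, hx]
  rw [val_redP hL', if_neg, val_redOut hL']
  grind [Int.natAbs_natCast, den_div_le]

def outPush : Prog := subP (var 1) (const 1) △ var 2 △ (subP (var 1) (const 1) △ ratP (fst ▷ fst) △ ratP (fst ▷ snd)) △ rest 3

/-- On `(z, (i, (L, acc)))`: the term with exponent `i - 1` and coefficient `z / L` is added. -/
def outStep : Prog := ite (fst ▷ fst) outPush
  (ite (fst ▷ snd) outPush (subP (var 1) (const 1) △ rest 2))

/-- The coefficient `z / L`. -/
def digitCoeff (L : ℕ) (z : ℤ × ℤ) : ℚ × ℚ :=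
  ((z.1 : ℚ) / (L : ℤ), (z.2 : ℚ) / (L : ℤ))

lemma digitCoeff_eq_zero {L : ℕ} (hL : 0 < L) {z : ℤ × ℤ} :
    digitCoeff L z = 0 ↔ z = 0 := by
  have : (L : ℚ) ≠ 0 := by exact_mod_cast hL.ne'
  simp [digitCoeff, Prod.ext_iff, this]

/-- The terms given by a list of digits, with exponents from `i` on. -/
def outList (L : ℕ) : ℕ → List (ℤ × ℤ) → UPoly
  | _, [] => []
  | i, z :: l => if z = 0 then outList L (i + 1) l
    else (i, toComplex (digitCoeff L z)) :: outList L (i + 1) l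

lemma encUPoly_cons (e : ℕ) (c : ℂ) (l : UPoly) :
    encUPoly ((e, c) :: l) = (.int e & encComplex c) & encUPoly l := rfl

lemma val_outStep {L : ℕ} (hL : 0 < L) (i : ℕ) (z : ℤ × ℤ) (l : UPoly) :
    outStep.val (encPair z & .int (i + 1 : ℕ) & .int L & encUPoly l) =
      .int i & .int L & encUPoly
        (if z = 0 then l else (i, toComplex (digitCoeff L z)) :: l) := by
  have h1 : outPush.val (encPair z & .int (i + 1 : ℕ) & .int L & encUPoly l) = .int i & .int L & encUPoly
        ((i, toComplex (digitCoeff L z)) :: l) := by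
    rw [encUPoly_cons, encComplex_toComplex, outPush, val_pair, val_pair, val_pair, val_pair,
      val_pair, val_ratP (N := z.1) hL rfl rfl, val_ratP (N := z.2) hL rfl rfl]
    simp [encGauss, digitCoeff]
  obtain ⟨a, b⟩ := z
  rw [outStep, val_ite, val_ite, h1]
  by_cases ha : a = 0 <;> by_cases hb : b = 0 <;> simp [encPair, ha, hb, Prod.ext_iff]

lemma foldState_outStep {L : ℕ} (hL : 0 < L) (i : ℕ) (l : List (ℤ × ℤ)) :
    foldState outStep (l.reverse.map encPair)
      (.int (i + l.length : ℕ) & .int L & .int 0) =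
      .int i & .int L & encUPoly (outList L i l) := by
  induction l generalizing i with
  | nil => rfl
  | cons z l ih =>
    rw [List.reverse_cons, map_append, foldState_append]
    have h1 : i + (z :: l).length = i + 1 + l.length := by simp; omega
    rw [h1, ih, map_cons, map_nil, foldState_cons, foldState_nil, val_outStep hL, outList]

lemma outList_exponent_le (L : ℕ) (i : ℕ) (l : List (ℤ × ℤ)) :
    ∀ t ∈ outList L i l, i ≤ t.1 := by
  induction l generalizing i with
  | nil => simp [outList]
  | cons z l ih =>
    intro t ht
    grind [outList]

lemma rep_outList {L : ℕ} (hL : 0 < L) (i : ℕ) (l : List (ℤ × ℤ)) :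
    Rep (outList L i l) (ofList (outList L i l)) := by
  refine ⟨?_, ?_, rfl⟩
  · induction l generalizing i with
    | nil => simp [outList]
    | cons z l ih =>
      rw [outList]
      split
      · exact ih _
      · refine pairwise_cons.2 ⟨fun t ht => ?_, ih _⟩
        have := outList_exponent_le _ _ _ t ht
        simp only; omega
  · induction l generalizing i with
    | nil => simp [outList]
    | cons z l ih =>
      rw [outList]
      split
      · exact ih _
      · rename_i hz
        intro t ht
        rcases mem_cons.1 ht with rfl | ht
        · simp only [ne_eq, toComplex_eq_zero, digitCoeff_eq_zero hL]; exact hz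
        · exact ih _ t ht

lemma length_outList (L : ℕ) (i : ℕ) (l : List (ℤ × ℤ)) :
    (outList L i l).length = l.countP fun z => z ≠ 0 := by
  induction l generalizing i with
  | nil => rfl
  | cons z l ih =>
    rw [outList, List.countP_cons]
    by_cases hz : z = 0 <;> simp [hz, ih]

lemma powerSum_add (g h : ℕ →₀ ℂ) (j : ℕ) :
    powerSum (g + h) j = powerSum g j + powerSum h j := by
  rw [powerSum, Finsupp.sum_add_index' (by simp) (by intros; ring)]; rfl

lemma powerSum_single (e : ℕ) (c : ℂ) (j : ℕ) :
    powerSum (single e c) j = c * (2 ^ e) ^ j := by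
  simp [powerSum]

lemma powerSum_outList {L : ℕ} (hL : 0 < L) (a b : List ℤ)
    (h : a.length = b.length) (i j : ℕ) :
    powerSum (ofList (outList L i (a.zip b))) j =
      ((2 : ℂ) ^ j) ^ i * toComplex ((polyEval (2 ^ j) a : ℚ) / (L : ℤ),
        (polyEval (2 ^ j) b : ℚ) / (L : ℤ)) := by
  induction a generalizing b i with
  | nil =>
    obtain rfl : b = [] := length_eq_zero_iff.1 h.symm
    have : toComplex (0, 0) = 0 := toComplex_eq_zero.2 rfl
    simp [outList, powerSum, polyEval, this]
  | cons x a ih =>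
    cases b with
    | nil => simp at h
    | cons y b =>
      have ih' := ih b (by simpa using h) (i + 1)
      have hsplit : toComplex ((polyEval (2 ^ j) (x :: a) : ℚ) / (L : ℤ),
          (polyEval (2 ^ j) (y :: b) : ℚ) / (L : ℤ)) = toComplex (digitCoeff L (x, y)) +
          (2 : ℂ) ^ j * toComplex ((polyEval (2 ^ j) a : ℚ) / (L : ℤ),
            (polyEval (2 ^ j) b : ℚ) / (L : ℤ)) := by
        have h2 : ((2 : ℂ) ^ j) = (((2 : ℝ) ^ j : ℝ) : ℂ) := by push_cast; rfl
        rw [h2]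
        apply Complex.ext
        · simp only [toComplex, digitCoeff, polyEval, foldr_cons, add_re,
            Complex.re_ofReal_mul]
          push_cast; ring
        · simp only [toComplex, digitCoeff, polyEval, foldr_cons, add_im,
            Complex.im_ofReal_mul]
          push_cast; ring
      rw [hsplit, List.zip_cons_cons, outList]
      split
      · rename_i hz
        rw [ih', toComplex_eq_zero.2 ((digitCoeff_eq_zero hL).2 hz)]
        ring
      · rw [ofList_cons, powerSum_add, powerSum_single, ih']
        simp only
        rw [← pow_mul, ← pow_mul, ← pow_mul]
        ring

/-! ### The check of the digits -/

/-- The value of the digits `p` at the current point, in the environment of `checkStep`. -/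
def checkEval (p : Prog) : Prog := (var 3 △ var 2 △ var 4 △ p) ▷ evalP

/-- On `(v, (flag, (y, (m, (pw, (L, (a, b)))))))`, compare the values at `y` of the digits `a, b`
with `L v`, and double `y`. -/
def checkStep : Prog := ite (subP (mulP (checkEval (var 6)) (fst ▷ fst ▷ snd))
      (mulP (var 5) (fst ▷ fst ▷ fst))) (const 0)
    (ite (subP (mulP (checkEval (rest 7)) (fst ▷ snd ▷ snd))
      (mulP (var 5) (fst ▷ snd ▷ fst))) (const 0) (var 1)) △ mulP (const 2) (var 2) △ rest 3

lemma sub_eq_zero_iff_div_eq {L : ℕ} (hL : 0 < L) (z : ℤ) (q : ℚ) :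
    z * q.den - L * q.num = 0 ↔ (z : ℚ) / (L : ℤ) = q := by
  have h1 : (L : ℚ) ≠ 0 := by exact_mod_cast hL.ne'
  have h2 : (q.den : ℚ) ≠ 0 := by exact_mod_cast q.den_nz
  have h3 : (q.num : ℚ) = q * q.den := (Rat.mul_den_eq_num q).symm
  rw [← Int.cast_inj (α := ℚ)]
  push_cast
  rw [h3, div_eq_iff h1]
  constructor
  · intro h
    have : (z - q * L) * q.den = 0 := by linear_combination h
    rcases mul_eq_zero.1 this with h' | h'
    · linear_combination h'
    · exact absurd h' h2
  · intro h; rw [h]; ring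

lemma val_checkStep {m pw L : ℕ} (hL : 0 < L) {a b : List ℤ} (ha : a.length = 2 ^ m)
    (hb : b.length = 2 ^ m) (hpw : 2 ^ m ≤ pw) (v : ℚ × ℚ) (fl y : ℤ) :
    checkStep.val (encGauss v & .int fl & .int y & .int m & .int pw & .int L & encInts a & encInts b) =
    .int (if ((polyEval y a : ℚ) / (L : ℤ), (polyEval y b : ℚ) / (L : ℤ)) = v then fl else 0) & .int (2 * y) & .int m & .int pw & .int L & encInts a & encInts b := by
  have h1 : ∀ p : Prog, ∀ x : Data, ∀ l : List ℤ, l.length = 2 ^ m →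
      (var 3 △ var 2 △ var 4 △ p).val x = .int m & .int y & .int pw & encInts l → (checkEval p).val x = .int (polyEval y l) := by
    intro p x l hl hx
    rw [checkEval, val_comp, hx, val_evalP hl (by omega)]
  have e1 := sub_eq_zero_iff_div_eq hL (polyEval y a) v.1
  have e2 := sub_eq_zero_iff_div_eq hL (polyEval y b) v.2
  set x : Data := encGauss v & .int fl & .int y & .int m & .int pw & .int L & encInts a & encInts b with hx
  have f1 : ((subP (mulP (checkEval (var 6)) (fst ▷ fst ▷ snd))
      (mulP (var 5) (fst ▷ fst ▷ fst))).val x).toInt =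
      polyEval y a * v.1.den - L * v.1.num := by
    rw [val_subP, val_mulP, val_mulP, h1 _ _ a ha rfl]; rfl
  have f2 : ((subP (mulP (checkEval (rest 7)) (fst ▷ snd ▷ snd))
      (mulP (var 5) (fst ▷ snd ▷ fst))).val x).toInt =
      polyEval y b * v.2.den - L * v.2.num := by
    rw [val_subP, val_mulP, val_mulP, h1 _ _ b hb rfl]; rfl
  rw [checkStep, val_pair, val_ite, val_ite]
  congr 1
  simp only [f1, f2, val_const, Prod.ext_iff, ne_eq]
  by_cases c1 : (polyEval y a : ℚ) / (L : ℤ) = v.1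
  · by_cases c2 : (polyEval y b : ℚ) / (L : ℤ) = v.2
    · rw [if_neg (not_not.2 (e1.2 c1)), if_neg (not_not.2 (e2.2 c2)), if_pos ⟨c1, c2⟩]; rfl
    · rw [if_neg (not_not.2 (e1.2 c1)), if_pos (fun h => c2 (e2.1 h)), if_neg (fun h => c2 h.2)]
  · rw [if_pos (fun h => c1 (e1.1 h)), if_neg (fun h => c1 h.1)]

lemma foldState_checkStep {m pw L : ℕ} (hL : 0 < L) {a b : List ℤ} (ha : a.length = 2 ^ m)
    (hb : b.length = 2 ^ m) (hpw : 2 ^ m ≤ pw) (vs : List (ℚ × ℚ)) (fl : ℤ) (y : ℤ) :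
    ∃ fl' : ℤ, foldState checkStep (vs.map encGauss) (.int fl & .int y & .int m & .int pw & .int L & encInts a & encInts b) =
    .int fl' & .int (2 ^ vs.length * y) & .int m & .int pw & .int L & encInts a & encInts b ∧
    (fl' = fl ∨ fl' = 0) ∧ (fl ≠ 0 → (fl' ≠ 0 ↔ ∀ j, (h : j < vs.length) →
      ((polyEval (2 ^ j * y) a : ℚ) / (L : ℤ), (polyEval (2 ^ j * y) b : ℚ) / (L : ℤ)) = vs[j])) := by
  induction vs generalizing fl y with
  | nil => exact ⟨fl, by simp [foldState], Or.inl rfl, by simp⟩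
  | cons v vs ih =>
    obtain ⟨fl', h1, h2, h3⟩ := ih (if ((polyEval y a : ℚ) / (L : ℤ),
      (polyEval y b : ℚ) / (L : ℤ)) = v then fl else 0) (2 * y)
    refine ⟨fl', ?_, ?_, ?_⟩
    · rw [map_cons, foldState_cons, val_checkStep hL ha hb hpw, h1]
      simp only [length_cons, pow_succ, mul_assoc]
    · split at h2
      · exact h2
      · right; tauto
    · intro hfl
      by_cases hv : ((polyEval y a : ℚ) / (L : ℤ), (polyEval y b : ℚ) / (L : ℤ)) = v
      · rw [if_pos hv] at h3
        rw [h3 hfl]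
        constructor
        · intro h j hj
          cases j with
          | zero => simpa using hv
          | succ j =>
            have := h j (by simpa using hj)
            simpa [pow_succ, mul_assoc] using this
        · intro h j hj
          have := h (j + 1) (by simpa using hj)
          simpa [pow_succ, mul_assoc] using this
      · rw [if_neg hv] at h2
        have h0 : fl' = 0 := by tauto
        simp only [h0, ne_eq, not_true_eq_false, false_iff, not_forall]
        exact ⟨0, by simp, by simpa using hv⟩

end Prog

lemma length_splitAll (ε : ℤ) (ys l : List ℤ) :
    (splitAll ε ys l).length = 2 ^ ys.length * l.length := by
  induction ys generalizing l with
  | nil => simp [splitAll]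
  | cons y ys ih =>
    have : splitAll ε (y :: ys) l = splitAll ε ys (splitPass y (ε * y / 2) l) := rfl
    rw [this, ih, length_splitPass, length_cons, pow_succ]
    ring

namespace Prog

/-- Coding of the input of the main part of the program: `m` and `2 ^ m` are bounds for the
exponents. -/
def encEnv (m T G : ℕ) (vs : List (ℚ × ℚ)) : Data :=
  .int m & .int (2 ^ m : ℕ) & .int T & .int G & encList (vs.map encGauss)

/-- Push the multiplier of the coefficients. -/
def pushMult : Prog := var 2 ▷ factP △ id

/-- Push the list of bases of the splitting. -/
def pushBases : Prog := (var 1 △ powP (subP (mulP (const 2) (var 3)) (const 1))) ▷ squaresP △ id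

/-- Push the last value. -/
def pushLast : Prog := (subP (mulP (const 2) (var 4)) (const 1) △ rest 6) ▷ loop snd ▷ fst △ id

/-- Push the digits of the imaginary part. -/
def pushIm : Prog := (var 3 △ var 4 △ const 1 △ var 1 △ divP (mulP (var 2) (var 0 ▷ snd ▷ fst)) (var 0 ▷ snd ▷ snd) △ const 0) ▷ splitAllP △ id

/-- Push the digits of the real part. -/
def pushRe : Prog := (var 4 △ var 5 △ const 1 △ var 2 △ divP (mulP (var 3) (var 1 ▷ fst ▷ fst)) (var 1 ▷ fst ▷ snd) △ const 0) ▷ splitAllP △ id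

/-- Push the list of pairs of digits, in reverse order. -/
def pushZip : Prog :=
  foldE (var 6) (var 0) (var 1 △ const 0) zipStep ▷ rest 1 △ id

/-- The environment of the check. -/
def digitsP : Prog :=
  pushMult ▷ (pushBases ▷ (pushLast ▷ (pushIm ▷ (pushRe ▷ pushZip))))

/-- The check of the digits. -/
def flagP : Prog := foldE (mulP (const 2) (var 8)) (rest 10)
  (leP (foldE (var 7) (var 0) (const 0) countStep) (var 8) △ const 1 △ var 6 △ var 7 △ var 5 △ var 1 △ var 2) checkStep ▷ fst

/-- The terms given by the digits. -/
def outP : Prog :=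
  foldE (var 7) (var 0) (var 7 △ var 5 △ const 0) outStep ▷ rest 2

/-- Try the digits of the last value, and run `slow` if they are not correct. -/
def fastP (slow : Prog) : Prog := digitsP ▷ ite flagP outP (rest 6 ▷ slow)

/-- The environments built up by `digitsP`. -/
def encBases (L m T G : ℕ) (vs : List (ℚ × ℚ)) : Data :=
  encInts (squares (2 ^ (2 * T - 1)) m) & .int L & encEnv m T G vs

def encDigits (a b : List ℤ) (w : Data) (L m T G : ℕ) (vs : List (ℚ × ℚ)) :
    Data :=
  encList ((a.zip b).reverse.map encPair) & encInts a & encInts b & w & encBases L m T G vs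

lemma iterate_snd (l : List Data) (i : ℕ) : snd.val^[i] (encList l) = encList (l.drop i) := by
  induction i generalizing l with
  | zero => rfl
  | succ i ih =>
    rw [iterate_succ_apply]
    cases l with
    | nil => simpa using ih []
    | cons x l => simpa using ih l

/-- The multiplier that belongs to a bound `T`. -/
def multiplier (T : ℕ) : ℕ := (val_factP T).choose

lemma val_factP_eq (T : ℕ) : factP.val (.int T) = .int (multiplier T) :=
  (val_factP T).choose_spec.1

lemma multiplier_pos (T : ℕ) : 0 < multiplier T := (val_factP T).choose_spec.2.1

lemma multiplier_le (T : ℕ) : multiplier T ≤ max T 1 := (val_factP T).choose_spec.2.2.1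

lemma dvd_multiplier {T j : ℕ} (h0 : 0 < j) (h : j.factorial ≤ T) : j ∣ multiplier T :=
  (val_factP T).choose_spec.2.2.2 j h0 h

lemma val_pushMult (m T G : ℕ) (vs : List (ℚ × ℚ)) :
    pushMult.val (encEnv m T G vs) = .int (multiplier T) & encEnv m T G vs := by
  rw [pushMult, val_pair, val_comp]
  exact congrArg₂ _ (val_factP_eq T) rfl

lemma val_pushBases (L m T G : ℕ) (vs : List (ℚ × ℚ)) :
    pushBases.val (.int L & encEnv m T G vs) = encBases L m T G vs := by
  have h1 : (powP (subP (mulP (const 2) (var 3)) (const 1))).val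
      (.int L & encEnv m T G vs) = .int (2 ^ (2 * T - 1)) := by
    rw [val_powP (z := 2 * (T : ℤ) - 1) rfl]
    congr 2
    omega
  rw [pushBases, val_pair, val_comp, val_pair, h1]
  exact congrArg₂ _ (val_squaresP m _) rfl

/-- The last value. -/
def lastData (T : ℕ) (vs : List (ℚ × ℚ)) : Data :=
  (encList ((vs.map encGauss).drop (2 * T - 1))).left

lemma val_pushLast (L m T G : ℕ) (vs : List (ℚ × ℚ)) :
    pushLast.val (encBases L m T G vs) = lastData T vs & encBases L m T G vs := by
  have h1 : (loop snd).val (.int (2 * (T : ℤ) - 1) & encList (vs.map encGauss)) =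
      encList ((vs.map encGauss).drop (2 * T - 1)) := by
    grind [val_loop, Data.left_pair, Data.right_pair, Data.toInt_int, iterate_snd]
  rw [pushLast, val_pair, val_id, val_comp, val_comp]
  exact congrArg₂ _ (congrArg Data.left h1) rfl

/-- The integer that is split into digits, from a fraction. -/
def scaled (L : ℕ) (r : Data) : ℤ := L * r.left.toInt / r.right.toInt

lemma val_splitAllP_single (m : ℕ) (y X : ℤ) :
    splitAllP.val (.int m & .int (2 ^ m : ℕ) & .int 1 & encInts (squares y m) & .int X & .int 0) =
      encInts (splitAll 1 (squares y m) [X]) :=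
  val_splitAllP (l := [X]) (by rw [length_squares]) (by rw [length_squares]; simp)

/-- The digits of a scaled fraction. -/
def digits (L m T : ℕ) (r : Data) : List ℤ :=
  splitAll 1 (squares (2 ^ (2 * T - 1)) m) [scaled L r]

lemma length_digits (L m T : ℕ) (r : Data) : (digits L m T r).length = 2 ^ m := by
  rw [digits, length_splitAll, length_squares]; simp

lemma val_pushIm (w : Data) (L m T G : ℕ) (vs : List (ℚ × ℚ)) :
    pushIm.val (w & encBases L m T G vs) =
      encInts (digits L m T w.right) & w & encBases L m T G vs := by
  have hin : (var 3 △ var 4 △ const 1 △ var 1 △ divP (mulP (var 2) (var 0 ▷ snd ▷ fst)) (var 0 ▷ snd ▷ snd) △ const 0).val (w & encBases L m T G vs) = .int m & .int (2 ^ m : ℕ) & .int 1 & encInts (squares (2 ^ (2 * T - 1)) m) & .int (scaled L w.right) & .int 0 := rfl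
  rw [pushIm, val_pair, val_id, val_comp, hin, val_splitAllP_single, digits]

lemma val_pushRe (b : Data) (w : Data) (L m T G : ℕ) (vs : List (ℚ × ℚ)) :
    pushRe.val (b & w & encBases L m T G vs) =
      encInts (digits L m T w.left) & b & w & encBases L m T G vs := by
  have hin : (var 4 △ var 5 △ const 1 △ var 2 △ divP (mulP (var 3) (var 1 ▷ fst ▷ fst)) (var 1 ▷ fst ▷ snd) △ const 0).val (b & w & encBases L m T G vs) = .int m & .int (2 ^ m : ℕ) & .int 1 & encInts (squares (2 ^ (2 * T - 1)) m) & .int (scaled L w.left) & .int 0 := rfl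
  rw [pushRe, val_pair, val_id, val_comp, hin, val_splitAllP_single, digits]

lemma val_pushZip {a b : List ℤ} {m : ℕ} (w : Data) (L T G : ℕ) (vs : List (ℚ × ℚ))
    (ha : a.length = 2 ^ m) (hb : b.length = 2 ^ m) :
    pushZip.val (encInts a & encInts b & w & encBases L m T G vs) =
      encDigits a b w L m T G vs := by
  rw [pushZip, val_pair, val_id, val_comp,
    val_foldE (c := 2 ^ m) (l := a.map Data.int) rfl rfl (by simp [ha])]
  have := foldState_zipStep a b (by rw [ha, hb]) []
  simp only [append_nil, map_nil, encList_nil] at this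
  exact congrArg₂ _ (congrArg Data.right this) rfl

lemma val_digitsP (m T G : ℕ) (vs : List (ℚ × ℚ)) :
    digitsP.val (encEnv m T G vs) = encDigits (digits (multiplier T) m T (lastData T vs).left)
      (digits (multiplier T) m T (lastData T vs).right) (lastData T vs) (multiplier T) m T G vs := by
  simp only [digitsP, val_comp, val_pushMult, val_pushBases, val_pushLast, val_pushIm, val_pushRe]
  rw [val_pushZip _ _ _ _ _ (length_digits _ _ _ _) (length_digits _ _ _ _)]

section

variable {a b : List ℤ} {w : Data} {L m T G : ℕ} {vs : List (ℚ × ℚ)}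

lemma val_flagP (hL : 0 < L) (ha : a.length = 2 ^ m) (hb : b.length = 2 ^ m)
    (hvs : vs.length = 2 * T) :
    (flagP.val (encDigits a b w L m T G vs)).toInt ≠ 0 ↔
      (a.zip b).countP (fun z => z ≠ 0) ≤ T ∧ ∀ j, (h : j < vs.length) →
        ((polyEval (2 ^ j) a : ℚ) / (L : ℤ), (polyEval (2 ^ j) b : ℚ) / (L : ℤ)) = vs[j] := by
  have hlen : ((a.zip b).reverse.map encPair).length = 2 ^ m := by simp [ha, hb]
  have h1 : (leP (foldE (var 7) (var 0) (const 0) countStep) (var 8)).val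
      (encDigits a b w L m T G vs) =
      .int (if (a.zip b).countP (fun z => z ≠ 0) ≤ T then 1 else 0) := by
    have h2 : (foldE (var 7) (var 0) (const 0) countStep).val (encDigits a b w L m T G vs) =
        .int ((a.zip b).countP (fun z => z ≠ 0) : ℕ) := by
      rw [val_foldE (c := 2 ^ m) (l := (a.zip b).reverse.map encPair) rfl rfl hlen.le, val_const,
        foldState_countStep, List.countP_reverse, zero_add]
    rw [val_leP, h2]
    simp only [Data.toInt_int]
    congr 1
    exact if_congr (by rw [← Nat.cast_le (α := ℤ)]; rfl) rfl rfl
  rw [flagP, val_comp, val_foldE (c := 2 * T) (l := vs.map encGauss) (by rfl) (by rfl)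
    (by simp [hvs])]
  simp only [val_pair, h1]
  obtain ⟨fl', e1, e2, e3⟩ := foldState_checkStep hL ha hb le_rfl vs
    (if (a.zip b).countP (fun z => z ≠ 0) ≤ T then 1 else 0) 1
  have h3 : foldState checkStep (vs.map encGauss) (.int (if (a.zip b).countP (fun z => z ≠ 0) ≤ T then 1 else 0) & ((const 1).val (encDigits a b w L m T G vs)).pair
        (((var 6).val (encDigits a b w L m T G vs)).pair
          (((var 7).val (encDigits a b w L m T G vs)).pair
            (((var 5).val (encDigits a b w L m T G vs)).pair
              (((var 1).val (encDigits a b w L m T G vs)).pair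
                ((var 2).val (encDigits a b w L m T G vs))))))) = _ := e1
  rw [h3]
  grind [val_fst, Data.left_pair, Data.toInt_int]

lemma val_outP (hL : 0 < L) (ha : a.length = 2 ^ m) (hb : b.length = 2 ^ m) :
    outP.val (encDigits a b w L m T G vs) = encUPoly (outList L 0 (a.zip b)) := by
  have hlen : ((a.zip b).reverse.map encPair).length = 2 ^ m := by simp [ha, hb]
  have hlen' : (a.zip b).length = 2 ^ m := by simp [ha, hb]
  rw [outP, val_comp, val_foldE (c := 2 ^ m) (l := (a.zip b).reverse.map encPair) rfl rfl hlen.le]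
  have := foldState_outStep hL 0 (a.zip b)
  rw [hlen', zero_add] at this
  exact congrArg (fun x : Data => x.right.right) this

end

lemma val_fastP {m T G : ℕ} {vs : List (ℚ × ℚ)} {slow : Prog} {g : ℕ →₀ ℂ}
    (hg : g.support.card ≤ T) (hvs : vs.length = 2 * T)
    (h : ∀ j, (hj : j < vs.length) → powerSum g j = toComplex vs[j])
    (hslow : slow.val (encEnv m T G vs) = encUPoly (sparseList g)) :
    (fastP slow).val (encEnv m T G vs) = encUPoly (sparseList g) := by
  rw [fastP, val_comp, val_digitsP, val_ite]
  set L := multiplier T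
  set w := lastData T vs
  have hL : 0 < L := multiplier_pos T
  have ha := length_digits L m T w.left
  have hb := length_digits L m T w.right
  split
  · rename_i hf
    rw [val_flagP hL ha hb hvs] at hf
    rw [val_outP hL ha hb]
    congr 1
    have hr := rep_outList hL 0 ((digits L m T w.left).zip (digits L m T w.right))
    suffices heq : ofList (outList L 0 ((digits L m T w.left).zip (digits L m T w.right))) = g by
      rw [heq] at hr
      exact hr.unique (Rep.sparseList g)
    refine eq_of_powerSum_eq (T := T) ?_ hg fun j hj => ?_
    · grind [hr.length_eq, length_outList]
    · rw [h j (by omega), ← hf.2 j (by omega), powerSum_outList hL _ _ (by rw [ha, hb])]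
      simp
  · exact hslow

end Prog

lemma polyEval_map_range (y : ℤ) (c : ℕ → ℤ) (M : ℕ) :
    polyEval y ((range M).map c) = ∑ i ∈ Finset.range M, c i * y ^ i := by
  induction M generalizing c with
  | zero => rfl
  | succ M ih =>
    rw [List.range_succ_eq_map, map_cons, map_map, sum_range_succ']
    have : polyEval y (c 0 :: (range M).map (c ∘ Nat.succ)) =
      c 0 + y * polyEval y ((range M).map (c ∘ Nat.succ)) := rfl
    rw [this, ih, mul_sum, add_comm, pow_zero, mul_one]
    grind

/-- The polynomial `g` has the coefficients `c e / L`, and the exponents are less than `M`. -/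
structure HasDigits (g : ℕ →₀ ℂ) (L M : ℕ) (c : ℕ → ℤ × ℤ) : Prop where
  lt : ∀ e ∈ g.support, e < M
  eq : ∀ e, g e = toComplex (digitCoeff L (c e))

namespace HasDigits

variable {g : ℕ →₀ ℂ} {L M : ℕ} {c : ℕ → ℤ × ℤ}

lemma powerSum_eq (h : HasDigits g L M c) (j : ℕ) : powerSum g j = toComplex
    ((polyEval (2 ^ j) ((range M).map fun e => (c e).1) : ℚ) / (L : ℤ),
      (polyEval (2 ^ j) ((range M).map fun e => (c e).2) : ℚ) / (L : ℤ)) := by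
  have h1 : powerSum g j = ∑ e ∈ Finset.range M, g e * (2 ^ e) ^ j := by
    grind [powerSum, Finsupp.sum, zero_mul, Finset.sum_subset, h.lt]
  have h2 : ∀ e : ℕ, ((2 : ℂ) ^ e) ^ j = (((2 ^ j) ^ e : ℝ) : ℂ) := fun e => by
    push_cast; rw [← pow_mul, ← pow_mul, mul_comm]
  rw [h1, polyEval_map_range, polyEval_map_range]
  apply Complex.ext
  · simp only [re_sum, h.eq, h2, re_mul_ofReal, toComplex, digitCoeff]
    push_cast
    rw [sum_div]
    grind
  · simp only [im_sum, h.eq, h2, im_mul_ofReal, toComplex, digitCoeff]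
    push_cast
    rw [sum_div]
    grind

lemma countP_le (h : HasDigits g L M c) (hL : 0 < L) :
    (((range M).map fun e => (c e).1).zip ((range M).map fun e => (c e).2)).countP
      (fun z => z ≠ 0) ≤ g.support.card := by
  classical
  rw [List.zip_map', countP_map, List.countP_eq_length_filter]
  have h1 : ((range M).filter ((fun z : ℤ × ℤ => decide (z ≠ 0)) ∘
      fun e => ((c e).1, (c e).2))).Nodup := List.nodup_range.filter _
  rw [← List.toFinset_card_of_nodup h1]
  refine card_le_card fun e he => ?_
  simp only [mem_toFinset, List.mem_filter, Function.comp, decide_eq_true_eq] at he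
  rw [mem_support_iff, h.eq, ne_eq, toComplex_eq_zero, digitCoeff_eq_zero hL]
  exact he.2

end HasDigits

lemma splitAll_polyEval {m : ℕ} {y : ℤ} {l : List ℤ} (hl : l.length = 2 ^ m)
    (h : ∀ x ∈ l, 2 * |x| + 1 ≤ y) : splitAll 1 (squares y m) [polyEval y l] = l := by
  rw [← pairUpAll_eq m y l hl]
  refine splitAll_pairUpAll (R := fun y x => 2 * |x| + 1 ≤ y) ?_ ?_ m y l hl h
  · intro y a b ha hb
    have hy : 0 < y := by have := abs_nonneg a; omega
    have h1 := abs_add_le a (y * b)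
    rw [abs_mul, abs_of_pos hy] at h1
    nlinarith [abs_nonneg b]
  · grind

lemma scaled_eq {L : ℕ} (hL : 0 < L) {z : ℤ} {q : ℚ} (h : (z : ℚ) / (L : ℤ) = q) :
    scaled L (encRat q) = z := by
  have := (sub_eq_zero_iff_div_eq hL z q).2 h
  simp only [scaled, encRat, Data.left_pair, Data.right_pair, Data.toInt_int]
  rw [show (L : ℤ) * q.num = z * q.den by omega]
  simp

lemma lastData_eq {T : ℕ} (hT : 1 ≤ T) {vs : List (ℚ × ℚ)} (hvs : vs.length = 2 * T) :
    lastData T vs = encGauss (vs[2 * T - 1]'(by omega)) := by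
  rw [lastData, drop_eq_getElem_cons (by simp; omega), encList_cons, Data.left_pair,
    List.getElem_map]

/-- If the digits are small, the check succeeds. -/
lemma HasDigits.flag {g : ℕ →₀ ℂ} {m T G : ℕ} {c : ℕ → ℤ × ℤ}
    (h : HasDigits g (multiplier T) (2 ^ m) c) (hT : 1 ≤ T) (hg : g.support.card ≤ T)
    (hc : ∀ e, 2 * |(c e).1| + 1 ≤ 2 ^ (2 * T - 1) ∧ 2 * |(c e).2| + 1 ≤ 2 ^ (2 * T - 1))
    {vs : List (ℚ × ℚ)} (hvs : vs.length = 2 * T)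
    (hv : ∀ j, (hj : j < vs.length) → powerSum g j = toComplex vs[j]) :
    digits (multiplier T) m T (lastData T vs).left = (range (2 ^ m)).map (fun e => (c e).1) ∧
    digits (multiplier T) m T (lastData T vs).right = (range (2 ^ m)).map (fun e => (c e).2) ∧
    (flagP.val (digitsP.val (encEnv m T G vs))).toInt ≠ 0 := by
  have hL := multiplier_pos T
  have hval : ∀ j, (hj : j < vs.length) → vs[j] =
      ((polyEval (2 ^ j) ((range (2 ^ m)).map fun e => (c e).1) : ℚ) / (multiplier T : ℤ),
      (polyEval (2 ^ j) ((range (2 ^ m)).map fun e => (c e).2) : ℚ) / (multiplier T : ℤ)) :=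
    fun j hj => by rw [← toComplex_inj, ← hv j hj, h.powerSum_eq]
  have hlast := hval (2 * T - 1) (by omega)
  have h1 : digits (multiplier T) m T (lastData T vs).left =
      (range (2 ^ m)).map (fun e => (c e).1) := by
    rw [lastData_eq hT hvs, encGauss, Data.left_pair, digits,
      scaled_eq hL (congrArg Prod.fst hlast).symm]
    grind [splitAll_polyEval]
  have h2 : digits (multiplier T) m T (lastData T vs).right =
      (range (2 ^ m)).map (fun e => (c e).2) := by
    rw [lastData_eq hT hvs, encGauss, Data.right_pair, digits,
      scaled_eq hL (congrArg Prod.snd hlast).symm]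
    grind [splitAll_polyEval]
  refine ⟨h1, h2, ?_⟩
  rw [val_digitsP, val_flagP hL (length_digits _ _ _ _) (length_digits _ _ _ _) hvs, h1, h2]
  exact ⟨(h.countP_le hL).trans hg, fun j hj => (hval j hj).symm⟩

end

section

open Polynomial Prog

/-! ### The orthogonal polynomials of a sequence of power sums -/

section

variable {g : ℕ →₀ ℂ} {T : ℕ} {D : ℕ}

/-- The moments of the measure `q · g`. -/
def moment (g : ℕ →₀ ℂ) (q : ℤ[X]) (i : ℕ) : ℂ :=
  g.sum fun e c => c * (q.eval (2 ^ e) : ℤ) * (2 ^ e) ^ i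

lemma moment_X_pow (k i : ℕ) : moment g (X ^ k) i = powerSum g (i + k) := by
  refine sum_congr rfl fun e _ => ?_
  simp only [eval_pow, eval_X]
  push_cast; ring

lemma moment_sub (q r : ℤ[X]) (i : ℕ) : moment g (q - r) i = moment g q i - moment g r i := by
  simp only [moment, Finsupp.sum, ← sum_sub_distrib]
  refine sum_congr rfl fun e _ => ?_
  rw [eval_sub]; push_cast; ring

lemma moment_C_mul (a : ℤ) (q : ℤ[X]) (i : ℕ) : moment g (C a * q) i = a * moment g q i := by
  simp only [moment, Finsupp.sum, mul_sum]
  refine sum_congr rfl fun e _ => ?_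
  rw [eval_mul, eval_C]; push_cast; ring

lemma moment_eq_sum (q : ℤ[X]) {N : ℕ} (hN : q.natDegree < N) (i : ℕ) :
    moment g q i = ∑ l ∈ Finset.range N, q.coeff l * powerSum g (i + l) := by
  simp only [moment, powerSum, Finsupp.sum, mul_sum]
  rw [sum_comm]
  refine sum_congr rfl fun e _ => ?_
  rw [eval_eq_sum_range' hN]
  push_cast
  rw [mul_sum, sum_mul]
  refine sum_congr rfl fun l _ => by ring

lemma moment_of_vanish {q : ℤ[X]} (h : ∀ e ∈ g.support, q.eval (2 ^ e) = 0) (i : ℕ) :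
    moment g q i = 0 :=
  sum_eq_zero fun e he => by simp only [h e he]; simp

lemma vanish_of_moment (hg : g.support.card ≤ T) {q : ℤ[X]} (h : ∀ i < T, moment g q i = 0) :
    ∀ e ∈ g.support, q.eval (2 ^ e) = 0 := by
  intro e he
  have h1 := eq_zero_of_powerSums (S := g.support) (c := fun e => g e * (q.eval (2 ^ e) : ℤ))
    (fun i hi => h i (by omega)) e he
  simp_all

/-- The bilinear form of the Hankel matrix multiplied by its adjoint. -/
def form (T : ℕ) (g : ℕ →₀ ℂ) (q r : ℤ[X]) : ℝ :=
  ∑ i ∈ Finset.range T, ((moment g q i).re * (moment g r i).re +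
    (moment g q i).im * (moment g r i).im)

lemma form_comm (q r : ℤ[X]) : form T g q r = form T g r q :=
  sum_congr rfl fun i _ => by ring

lemma form_comb (a b : ℤ) (q r p : ℤ[X]) :
    form T g (C a * q - C b * r) p = a * form T g q p - b * form T g r p := by
  simp only [form, mul_sum, ← sum_sub_distrib, moment_sub, moment_C_mul]
  refine sum_congr rfl fun i _ => ?_
  have h1 : ∀ (a : ℤ) (z : ℂ), ((a : ℂ) * z).re = a * z.re := fun a z => by simp
  have h2 : ∀ (a : ℤ) (z : ℂ), ((a : ℂ) * z).im = a * z.im := fun a z => by simp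
  rw [sub_re, sub_im, h1, h1, h2, h2]
  ring

lemma form_of_vanish {q : ℤ[X]} (h : ∀ e ∈ g.support, q.eval (2 ^ e) = 0) (p : ℤ[X]) :
    form T g q p = 0 :=
  sum_eq_zero fun i _ => by rw [moment_of_vanish h]; simp

lemma vanish_of_form (hg : g.support.card ≤ T) {q : ℤ[X]} (h : form T g q q = 0) :
    ∀ e ∈ g.support, q.eval (2 ^ e) = 0 := by
  refine vanish_of_moment hg fun i hi => ?_
  have h1 := (Finset.sum_eq_zero_iff_of_nonneg (fun i _ => add_nonneg (mul_self_nonneg _)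
    (mul_self_nonneg _))).1 h i (mem_range.2 hi)
  have h2 := mul_self_nonneg (moment g q i).re
  have h3 := mul_self_nonneg (moment g q i).im
  exact Complex.ext (mul_self_eq_zero.1 (by linarith)) (mul_self_eq_zero.1 (by linarith))

lemma form_eq_zero_of_degree_lt {q : ℤ[X]} {k : ℕ} {qs : List ℤ[X]}
    (h1 : ∀ i < k, ∃ r ∈ qs, r.degree = i) (h2 : ∀ r ∈ qs, form T g q r = 0) :
    ∀ p : ℤ[X], p.degree < k → form T g q p = 0 := by
  induction k with
  | zero =>
    intro p hp
    have : p = 0 := degree_eq_bot.1 (by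
      rw [← WithBot.lt_coe_bot]; exact_mod_cast hp)
    subst this
    rw [form_comm]
    exact form_of_vanish (by simp) q
  | succ k ih =>
    have ih := ih fun i hi => h1 i (by omega)
    intro p hp
    obtain ⟨r, hr, hrk⟩ := h1 k (by omega)
    have hlc : r.leadingCoeff ≠ 0 := leadingCoeff_ne_zero.2 fun h0 => by simp [h0] at hrk
    have hrk' : r.natDegree = k := natDegree_eq_of_degree_eq_some hrk
    have hlow : (C r.leadingCoeff * p - C (p.coeff k) * r).degree < k := by
      rw [degree_lt_iff_coeff_zero]
      intro j hj
      rw [coeff_sub, coeff_C_mul, coeff_C_mul]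
      rcases hj.eq_or_lt with rfl | hj
      · rw [leadingCoeff, hrk']; ring
      · rw [coeff_eq_zero_of_degree_lt (p := p) (hp.trans_le (by exact_mod_cast hj)),
          coeff_eq_zero_of_natDegree_lt (p := r) (by omega)]
        ring
    have h3 := ih _ hlow
    rw [form_comm, form_comb, form_comm, form_comm r, h2 r hr, mul_zero, sub_zero] at h3
    exact (mul_eq_zero.1 h3).resolve_left (by exact_mod_cast hlc)

/-! ### Vectors of moments -/

/-- The inner product of the first `T` entries. -/
def innerL (w v : List (ℤ × ℤ × ℤ)) : ℤ :=
  ((w.zip v).map fun z => z.1.1 * z.2.1 + z.1.2.1 * z.2.2.1).sum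

/-- Linear combination. -/
def combL (α β : ℤ) (w v : List (ℤ × ℤ × ℤ)) : List (ℤ × ℤ × ℤ) :=
  List.zipWith (fun x y => (α * x.1 - β * y.1, α * x.2.1 - β * y.2.1, α * x.2.2 - β * y.2.2)) w v

/-- The list `w` starts with the moments of `D q g`, in two coordinates, and has the coefficients
of `q` in the third coordinate, the coefficient number `T` first. -/
structure IsVec (T D : ℕ) (g : ℕ →₀ ℂ) (w : List (ℤ × ℤ × ℤ)) (q : ℤ[X]) : Prop where
  le_length : T + 1 ≤ w.length
  re : ∀ i < T, ((w.getD i 0).1 : ℝ) = D * (moment g q i).re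
  im : ∀ i < T, ((w.getD i 0).2.1 : ℝ) = D * (moment g q i).im
  coeff : ∀ i, (w.getD i 0).2.2 = if i ≤ T then q.coeff (T - i) else 0

lemma innerL_eq_sum (T : ℕ) (w v : List (ℤ × ℤ × ℤ)) (hw : T ≤ w.length) (hv : T ≤ v.length) :
    innerL (w.take T) v = ∑ i ∈ Finset.range T, ((w.getD i 0).1 * (v.getD i 0).1 +
      (w.getD i 0).2.1 * (v.getD i 0).2.1) := by
  induction T generalizing w v with
  | zero => simp [innerL]
  | succ T ih =>
    match w, v, hw, hv with
    | x :: w, y :: v, hw, hv =>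
      have := ih w v (by simpa using hw) (by simpa using hv)
      rw [sum_range_succ']
      simp only [List.getD_cons_succ, List.getD_cons_zero]
      rw [← this, innerL, innerL, List.take_succ_cons, List.zip_cons_cons, map_cons,
        sum_cons]
      ring

lemma getD_combL (α β : ℤ) {w v : List (ℤ × ℤ × ℤ)} {i : ℕ} (hw : i < w.length)
    (hv : i < v.length) : (combL α β w v).getD i 0 =
      (α * (w.getD i 0).1 - β * (v.getD i 0).1, α * (w.getD i 0).2.1 - β * (v.getD i 0).2.1,
        α * (w.getD i 0).2.2 - β * (v.getD i 0).2.2) := by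
  simp_all [combL]

namespace IsVec

variable {w v : List (ℤ × ℤ × ℤ)} {q r : ℤ[X]}

lemma innerL_eq (hw : IsVec T D g w q) (hv : IsVec T D g v r) :
    (innerL (w.take T) v : ℝ) = D ^ 2 * form T g q r := by
  have h1 := hw.le_length
  have h2 := hv.le_length
  rw [innerL_eq_sum T w v (by omega) (by omega), form, mul_sum]
  push_cast
  refine sum_congr rfl fun i hi => ?_
  rw [mem_range] at hi
  rw [hw.re i hi, hv.re i hi, hw.im i hi, hv.im i hi]
  ring

lemma comb (hw : IsVec T D g w q) (hv : IsVec T D g v r) (α β : ℤ) :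
    IsVec T D g (combL α β w v) (C α * q - C β * r) := by
  have h1 := hw.le_length
  have h2 := hv.le_length
  refine ⟨by simp [combL]; omega, fun i hi => ?_, fun i hi => ?_, fun i => ?_⟩
  · rw [getD_combL α β (by omega) (by omega), moment_sub, moment_C_mul, moment_C_mul]
    grind [sub_re, mul_re, intCast_re, intCast_im, zero_mul, sub_zero, hw.re, hv.re]
  · rw [getD_combL α β (by omega) (by omega), moment_sub, moment_C_mul, moment_C_mul]
    push_cast
    simp only [sub_im, mul_im, intCast_re, intCast_im, zero_mul,
      add_zero, hw.im i hi, hv.im i hi]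
    ring
  · rcases lt_or_ge i (combL α β w v).length with hi | hi
    · have hi' : i < w.length ∧ i < v.length := by simpa [combL] using hi
      rw [getD_combL α β hi'.1 hi'.2]
      simp only [hw.coeff, hv.coeff, coeff_sub, coeff_C_mul]
      split <;> ring
    · rw [List.getD_eq_default _ _ hi, if_neg]
      · rfl
      · simp [combL] at hi; omega

end IsVec

/-! ### Orthogonalization -/

/-- Subtract from `w` its projections to the vectors `ws`, without divisions. -/
def gsReduce (T : ℕ) (w : List (ℤ × ℤ × ℤ)) (ws : List (List (ℤ × ℤ × ℤ))) : List (ℤ × ℤ × ℤ) :=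
  ws.foldl (fun w v => combL (innerL (v.take T) v) (innerL (w.take T) v) w v) w

lemma degree_C_mul_le' (a : ℤ) (q : ℤ[X]) : (C a * q).degree ≤ q.degree := by
  rw [← smul_eq_C_mul]; exact degree_smul_le a q

lemma exists_gsReduce (hD : 0 < D) {ws : List (List (ℤ × ℤ × ℤ))} {qs : List ℤ[X]}
    (h : Forall₂ (IsVec T D g) ws qs) (hn : ∀ q ∈ qs, form T g q q ≠ 0)
    (ho : qs.Pairwise fun q r => form T g q r = 0) {k : ℕ} (hk : ∀ q ∈ qs, q.degree < k)
    {w : List (ℤ × ℤ × ℤ)} {r : ℤ[X]} (hw : IsVec T D g w r) (hr : r.degree = k) :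
    ∃ r', IsVec T D g (gsReduce T w ws) r' ∧ r'.degree = k ∧ (∀ q ∈ qs, form T g r' q = 0) ∧
      ∀ p, form T g r p = 0 → (∀ q ∈ qs, form T g q p = 0) → form T g r' p = 0 := by
  induction h generalizing w r with
  | nil => exact ⟨r, hw, hr, by simp, fun p hp _ => hp⟩
  | @cons v q ws qs hv _ ih =>
    set α := innerL (v.take T) v with hα
    set β := innerL (w.take T) v with hβ
    have hα' : (α : ℝ) = D ^ 2 * form T g q q := hv.innerL_eq hv
    have hβ' : (β : ℝ) = D ^ 2 * form T g r q := hw.innerL_eq hv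
    have hα0 : α ≠ 0 := by
      intro h0
      rw [h0, Int.cast_zero, eq_comm] at hα'
      rcases mul_eq_zero.1 hα' with h1 | h1
      · have : (0 : ℝ) < (D : ℝ) ^ 2 := by positivity
        exact this.ne' h1
      · exact hn q (by simp) h1
    rw [pairwise_cons] at ho
    have hdeg : (C α * r - C β * q).degree = k := by
      have h1 : (C α * r).degree = k := by rw [degree_C_mul hα0, hr]
      rw [← h1]
      refine degree_sub_eq_left_of_degree_lt ?_
      rw [h1]
      exact (degree_C_mul_le' β q).trans_lt (hk q (by simp))
    obtain ⟨r', h1, h2, h3, h4⟩ := ih (fun q hq => hn q (by simp [hq])) ho.2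
      (fun q hq => hk q (by simp [hq])) (hw.comb hv α β) hdeg
    have hq : form T g r' q = 0 := by
      refine h4 q ?_ fun q' hq' => by rw [form_comm]; exact ho.1 q' hq'
      rw [form_comb, hα', hβ']; ring
    refine ⟨r', h1, h2, ?_, fun p hp hp' => h4 p ?_ fun q hq => hp' q (by simp [hq])⟩
    · intro q' hq'
      rcases mem_cons.1 hq' with rfl | hq'
      · exact hq
      · exact h3 q' hq'
    · rw [form_comb, hp, hp' q (by simp)]; ring

/-- The integer polynomial with the roots `2 ^ e`. -/
def rootPoly (g : ℕ →₀ ℂ) : ℤ[X] := ∏ e ∈ g.support, (X - C ((2 : ℤ) ^ e))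

lemma degree_rootPoly (g : ℕ →₀ ℂ) : (rootPoly g).degree = g.support.card := by
  rw [rootPoly, degree_prod]; simp only [degree_X_sub_C]; simp

lemma eval_rootPoly {e : ℕ} (he : e ∈ g.support) : (rootPoly g).eval (2 ^ e) = 0 := by
  rw [rootPoly, eval_prod]
  exact Finset.prod_eq_zero he (by simp)

lemma monic_rootPoly (g : ℕ →₀ ℂ) : (rootPoly g).Monic :=
  monic_prod_of_monic _ _ fun _ _ => monic_X_sub_C _

lemma eq_zero_of_vanish {q : ℤ[X]} (h : ∀ e ∈ g.support, q.eval (2 ^ e) = 0)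
    (hq : q.degree < g.support.card) : q = 0 := by
  have h2 : Injective fun e : ℕ => (2 : ℤ) ^ e := fun a b hab =>
    Nat.pow_right_injective le_rfl (by simp only at hab; exact_mod_cast hab)
  by_contra h0
  have hs : (g.support.image fun e : ℕ => (2 : ℤ) ^ e).card = g.support.card :=
    Finset.card_image_of_injective _ h2
  have := card_le_degree_of_subset_roots (p := q)
    (Z := g.support.image fun e : ℕ => (2 : ℤ) ^ e) (by
    intro x hx
    obtain ⟨e, he, rfl⟩ := mem_image.1 (Finset.mem_def.2 hx)
    exact (mem_roots h0).2 (h e he))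
  rw [hs] at this
  rw [degree_eq_natDegree h0] at hq
  exact absurd (by exact_mod_cast hq) (not_lt.2 this)

lemma eq_of_vanish {q : ℤ[X]} (h : ∀ e ∈ g.support, q.eval (2 ^ e) = 0)
    (hq : q.degree = g.support.card) : q = C q.leadingCoeff * rootPoly g := by
  rw [← sub_eq_zero]
  refine eq_zero_of_vanish (g := g) (fun e he => by
    rw [eval_sub, eval_mul, h e he, eval_rootPoly he]; ring) ?_
  rw [← hq]
  have hq0 : q ≠ 0 := fun h0 => by simp [h0] at hq
  refine degree_sub_lt_left ?_ hq0 ?_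
  · rw [degree_C_mul (leadingCoeff_ne_zero.2 hq0), degree_rootPoly, hq]
  · rw [leadingCoeff_mul, leadingCoeff_C, (monic_rootPoly g).leadingCoeff, mul_one]

end

open Polynomial

/-! ### The loop of the orthogonalization -/

/-- A state is a flag, the result, the current vector and the previous orthogonal vectors. -/
abbrev GSState : Type :=
  Bool × List (ℤ × ℤ × ℤ) × List (ℤ × ℤ × ℤ) × List (List (ℤ × ℤ × ℤ))

/-- One pass of the orthogonalization. -/
def gsPass (T : ℕ) (s : GSState) : GSState :=
  if s.1 = true then s
  else if innerL ((gsReduce T s.2.2.1 s.2.2.2).take T) (gsReduce T s.2.2.1 s.2.2.2) ≠ 0 then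
    (false, [], s.2.2.1.tail, gsReduce T s.2.2.1 s.2.2.2 :: s.2.2.2)
  else (true, gsReduce T s.2.2.1 s.2.2.2, s.2.2.1, s.2.2.2)

variable {g : ℕ →₀ ℂ} {T D : ℕ}

/-- The vectors `ws` belong to orthogonal polynomials of the degrees less than `k`. -/
def GSInv (T D : ℕ) (g : ℕ →₀ ℂ) (k : ℕ) (ws : List (List (ℤ × ℤ × ℤ))) : Prop :=
  ∃ qs : List ℤ[X], Forall₂ (IsVec T D g) ws qs ∧ (∀ q ∈ qs, form T g q q ≠ 0) ∧
    (qs.Pairwise fun q r => form T g q r = 0) ∧ (∀ q ∈ qs, q.degree < k) ∧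
    (∀ i < k, ∃ q ∈ qs, q.degree = i) ∧ qs.length = k

lemma GSInv.succ (hD : 0 < D) (hg : g.support.card ≤ T) {k : ℕ} (hk : k < g.support.card)
    {ws : List (List (ℤ × ℤ × ℤ))} (h : GSInv T D g k ws) {w : List (ℤ × ℤ × ℤ)}
    (hw : IsVec T D g w (X ^ k)) :
    innerL ((gsReduce T w ws).take T) (gsReduce T w ws) ≠ 0 ∧
      GSInv T D g (k + 1) (gsReduce T w ws :: ws) := by
  obtain ⟨qs, h1, h2, h3, h4, h5, h6⟩ := h
  obtain ⟨r, h7, h8, h9, -⟩ := exists_gsReduce hD h1 h2 h3 h4 hw (degree_X_pow k)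
  have hr : form T g r r ≠ 0 := by
    intro h0
    have : r = 0 := eq_zero_of_vanish (vanish_of_form hg h0) (by rw [h8]; exact_mod_cast hk)
    simp [this] at h8
  refine ⟨fun h0 => ?_, r :: qs, Forall₂.cons h7 h1, ?_, ?_, ?_, ?_, ?_⟩
  · have := h7.innerL_eq h7
    rw [h0, Int.cast_zero, eq_comm] at this
    rcases mul_eq_zero.1 this with h' | h'
    · have : (0 : ℝ) < (D : ℝ) ^ 2 := by positivity
      exact this.ne' h'
    · exact hr h'
  · exact fun q hq => (mem_cons.1 hq).elim (fun e => e ▸ hr) (h2 q)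
  · exact pairwise_cons.2 ⟨h9, h3⟩
  · intro q hq
    rcases mem_cons.1 hq with rfl | hq
    · rw [h8]; exact_mod_cast Nat.lt_succ_self k
    · exact (h4 q hq).trans (by exact_mod_cast Nat.lt_succ_self k)
  · intro i hi
    rcases (Nat.lt_succ_iff.1 hi).eq_or_lt with rfl | hi
    · exact ⟨r, by simp, h8⟩
    · obtain ⟨q, hq, hqi⟩ := h5 i hi
      exact ⟨q, by simp [hq], hqi⟩
  · simp [h6]

lemma GSInv.last (hD : 0 < D) (hg : g.support.card ≤ T) {ws : List (List (ℤ × ℤ × ℤ))}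
    (h : GSInv T D g g.support.card ws) {w : List (ℤ × ℤ × ℤ)}
    (hw : IsVec T D g w (X ^ g.support.card)) :
    innerL ((gsReduce T w ws).take T) (gsReduce T w ws) = 0 ∧
      ∃ c : ℤ, c ≠ 0 ∧ IsVec T D g (gsReduce T w ws) (C c * rootPoly g) := by
  obtain ⟨qs, h1, h2, h3, h4, h5, h6⟩ := h
  obtain ⟨r, h7, h8, h9, -⟩ := exists_gsReduce hD h1 h2 h3 h4 hw (degree_X_pow _)
  have hr0 : r ≠ 0 := fun h0 => by simp [h0] at h8
  have hlow : (r - C r.leadingCoeff * rootPoly g).degree < g.support.card := by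
    rw [← h8]
    refine degree_sub_lt_left ?_ hr0 ?_
    · rw [degree_C_mul (leadingCoeff_ne_zero.2 hr0), degree_rootPoly, h8]
    · rw [leadingCoeff_mul, leadingCoeff_C, (monic_rootPoly g).leadingCoeff, mul_one]
  have hr : form T g r r = 0 := by
    have e1 := form_eq_zero_of_degree_lt h5 h9 _ hlow
    have e2 : form T g (rootPoly g) r = 0 := form_of_vanish (fun e he => eval_rootPoly he) r
    have e3 := form_comb (T := T) (g := g) 1 r.leadingCoeff r (rootPoly g) r
    simp_all [one_mul, form_comm]
  refine ⟨?_, r.leadingCoeff, leadingCoeff_ne_zero.2 hr0, ?_⟩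
  · have := h7.innerL_eq h7
    simp_all
  · rw [← eq_of_vanish (vanish_of_form hg hr) h8]
    exact h7

lemma iterate_gsPass (hD : 0 < D) (hg : g.support.card ≤ T) {A : List (ℤ × ℤ × ℤ)}
    (hA : ∀ k ≤ T, IsVec T D g (A.drop k) (X ^ k)) (i : ℕ) (hi : i ≤ g.support.card) :
    ∃ ws, (gsPass T)^[i] (false, [], A, []) = (false, [], A.drop i, ws) ∧ GSInv T D g i ws := by
  induction i with
  | zero => exact ⟨[], rfl, [], Forall₂.nil, by simp, by simp, by simp, by simp, rfl⟩
  | succ i ih =>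
    obtain ⟨ws, h1, h2⟩ := ih (by omega)
    obtain ⟨h3, h4⟩ := h2.succ hD hg hi (hA i (by omega))
    simp_all [iterate_succ_apply', gsPass, List.tail_drop]

lemma iterate_gsPass_last (hD : 0 < D) (hg : g.support.card ≤ T) {A : List (ℤ × ℤ × ℤ)}
    (hA : ∀ k ≤ T, IsVec T D g (A.drop k) (X ^ k)) :
    ∃ w cur ws c, (gsPass T)^[T + 1] (false, [], A, []) = (true, w, cur, ws) ∧ c ≠ 0 ∧
      IsVec T D g w (C c * rootPoly g) := by
  obtain ⟨ws, h1, h2⟩ := iterate_gsPass hD hg hA _ le_rfl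
  obtain ⟨h3, c, hc, h4⟩ := h2.last hD hg (hA _ hg)
  refine ⟨_, A.drop g.support.card, ws, c, ?_, hc, h4⟩
  have h5 : T + 1 = (T - g.support.card) + 1 + g.support.card := by omega
  rw [h5, Function.iterate_add_apply, h1, iterate_succ_apply, gsPass, if_neg (by simp),
    if_neg (not_not.2 h3)]
  have h6 : ∀ j (s : GSState), s.1 = true → (gsPass T)^[j] s = s := by
    intro j s hs
    induction j with
    | zero => rfl
    | succ j ih => rw [iterate_succ_apply', ih, gsPass, if_pos hs]
  rw [h6 _ _ rfl]

/-! ### The vectors of the values -/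

/-- The integer `D v`, if the denominator of `v` divides `D`. -/
def clear (D : ℕ) (v : ℚ) : ℤ := D * v.num / v.den

lemma clear_eq {v : ℚ} (h : v.den ∣ D) : (clear D v : ℝ) = D * (v : ℝ) := by
  obtain ⟨c, rfl⟩ := h
  have h0 : (v.den : ℤ) ≠ 0 := by exact_mod_cast v.den_nz
  have h1 : clear (v.den * c) v = c * v.num := by
    simp [clear, mul_assoc]
  have h2 : (v.num : ℝ) = v * v.den := by exact_mod_cast (Rat.mul_den_eq_num v).symm
  rw [h1]; push_cast; rw [h2]; ring

/-- The list of the values multiplied by `D`, the entry number `T` being marked. -/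
def triples (D T : ℕ) : ℕ → List (ℚ × ℚ) → List (ℤ × ℤ × ℤ)
  | _, [] => [(0, 0, 0)]
  | j, v :: vs => (clear D v.1, clear D v.2, if j = T then 1 else 0) :: triples D T (j + 1) vs

lemma length_triples (D T j : ℕ) (vs : List (ℚ × ℚ)) :
    (triples D T j vs).length = vs.length + 1 := by
  induction vs generalizing j with
  | nil => rfl
  | cons v vs ih => simp [triples, ih]

lemma getD_triples (D T j : ℕ) (vs : List (ℚ × ℚ)) (i : ℕ) : (triples D T j vs).getD i 0 =
    if h : i < vs.length then (clear D vs[i].1, clear D vs[i].2, if j + i = T then 1 else 0)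
    else 0 := by
  induction vs generalizing i j with
  | nil => cases i <;> simp [triples]
  | cons v vs ih =>
    cases i with
    | zero => simp [triples]
    | succ i =>
      rw [triples, List.getD_cons_succ, ih]
      grind

lemma isVec_drop_triples (hT : 1 ≤ T) {vs : List (ℚ × ℚ)} (hvs : vs.length = 2 * T)
    (hv : ∀ j, (hj : j < vs.length) → powerSum g j = toComplex vs[j])
    (hD : ∀ v ∈ vs, v.1.den ∣ D ∧ v.2.den ∣ D) {k : ℕ} (hk : k ≤ T) :
    IsVec T D g ((triples D T 0 vs).drop k) (X ^ k) := by
  have h1 : ∀ i, ((triples D T 0 vs).drop k).getD i 0 = (triples D T 0 vs).getD (k + i) 0 := by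
    intro i
    rw [List.getD_eq_getElem?_getD, List.getElem?_drop, ← List.getD_eq_getElem?_getD]
  refine ⟨by rw [List.length_drop, length_triples]; omega, fun i hi => ?_, fun i hi => ?_,
    fun i => ?_⟩
  · have h2 : k + i < vs.length := by omega
    rw [h1, getD_triples, dif_pos h2, moment_X_pow, add_comm i, hv _ h2]
    exact clear_eq (hD _ (getElem_mem h2)).1
  · have h2 : k + i < vs.length := by omega
    rw [h1, getD_triples, dif_pos h2, moment_X_pow, add_comm i, hv _ h2]
    exact clear_eq (hD _ (getElem_mem h2)).2
  · rw [h1, getD_triples]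
    by_cases h2 : k + i < vs.length
    · rw [dif_pos h2, coeff_X_pow]
      simp only [zero_add]
      by_cases h3 : i ≤ T
      · rw [if_pos h3]
        exact if_congr (by omega) rfl rfl
      · rw [if_neg h3, if_neg (by omega)]
    · rw [dif_neg h2]
      split
      · rw [coeff_X_pow, if_neg (by omega)]; rfl
      · rfl

/-! ### The exponents -/

lemma sum_two_pow_eq {w : List (ℤ × ℤ × ℤ)} {c : ℤ} (hc : c ≠ 0) (hg : g.support.card ≤ T)
    (hw : IsVec T D g w (C c * rootPoly g)) :
    (∀ i < T - g.support.card, (w.getD i 0).2.2 = 0) ∧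
    (w.getD (T - g.support.card) 0).2.2 ≠ 0 ∧
    (0 - (w.getD (T - g.support.card + 1) 0).2.2) / (w.getD (T - g.support.card) 0).2.2 =
      ∑ e ∈ g.support, 2 ^ e := by
  have hn : (rootPoly g).natDegree = g.support.card :=
    natDegree_eq_of_degree_eq_some (degree_rootPoly g)
  have h1 : (w.getD (T - g.support.card) 0).2.2 = c := by
    rw [hw.coeff, if_pos (by omega), coeff_C_mul, show T - (T - g.support.card) =
      (rootPoly g).natDegree by omega, coeff_natDegree, (monic_rootPoly g).leadingCoeff, mul_one]
  refine ⟨fun i hi => ?_, by rw [h1]; exact hc, ?_⟩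
  · rw [hw.coeff, if_pos (by omega), coeff_C_mul,
      coeff_eq_zero_of_natDegree_lt (by omega), mul_zero]
  · rw [h1, hw.coeff]
    rcases Nat.eq_zero_or_pos g.support.card with h0 | h0
    · rw [if_neg (by omega), Finset.card_eq_zero.1 h0]; simp
    · rw [if_pos (by omega), coeff_C_mul, show T - (T - g.support.card + 1) =
        g.support.card - 1 by omega, rootPoly, prod_X_sub_C_coeff_card_pred _ _ h0,
        show 0 - c * -∑ i ∈ g.support, (2 : ℤ) ^ i = c * ∑ i ∈ g.support, (2 : ℤ) ^ i by ring,
        Int.mul_ediv_cancel_left _ hc]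

lemma splitAll_bits {m : ℕ} (h : ∀ e ∈ g.support, e < 2 ^ m) :
    splitAll 0 (squares 2 m) [∑ e ∈ g.support, 2 ^ e] =
      (range (2 ^ m)).map fun e => if e ∈ g.support then 1 else 0 := by
  have h1 : (∑ e ∈ g.support, 2 ^ e : ℤ) =
      polyEval 2 ((range (2 ^ m)).map fun e => if e ∈ g.support then 1 else 0) := by
    rw [polyEval_map_range]
    simp only [ite_mul, one_mul, zero_mul]
    rw [← sum_filter]
    congr 1
    grind
  rw [h1, ← pairUpAll_eq m 2 _ (by simp)]
  refine splitAll_pairUpAll (R := fun y x => 0 ≤ x ∧ x < y) ?_ ?_ m 2 _ (by simp) ?_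
  · rintro y a b ⟨ha, ha'⟩ ⟨hb, hb'⟩
    exact ⟨by nlinarith, by nlinarith⟩
  · omega
  · grind

/-! ### The coefficients -/

/-- Synthetic division by `X - x`: the value of the quotient at `x` and the combinations of the
entries of the second list with the coefficients of the quotient. -/
def hornerL (x : ℤ) : List (ℤ × ℤ × ℤ) → List (ℤ × ℤ × ℤ) → ℤ × ℤ × ℤ × ℤ → ℤ × ℤ × ℤ × ℤ
  | q :: w, a :: l, s => hornerL x w l (s.1 * x + q.2.2, s.2.1 * x + (s.1 * x + q.2.2),
      s.2.2.1 + (s.1 * x + q.2.2) * a.1, s.2.2.2 + (s.1 * x + q.2.2) * a.2.1)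
  | _, _, s => s

lemma hornerL_map_range {x : ℤ} {q : ℤ[X]} {F A : ℕ → ℤ × ℤ × ℤ} (k : ℕ)
    (hF : ∀ l < k, (F l).2.2 = q.coeff (l + 1)) (d s s' : ℤ) :
    hornerL x ((range k).reverse.map F) ((range k).reverse.map A)
      ((q /ₘ (X - C x)).coeff k, d, s, s') = ((q /ₘ (X - C x)).coeff 0,
        d * x ^ k + ∑ l ∈ Finset.range k, (q /ₘ (X - C x)).coeff l * x ^ l,
        s + ∑ l ∈ Finset.range k, (q /ₘ (X - C x)).coeff l * (A l).1,
        s' + ∑ l ∈ Finset.range k, (q /ₘ (X - C x)).coeff l * (A l).2.1) := by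
  induction k generalizing d s s' with
  | zero => simp [hornerL]
  | succ k ih =>
    have h1 : (q /ₘ (X - C x)).coeff (k + 1) * x + (F k).2.2 = (q /ₘ (X - C x)).coeff k := by
      rw [hF k (by omega), coeff_divByMonic_X_sub_C_rec q x k]; ring
    rw [List.range_succ, List.reverse_append, List.reverse_singleton, List.singleton_append,
      map_cons, map_cons, hornerL]
    simp only [h1]
    rw [ih fun l hl => hF l (by omega)]
    simp only [sum_range_succ, Prod.mk.injEq, true_and]
    refine ⟨by ring, by ring, by ring⟩

lemma take_eq_map_range (w : List (ℤ × ℤ × ℤ)) {k : ℕ} (hk : k ≤ w.length) :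
    w.take k = (range k).reverse.map fun l => w.getD (k - 1 - l) 0 := by
  refine ext_getElem (by simpa using hk) fun i h1 h2 => ?_
  grind

lemma take_reverse_eq_map_range (w : List (ℤ × ℤ × ℤ)) {k : ℕ} (hk : k ≤ w.length) :
    (w.take k).reverse = (range k).reverse.map fun l => w.getD l 0 := by
  rw [map_reverse]
  congr 1
  refine ext_getElem (by simpa using hk) fun i h1 h2 => ?_
  grind

/-- Synthetic division gives the coefficients of `g`. -/
lemma exists_hornerL (hD : 0 < D) (hg : g.support.card ≤ T) {w A : List (ℤ × ℤ × ℤ)} {c : ℤ}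
    (hc : c ≠ 0) (hw : IsVec T D g w (C c * rootPoly g)) (hA : IsVec T D g A (X ^ 0)) {e : ℕ}
    (he : e ∈ g.support) : ∃ b d s s' : ℤ,
      hornerL (2 ^ e) (w.take T) (A.take T).reverse (0, 0, 0, 0) = (b, d, s, s') ∧ d ≠ 0 ∧
      (s : ℝ) / ((D * d : ℤ) : ℝ) = (g e).re ∧ (s' : ℝ) / ((D * d : ℤ) : ℝ) = (g e).im := by
  set q : ℤ[X] := C c * rootPoly g with hq
  set x : ℤ := 2 ^ e with hx
  set r : ℤ[X] := q /ₘ (X - C x) with hr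
  have hq0 : q ≠ 0 := mul_ne_zero (C_ne_zero.2 hc) (monic_rootPoly g).ne_zero
  have hdeg : q.natDegree = g.support.card := by
    rw [hq, natDegree_C_mul hc]; exact natDegree_eq_of_degree_eq_some (degree_rootPoly g)
  have hqe : ∀ e ∈ g.support, q.eval (2 ^ e) = 0 := fun e he => by
    rw [hq, eval_mul, eval_rootPoly he, mul_zero]
  have hmul : (X - C x) * r = q := mul_divByMonic_eq_iff_isRoot.2 (hqe e he)
  have hrdeg : r.natDegree = g.support.card - 1 := by
    rw [hr, natDegree_divByMonic q (monic_X_sub_C x), hdeg, natDegree_X_sub_C]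
  have ht : 0 < g.support.card := card_pos.2 ⟨e, he⟩
  have hr0 : r ≠ 0 := fun h0 => hq0 (by rw [← hmul, h0, mul_zero])
  have hinj : ∀ {a b : ℕ}, (2 : ℤ) ^ a = 2 ^ b → a = b := fun h =>
    Nat.pow_right_injective le_rfl (by exact_mod_cast h)
  have hre : ∀ e' ∈ g.support, e' ≠ e → r.eval (2 ^ e') = 0 := by
    intro e' he' hne
    have h1 := hqe e' he'
    rw [← hmul, eval_mul, eval_sub, eval_X, eval_C] at h1
    refine (mul_eq_zero.1 h1).resolve_left fun h2 => hne (hinj (by rw [← sub_eq_zero]; exact h2))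
  have hrx : r.eval x ≠ 0 := by
    intro h0
    refine hr0 (eq_zero_of_vanish (g := g) (fun e' he' => ?_) ?_)
    · by_cases h : e' = e
      · rw [h]; exact h0
      · exact hre e' he' h
    · rw [degree_eq_natDegree hr0, hrdeg]
      exact_mod_cast (show g.support.card - 1 < g.support.card by omega)
  have hlw := hw.le_length
  have hlA := hA.le_length
  have hrT : r.coeff T = 0 := coeff_eq_zero_of_natDegree_lt (by omega)
  have h1 := hornerL_map_range (x := x) (q := q) (F := fun l => w.getD (T - 1 - l) 0)
    (A := fun l => A.getD l 0) T (fun l hl => by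
      rw [hw.coeff, if_pos (by omega)]; congr 1; omega) 0 0 0
  rw [← hr, hrT, ← take_eq_map_range w (by omega), ← take_reverse_eq_map_range A (by omega)] at h1
  have hev : ∑ l ∈ Finset.range T, r.coeff l * x ^ l = r.eval x :=
    (eval_eq_sum_range' (by omega) x).symm
  have hm : moment g r 0 = g e * (r.eval x : ℤ) := by
    rw [moment, Finsupp.sum, Finset.sum_eq_single_of_mem e he fun e' he' hne => by
      rw [hre e' he' hne]; simp]
    rw [pow_zero, mul_one]
  have hm' := moment_eq_sum (g := g) r (N := T) (by omega) 0
  rw [hm] at hm'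
  have hDd : ((D * r.eval x : ℤ) : ℝ) ≠ 0 := by
    exact_mod_cast mul_ne_zero (by exact_mod_cast hD.ne') hrx
  refine ⟨_, _, _, _, h1, ?_, ?_, ?_⟩
  · rw [hev]; simpa using hrx
  · rw [hev, zero_mul, zero_add, zero_add, div_eq_iff hDd]
    have h2 := congrArg Complex.re hm'
    rw [re_sum] at h2
    simp only [mul_re, intCast_re, intCast_im, zero_mul, mul_zero,
      sub_zero, zero_add] at h2
    push_cast
    rw [← mul_assoc, mul_comm _ (D : ℝ), mul_assoc, h2, mul_sum]
    refine sum_congr rfl fun l hl => ?_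
    rw [hA.re l (mem_range.1 hl), moment_X_pow, add_zero]; ring
  · rw [hev, zero_mul, zero_add, zero_add, div_eq_iff hDd]
    have h2 := congrArg Complex.im hm'
    rw [im_sum] at h2
    simp only [mul_im, intCast_re, intCast_im, zero_mul, mul_zero,
      add_zero, zero_add] at h2
    push_cast
    rw [← mul_assoc, mul_comm _ (D : ℝ), mul_assoc, h2, mul_sum]
    refine sum_congr rfl fun l hl => ?_
    rw [hA.im l (mem_range.1 hl), moment_X_pow, add_zero]; ring

end

section

open Prog

/-- Coding of triples and of lists of triples. -/
def encTriple (t : ℤ × ℤ × ℤ) : Data := .int t.1 & .int t.2.1 & .int t.2.2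

def encVec (w : List (ℤ × ℤ × ℤ)) : Data := encList (w.map encTriple)

@[simp] lemma encVec_nil : encVec [] = .int 0 := rfl
@[simp] lemma encVec_cons (a : ℤ × ℤ × ℤ) (w : List (ℤ × ℤ × ℤ)) :
    encVec (a :: w) = encTriple a & encVec w := rfl

namespace Prog

lemma val_foldE_take {cnt lst init step : Prog} {x : Data} {c : ℕ} {l : List Data}
    (hc : cnt.val x = .int c) (hl : lst.val x = encList l) :
    (foldE cnt lst init step).val x = foldState step (l.take c) (init.val x) := by
  simp [foldE, val_comp, val_pair, hc, hl, foldP, val_loop, Data.left_pair, Data.toInt_int, Data.right_pair, Int.toNat_natCast, iterate_foldBody]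

/-! ### Inner products and linear combinations -/

def innerStep : Prog := var 1 ▷ snd △ addP (rest 2)
  (addP (mulP (var 0 ▷ fst) (var 1 ▷ fst ▷ fst))
    (mulP (var 0 ▷ snd ▷ fst) (var 1 ▷ fst ▷ snd ▷ fst)))

lemma foldState_innerStep (w v : List (ℤ × ℤ × ℤ)) (h : w.length ≤ v.length) (s : ℤ) :
    foldState innerStep (w.map encTriple) (encVec v & .int s) =
      encVec (v.drop w.length) & .int (s + innerL w v) := by
  induction w generalizing v s with
  | nil => simp [foldState, innerL]
  | cons x w ih =>
    cases v with
    | nil => simp at h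
    | cons y v =>
      rw [map_cons, foldState_cons]
      have : innerStep.val (encTriple x & encVec (y :: v) & .int s) =
          encVec v & .int (s + (x.1 * y.1 + x.2.1 * y.2.1)) := by
        simp [innerStep, encTriple]
      rw [this, ih v (by simpa using h)]
      simp [innerL, add_assoc]

/-- On `(T, (w, v))`, the inner product of the first `T` entries. -/
def innerP : Prog := foldE (var 0) (var 1) (rest 2 △ const 0) innerStep ▷ snd

lemma val_innerP {T : ℕ} {w v : List (ℤ × ℤ × ℤ)} (h : w.length ≤ v.length) :
    innerP.val (.int T & encVec w & encVec v) = .int (innerL (w.take T) v) := by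
  rw [innerP, val_comp, val_foldE_take (c := T) (l := w.map encTriple) rfl rfl, ← map_take]
  have := foldState_innerStep (w.take T) v (by simp; omega) 0
  simp_all

def combStep : Prog := var 1 ▷ snd △ var 2 △ var 3 △ (subP (mulP (var 2) (var 0 ▷ fst)) (mulP (var 3) (var 1 ▷ fst ▷ fst)) △ subP (mulP (var 2) (var 0 ▷ snd ▷ fst))
        (mulP (var 3) (var 1 ▷ fst ▷ snd ▷ fst)) △ subP (mulP (var 2) (var 0 ▷ snd ▷ snd))
        (mulP (var 3) (var 1 ▷ fst ▷ snd ▷ snd))) △ rest 4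

lemma foldState_combStep (α β : ℤ) (w v acc : List (ℤ × ℤ × ℤ)) (h : w.length ≤ v.length) :
    foldState combStep (w.map encTriple)
      (encVec v & .int α & .int β & encVec acc) =
      encVec (v.drop w.length) & .int α & .int β & encVec ((combL α β w v).reverse ++ acc) := by
  induction w generalizing v acc with
  | nil => simp [foldState, combL]
  | cons x w ih =>
    cases v with
    | nil => simp at h
    | cons y v =>
      rw [map_cons, foldState_cons]
      have : combStep.val (encTriple x & encVec (y :: v) & .int α & .int β & encVec acc) = encVec v & .int α & .int β & encVec ((α * x.1 - β * y.1, α * x.2.1 - β * y.2.1,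
            α * x.2.2 - β * y.2.2) :: acc) := by
        simp [combStep, encTriple]
      rw [this, ih v _ (by simpa using h)]
      simp [combL]

/-- On `(c, (α, (β, (w, v))))`, the linear combination `α w - β v`. -/
def combP : Prog := revE (var 0)
  (foldE (var 0) (var 3) (rest 4 △ var 1 △ var 2 △ const 0) combStep ▷ rest 3)

lemma val_combP {c : ℕ} {α β : ℤ} {w v : List (ℤ × ℤ × ℤ)} (h : w.length ≤ v.length)
    (hc : w.length ≤ c) : combP.val (.int c & .int α & .int β & encVec w & encVec v) = encVec (combL α β w v) := by
  have h1 : (foldE (var 0) (var 3) (rest 4 △ var 1 △ var 2 △ const 0)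
      combStep ▷ rest 3).val (.int c & .int α & .int β & encVec w & encVec v) = encList ((combL α β w v).reverse.map encTriple) := by
    rw [val_comp, val_foldE (c := c) (l := w.map encTriple) rfl rfl (by simpa using hc)]
    have := foldState_combStep α β w v [] h
    simp_all [encVec]
  rw [combP, val_revE (c := c) rfl h1 (by simp [combL]; omega), ← map_reverse,
    reverse_reverse]
  rfl

/-! ### Orthogonalization -/

def gsStep : Prog := var 1 △ (addP (mulP (const 2) (var 1)) (const 1) △ (var 1 △ var 0 △ var 0) ▷ innerP △ (var 1 △ rest 2 △ var 0) ▷ innerP △ rest 2 △ var 0) ▷ combP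

lemma val_gsStep {T : ℕ} {w v : List (ℤ × ℤ × ℤ)} (h : w.length ≤ v.length)
    (hw : w.length ≤ 2 * T + 1) : gsStep.val (encVec v & .int T & encVec w) =
      .int T & encVec (combL (innerL (v.take T) v) (innerL (w.take T) v) w v) := by
  have h1 : (addP (mulP (const 2) (var 1)) (const 1) △ (var 1 △ var 0 △ var 0) ▷ innerP △ (var 1 △ rest 2 △ var 0) ▷ innerP △ rest 2 △ var 0).val
      (encVec v & .int T & encVec w) = .int (2 * T + 1 : ℕ) & .int (innerL (v.take T) v) & .int (innerL (w.take T) v) & encVec w & encVec v := by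
    rw [← val_innerP h, ← val_innerP le_rfl]; rfl
  rw [gsStep, val_pair, val_comp, h1, val_combP h hw]
  rfl

lemma length_gsReduce (T : ℕ) {w : List (ℤ × ℤ × ℤ)} {ws : List (List (ℤ × ℤ × ℤ))}
    (h : ∀ v ∈ ws, w.length ≤ v.length) : (gsReduce T w ws).length = w.length := by
  induction ws generalizing w with
  | nil => rfl
  | cons v ws ih =>
    simp_all [combL, gsReduce, foldl_cons]

lemma foldState_gsStep {T : ℕ} {w : List (ℤ × ℤ × ℤ)} {ws : List (List (ℤ × ℤ × ℤ))}
    (h : ∀ v ∈ ws, w.length ≤ v.length) (hw : w.length ≤ 2 * T + 1) :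
    foldState gsStep (ws.map encVec) (.int T & encVec w) =
      .int T & encVec (gsReduce T w ws) := by
  induction ws generalizing w with
  | nil => rfl
  | cons v ws ih =>
    have hl : (combL (innerL (v.take T) v) (innerL (w.take T) v) w v).length = w.length := by
      have := h v (by simp)
      simp [combL]; omega
    rw [map_cons, foldState_cons, val_gsStep (h v (by simp)) hw,
      ih (fun v' hv' => by rw [hl]; exact h v' (by simp [hv'])) (by rw [hl]; exact hw)]
    rfl

/-- Coding of the states of the orthogonalization. -/
def encGS (T : ℕ) (s : GSState) : Data :=
  .int (if s.1 = true then 1 else 0) & encVec s.2.1 & encVec s.2.2.1 & encList (s.2.2.2.map encVec) & .int T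

def gsNew : Prog :=
  foldE (rest 4) (var 3) (rest 4 △ var 2) gsStep ▷ rest 1

def gsBody : Prog := ite (var 0) id ((gsNew △ id) ▷ ite ((rest 5 △ var 0 △ var 0) ▷ innerP)
    (const 0 △ const 0 △ var 3 ▷ snd △ (var 0 △ var 4) △ rest 5)
    (const 1 △ var 0 △ rest 3))

/-- The lengths in a state after at most `i` passes. -/
def _root_.SparseInterp.GSState.Good (T i : ℕ) (s : GSState) : Prop :=
  s.1 = true ∨ ((∀ v ∈ s.2.2.2, s.2.2.1.length ≤ v.length) ∧ s.2.2.1.length ≤ 2 * T + 1 ∧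
    s.2.2.2.length ≤ i)

lemma _root_.SparseInterp.GSState.Good.pass {T i : ℕ} {s : GSState} (h : s.Good T i) :
    GSState.Good T (i + 1) (gsPass T s) := by
  rw [gsPass]
  split
  · rename_i h1; exact Or.inl h1
  · rename_i h1
    obtain ⟨h2, h3, h4⟩ := h.resolve_left h1
    split
    · refine Or.inr ⟨fun v hv => ?_, ?_, by simpa using h4⟩
      · simp only [List.length_tail]
        rcases mem_cons.1 hv with rfl | hv
        · rw [length_gsReduce T h2]; omega
        · have := h2 v hv; omega
      · simp only [List.length_tail]; omega
    · exact Or.inl rfl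

lemma val_gsNew {T : ℕ} {w' cur : List (ℤ × ℤ × ℤ)} {z : ℤ} {ws : List (List (ℤ × ℤ × ℤ))}
    (h : ∀ v ∈ ws, cur.length ≤ v.length) (hw : cur.length ≤ 2 * T + 1) (hws : ws.length ≤ T) :
    gsNew.val (.int z & encVec w' & encVec cur & encList (ws.map encVec) & .int T) = encVec (gsReduce T cur ws) := by
  rw [gsNew, val_comp, val_foldE (c := T) (l := ws.map encVec) rfl rfl (by simpa using hws)]
  exact congrArg Data.right (foldState_gsStep h hw)

lemma val_gsBody {T i : ℕ} {s : GSState} (h : s.Good T i) (hi : i ≤ T) :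
    gsBody.val (encGS T s) = encGS T (gsPass T s) := by
  obtain ⟨d, w, cur, ws⟩ := s
  cases d with
  | true => simp [gsBody, encGS, gsPass]
  | false =>
    obtain ⟨h1, h2, h3⟩ := h.resolve_left (by simp)
    simp only at h1 h2 h3
    have h4 : (gsNew △ id).val (encGS T (false, w, cur, ws)) =
        encVec (gsReduce T cur ws) & encGS T (false, w, cur, ws) := by
      rw [val_pair, val_id, encGS, val_gsNew h1 h2 (by omega)]
    have h5 : ((rest 5 △ var 0 △ var 0) ▷ innerP).val
        (encVec (gsReduce T cur ws) & encGS T (false, w, cur, ws)) =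
        .int (innerL ((gsReduce T cur ws).take T) (gsReduce T cur ws)) := by
      rw [← val_innerP le_rfl]; rfl
    have h6 : encVec cur.tail = (encVec cur).right := by cases cur <;> rfl
    rw [gsBody, val_ite, if_neg (by simp [encGS]), val_comp, h4, val_ite, h5, Data.toInt_int]
    by_cases h7 : innerL ((gsReduce T cur ws).take T) (gsReduce T cur ws) = 0
    · simp [gsPass, h7, encGS]
    · simp [gsPass, h7, encGS, h6]

/-- On `(T, A)`, the result of the orthogonalization. -/
def gsP : Prog := (addP (var 0) (const 1) △ const 0 △ const 0 △ rest 1 △ const 0 △ var 0) ▷ (loop gsBody ▷ var 1)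

lemma iterate_gsBody {T : ℕ} {A : List (ℤ × ℤ × ℤ)} (hA : A.length ≤ 2 * T + 1) (i : ℕ)
    (hi : i ≤ T + 1) :
    gsBody.val^[i] (encGS T (false, [], A, [])) = encGS T ((gsPass T)^[i] (false, [], A, [])) ∧
      GSState.Good T i ((gsPass T)^[i] (false, [], A, [])) := by
  induction i with
  | zero => exact ⟨rfl, Or.inr ⟨by simp, hA, by simp⟩⟩
  | succ i ih =>
    obtain ⟨h1, h2⟩ := ih (by omega)
    rw [iterate_succ_apply', iterate_succ_apply', h1, val_gsBody h2 (by omega)]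
    exact ⟨rfl, h2.pass⟩

lemma val_gsP {T : ℕ} {A : List (ℤ × ℤ × ℤ)} (hA : A.length ≤ 2 * T + 1) :
    gsP.val (.int T & encVec A) = encVec ((gsPass T)^[T + 1] (false, [], A, [])).2.1 := by
  have h1 : (addP (var 0) (const 1) △ const 0 △ const 0 △ rest 1 △ const 0 △ var 0).val (.int T & encVec A) =
      .int (T + 1 : ℕ) & encGS T (false, [], A, []) := rfl
  rw [gsP, val_comp, h1, val_comp, val_loop]
  simp only [Data.left_pair, Data.toInt_int, Data.right_pair, Int.toNat_natCast]
  rw [(iterate_gsBody hA _ le_rfl).1]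
  rfl

/-! ### The values as vectors -/

def denStep : Prog :=
  mulP (mulP (rest 1) (var 0 ▷ fst ▷ snd)) (var 0 ▷ snd ▷ snd)

/-- The product of all denominators. -/
def denProd (vs : List (ℚ × ℚ)) : ℕ :=
  (vs.map fun v => v.1.den * v.2.den).prod

lemma foldState_denStep (vs : List (ℚ × ℚ)) (z : ℤ) :
    foldState denStep (vs.map encGauss) (.int z) = .int (z * denProd vs) := by
  induction vs generalizing z with
  | nil => simp [foldState, denProd]
  | cons v vs ih =>
    rw [map_cons, foldState_cons]
    have : denStep.val (encGauss v & .int z) = .int (z * v.1.den * v.2.den) := by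
      simp [denStep, encGauss, encRat]
    have h2 : denProd (v :: vs) = v.1.den * v.2.den * denProd vs := by simp [denProd]
    rw [this, ih, h2]
    push_cast; ring_nf

lemma denProd_pos (vs : List (ℚ × ℚ)) : 0 < denProd vs := by
  refine List.prod_pos fun x hx => ?_
  obtain ⟨v, -, rfl⟩ := mem_map.1 hx
  exact Nat.mul_pos v.1.den_pos v.2.den_pos

lemma dvd_denProd {vs : List (ℚ × ℚ)} {v : ℚ × ℚ} (hv : v ∈ vs) :
    v.1.den ∣ denProd vs ∧ v.2.den ∣ denProd vs := by
  have : v.1.den * v.2.den ∣ denProd vs := List.dvd_prod (mem_map.2 ⟨v, hv, rfl⟩)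
  exact ⟨(Dvd.intro _ rfl).trans this, (Dvd.intro_left _ rfl).trans this⟩

def tripStep : Prog := addP (var 1) (const 1) △ var 2 △ var 3 △ (divP (mulP (var 3) (var 0 ▷ fst ▷ fst)) (var 0 ▷ fst ▷ snd) △ divP (mulP (var 3) (var 0 ▷ snd ▷ fst)) (var 0 ▷ snd ▷ snd) △ ite (subP (var 1) (var 2)) (const 0) (const 1)) △ rest 4

lemma foldState_tripStep (D T : ℕ) (j : ℕ) (vs : List (ℚ × ℚ)) (acc : List (ℤ × ℤ × ℤ)) :
    ∃ l, foldState tripStep (vs.map encGauss) (.int j & .int T & .int D & encVec acc) = .int (j + vs.length : ℕ) & .int T & .int D & encVec (l.reverse ++ acc) ∧ l ++ [(0, 0, 0)] = triples D T j vs := by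
  induction vs generalizing j acc with
  | nil => exact ⟨[], rfl, rfl⟩
  | cons v vs ih =>
    have h1 : tripStep.val (encGauss v & .int j & .int T & .int D & encVec acc) = .int (j + 1 : ℕ) & .int T & .int D & encVec ((clear D v.1, clear D v.2, if j = T then 1 else 0) :: acc) := by
      have h2 : ((j : ℤ) - T = 0) ↔ j = T := by omega
      by_cases hj : j = T <;> simp [tripStep, encGauss, encRat, encTriple, clear, h2, hj]
    obtain ⟨l, e1, e2⟩ := ih (j + 1) ((clear D v.1, clear D v.2, if j = T then 1 else 0) :: acc)
    refine ⟨(clear D v.1, clear D v.2, if j = T then 1 else 0) :: l, ?_, ?_⟩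
    · rw [map_cons, foldState_cons, h1, e1]
      simp [add_assoc, add_comm 1]
    · rw [List.cons_append, e2]; rfl

/-- On `(c, (D, (T, vals)))`, where `c` bounds the number of values, the list of triples. -/
def tripP : Prog := foldE (var 0)
  (foldE (var 0) (rest 3) (const 0 △ var 2 △ var 1 △ const 0) tripStep ▷ rest 3) ((const 0 △ const 0 △ const 0) △ const 0) id

lemma val_tripP {c D T : ℕ} {vs : List (ℚ × ℚ)} (hc : vs.length ≤ c) :
    tripP.val (.int c & .int D & .int T & encList (vs.map encGauss)) =
      encVec (triples D T 0 vs) := by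
  obtain ⟨l, h1, h2⟩ := foldState_tripStep D T 0 vs []
  have hl : l.length = vs.length := by
    grind [length_triples]
  have h3 : (foldE (var 0) (rest 3) (const 0 △ var 2 △ var 1 △ const 0) tripStep ▷ rest 3).val (.int c & .int D & .int T & encList (vs.map encGauss)) = encList (l.reverse.map encTriple) := by
    rw [val_comp, val_foldE (c := c) (l := vs.map encGauss) rfl rfl (by simpa using hc)]
    simp_all [encVec]
  rw [tripP, val_foldE (c := c) rfl h3 (by simp; omega)]
  have := foldState_id (l.reverse.map encTriple) [encTriple 0]
  rw [← h2]
  simp only [encVec, map_append]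
  simpa [encTriple] using this

/-! ### Leading zeros -/

def dropBody : Prog := ite (fst ▷ (snd ▷ snd)) id snd

/-- On `(T, w)`, the vector `w` without leading entries that have third coordinate zero. -/
def dropP : Prog := loop dropBody

lemma iterate_dropBody {w : List (ℤ × ℤ × ℤ)} {k : ℕ} (h0 : ∀ i < k, (w.getD i 0).2.2 = 0)
    (hk : (w.getD k 0).2.2 ≠ 0) (i : ℕ) :
    dropBody.val^[i] (encVec w) = encVec (w.drop (min i k)) := by
  have hlen : k < w.length := by
    by_contra h
    simp_all
  induction i with
  | zero => simp
  | succ i ih =>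
    rw [iterate_succ_apply', ih]
    have hd : min i k < w.length := by omega
    rw [drop_eq_getElem_cons hd, ← getD_eq_getElem w 0 hd]
    rcases lt_or_ge i k with h | h
    · have h1 := h0 i h
      rw [min_eq_left h.le, min_eq_left (by omega : i + 1 ≤ k)]
      simp_all [dropBody, encTriple]
    · rw [min_eq_right h, min_eq_right (by omega : k ≤ i + 1),
        drop_eq_getElem_cons hlen, ← getD_eq_getElem w 0 hlen]
      simp [dropBody, encTriple, -List.getD_eq_getElem?_getD, hk]

lemma val_dropP {w : List (ℤ × ℤ × ℤ)} {k T : ℕ} (h0 : ∀ i < k, (w.getD i 0).2.2 = 0)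
    (hk : (w.getD k 0).2.2 ≠ 0) (hT : k ≤ T) :
    dropP.val (.int T & encVec w) = encVec (w.drop k) := by
  rw [dropP, val_loop]
  simp only [Data.left_pair, Data.toInt_int, Data.right_pair, Int.toNat_natCast]
  rw [iterate_dropBody h0 hk, min_eq_right hT]

lemma third_head (w : List (ℤ × ℤ × ℤ)) :
    ((fst ▷ (snd ▷ snd)).val (encVec w)).toInt = (w.getD 0 0).2.2 := by
  cases w <;> simp [encTriple]

lemma snd_encVec (w : List (ℤ × ℤ × ℤ)) : (encVec w).right = encVec w.tail := by
  cases w <;> rfl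

/-- The quotient of the first two third coordinates, with the opposite sign. -/
def sumPowP : Prog := divP (subP (const 0) (snd ▷ (fst ▷ (snd ▷ snd))))
  (fst ▷ (snd ▷ snd))

lemma val_sumPowP (w : List (ℤ × ℤ × ℤ)) (k : ℕ) : sumPowP.val (encVec (w.drop k)) =
    .int ((0 - (w.getD (k + 1) 0).2.2) / (w.getD k 0).2.2) := by
  have h1 : ∀ i, ((w.drop k).getD i 0) = w.getD (k + i) 0 := fun i => by
    simp
  rw [sumPowP, val_divP, val_subP, val_const, val_comp snd, val_snd, snd_encVec, third_head,
    third_head, h1, List.tail_drop]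
  simp

/-! ### The list of exponents -/

def scanStep : Prog := ite (var 0) (addP (var 1) (const 1) △ var 1 △ rest 2)
  (addP (var 1) (const 1) △ rest 2)

/-- Coding of lists of natural numbers. -/
def encNats (l : List ℕ) : Data := encList (l.map fun e : ℕ => .int e)

lemma foldState_scanStep (S : Finset ℕ) (M : ℕ) :
    foldState scanStep (((range M).map fun e => if e ∈ S then (1 : ℤ) else 0).map Data.int)
      (.int 0 & .int 0) =
      .int M & encNats ((range M).filter fun e => e ∈ S).reverse := by
  induction M with
  | zero => rfl
  | succ M ih =>
    rw [List.range_succ, map_append, map_append, foldState_append, ih,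
      List.filter_append, List.reverse_append]
    by_cases h : M ∈ S <;> simp [foldState, scanStep, h, encNats]

lemma filter_range_eq_sort {S : Finset ℕ} {M : ℕ} (h : ∀ e ∈ S, e < M) :
    (range M).filter (fun e => e ∈ S) = S.sort (fun x y => x ≤ y) := by
  refine List.Perm.eq_of_pairwise (le := (· ≤ ·)) (fun a b _ _ => le_antisymm) ?_ ?_ ?_
  · exact (List.pairwise_le_range).filter _
  · exact Finset.pairwise_sort _ _
  · refine (List.perm_ext_iff_of_nodup (List.nodup_range.filter _) (Finset.sort_nodup _ _)).2
      fun e => ?_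
    simp_all

/-! ### Synthetic division -/

def hornerStep : Prog := (addP (mulP (var 3) (var 1)) (var 0 ▷ snd ▷ snd) △ id) ▷ (var 2 △ var 3 ▷ snd △ var 0 △ addP (mulP (var 5) (var 2)) (var 0) △ addP (var 6) (mulP (var 0) (var 3 ▷ fst ▷ fst)) △ addP (rest 7) (mulP (var 0) (var 3 ▷ fst ▷ snd ▷ fst)))

lemma foldState_hornerStep (x : ℤ) (w l : List (ℤ × ℤ × ℤ)) (h : w.length ≤ l.length)
    (b d s s' : ℤ) :
    foldState hornerStep (w.map encTriple) (.int x & encVec l & .int b & .int d & .int s & .int s') =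
      .int x & encVec (l.drop w.length) & .int (hornerL x w l (b, d, s, s')).1 & .int (hornerL x w l (b, d, s, s')).2.1 & .int (hornerL x w l (b, d, s, s')).2.2.1 & .int (hornerL x w l (b, d, s, s')).2.2.2 := by
  induction w generalizing l b d s s' with
  | nil => simp [foldState, hornerL]
  | cons q w ih =>
    cases l with
    | nil => simp at h
    | cons a l =>
      rw [map_cons, foldState_cons]
      have : hornerStep.val (encTriple q & .int x & encVec (a :: l) & .int b & .int d & .int s & .int s') =
          .int x & encVec l & .int (b * x + q.2.2) & .int (d * x + (b * x + q.2.2)) & .int (s + (b * x + q.2.2) * a.1) & .int (s' + (b * x + q.2.2) * a.2.1) := by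
        simp [hornerStep, encTriple]
      rw [this, ih l (by simpa using h)]
      simp [hornerL]

/-! ### Fractions in lowest terms -/

/-- On `(c, (N, D))`, the fraction `N / D`; denominators up to `c` are tried first. -/
def fracP : Prog := (redP △ id) ▷ ite (fst ▷ fst) (fst ▷ redOut)
  ((mulP (rest 3) (rest 3) △ rest 2) ▷ redP ▷ redOut)

lemma val_fracP {N D : ℤ} (hD : D ≠ 0) (c : ℕ) :
    fracP.val (.int c & .int N & .int D) = encRat ((N : ℚ) / D) := by
  have h1 : (D.natAbs : ℤ) * D.natAbs = D * D := Int.natAbs_mul_self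
  have h2 : ((mulP (rest 3) (rest 3) △ rest 2) ▷ redP ▷ redOut).val
      (redP.val (.int c & .int N & .int D) & .int c & .int N & .int D) = encRat ((N : ℚ) / D) := by
    have h3 : (mulP (rest 3) (rest 3) △ rest 2).val
      (redP.val (.int c & .int N & .int D) & .int c & .int N & .int D) =
        .int (D.natAbs * D.natAbs : ℕ) & .int N & .int D := by
      rw [cast_mul, h1]
      rfl
    rw [val_comp, val_comp, h3, val_redP hD, if_neg, val_redOut hD]
    have := den_div_le (N := N) hD
    have h4 := Int.natAbs_pos.2 hD
    rw [not_lt]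
    exact this.trans (le_mul_of_pos_left _ h4)
  rw [fracP, val_comp, val_pair, val_id, val_ite, h2, val_comp fst fst, val_comp fst redOut]
  simp only [val_fst, Data.left_pair]
  rw [val_redP hD]
  by_cases hc : c < ((N : ℚ) / D).den
  · simp [hc]
  · simp [hc, val_redOut hD]

/-! ### The coefficients -/

/-- Environment of the computation of the coefficients. -/
def encSlow (al w A : List (ℤ × ℤ × ℤ)) (es : List ℕ) (D m T G : ℕ)
    (vs : List (ℚ × ℚ)) : Data :=
  encVec al & encNats es & encVec w & encVec A & .int D & encEnv m T G vs

/-- Synthetic division, in the environment `(e, (acc, encSlow ..))`. -/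
def coefP : Prog := foldE (var 9) (var 4) ((var 7 △ var 0) ▷ binPowP △ var 2 △ const 0 △ const 0 △ const 0 △ const 0) hornerStep

/-- The coefficient, in the environment `(coefP, (e, (acc, encSlow ..)))`. -/
def coefRatP : Prog :=
  (var 11 △ var 0 ▷ var 4 △ mulP (var 7) (var 0 ▷ var 3)) ▷ fracP △ (var 11 △ var 0 ▷ rest 5 △ mulP (var 7) (var 0 ▷ var 3)) ▷ fracP

def slowOutStep : Prog :=
  ((var 0 △ (coefP △ id) ▷ coefRatP) △ var 1) △ rest 2

lemma exists_val_coefP {g : ℕ →₀ ℂ} {D m T G : ℕ} (hD : 0 < D) (hg : g.support.card ≤ T)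
    {w A : List (ℤ × ℤ × ℤ)} {es : List ℕ} {vs : List (ℚ × ℚ)} {c : ℤ} (hc : c ≠ 0)
    (hw : IsVec T D g w (Polynomial.C c * rootPoly g)) (hA : IsVec T D g A (Polynomial.X ^ 0))
    {e : ℕ} (he : e ∈ g.support) (hm : e < 2 ^ m) {v : ℚ × ℚ} (hv : toComplex v = g e)
    (acc : Data) : ∃ (y : Data) (b d s s' : ℤ),
      coefP.val (.int e & acc & encSlow (A.take T).reverse w A es D m T G vs) =
        .int (2 ^ e) & y & .int b & .int d & .int s & .int s' ∧
      (D * d : ℤ) ≠ 0 ∧ (s : ℚ) / ((D * d : ℤ) : ℚ) = v.1 ∧ (s' : ℚ) / ((D * d : ℤ) : ℚ) = v.2 := by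
  obtain ⟨b, d, s, s', h1, hd, h2, h3⟩ := exists_hornerL hD hg hc hw hA he
  set x : Data := .int e & acc & encSlow (A.take T).reverse w A es D m T G vs with hx
  have hlw := hw.le_length
  have hlA := hA.le_length
  have hpow : ((var 7 △ var 0) ▷ binPowP).val x = .int (2 ^ e) := by
    rw [val_comp, ← val_binPowP hm]; rfl
  refine ⟨encVec ((A.take T).reverse.drop (w.take T).length), b, d, s, s', ?_, mul_ne_zero (by exact_mod_cast hD.ne') hd, ?_, ?_⟩
  · have := foldState_hornerStep (2 ^ e) (w.take T) (A.take T).reverse (by simp; omega) 0 0 0 0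
    rw [h1] at this
    rw [coefP, val_foldE_take (c := T) (l := w.map encTriple) rfl rfl, val_pair, hpow,
      ← map_take]
    exact this
  · rw [← hv] at h2
    have h4 : (((s : ℚ) / ((D * d : ℤ) : ℚ) : ℚ) : ℝ) = (v.1 : ℝ) := by
      push_cast at h2 ⊢; exact h2
    exact_mod_cast h4
  · rw [← hv] at h3
    have h4 : (((s' : ℚ) / ((D * d : ℤ) : ℚ) : ℚ) : ℝ) = (v.2 : ℝ) := by
      push_cast at h3 ⊢; exact h3
    exact_mod_cast h4

lemma val_slowOutStep {g : ℕ →₀ ℂ} {D m T G : ℕ} (hD : 0 < D) (hg : g.support.card ≤ T)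
    {w A : List (ℤ × ℤ × ℤ)} {es : List ℕ} {vs : List (ℚ × ℚ)} {c : ℤ} (hc : c ≠ 0)
    (hw : IsVec T D g w (Polynomial.C c * rootPoly g)) (hA : IsVec T D g A (Polynomial.X ^ 0))
    {e : ℕ} (he : e ∈ g.support) (hm : e < 2 ^ m) (hrat : ∃ v, toComplex v = g e) (acc : Data) :
    slowOutStep.val (.int e & acc & encSlow (A.take T).reverse w A es D m T G vs) =
      ((.int e & encComplex (g e)) & acc) & encSlow (A.take T).reverse w A es D m T G vs := by
  obtain ⟨v, hv⟩ := hrat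
  obtain ⟨y, b, d, s, s', hcoef, hDd, e1, e2⟩ := exists_val_coefP (es := es) (G := G) (vs := vs)
    hD hg hc hw hA he hm hv acc
  have e3 : ((coefP △ id) ▷ coefRatP).val (.int e & acc & encSlow (A.take T).reverse w A es D m T G vs) = encGauss v := by
    rw [val_comp, val_pair, hcoef, val_id, coefRatP, val_pair, val_comp, val_comp, encGauss, ← e1,
      ← e2, ← val_fracP hDd G, ← val_fracP hDd G]
    rfl
  rw [slowOutStep, val_pair, val_pair, val_pair, e3, ← hv, encComplex_toComplex]
  rfl

lemma foldState_slowOutStep {g : ℕ →₀ ℂ} {D m T G : ℕ} (hD : 0 < D) (hg : g.support.card ≤ T)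
    {w A : List (ℤ × ℤ × ℤ)} {es : List ℕ} {vs : List (ℚ × ℚ)} {c : ℤ} (hc : c ≠ 0)
    (hw : IsVec T D g w (Polynomial.C c * rootPoly g)) (hA : IsVec T D g A (Polynomial.X ^ 0))
    (hm : ∀ e ∈ g.support, e < 2 ^ m) (hrat : ∀ e, ∃ v, toComplex v = g e)
    (l : List ℕ) (hl : ∀ e ∈ l, e ∈ g.support) (acc : UPoly) :
    foldState slowOutStep (l.map fun e : ℕ => .int e)
      (encUPoly acc & encSlow (A.take T).reverse w A es D m T G vs) =
      encUPoly ((l.reverse.map fun e => (e, g e)) ++ acc) & encSlow (A.take T).reverse w A es D m T G vs := by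
  induction l generalizing acc with
  | nil => rfl
  | cons e l ih =>
    have he := hl e (by simp)
    rw [map_cons, foldState_cons, val_slowOutStep hD hg hc hw hA he (hm e he) (hrat e),
      ← encUPoly_cons, ih fun e' he' => hl e' (by simp [he'])]
    simp

/-! ### The general program -/

def pushDen : Prog := foldE (mulP (const 2) (var 2)) (rest 4) (const 1) denStep △ id

def pushTriples : Prog := (mulP (const 2) (var 3) △ var 0 △ var 3 △ rest 5) ▷ tripP △ id

def pushRel : Prog := (var 4 △ var 0) ▷ gsP △ id

/-- The digits of the sum of the powers of two. -/
def bitsP : Prog := (var 3 △ var 4 △ const 0 △ (var 3 △ const 2) ▷ squaresP △ (var 5 △ var 0) ▷ dropP ▷ sumPowP △ const 0) ▷ splitAllP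

def pushExps : Prog :=
  foldE (var 4) bitsP (const 0 △ const 0) scanStep ▷ snd △ id

def pushRev : Prog := foldE (var 6) (var 2) (const 0) id △ id

def slowOutP : Prog := foldE (var 7) (var 1) (const 0 △ id) slowOutStep ▷ fst

/-- The interpolant by linear algebra. -/
def slowP : Prog :=
  pushDen ▷ (pushTriples ▷ (pushRel ▷ (pushExps ▷ (pushRev ▷ slowOutP))))

section

variable {g : ℕ →₀ ℂ} {m T G : ℕ} {vs : List (ℚ × ℚ)}

lemma val_pushDen (hvs : vs.length = 2 * T) :
    pushDen.val (encEnv m T G vs) = .int (denProd vs) & encEnv m T G vs := by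
  rw [pushDen, val_pair, val_id, val_foldE (c := 2 * T) (l := vs.map encGauss) rfl rfl
    (by simp [hvs]), val_const, foldState_denStep, one_mul]

lemma val_pushTriples (D : ℕ) (hvs : vs.length = 2 * T) :
    pushTriples.val (.int D & encEnv m T G vs) =
      encVec (triples D T 0 vs) & .int D & encEnv m T G vs := by
  rw [pushTriples, val_pair, val_id, val_comp, ← val_tripP hvs.le]
  rfl

lemma val_pushRel (D : ℕ) {A : List (ℤ × ℤ × ℤ)} (hA : A.length ≤ 2 * T + 1) :
    pushRel.val (encVec A & .int D & encEnv m T G vs) =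
      encVec ((gsPass T)^[T + 1] (false, [], A, [])).2.1 & encVec A & .int D & encEnv m T G vs := by
  rw [pushRel, val_pair, val_id, val_comp, ← val_gsP hA]
  rfl

lemma val_bitsP {D : ℕ} (hg : g.support.card ≤ T) (hm : ∀ e ∈ g.support, e < 2 ^ m)
    {w A : List (ℤ × ℤ × ℤ)} {c : ℤ} (hc : c ≠ 0)
    (hw : IsVec T D g w (Polynomial.C c * rootPoly g)) :
    bitsP.val (encVec w & encVec A & .int D & encEnv m T G vs) =
      encInts ((range (2 ^ m)).map fun e => if e ∈ g.support then (1 : ℤ) else 0) := by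
  obtain ⟨h0, h1, h2⟩ := sum_two_pow_eq hc hg hw
  set x : Data := encVec w & encVec A & .int D & encEnv m T G vs with hx
  have h3 : ((var 5 △ var 0) ▷ dropP ▷ sumPowP).val x =
      .int (∑ e ∈ g.support, 2 ^ e) := by
    have h4 : (var 5 △ var 0).val x = .int T & encVec w := rfl
    rw [val_comp, val_comp, h4, val_dropP h0 h1 (by omega), val_sumPowP, h2]
  have h5 : ((var 3 △ const 2) ▷ squaresP).val x = encInts (squares 2 m) := by
    rw [val_comp, ← val_squaresP]; rfl
  rw [bitsP, val_comp, val_pair, val_pair, val_pair, val_pair, val_pair, h3, h5, ← splitAll_bits hm]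
  exact val_splitAllP (m := m) (pw := 2 ^ m) (ε := 0) (l := [∑ e ∈ g.support, 2 ^ e])
    (by rw [length_squares]) (by rw [length_squares]; simp)

lemma val_pushExps {D : ℕ} (hg : g.support.card ≤ T) (hm : ∀ e ∈ g.support, e < 2 ^ m)
    {w A : List (ℤ × ℤ × ℤ)} {c : ℤ} (hc : c ≠ 0)
    (hw : IsVec T D g w (Polynomial.C c * rootPoly g)) :
    pushExps.val (encVec w & encVec A & .int D & encEnv m T G vs) =
      encNats (g.support.sort fun x y => x ≤ y).reverse & encVec w & encVec A & .int D & encEnv m T G vs := by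
  rw [pushExps, val_pair, val_id, val_comp,
    val_foldE (c := 2 ^ m) rfl (val_bitsP hg hm hc hw) (by simp), ← filter_range_eq_sort hm]
  have := foldState_scanStep g.support (2 ^ m)
  simp_all

lemma foldState_reverse (A : List (ℤ × ℤ × ℤ)) (k : ℕ) :
    foldState id ((A.map encTriple).take k) (.int 0) = encVec (A.take k).reverse := by
  have := foldState_id ((A.map encTriple).take k) []
  simp_all [encVec, map_reverse, map_take]

lemma val_pushRev (D : ℕ) (A w : List (ℤ × ℤ × ℤ)) (es : List ℕ) :
    pushRev.val (encNats es & encVec w & encVec A & .int D & encEnv m T G vs) = encSlow (A.take T).reverse w A es D m T G vs := by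
  rw [pushRev, val_pair, val_id, val_foldE_take (c := T) (l := A.map encTriple) rfl rfl, val_const,
    foldState_reverse]
  rfl

lemma val_slowP (hT : 1 ≤ T) (hg : g.support.card ≤ T) (hm : ∀ e ∈ g.support, e < 2 ^ m)
    (hvs : vs.length = 2 * T) (hv : ∀ j, (hj : j < vs.length) → powerSum g j = toComplex vs[j])
    (hrat : ∀ e, ∃ v, toComplex v = g e) :
    slowP.val (encEnv m T G vs) = encUPoly (sparseList g) := by
  have hD := denProd_pos vs
  have hA : ∀ k ≤ T, IsVec T (denProd vs) g ((triples (denProd vs) T 0 vs).drop k)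
      (Polynomial.X ^ k) := fun k hk => isVec_drop_triples hT hvs hv (fun v hv => dvd_denProd hv) hk
  obtain ⟨w, cur, ws, c, h1, hc, hw⟩ := iterate_gsPass_last hD hg hA
  have hl : (triples (denProd vs) T 0 vs).length ≤ 2 * T + 1 := by rw [length_triples, hvs]
  simp only [slowP, val_comp]
  rw [val_pushDen hvs, val_pushTriples _ hvs, val_pushRel _ hl, h1, val_pushExps hg hm hc hw,
    val_pushRev, slowOutP, val_comp, val_foldE (c := T)
    (l := (g.support.sort fun x y => x ≤ y).reverse.map fun e : ℕ => .int e) rfl rfl (by simp [hg])]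
  have := foldState_slowOutStep (es := (g.support.sort fun x y => x ≤ y).reverse) (G := G)
    (vs := vs) hD hg hc hw (hA 0 (by omega)) hm hrat
    (g.support.sort fun x y => x ≤ y).reverse (by simp) []
  rw [append_nil, reverse_reverse] at this
  exact congrArg Data.left this

end

/-! ### The program for Ben-Or and Tiwari's algorithm -/

/-- From `(T, (G, vals))`, the environment of the main part. -/
def envP : Prog := (var 1 ▷ sizeP △ id) ▷ (var 0 ▷ fst △ var 0 ▷ snd △ rest 1)

lemma val_envP (T G : ℕ) (vs : List (ℚ × ℚ)) :
    envP.val (.int T & .int G & encList (vs.map encGauss)) =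
      encEnv (clog 2 G) T G vs := by
  have h1 : (var 1 ▷ sizeP).val
      (.int T & .int G & encList (vs.map encGauss)) = _ := val_sizeP G
  rw [envP, val_comp, val_pair (var 1 ▷ sizeP), val_id, h1]
  rfl

/-- Ben-Or and Tiwari's algorithm. -/
def interpP : Prog := ite (var 0) (envP ▷ fastP slowP) (const 0)

lemma val_interpP {T G : ℕ} {vs : List (ℚ × ℚ)} {g : ℕ →₀ ℂ} (hG : ∀ e ∈ g.support, e < G)
    (hg : g.support.card ≤ T) (hvs : vs.length = 2 * T)
    (hv : ∀ j, (hj : j < vs.length) → powerSum g j = toComplex vs[j])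
    (hrat : ∀ e, ∃ v, toComplex v = g e) :
    interpP.val (.int T & .int G & encList (vs.map encGauss)) =
      encUPoly (sparseList g) := by
  have h0 : ((var 0).val (.int T & .int G & encList (vs.map encGauss))).toInt =
    T := rfl
  rw [interpP, val_ite, h0]
  rcases Nat.eq_zero_or_pos T with rfl | hT
  · simp_all [sparseList, encUPoly]
  · rw [if_pos (by omega), val_comp, val_envP]
    exact val_fastP hg hvs hv (val_slowP hT hg
      (fun e he => (hG e he).trans_le (le_pow_clog (by norm_num) G)) hvs hv hrat)

end Prog

lemma IsGaussRat.zero : IsGaussRat 0 := ⟨⟨0, by simp⟩, ⟨0, by simp⟩⟩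

lemma IsGaussRat.add {z w : ℂ} (hz : IsGaussRat z) (hw : IsGaussRat w) : IsGaussRat (z + w) := by
  obtain ⟨⟨a, ha⟩, ⟨b, hb⟩⟩ := hz
  obtain ⟨⟨c, hc⟩, ⟨d, hd⟩⟩ := hw
  exact ⟨⟨a + c, by push_cast; rw [ha, hc, add_re]⟩,
    ⟨b + d, by push_cast; rw [hb, hd, add_im]⟩⟩

lemma IsGaussRat.mul_two_pow {z : ℂ} (hz : IsGaussRat z) (k : ℕ) : IsGaussRat (z * 2 ^ k) := by
  obtain ⟨⟨a, ha⟩, ⟨b, hb⟩⟩ := hz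
  have h2 : (2 : ℂ) ^ k = ((2 ^ k : ℝ) : ℂ) := by push_cast; rfl
  rw [h2]
  refine ⟨⟨a * 2 ^ k, ?_⟩, ⟨b * 2 ^ k, ?_⟩⟩
  · rw [re_mul_ofReal, ← ha]; push_cast; rfl
  · rw [im_mul_ofReal, ← hb]; push_cast; rfl

lemma isGaussRat_sum {ι : Type*} (s : Finset ι) {f : ι → ℂ} (h : ∀ i ∈ s, IsGaussRat (f i)) :
    IsGaussRat (∑ i ∈ s, f i) := Finset.sum_induction _ _ (fun _ _ => IsGaussRat.add)
  IsGaussRat.zero h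

lemma isGaussRat_powerSum {g : ℕ →₀ ℂ} (h : ∀ e, IsGaussRat (g e)) (j : ℕ) :
    IsGaussRat (powerSum g j) :=
  isGaussRat_sum _ fun e _ => by
    simp only [← pow_mul]; exact (h e).mul_two_pow _

/-- The values of a polynomial over `ℚ(i)`. -/
lemma exists_values {g : ℕ →₀ ℂ} (h : ∀ e, IsGaussRat (g e)) (T : ℕ) : ∃ vs : List (ℚ × ℚ),
    vs.length = 2 * T ∧ (∀ j, (hj : j < vs.length) → powerSum g j = toComplex vs[j]) ∧
    ((range (2 * T)).map (powerSum g)).map encComplex = vs.map encGauss := by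
  choose v hv using fun j => (isGaussRat_powerSum h j).exists_toComplex
  refine ⟨(range (2 * T)).map v, by simp, fun j hj => by simp [hv], ?_⟩
  rw [map_map, map_map]
  refine map_congr_left fun j _ => ?_
  rw [Function.comp, Function.comp, ← hv j, encComplex_toComplex]

lemma val_interpP_input {g : ℕ →₀ ℂ} {T G : ℕ} (hG : ∀ e ∈ g.support, e < G)
    (hg : g.support.card ≤ T) (h : ∀ e, IsGaussRat (g e)) :
    interpP.val (BenOrTiwari.input T G ((range (2 * T)).map (powerSum g))) =
      encUPoly (BenOrTiwari.interpolant T G ((range (2 * T)).map (powerSum g))) := by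
  obtain ⟨vs, h1, h2, h3⟩ := exists_values h T
  rw [BenOrTiwari.interpolant_eq hG hg, BenOrTiwari.input, h3]
  exact val_interpP hG hg h1 h2 fun e => (h e).exists_toComplex

lemma isImplementation_interpP : BenOrTiwari.IsImplementation interpP := by
  intro T G g hG hg hrat values hvalues
  set k : ℕ →₀ ℂ := onFinset g.support g.coeff (fun e he => Polynomial.mem_support_iff.2 he)
    with hk
  have hs : k.support = g.support := by
    grind
  have hv : values = (range (2 * T)).map (powerSum k) := by
    rw [hvalues]
    refine map_congr_left fun j _ => ?_
    rw [Polynomial.eval_eq_sum, Polynomial.sum, powerSum, Finsupp.sum, hs]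
    refine sum_congr rfl fun e _ => ?_
    rw [hk, Finsupp.onFinset_apply, ← pow_mul, ← pow_mul, mul_comm j]
  rw [hv]
  refine val_interpP_input (fun e he => ?_) (by rw [hs]; exact hg) hrat
  rw [hs] at he
  exact (Polynomial.le_natDegree_of_mem_supp e he).trans_lt hG

/-! ### Domination up to a constant factor -/

/-- The function `f` is at most a constant times `W + 1`. -/
def Dom {ι : Type*} (f W : ι → ℕ) : Prop := ∃ c, ∀ i, f i ≤ c * (W i + 1)

lemma mul_softMul_le {a S R : ℕ} (h : a * S ≤ R) : a * softMul S ≤ softMul R := by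
  rcases a.eq_zero_or_pos with rfl | ha
  · simp
  · rw [softMul, ← mul_assoc]
    exact Nat.mul_le_mul h (pow_le_pow_left (size_le_size
      ((le_mul_of_pos_left _ ha).trans h)) 2)

namespace Dom

variable {ι : Type*} {f g W S : ι → ℕ}

lemma of_le (h : ∀ i, f i ≤ W i) : Dom f W := ⟨1, fun i => by have := h i; omega⟩

lemma mono (h : ∀ i, f i ≤ g i) : Dom g W → Dom f W := fun ⟨c, hc⟩ =>
  ⟨c, fun i => (h i).trans (hc i)⟩

lemma trans : Dom f g → Dom g W → Dom f W := fun ⟨a, ha⟩ ⟨b, hb⟩ =>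
  ⟨a * (b + 1), fun i => (ha i).trans (by
    rw [mul_assoc, add_mul]; exact Nat.mul_le_mul_left a (add_le_add (hb i) (by omega)))⟩

lemma add : Dom f W → Dom g W → Dom (fun i => f i + g i) W := fun ⟨a, ha⟩ ⟨b, hb⟩ =>
  ⟨a + b, fun i => by rw [add_mul]; exact add_le_add (ha i) (hb i)⟩

lemma const (k : ℕ) : Dom (fun _ => k) W := ⟨k, fun i => le_mul_of_pos_right _ (by omega)⟩

lemma const_mul (k : ℕ) : Dom f W → Dom (fun i => k * f i) W := fun ⟨a, ha⟩ =>
  ⟨k * a, fun i => by rw [mul_assoc]; exact Nat.mul_le_mul_left k (ha i)⟩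

lemma comp {κ : Type*} (h : Dom f W) (e : κ → ι) : Dom (fun k => f (e k)) fun k => W (e k) :=
  h.imp fun _ hc k => hc (e k)

lemma softMul (h : Dom f S) (hS : ∀ i, 1 ≤ S i) :
    Dom (fun i => softMul (f i)) fun i => softMul (S i) := by
  obtain ⟨c, hc⟩ := h
  exact Dom.mono (fun i => (softMul_mono ((hc i).trans (show _ ≤ c * 2 * S i by
    have := hS i; rw [mul_assoc]; gcongr; omega))).trans (softMul_mul_le _ (hS i)))
      ((Dom.of_le fun _ => le_rfl).const_mul _)

end Dom

@[simp] lemma intLen_zero : intLen 0 = 1 := rfl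
@[simp] lemma intLen_one : intLen 1 = 2 := by decide
@[simp] lemma intLen_two : intLen 2 = 3 := by decide

lemma intLen_natCast_le (c : ℕ) : intLen (c : ℤ) ≤ c + 1 := by
  simp only [intLen, Int.natAbs_natCast]
  have : size c ≤ c := size_le.2 lt_two_pow_self
  omega

lemma intLen_le_of_abs_le {x z : ℤ} {k : ℕ} (h : |x| ≤ z) (hz : z < 2 ^ k) : intLen x ≤ k + 1 :=
  intLen_le_of_lt_two_pow (h.trans_lt hz)

lemma intLen_le_of_le_two_pow {x m : ℕ} (h : x ≤ 2 ^ m) : intLen x ≤ m + 2 := by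
  refine intLen_le_of_lt_two_pow (k := m + 1) ?_
  grind

lemma intLen_two_pow (i : ℕ) : intLen (2 ^ i) ≤ i + 2 := by
  exact_mod_cast intLen_le_of_le_two_pow (le_refl (2 ^ i))

lemma bdd_encInts {S : ℕ} (hS : 1 ≤ S) {l : List ℤ} :
    (encInts l).Bdd S ↔ ∀ x ∈ l, intLen x ≤ S := by
  simp [encInts, bdd_encList hS]

namespace Prog

/-- A program without loops and arithmetic. -/
def Plain : Prog → Bool
  | comp p q | pair p q => Plain p && Plain q
  | ite c p q => Plain c && Plain p && Plain q
  | id | const _ | fst | snd | isPair => true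
  | _ => false

lemma cost_ite_le (c p q : Prog) (x : Data) :
    (ite c p q).cost x ≤ c.cost x + p.cost x + q.cost x + 1 := by
  rw [cost_ite]; split <;> omega

lemma exists_cost_le_of_plain {P : Prog} (h : P.Plain = true) : ∃ c, ∀ x, P.cost x ≤ c := by
  induction P with
  | comp p q hp hq | pair p q hp hq =>
    rw [Plain, Bool.and_eq_true] at h
    obtain ⟨⟨a, ha⟩, b, hb⟩ := And.intro (hp h.1) (hq h.2)
    exact ⟨a + b + 1, fun x => succ_le_succ (add_le_add (ha x) (hb _))⟩
  | ite c p q hc hp hq =>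
    rw [Plain, Bool.and_eq_true, Bool.and_eq_true] at h
    obtain ⟨⟨a, ha⟩, ⟨b, hb⟩, d, hd⟩ := And.intro (hc h.1.1) (And.intro (hp h.1.2) (hq h.2))
    exact ⟨a + b + d + 1, fun x => (cost_ite_le c p q x).trans
      (succ_le_succ (add_le_add (add_le_add (ha x) (hb x)) (hd x)))⟩
  | id | const | fst | snd | isPair => exact ⟨_, fun _ => le_rfl⟩
  | _ => simp [Plain] at h

/-- The costs of the program `P` on the data `x i` are at most a constant times `W i + 1`. -/
def Cheap {ι : Type*} (W : ι → ℕ) (P : Prog) (x : ι → Data) : Prop :=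
  Dom (fun i => P.cost (x i)) W

/-- A decomposition of one of the lists `l i`, at one of its elements. -/
structure Split {ι α : Type*} (l : ι → List α) where
  i : ι
  l1 : List α
  y : α
  l2 : List α
  eq : l i = l1 ++ y :: l2

lemma Split.mem {ι α : Type*} {l : ι → List α} (j : Split l) : j.y ∈ l j.i := by simp [j.eq]

lemma Split.length {ι α : Type*} {l : ι → List α} (j : Split l) :
    (l j.i).length = j.l1.length + 1 + j.l2.length := by
  rw [j.eq, length_append, length_cons]; omega

/-- The cost of the steps of a fold. -/
def foldCost (step : Prog) : List Data → Data → ℕ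
  | [], _ => 0
  | x :: l, s => step.cost (x & s) + foldCost step l (step.val (x & s))

lemma foldCost_map_le {α : Type*} (f : α → Data) {step : Prog} {K : ℕ} {l : List α} {s : Data}
    (h : ∀ l1 y l2, l = l1 ++ y :: l2 → step.cost (f y & foldState step (l1.map f) s) ≤ K) :
    foldCost step (l.map f) s ≤ l.length * K := by
  induction l generalizing s with
  | nil => simp [foldCost]
  | cons a l ih =>
    have h1 := h [] a l rfl
    have h2 := ih (s := step.val (f a & s)) fun l1 y l2 hl => h (a :: l1) y l2 (by rw [hl]; rfl)
    rw [map_cons, foldCost, length_cons, add_mul, one_mul]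
    exact (Nat.add_le_add h1 h2).trans_eq (add_comm _ _)

lemma cost_foldE (cnt lst init step : Prog) {x : Data} {c : ℕ} {l : List Data}
    (hc : cnt.val x = .int c) (hl : lst.val x = encList l) :
    (foldE cnt lst init step).cost x ≤ cnt.cost x + lst.cost x + init.cost x + 28 * (c + 1) +
      foldCost step l (init.val x) := by
  rw [foldE, cost_comp, cost_pair, cost_pair, val_pair, val_pair, hc, hl, foldP, cost_comp,
    cost_loop, show ∀ d, snd.cost d = 1 from fun _ => rfl]
  simp only [Data.left_pair, Data.toInt_int, Data.right_pair, Int.toNat_natCast]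
  have h1 : ∀ (c : ℕ) (l : List Data) (s : Data), ∑ i ∈ Finset.range c, ((foldBody step).cost
      ((foldBody step).val^[i] (encList l & s)) + 1) ≤ 15 * c + foldCost step l s := by
    intro c
    induction c with
    | zero => simp
    | succ c ih =>
      intro l s
      rw [sum_range_succ']
      simp only [iterate_succ_apply, Function.iterate_zero_apply]
      cases l with
      | nil =>
        grind [encList_nil, val_foldBody_nil, cost_foldBody_nil]
      | cons y l =>
        have := ih l (step.val (y & s))
        rw [encList_cons, val_foldBody_cons, cost_foldBody_cons, foldCost]
        omega
  have := h1 c l (init.val x)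
  have := intLen_natCast_le c
  omega

section

variable {ι : Type*} {W S c K : ι → ℕ} {p q r : Prog} {x : ι → Data}

lemma Cheap.plain (h : p.Plain = true := by rfl) : Cheap W p x :=
  have ⟨c, hc⟩ := exists_cost_le_of_plain h
  Dom.mono (fun i => hc (x i)) (.const c)

lemma Cheap.comp (hp : Cheap W p x) (hq : Cheap W q fun i => p.val (x i)) :
    Cheap W (p ▷ q) x := (Dom.add hp hq).add (.const 1)

lemma Cheap.pair (hp : Cheap W p x) (hq : Cheap W q x) : Cheap W (p △ q) x :=
  (Dom.add hp hq).add (.const 1)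

lemma Cheap.ite (hr : Cheap W r x) (hp : Cheap W p x) (hq : Cheap W q x) :
    Cheap W (Prog.ite r p q) x :=
  Dom.mono (fun i => cost_ite_le r p q (x i)) (((Dom.add hr hp).add hq).add (.const 1))

lemma Cheap.mulP (hp : Cheap W p x) (hq : Cheap W q x) (h : Dom (fun i =>
    softMul (intLen (p.val (x i)).toInt + intLen (q.val (x i)).toInt)) W) : Cheap W (Prog.mulP p q) x :=
  .comp (.pair hp hq) h

lemma Cheap.subP (hp : Cheap W p x) (hq : Cheap W q x) (h : Dom (fun i =>
    intLen (p.val (x i)).toInt + intLen (q.val (x i)).toInt) W) : Cheap W (Prog.subP p q) x :=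
  .comp (.pair hp hq) h

lemma Cheap.loopB (m : ℕ) (hx : ∃ c, ∀ i, (x i).Bdd (c * S i)) (hl : ∀ i, LoopB m p (x i)) :
    Cheap (fun i => softMul (S i)) p x := by
  obtain ⟨c, hc⟩ := hx
  obtain ⟨k, hk⟩ := exists_costBound p m
  exact Dom.mono (fun i => ((hk _ _ (hc i) (hl i)).2.trans (Nat.mul_le_mul_left k (softMul_mul_le c
    (Nat.pos_of_ne_zero fun h => by have := (hc i).pos; rw [h] at this; omega)))))
    (((Dom.of_le fun _ => le_rfl).const_mul _).const_mul k)

lemma bdd_val (m : ℕ) (hx : ∃ c, ∀ i, (x i).Bdd (c * S i)) (hl : ∀ i, LoopB m p (x i)) :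
    ∃ c, ∀ i, (p.val (x i)).Bdd (c * S i) := by
  obtain ⟨c, hc⟩ := hx
  obtain ⟨k, hk⟩ := exists_costBound p m
  exact ⟨k * c, fun i => by rw [mul_assoc]; exact (hk _ _ (hc i) (hl i)).1⟩

lemma Cheap.loopFree (hx : ∃ c, ∀ i, (x i).Bdd (c * S i)) (hp : p.LoopFree = true := by rfl) :
    Cheap (fun i => softMul (S i)) p x := Cheap.loopB 0 hx fun _ => LoopFree.loopB hp 0 _

lemma Cheap.congr {y : ι → Data} (h : ∀ i, x i = y i) (hy : Cheap W p y) : Cheap W p x :=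
  (funext h : x = y) ▸ hy

lemma Cheap.loop_sum {K : ι → ℕ → ℕ} (hx : ∀ i, (x i).left = .int (c i))
    (h : Cheap (fun j : {j : ι × ℕ // j.2 < c j.1} => K j.1.1 j.1.2) p
      fun j => p.val^[j.1.2] (x j.1.1).right)
    (hW : Dom (fun i => ∑ j ∈ Finset.range (c i), (K i j + 1)) W) : Cheap W (Prog.loop p) x := by
  obtain ⟨a, ha⟩ := h
  refine Dom.mono (fun i => ?_) ((hW.const_mul (a + 2)).add (.const 1))
  have h1 : ∑ j ∈ Finset.range (c i), (p.cost (p.val^[j] (x i).right) + 1) ≤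
      ∑ j ∈ Finset.range (c i), (a * (K i j + 1) + 1) :=
    sum_le_sum fun j hj => succ_le_succ (ha ⟨(i, j), mem_range.1 hj⟩)
  have h2 := intLen_natCast_le (c i)
  have h3 : c i ≤ ∑ j ∈ Finset.range (c i), (K i j + 1) := by
    simpa using sum_le_sum fun j (_ : j ∈ Finset.range (c i)) => Nat.le_add_left 1 (K i j)
  rw [sum_add_distrib (f := fun j => a * _), ← mul_sum, sum_const,
    card_range, smul_eq_mul, mul_one] at h1
  rw [cost_loop, hx, Data.toInt_int, Int.toNat_natCast, add_mul]
  omega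

lemma Cheap.loop (hx : ∀ i, (x i).left = .int (c i))
    (h : Cheap (fun j : {j : ι × ℕ // j.2 < c j.1} => K j.1.1) p
      fun j => p.val^[j.1.2] (x j.1.1).right) (hW : Dom (fun i => c i * (K i + 1)) W) :
    Cheap W (Prog.loop p) x :=
  .loop_sum (K := fun i _ => K i) hx h (by simpa using hW)

lemma Cheap.loop_plain (hx : ∀ i, (x i).left = .int (c i)) (hW : Dom c W)
    (hp : p.Plain = true := by rfl) : Cheap W (Prog.loop p) x :=
  .loop (K := fun _ => 1) hx (.plain hp) ((hW.const_mul 2).mono fun i => by omega)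

lemma Cheap.revE {cnt lst : Prog} (h1 : ∀ i, cnt.val (x i) = .int (c i)) (h2 : Cheap W cnt x)
    (h3 : Cheap W lst x) (hW : Dom c W) : Cheap W (Prog.revE cnt lst) x :=
  .comp (.pair h2 (.pair h3 .plain)) (.comp (.loop_plain h1 hW) .plain)

lemma Cheap.foldE {α : Type*} {f : α → Data} {l : ι → List α} {cnt lst init step : Prog}
    (h1 : ∀ i, cnt.val (x i) = .int (c i)) (h2 : ∀ i, lst.val (x i) = encList ((l i).map f))
    (h3 : Cheap W cnt x) (h4 : Cheap W lst x) (h5 : Cheap W init x) (h6 : Dom c W)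
    (h7 : Cheap (fun j : Split l => K j.i) step
      fun j => f j.y & foldState step (j.l1.map f) (init.val (x j.i)))
    (h8 : Dom (fun i => (l i).length * (K i + 1)) W) : Cheap W (Prog.foldE cnt lst init step) x := by
  refine Dom.mono (fun i => cost_foldE cnt lst init step (h1 i) (h2 i))
    ((((Dom.add h3 h4).add h5).add ((h6.add (.const 1)).const_mul 28)).add ?_)
  obtain ⟨a, ha⟩ := h7
  exact (h8.const_mul a).mono fun i => (foldCost_map_le f fun l1 y l2 hl =>
    ha ⟨i, l1, y, l2, hl⟩).trans (by rw [mul_left_comm])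

end

/-! ### Costs of splitting -/

lemma cheap_splitPassP {S pw : ι → ℕ} {y h : ι → ℤ} {l : ι → List ℤ}
    (hy : ∀ i, intLen (y i) ≤ S i) (hh : ∀ i, intLen (h i) ≤ S i)
    (hl : ∀ i, ∀ x ∈ l i, intLen x ≤ S i) (hpw : ∀ i, 2 * (l i).length ≤ pw i) :
    Cheap (fun i => pw i + (l i).length * softMul (S i)) splitPassP
      fun i => .int (pw i) & (.int (y i) & .int (h i)) & encInts (l i) := by
  have hw : Dom pw fun i => pw i + (l i).length * softMul (S i) := .of_le fun i => by omega
  refine .revE (c := pw) (fun _ => rfl) .plain (.comp (.foldE (f := Data.int)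
    (K := fun i => softMul (S i)) (fun _ => rfl) (fun _ => rfl) .plain .plain .plain hw ?_
      (.of_le fun i => ?_)) .plain) hw
  · refine .congr (fun j => congrArg _ (foldState_splitStep (y j.i) (h j.i) j.l1 []))
      (.loopFree ⟨3, fun j => ?_⟩)
    have h1 := hy j.i
    have h2 := hh j.i
    have h3 := hl j.i j.y j.mem
    have h4 := intLen_pos (y j.i)
    refine ⟨show intLen j.y ≤ _ by omega, ⟨show intLen _ ≤ _ by omega, show intLen _ ≤ _ by omega⟩,
      (bdd_encInts (by omega)).2 fun x hx => ?_⟩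
    simp only [append_nil, List.mem_reverse, splitPass, List.mem_flatMap, mem_cons,
      List.not_mem_nil, or_false] at hx
    obtain ⟨z, hz, rfl | rfl⟩ := hx <;> have h5 := hl j.i z (by simp [j.eq, hz]) <;>
      have h6 := intLen_add_le z (h j.i)
    · have := intLen_sub_le ((z + h j.i) % y j.i) (h j.i)
      grind [intLen_mod_le]
    grind [intLen_div_le]
  · grind

lemma natAbs_splitPass_le {y : ℤ} (hy : 2 ≤ y) {K : ℕ} {l : List ℤ}
    (hl : ∀ x ∈ l, |x| ≤ y * y * K) {ε : ℤ} (hε : ε = 0 ∨ ε = 1) :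
    ∀ x ∈ splitPass y (ε * y / 2) l, |x| ≤ y * (K + 1 : ℕ) := by
  intro x hx
  obtain ⟨z, hz, hx⟩ := List.mem_flatMap.1 hx
  have hz' := abs_le.1 (hl z hz)
  have hh : 0 ≤ ε * y / 2 ∧ ε * y / 2 ≤ y := by
    rcases hε with rfl | rfl <;> simp <;> omega
  have hK : (0 : ℤ) ≤ y * K := by positivity
  rw [abs_le]
  push_cast
  simp only [mem_cons, List.not_mem_nil, or_false] at hx
  rcases hx with rfl | rfl
  · have h1 := Int.emod_nonneg (z + ε * y / 2) (show y ≠ 0 by omega)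
    have h2 := Int.emod_lt_of_pos (z + ε * y / 2) (show 0 < y by omega)
    constructor <;> nlinarith
  · constructor
    · rw [Int.le_ediv_iff_mul_le (by omega)]; nlinarith
    · refine Int.le_of_lt_add_one ((Int.ediv_lt_iff_lt_mul (by omega)).2 ?_)
      nlinarith

lemma abs_splitAll_le {K m : ℕ} {y ε X : ℤ} (hy : 2 ≤ y) (hε : ε = 0 ∨ ε = 1)
    (hX : |X| ≤ y ^ 2 ^ m * K) : ∀ x ∈ splitAll ε (squares y m) [X], |x| ≤ y * (K + m : ℕ) := by
  induction m generalizing y with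
  | zero => simpa [squares, splitAll] using hX
  | succ m ih =>
    rw [show splitAll ε (squares y (m + 1)) [X] = splitPass y (ε * y / 2)
      (splitAll ε (squares (y * y) m) [X]) by simp [splitAll, squares]]
    exact natAbs_splitPass_le hy (ih (y := y * y) (by nlinarith)
      (by rwa [← pow_two, ← pow_mul, ← pow_succ'])) hε

lemma squares_add (y : ℤ) (a b : ℕ) :
    squares y (a + b) = squares (y ^ 2 ^ b) a ++ squares y b := by
  induction b generalizing y with
  | zero => simp [squares]
  | succ b ih =>
    simp [add_assoc, squares, ih, List.append_assoc, pow_two, pow_mul, pow_succ']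

lemma squares_split {y z : ℤ} {m : ℕ} {l1 l2 : List ℤ} (h : squares y m = l1 ++ z :: l2) :
    m = l1.length + (l2.length + 1) ∧ l1 = squares (y ^ 2 ^ (l2.length + 1)) l1.length ∧
      z = y ^ 2 ^ l2.length := by
  grind [length_squares, length_append, length_cons, squares_add, squares, List.nil_append, List.cons_append, List.cons.injEq, List.append_inj]

lemma intLen_pow_le {y : ℤ} {b : ℕ} (h0 : 0 ≤ y) (hy : y < 2 ^ b) (k : ℕ) :
    intLen (y ^ 2 ^ k) ≤ 2 ^ k * b + 1 := by
  refine intLen_le_of_lt_two_pow ?_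
  rw [abs_of_nonneg (pow_nonneg h0 _), mul_comm, pow_mul]
  exact pow_lt_pow_left₀ hy h0 (by positivity)

lemma bdd_squares {y : ℤ} {b : ℕ} (h0 : 0 ≤ y) (hy : y < 2 ^ b) (m : ℕ) :
    ∀ x ∈ squares y m, intLen x ≤ 2 ^ m * b + 1 := fun x hx => by
  obtain ⟨l1, l2, h⟩ := List.append_of_mem hx
  obtain ⟨hm, -, rfl⟩ := squares_split h
  exact (intLen_pow_le h0 hy _).trans (by gcongr; exacts [by norm_num, by omega])

lemma cheap_squaresP {b m : ι → ℕ} {y : ι → ℤ} (h0 : ∀ i, 0 ≤ y i) (hy : ∀ i, y i < 2 ^ b i) :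
    Cheap (fun i => m i * (softMul (2 * (2 ^ m i * b i + 1)) + 1)) squaresP
      fun i => .int (m i) & .int (y i) := by
  refine .comp .plain (.comp (.loop (c := m) (K := fun i => softMul (2 * (2 ^ m i * b i + 1)))
    (fun _ => rfl) (.congr (fun j => iterate_squares j.1.2 (y j.1.1) []) (.pair (.mulP .plain .plain
      (.of_le fun j => softMul_mono ?_)) .plain)) (.of_le fun _ => le_rfl)) .plain)
  show intLen (y j.1.1 ^ 2 ^ j.1.2) + intLen (y j.1.1 ^ 2 ^ j.1.2) ≤ _
  have h1 := intLen_pow_le (h0 j.1.1) (hy j.1.1) j.1.2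
  have h2 : 2 ^ j.1.2 * b j.1.1 ≤ 2 ^ m j.1.1 * b j.1.1 :=
    Nat.mul_le_mul_right _ (pow_le_pow_right (by norm_num) j.2.le)
  omega

lemma cheap_splitAllP {κ K m b : ι → ℕ} {y ε X : ι → ℤ} (hy : ∀ i, 2 ≤ y i)
    (hb : ∀ i, y i < 2 ^ b i) (hε : ∀ i, ε i = 0 ∨ ε i = 1)
    (hX : ∀ i, |X i| ≤ y i ^ 2 ^ m i * K i) (hκ : ∀ i, K i + m i < 2 ^ κ i) :
    Cheap (fun i => (m i + 1) * softMul (2 ^ m i * (b i + κ i + 4))) splitAllP fun i =>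
      .int (m i) & .int (2 ^ m i : ℕ) & .int (ε i) & encInts (squares (y i) (m i)) &
        .int (X i) & .int 0 := by
  have hR : ∀ i, 2 ^ m i ≤ softMul (2 ^ m i * (b i + κ i + 4)) := fun i =>
    (le_mul_of_pos_right _ (by omega)).trans (le_softMul (Nat.mul_pos (two_pow_pos _) (by omega)))
  have h1 : ∀ i, 1 ≤ softMul (2 ^ m i * (b i + κ i + 4)) := fun i => one_le_two_pow.trans (hR i)
  refine .comp (.foldE (c := m) (f := Data.int) (K := fun i => softMul (2 ^ m i * (b i + κ i + 4)))
    (fun _ => rfl) (fun _ => rfl) .plain .plain .plain (.of_le fun i => ?_) ?_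
      ((Dom.const_mul 2 (.of_le fun i => le_rfl)).mono fun i => ?_)) .plain
  · have := le_mul_of_pos_right (m i + 1) (h1 i); omega
  · let J := Split fun i => squares (y i) (m i)
    have hs : ∀ j : J, _ := fun j => squares_split j.eq
    have h2 : ∀ j : J,
        (splitAll (ε j.i) j.l1 [X j.i]).length = 2 ^ j.l1.length := fun j => by
      rw [length_splitAll, List.length_singleton, mul_one]
    have hp : ∀ j : J, 2 ^ m j.i =
        2 ^ j.l1.length * (2 * 2 ^ j.l2.length) := fun j => by
      rw [(hs j).1, pow_add, pow_succ']
    have hS : ∀ j : J, 2 ^ j.l1.length *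
        (2 ^ (j.l2.length + 1) * b j.i + κ j.i + 4) ≤ 2 ^ m j.i * (b j.i + κ j.i + 4) := fun j => by
      rw [hp, pow_succ', mul_assoc (2 ^ _), add_assoc, add_assoc, mul_add _ (b j.i)]
      gcongr
      exact le_mul_of_pos_left _ (by positivity)
    have hy' : ∀ j : J,
        intLen j.y + 3 ≤ 2 ^ (j.l2.length + 1) * b j.i + κ j.i + 4 := fun j => by
      have := intLen_pow_le (by linarith [hy j.i]) (hb j.i) j.l2.length
      rw [(hs j).2.2, pow_succ', mul_assoc]
      omega
    have hε' : ∀ j : J, intLen (ε j.i) ≤ 2 ∧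
        intLen (ε j.i * j.y) ≤ intLen j.y := fun j => by
      rcases hε j.i with h | h <;> rw [h]
      · exact ⟨by decide, by simpa using intLen_pos j.y⟩
      · exact ⟨by decide, by rw [one_mul]⟩
    have hx : ∀ j : J, ∀ x ∈ splitAll (ε j.i) j.l1 [X j.i],
        intLen x ≤ 2 ^ (j.l2.length + 1) * b j.i + κ j.i + 4 := fun j x hx => by
      have hy2 : 2 ≤ y j.i ^ 2 ^ (j.l2.length + 1) :=
        (hy j.i).trans (le_self_pow₀ (by linarith [hy j.i]) (by positivity))
      rw [(hs j).2.1] at hx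
      refine ((intLen_le_of_abs_le (abs_splitAll_le (K := K j.i) hy2 (hε j.i) ?_ x hx)
        (k := 2 ^ (j.l2.length + 1) * b j.i + κ j.i) ?_ :) |>.trans (by omega))
      · rw [← pow_mul, ← pow_add, add_comm, ← (hs j).1]; exact hX j.i
      · rw [pow_add (2 : ℤ) (_ * b j.i), mul_comm (2 ^ _) (b j.i), pow_mul]
        have := (hs j).1
        have h5 : y j.i ^ 2 ^ (j.l2.length + 1) < (2 ^ b j.i) ^ 2 ^ (j.l2.length + 1) :=
          pow_lt_pow_left₀ (hb j.i) (by linarith [hy j.i]) (by positivity)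
        have h6 : ((K j.i + j.l1.length : ℕ) : ℤ) < 2 ^ κ j.i := by
          have := hκ j.i
          exact_mod_cast (by omega : K j.i + j.l1.length < 2 ^ κ j.i)
        exact mul_lt_mul'' h5 h6 (by linarith) (by positivity)
    have hS' : ∀ j : J, intLen j.y + 3 ≤
        2 ^ m j.i * (b j.i + κ j.i + 4) := fun j =>
      (hy' j).trans ((le_mul_of_pos_left _ (by positivity)).trans (hS j))
    refine .congr (fun j => congrArg _ (foldState_splitAllStep (pw := 2 ^ m j.i) j.l1 [X j.i] ?_))
      (.pair .plain (.pair .plain (.comp (.pair .plain (.pair (.pair .plain (.mulP (.mulP .plain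
        .plain (.of_le fun j => softMul_mono ?_)) .plain (.of_le fun j => softMul_mono ?_))) .plain))
        (Dom.trans (cheap_splitPassP (S := fun j => 2 ^ (j.l2.length + 1) * b j.i + κ j.i + 4)
          (fun j => Nat.le_of_add_right_le (hy' j))
          (fun j => (intLen_div_le _ _).trans ((hε' j).2.trans (Nat.le_of_add_right_le (hy' j)))) hx fun j => ?_)
          (Dom.mono (fun j => ?_) ((Dom.of_le fun j => le_rfl).const_mul 2))))))
    · rw [List.length_singleton, mul_one]
      exact pow_le_pow_right (by norm_num) (by have := (hs j).1; omega)
    · show intLen (ε j.i) + intLen j.y ≤ _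
      have := (hε' j).1; have := hS' j; omega
    · show intLen (ε j.i * j.y) + intLen 2 ≤ _
      have := (hε' j).2; have := hS' j; rw [intLen_two]; omega
    · rw [h2, hp, mul_left_comm]
      exact Nat.mul_le_mul_left _ (le_mul_of_pos_right _ (by positivity))
    · have := hR j.i
      have := mul_softMul_le (hS j)
      show 2 ^ m j.i + _ ≤ _
      rw [h2]; omega
  · have := h1 i
    rw [length_squares]; nlinarith

/-! ### Costs of evaluation -/

lemma intLen_pair_le {a b y : ℤ} {e s : ℕ} (ha : intLen a ≤ e) (hb : intLen b ≤ e)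
    (hy : intLen y ≤ s) : intLen (a + y * b) ≤ e + s + 1 := by
  grind [intLen_add_le, intLen_mul_le]

lemma intLen_pairUp_le {y : ℤ} {e s : ℕ} (hy : intLen y ≤ s) : ∀ (l : List ℤ), Even l.length →
    (∀ x ∈ l, intLen x ≤ e) → ∀ x ∈ pairUp y l, intLen x ≤ e + s + 1
  | [], _, _ => by simp [pairUp]
  | [_], h, _ => by simp at h
  | a :: b :: l, h, hl => fun x hx => by
    rw [pairUp, mem_cons] at hx
    rcases hx with rfl | hx
    · exact intLen_pair_le (hl a (by simp)) (hl b (by simp)) hy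
    · exact intLen_pairUp_le hy l (by simpa [Nat.even_add_one] using h)
        (fun x hx => hl x (by simp [hx])) x hx

lemma bdd_foldState_pairUpStep {y : ℤ} {e s : ℕ} {l : List ℤ} (hy : intLen y ≤ s)
    (hl : ∀ x ∈ l, intLen x ≤ e) :
    (foldState pairUpStep (l.map .int) (.int y & .int 0 & .int 0)).Bdd (e + s + 1) := by
  have h0 : ∀ l : List ℤ, Even l.length → (∀ x ∈ l, intLen x ≤ e) →
      (encInts ((pairUp y l).reverse ++ [])).Bdd (e + s + 1) := fun l h hl =>
    (bdd_encInts (by omega)).2 fun x hx => intLen_pairUp_le hy l h hl x (by simpa using hx)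
  have hy' : intLen y ≤ e + s + 1 := by omega
  have hz : intLen 0 ≤ e + s + 1 := show 1 ≤ _ by omega
  rcases Nat.even_or_odd l.length with h | h
  · rw [show Data.int 0 & Data.int 0 = .int 0 & encInts [] from rfl, foldState_pairUpStep y l [] h]
    exact ⟨hy', hz, h0 l h hl⟩
  · rcases l.eq_nil_or_concat with rfl | ⟨l, a, rfl⟩
    · simp at h
    rw [List.concat_eq_append] at h hl ⊢
    have he : Even l.length := by simpa [Nat.odd_add_one] using h
    rw [map_append, foldState_append,
      show Data.int 0 & Data.int 0 = .int 0 & encInts [] from rfl, foldState_pairUpStep y l [] he]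
    have ha : intLen a ≤ e + s + 1 := (hl a (by simp)).trans (by omega)
    exact ⟨hy', ⟨ha, hz⟩, h0 l he fun x hx => hl x (by simp [hx])⟩

lemma cheap_pairUpP {s e pw : ι → ℕ} {y : ι → ℤ} {l : ι → List ℤ} (hy : ∀ i, intLen (y i) ≤ s i)
    (hl : ∀ i, ∀ x ∈ l i, intLen x ≤ e i) (hpw : ∀ i, (l i).length ≤ pw i) :
    Cheap (fun i => pw i + (l i).length * softMul (e i + s i + 1)) pairUpP
      fun i => .int (y i) & .int (pw i) & encInts (l i) := by
  have hw : Dom pw fun i => pw i + (l i).length * softMul (e i + s i + 1) :=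
    .of_le fun i => by omega
  refine .revE (c := pw) (fun _ => rfl) .plain (.comp (.foldE (f := Data.int)
    (K := fun i => softMul (e i + s i + 1)) (fun _ => rfl) (fun _ => rfl) .plain .plain .plain hw
      (.loopFree ⟨1, fun j => ?_⟩) (.of_le fun i => ?_)) .plain) hw
  · rw [one_mul]
    exact ⟨(hl j.i j.y j.mem).trans (by omega),
      bdd_foldState_pairUpStep (hy j.i) fun x hx => hl j.i x (by simp [j.eq, hx])⟩
  · grind

lemma pairUpAll_facts {s e : ℕ} {y : ℤ} {l : List ℤ} (j k : ℕ) (hy : intLen y ≤ s)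
    (hl : ∀ x ∈ l, intLen x ≤ e) (hk : l.length = 2 ^ j * k) :
    (pairUpAll y j l).length = k ∧ intLen (y ^ 2 ^ j) ≤ 2 ^ j * s ∧
      ∀ x ∈ pairUpAll y j l, intLen x + (s + 1) ≤ e + 2 ^ j * (s + 1) := by
  induction j generalizing y s e l with
  | zero => exact ⟨by simpa [pairUpAll] using hk, by simpa using hy, fun x hx => by have := hl x hx; omega⟩
  | succ j ih =>
    have hk' : l.length = 2 * (2 ^ j * k) := by rw [hk, pow_succ]; ring
    obtain ⟨h1, h2, h3⟩ := ih (s := 2 * s) ((intLen_mul_le y y).trans (by omega))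
      (intLen_pairUp_le hy l (by rw [hk']; simp) hl) (length_pairUp y _ l hk')
    refine ⟨h1, by rwa [pow_succ', pow_mul, pow_two, mul_comm 2, mul_assoc], fun x hx => ?_⟩
    have := h3 x hx
    have := two_pow_pos j
    rw [pow_succ]
    nlinarith

lemma intLen_polyEval_le {s e m : ℕ} {y : ℤ} {l : List ℤ} (hy : intLen y ≤ s)
    (hl : ∀ x ∈ l, intLen x ≤ e) (hm : l.length = 2 ^ m) :
    intLen (polyEval y l) ≤ 2 ^ m * (e + 2 * s + 2) := by
  have := (pairUpAll_facts m 1 hy hl (by simpa using hm)).2.2 (polyEval y l)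
    (by rw [pairUpAll_eq m y l hm]; simp)
  have := two_pow_pos m
  nlinarith

lemma cheap_evalP {s e m S : ι → ℕ} {y : ι → ℤ} {l : ι → List ℤ} (hy : ∀ i, intLen (y i) ≤ s i)
    (hl : ∀ i, ∀ x ∈ l i, intLen x ≤ e i) (hm : ∀ i, (l i).length = 2 ^ m i)
    (hS : ∀ i, 2 ^ m i * (e i + 2 * s i + 2) ≤ S i) :
    Cheap (fun i => (m i + 1) * softMul (S i)) evalP
      fun i => .int (m i) & .int (y i) & .int (2 ^ m i : ℕ) & encInts (l i) := by
  have h2 : ∀ i, 2 ^ m i ≤ softMul (S i) := fun i => by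
    grind [le_mul_of_pos_right, two_pow_pos, le_softMul]
  refine .comp (.loop (c := m) (K := fun i => softMul (S i)) (fun _ => rfl) ?_
    ((Dom.const_mul 2 (.of_le fun i => le_rfl)).mono fun i => ?_)) .plain
  · let J := {j : ι × ℕ // j.2 < m j.1}
    have hf : ∀ j : J, _ := fun j =>
      pairUpAll_facts j.1.2 (2 ^ (m j.1.1 - j.1.2)) (hy j.1.1) (hl j.1.1)
        (by rw [hm, ← pow_add]; congr 1; have := j.2; omega)
    have hb : ∀ j : J, 2 ^ (m j.1.1 - j.1.2) *
        (e j.1.1 + 2 ^ j.1.2 * (2 * s j.1.1 + 2)) ≤ S j.1.1 := fun j => by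
      refine le_trans ?_ (hS j.1.1)
      have : 2 ^ m j.1.1 = 2 ^ (m j.1.1 - j.1.2) * 2 ^ j.1.2 := by
        rw [← pow_add]; congr 1; have := j.2; omega
      have := le_mul_of_pos_left (e j.1.1) (two_pow_pos j.1.2)
      rw [‹2 ^ m j.1.1 = _›, mul_assoc, add_assoc, mul_add (2 ^ j.1.2) (e _)]
      exact Nat.mul_le_mul_left _ (by omega)
    refine .congr (fun j => iterate_evalBody j.1.2 (2 ^ (m j.1.1 - j.1.2)) _ _
      (by rw [hm, ← pow_add]; congr 1; have := j.2; omega) (hm j.1.1).le)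
      (.pair (.mulP .plain .plain (.of_le fun j => softMul_mono ?_)) (.pair .plain (Dom.trans
        (cheap_pairUpP (s := fun j => 2 ^ j.1.2 * s j.1.1)
          (e := fun j => e j.1.1 + 2 ^ j.1.2 * (s j.1.1 + 1)) (fun j => (hf j).2.1)
            (fun j x hx => ?_) fun j => ?_) (Dom.mono (fun j => ?_)
              ((Dom.of_le fun j => le_rfl).const_mul 2)))))
    · refine le_trans ?_ (hb j)
      have := (hf j).2.1
      refine le_trans ?_ (le_mul_of_pos_left _ (two_pow_pos _))
      show intLen (y j.1.1 ^ 2 ^ j.1.2) + intLen (y j.1.1 ^ 2 ^ j.1.2) ≤ _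
      nlinarith [two_pow_pos j.1.2]
    · have := (hf j).2.2 x hx; omega
    · rw [(hf j).1]; exact pow_le_pow_right (by norm_num) (by omega)
    · have := h2 j.1.1
      have h3 := mul_softMul_le (hb j)
      have : softMul (e j.1.1 + 2 ^ j.1.2 * (s j.1.1 + 1) + 2 ^ j.1.2 * s j.1.1 + 1) ≤
        softMul (e j.1.1 + 2 ^ j.1.2 * (2 * s j.1.1 + 2)) := softMul_mono (by
          have := two_pow_pos j.1.2; nlinarith)
      rw [(hf j).1]
      have := (Nat.mul_le_mul_left (2 ^ (m j.1.1 - j.1.2)) this).trans h3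
      omega
  · have := h2 i
    have := two_pow_pos (m i)
    nlinarith

/-! ### Costs of the check and of the output -/

lemma cheap_checkStep {s e m S L : ι → ℕ} {a b : ι → List ℤ} {v : ι → ℚ × ℚ} {fl y : ι → ℤ}
    (hv : ∀ i, (encGauss (v i)).Bdd (S i)) (hy : ∀ i, intLen (y i) ≤ s i)
    (hL : ∀ i, intLen (L i) ≤ S i) (ha : ∀ i, ∀ x ∈ a i, intLen x ≤ e i)
    (hb : ∀ i, ∀ x ∈ b i, intLen x ≤ e i) (ham : ∀ i, (a i).length = 2 ^ m i)
    (hbm : ∀ i, (b i).length = 2 ^ m i) (hS : ∀ i, 2 ^ m i * (e i + 2 * s i + 2) ≤ S i) :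
    Cheap (fun i => (m i + 1) * softMul (S i)) checkStep fun i => encGauss (v i) & .int (fl i) &
      .int (y i) & .int (m i) & .int (2 ^ m i : ℕ) & .int (L i) & encInts (a i) & encInts (b i) := by
  have h1 : ∀ i, 1 ≤ S i := fun i => (hv i).pos
  have hm : ∀ {f : ι → ℕ}, (∀ i, f i ≤ 3 * S i) →
      Dom (fun i => softMul (f i)) fun i => (m i + 1) * softMul (S i) := fun h =>
    Dom.trans (.softMul (Dom.mono h ((Dom.of_le fun _ => le_rfl).const_mul 3)) h1)
      (.of_le fun i => le_mul_of_pos_left _ (succ_pos _))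
  have key : ∀ {p num den : Prog} {l : ι → List ℤ} {n d : ι → ℤ} {x : ι → Data},
      p.Plain = true → num.Plain = true → den.Plain = true → (∀ i, (var 3 △ var 2 △ var 4 △ p).val
        (x i) = .int (m i) & .int (y i) & .int (2 ^ m i : ℕ) & encInts (l i)) →
      (∀ i, ∀ x ∈ l i, intLen x ≤ e i) → (∀ i, (l i).length = 2 ^ m i) →
      (∀ i, (num.val (x i)).toInt = n i ∧ intLen (n i) ≤ S i) →
      (∀ i, (den.val (x i)).toInt = d i ∧ intLen (d i) ≤ S i) →
      (∀ i, ((var 5).val (x i)).toInt = L i) → Cheap (fun i => (m i + 1) * softMul (S i))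
        (subP (mulP (checkEval p) den) (mulP (var 5) num)) x := by
    intro p num den l n d x hp hnum hden hx hl hlm hn hd hL'
    have e1 : ∀ i, (checkEval p).val (x i) = .int (polyEval (y i) (l i)) := fun i => by
      rw [checkEval, val_comp, hx, val_evalP (hlm i) (hlm i).le]
    have e2 := fun i => (intLen_polyEval_le (hy i) (hl i) (hlm i)).trans (hS i)
    refine .subP (.mulP (.comp (.pair .plain (.pair .plain (.pair .plain (.plain hp))))
      (.congr hx (cheap_evalP hy hl hlm hS))) (.plain hden) (hm fun i => ?_))
      (.mulP .plain (.plain hnum) (hm fun i => ?_)) (Dom.mono (fun i => ?_)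
        ((hm (f := fun i => S i) fun i => by omega).const_mul 4))
    · rw [e1, (hd i).1, Data.toInt_int]; have := e2 i; have := (hd i).2; omega
    · rw [hL', (hn i).1]; have := hL i; have := (hn i).2; omega
    · have h3 := intLen_mul_le (polyEval (y i) (l i)) (d i)
      have h4 := intLen_mul_le (L i) (n i)
      have := e2 i; have := hL i; have := (hd i).2; have := (hn i).2
      have := le_softMul (h1 i)
      rw [val_mulP, val_mulP, e1, hL', (hn i).1, (hd i).1]
      simp only [Data.toInt_int]; omega
  refine .pair (.ite (key rfl rfl rfl (fun _ => rfl) ha ham (fun i => ⟨rfl, (hv i).1.1⟩)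
    (fun i => ⟨rfl, (hv i).1.2⟩) fun _ => rfl) .plain (.ite (key rfl rfl rfl (fun _ => rfl) hb hbm
      (fun i => ⟨rfl, (hv i).2.1⟩) (fun i => ⟨rfl, (hv i).2.2⟩) fun _ => rfl) .plain .plain))
    (.pair (.mulP .plain .plain (hm fun i => ?_)) .plain)
  show intLen 2 + intLen (y i) ≤ _
  have := hS i
  have := h1 i
  have := hy i
  have := le_mul_of_pos_left (e i + 2 * s i + 2) (two_pow_pos (m i))
  rw [intLen_two]; omega

lemma val_redP_of_le {N D : ℤ} (hD : D ≠ 0) {c : ℕ} (h : ((N : ℚ) / D).den ≤ c) :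
    redP.val (.int c & .int N & .int D) = .int 1 & .int ((N : ℚ) / D).den & .int N & .int D := by
  rw [val_redP hD, if_neg (by omega)]

lemma cheap_redP {S c : ι → ℕ} {N D : ι → ℤ} (hD : ∀ i, D i ≠ 0) (hN : ∀ i, intLen (N i) ≤ S i)
    (hDS : ∀ i, intLen (D i) ≤ S i) (hd : ∀ i, intLen (((N i : ℚ) / D i).den : ℤ) ≤ S i) :
    Cheap (fun i => c i + ((N i : ℚ) / D i).den * softMul (S i)) redP
      fun i => .int (c i) & .int (N i) & .int (D i) := by
  refine .comp .plain (.loop_sum (c := c)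
    (K := fun i j => if j < ((N i : ℚ) / D i).den then softMul (S i) else 0) (fun _ => rfl) ?_
      (.of_le fun i => ?_))
  · obtain ⟨k, hk⟩ := exists_cost_le_of_loopFree (P := redBody) rfl
    refine ⟨k + 10, fun ⟨(i, j), _⟩ => ?_⟩
    show redBody.cost (redBody.val^[j] (.int 0 & .int 1 & .int (N i) & .int (D i))) ≤
      (k + 10) * ((if j < ((N i : ℚ) / D i).den then softMul (S i) else 0) + 1)
    rw [iterate_redBody (hD i)]
    split
    · refine (hk (S i) _ ?_).trans (Nat.mul_le_mul (by omega) (by omega))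
      exact ⟨(intLen_pos (N i)).trans (hN i), (intLen_le_of_natAbs_le (by simp; omega)).trans (hd i),
        hN i, hDS i⟩
    · rw [redBody, cost_ite, if_pos (by simp)]
      show 3 ≤ _
      omega
  · rw [sum_add_distrib, ← sum_filter, sum_const, sum_const, add_comm]
    simp only [smul_eq_mul, card_range, mul_one]
    gcongr
    exact (card_le_card (t := Finset.range _) fun j hj => by simp at hj ⊢; omega).trans
      (card_range _).le

lemma cheap_redOut {S : ι → ℕ} {N D : ι → ℤ} (hN : ∀ i, intLen (N i) ≤ S i)
    (hDS : ∀ i, intLen (D i) ≤ S i) (hd : ∀ i, intLen (((N i : ℚ) / D i).den : ℤ) ≤ S i)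
    (h2 : ∀ i, 2 ≤ S i) : Cheap (fun i => softMul (S i)) redOut
      fun i => .int 1 & .int ((N i : ℚ) / D i).den & .int (N i) & .int (D i) :=
  .loopFree ⟨1, fun i => by rw [one_mul]; exact ⟨h2 i, hd i, hN i, hDS i⟩⟩

lemma cheap_outStep {S L n : ι → ℕ} {z : ι → ℤ × ℤ} {acc : ι → Data} (hL : ∀ i, 0 < L i)
    (h1 : ∀ i, intLen (z i).1 ≤ S i) (h2 : ∀ i, intLen (z i).2 ≤ S i)
    (hLS : ∀ i, intLen (L i) ≤ S i) (hn : ∀ i, intLen (n i) ≤ S i) (hS : ∀ i, 2 ≤ S i) :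
    Cheap (fun i => (L i + 1) * softMul (S i)) outStep
      fun i => encPair (z i) & .int (n i) & .int (L i) & acc i := by
  have hW : ∀ i, S i ≤ softMul (S i) ∧ softMul (S i) ≤ (L i + 1) * softMul (S i) ∧
      L i ≤ L i * softMul (S i) := fun i => by
    have := hS i
    have h := le_softMul (show 1 ≤ S i by omega)
    exact ⟨h, le_mul_of_pos_left _ (by omega), le_mul_of_pos_right _ (by omega)⟩
  have hs : Cheap (fun i => (L i + 1) * softMul (S i)) (subP (var 1) (const 1))
      fun i => encPair (z i) & .int (n i) & .int (L i) & acc i :=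
    .subP .plain .plain (Dom.mono (fun i => by
      show intLen (n i) + intLen 1 ≤ 2 * ((L i + 1) * softMul (S i))
      have := hn i; have := hS i; have := hW i; rw [intLen_one]; omega)
      ((Dom.of_le fun _ => le_rfl).const_mul 2))
  have hr : ∀ {p : Prog} {N : ι → ℤ}, p.Plain = true →
      (∀ i, p.val (encPair (z i) & .int (n i) & .int (L i) & acc i) = .int (N i)) →
      (∀ i, intLen (N i) ≤ S i) → Cheap (fun i => (L i + 1) * softMul (S i)) (ratP p)
      fun i => encPair (z i) & .int (n i) & .int (L i) & acc i := fun {p N} hp hN hNS => by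
    have hL' : ∀ i, (L i : ℤ) ≠ 0 := fun i => by have := hL i; omega
    have hden : ∀ i, ((N i : ℚ) / (L i : ℤ)).den ≤ L i := fun i => by
      simpa using den_div_le (N := N i) (hL' i)
    have hdS : ∀ i, intLen (((N i : ℚ) / (L i : ℤ)).den : ℤ) ≤ S i := fun i =>
      (intLen_le_of_natAbs_le (by simpa using hden i)).trans (hLS i)
    have hx : ∀ i, (var 2 △ p △ var 2).val (encPair (z i) & .int (n i) & .int (L i) & acc i) =
        .int (L i) & .int (N i) & .int (L i) := fun i => by rw [val_pair, val_pair, hN]; rfl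
    refine .comp (.comp (.pair .plain (.pair (.plain hp) .plain)) (.congr hx (Dom.trans
      (cheap_redP hL' hNS hLS hdS) (Dom.mono (fun i => ?_)
        ((Dom.of_le fun _ => le_rfl).const_mul 2))))) (.congr (fun i => ?_) (Dom.trans
          (cheap_redOut hNS hLS hdS hS) (.of_le fun i => (hW i).2.1)))
    · have := Nat.mul_le_mul_right (softMul (S i)) (hden i)
      have := hW i
      rw [add_mul] at this ⊢; omega
    · rw [val_comp, hx, val_redP_of_le (hL' i) (hden i)]
  have ho : Cheap (fun i => (L i + 1) * softMul (S i)) outPush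
      fun i => encPair (z i) & .int (n i) & .int (L i) & acc i :=
    .pair hs (.pair .plain (.pair (.pair hs (.pair (hr rfl (fun _ => rfl) h1)
      (hr rfl (fun _ => rfl) h2))) .plain))
  exact .ite .plain ho (.ite .plain ho (.pair hs .plain))

end Prog

/-- Bounds for the sizes of the numbers that occur in the first part of the program. -/
structure Sized where
  (U κ K m T G : ℕ)
  vs : List (ℚ × ℚ)
  pos : 1 ≤ T
  len : vs.length = 2 * T
  bdd : ∀ v ∈ vs, (encGauss v).Bdd U
  intLen_le : intLen G ≤ U
  le : (m + 1) * (2 ^ m * (2 * T + κ + 5)) ≤ U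
  re : |scaled (multiplier T) (lastData T vs).left| ≤ (2 ^ (2 * T - 1)) ^ 2 ^ m * K
  im : |scaled (multiplier T) (lastData T vs).right| ≤ (2 ^ (2 * T - 1)) ^ 2 ^ m * K
  lt : K + m < 2 ^ κ

namespace Sized

variable (h : Sized)

lemma two_pow_mul_le : 2 ^ h.m * (2 * h.T + h.κ + 5) ≤ h.U :=
  (le_mul_of_pos_left _ (succ_pos h.m)).trans h.le

lemma add_le : 2 * h.T + h.κ + 5 ≤ h.U :=
  (le_mul_of_pos_left _ (two_pow_pos h.m)).trans h.two_pow_mul_le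

lemma one_le : 1 ≤ h.U := by have := h.add_le; omega

lemma two_pow_le : 2 ^ h.m * 5 ≤ h.U :=
  le_trans (Nat.mul_le_mul_left _ (by omega)) h.two_pow_mul_le

lemma bdd_encEnv : (encEnv h.m h.T h.G h.vs).Bdd h.U := by
  have h1 := h.add_le
  have h2 := h.two_pow_le
  have h3 := intLen_natCast_le h.m
  have h4 := intLen_natCast_le (2 ^ h.m)
  have h5 := intLen_natCast_le h.T
  have h6 : h.m < 2 ^ h.m := lt_two_pow_self
  exact ⟨show intLen h.m ≤ h.U by omega, show intLen (2 ^ h.m : ℕ) ≤ h.U by omega,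
    show intLen h.T ≤ h.U by omega, h.intLen_le, (bdd_encList h.one_le).2 fun x hx => by
      obtain ⟨v, hv, rfl⟩ := mem_map.1 hx; exact h.bdd v hv⟩

lemma multiplier_le' : multiplier h.T ≤ h.T := (multiplier_le h.T).trans (by simp [h.pos])

lemma intLen_multiplier : intLen (multiplier h.T) ≤ h.U := by
  grind [intLen_natCast_le, h.multiplier_le', h.add_le]

lemma pow_lt : (2 : ℤ) ^ (2 * h.T - 1) < 2 ^ (2 * h.T) :=
  pow_lt_pow_right₀ (by norm_num) (by have := h.pos; omega)

lemma two_le_pow : (2 : ℤ) ≤ 2 ^ (2 * h.T - 1) :=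
  calc (2 : ℤ) = 2 ^ 1 := by norm_num
    _ ≤ _ := pow_le_pow_right₀ (by norm_num) (by have := h.pos; omega)

lemma bdd_encBases : (encBases (multiplier h.T) h.m h.T h.G h.vs).Bdd h.U := by
  have h1 := h.two_pow_mul_le
  have hp : 1 ≤ 2 ^ h.m := one_le_two_pow
  refine ⟨(bdd_encInts h.one_le).2 fun x hx => ?_, h.intLen_multiplier, h.bdd_encEnv⟩
  exact (bdd_squares (by positivity) h.pow_lt h.m x hx).trans (by nlinarith)

lemma bdd_lastData : (lastData h.T h.vs).Bdd h.U := by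
  rw [lastData_eq h.pos h.len]
  exact h.bdd _ (getElem_mem _)

/-- The part of the last value that gives the real parts, or the imaginary parts. -/
def part (h : Sized) (b : Bool) : Data :=
  if b then (lastData h.T h.vs).left else (lastData h.T h.vs).right

/-- The digits of the real parts, or of the imaginary parts. -/
def dig (h : Sized) (b : Bool) : List ℤ := digits (multiplier h.T) h.m h.T (h.part b)

lemma length_dig (b : Bool) : (h.dig b).length = 2 ^ h.m := length_digits _ _ _ _

lemma X_le (b : Bool) : |scaled (multiplier h.T) (h.part b)| ≤
    (2 ^ (2 * h.T - 1)) ^ 2 ^ h.m * h.K := by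
  cases b; exacts [h.im, h.re]

lemma intLen_dig (b : Bool) : ∀ x ∈ h.dig b, intLen x ≤ 2 * h.T + h.κ := by
  have hT := h.pos
  intro x hx
  have h2 : (2 : ℤ) ^ (2 * h.T - 1) * (h.K + h.m : ℕ) < 2 ^ (2 * h.T - 1 + h.κ) := by
    rw [pow_add]
    exact mul_lt_mul_of_pos_left (by exact_mod_cast h.lt) (by positivity)
  have := intLen_le_of_abs_le (abs_splitAll_le h.two_le_pow (.inr rfl) (h.X_le b) x hx) h2
  omega

lemma bdd_dig (b : Bool) : (encInts (h.dig b)).Bdd h.U :=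
  (bdd_encInts h.one_le).2 fun x hx => (h.intLen_dig b x hx).trans (by have := h.add_le; omega)

/-- The budget of the first part of the program. -/
def W (h : Sized) : ℕ := (h.T + 1) * ((h.m + 1) * softMul h.U)

lemma softMul_le_W : (h.m + 1) * softMul h.U ≤ h.W ∧ (h.T + 1) * softMul h.U ≤ h.W ∧
    softMul h.U ≤ h.W := by
  have h1 : softMul h.U ≤ (h.m + 1) * softMul h.U := le_mul_of_pos_left _ (by omega)
  have h2 : (h.m + 1) * softMul h.U ≤ h.W := le_mul_of_pos_left _ (by omega)
  exact ⟨h2, Nat.mul_le_mul_left _ h1, h1.trans h2⟩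

lemma dom_W : Dom W W := .of_le fun _ => le_rfl

lemma dom_softMul : Dom (fun h : Sized => softMul h.U) W :=
  Dom.of_le fun h => h.softMul_le_W.2.2

lemma dom_U : Dom (fun h : Sized => h.U) W :=
  (Dom.of_le fun h => le_softMul h.one_le).trans dom_softMul

lemma cheap_splitAllP (b : Bool) : Cheap W splitAllP fun h => .int h.m & .int (2 ^ h.m : ℕ) &
    .int 1 & encInts (squares (2 ^ (2 * h.T - 1)) h.m) &
      .int (scaled (multiplier h.T) (h.part b)) & .int 0 :=
  Dom.trans (Prog.cheap_splitAllP two_le_pow pow_lt (fun _ => .inr rfl) (fun h => h.X_le b) lt)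
    (.of_le fun h => (Nat.mul_le_mul_left _ (softMul_mono (le_trans (Nat.mul_le_mul_left _ (by
      omega)) h.two_pow_mul_le))).trans h.softMul_le_W.1)

lemma _root_.SparseInterp.Prog.Cheap.sized {p : Prog} {x : Sized → Data} (hx : ∀ h, (x h).Bdd h.U)
    (hp : p.LoopFree = true := by rfl) : Cheap W p x :=
  Dom.trans (Cheap.loopFree ⟨1, fun h => by rw [one_mul]; exact hx h⟩ hp) dom_softMul

lemma cheap_pushMult : Cheap W pushMult fun h => encEnv h.m h.T h.G h.vs := by
  refine .pair (.comp .plain (.comp .plain (.comp (.loop (c := fun h : Sized => h.T)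
    (K := fun h => softMul h.U) (fun _ => rfl) (.congr (fun j => (iterate_factBody j.1.1.T
      j.1.2).choose_spec.1) (.loopFree ⟨1, fun j => ?_⟩)) (.trans (.of_le fun h => ?_)
        (dom_W.const_mul 2))) .plain))) .plain
  · obtain ⟨-, h2, h3, -⟩ := (iterate_factBody j.1.1.T j.1.2).choose_spec
    have e1 := intLen_natCast_le j.1.1.T
    have e2 := intLen_natCast_le (iterate_factBody j.1.1.T j.1.2).choose
    have e3 := intLen_natCast_le (iterate_factBody j.1.1.T j.1.2).choose.factorial
    have := j.1.1.add_le
    have := j.1.1.pos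
    have := j.2
    rw [one_mul]
    exact ⟨show intLen j.1.1.T ≤ _ by omega, show intLen _ ≤ _ by omega,
      show intLen _ ≤ _ by omega⟩
  · have h1 := h.softMul_le_W.2.1
    have h2 := h.one_le.trans (le_softMul h.one_le)
    nlinarith

lemma val_lastIndex {x : Sized → Data} {p : Prog} (hx : ∀ h, p.val (x h) = .int h.T) (h : Sized) :
    (subP (mulP (const 2) p) (const 1)).val (x h) = .int (2 * h.T - 1 : ℕ) := by
  have := h.pos
  simp [val_subP, val_mulP, hx]; omega

lemma cheap_pushBases : Cheap W pushBases fun h =>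
    .int (multiplier h.T) & encEnv h.m h.T h.G h.vs := by
  have hb : ∀ h : Sized, (.int (multiplier h.T) & encEnv h.m h.T h.G h.vs).Bdd h.U :=
    fun h => ⟨h.intLen_multiplier, h.bdd_encEnv⟩
  have e1 := val_lastIndex (x := fun h => .int (multiplier h.T) & encEnv h.m h.T h.G h.vs)
    (p := var 3) fun _ => rfl
  have e2 : ∀ h : Sized, (var 1 △ powP (subP (mulP (const 2) (var 3)) (const 1))).val
      (.int (multiplier h.T) & encEnv h.m h.T h.G h.vs) = .int h.m & .int (2 ^ (2 * h.T - 1)) :=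
    fun h => by rw [val_pair, val_powP (e1 h), Int.toNat_natCast]; rfl
  have hm : Dom (fun h : Sized => (h.m + 1) * softMul (2 * h.U)) W :=
    Dom.trans (g := fun h => (h.m + 1) * softMul h.U) ⟨_, fun h => (Nat.mul_le_mul_left _
      (softMul_mul_le 2 h.one_le)).trans ((mul_left_comm _ _ _).le.trans
        (Nat.mul_le_mul_left _ (le_succ _)))⟩
      (.of_le fun h => h.softMul_le_W.1)
  refine .pair (.comp (.pair .plain (.comp (.pair (.sized hb) .plain) (.loop
    (c := fun h : Sized => 2 * h.T - 1) (K := fun h => h.U) e1 (.congr (fun j => iterate_double _ _)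
      (.comp .plain (.mono (fun j => ?_) (.const_mul 4 (.of_le fun j => le_rfl)))))
        (.mono (fun h => ?_) (dom_W.const_mul 4)))))
          (.congr e2 (.trans (cheap_squaresP (fun h => by positivity) pow_lt)
            (.mono (fun h => ?_) (hm.const_mul 2))))) .plain
  · show intLen (1 * 2 ^ j.1.2) + intLen (1 * 2 ^ j.1.2) ≤ 4 * j.1.1.U
    have := intLen_two_pow j.1.2
    have := j.1.1.add_le
    have := j.2
    rw [one_mul]
    omega
  · have h1 := h.softMul_le_W.2.1
    have h2 := le_softMul h.one_le
    have h3 := h.one_le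
    calc (2 * h.T - 1) * (h.U + 1) ≤ (2 * (h.T + 1)) * (2 * softMul h.U) :=
          Nat.mul_le_mul (by omega) (by omega)
      _ ≤ 4 * h.W := by linarith
  · have h1 : softMul (2 * (2 ^ h.m * (2 * h.T) + 1)) ≤ softMul (2 * h.U) := softMul_mono (by
      have := h.two_pow_mul_le
      have : 1 ≤ 2 ^ h.m := one_le_two_pow
      nlinarith)
    have h2 := le_softMul (show 1 ≤ 2 * h.U by have := h.one_le; omega)
    have := h.one_le
    nlinarith

lemma cheap_pushLast : Cheap W pushLast fun h => encBases (multiplier h.T) h.m h.T h.G h.vs :=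
  .pair (.comp (.comp (.pair (.sized bdd_encBases) .plain) (.loop_plain
    (val_lastIndex (p := var 4) fun _ => rfl) (Dom.mono (fun h => by have := h.add_le; omega) dom_U)))
      .plain) .plain

lemma cheap_pushIm : Cheap W pushIm fun h =>
    lastData h.T h.vs & encBases (multiplier h.T) h.m h.T h.G h.vs :=
  .pair (.comp (.sized fun h => ⟨h.bdd_lastData, h.bdd_encBases⟩) (cheap_splitAllP false)) .plain

lemma cheap_pushRe : Cheap W pushRe fun h => encInts (h.dig false) & lastData h.T h.vs & encBases (multiplier h.T) h.m h.T h.G h.vs :=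
  .pair (.comp (.sized fun h => ⟨h.bdd_dig false, h.bdd_lastData, h.bdd_encBases⟩)
    (cheap_splitAllP true)) .plain

/-- The digits, from the last one on. -/
def pairs (h : Sized) : List (ℤ × ℤ) := ((h.dig true).zip (h.dig false)).reverse

lemma length_pairs : h.pairs.length = 2 ^ h.m := by
  simp [pairs, length_reverse, List.length_zip, length_dig, min_self]

lemma intLen_pairs {z : ℤ × ℤ} (hz : z ∈ h.pairs) :
    intLen z.1 ≤ 2 * h.T + h.κ ∧ intLen z.2 ≤ 2 * h.T + h.κ := by
  have := List.of_mem_zip (List.mem_reverse.1 hz)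
  exact ⟨h.intLen_dig _ _ this.1, h.intLen_dig _ _ this.2⟩

/-- The environment of the check. -/
def env (h : Sized) : Data := encDigits (h.dig true) (h.dig false)
  (lastData h.T h.vs) (multiplier h.T) h.m h.T h.G h.vs

lemma dom_two_pow : Dom (fun h : Sized => 2 ^ h.m) W :=
  Dom.mono (fun h => by have := h.two_pow_le; omega) dom_U

lemma cheap_pushZip : Cheap W pushZip fun h => encInts (h.dig true) & encInts (h.dig false) & lastData h.T h.vs & encBases (multiplier h.T) h.m h.T h.G h.vs :=
  .pair (.comp (.foldE (c := fun h => 2 ^ h.m) (l := fun h => h.dig true) (f := Data.int)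
    (K := fun _ => 1) (fun _ => rfl) (fun _ => rfl) .plain .plain .plain dom_two_pow .plain
      (.mono (fun h => by rw [length_dig, mul_comm]) (dom_two_pow.const_mul 2))) .plain) .plain

lemma cheap_digitsP : Cheap W digitsP fun h => encEnv h.m h.T h.G h.vs := by
  refine .comp cheap_pushMult ?_
  simp only [val_pushMult]
  refine .comp cheap_pushBases ?_
  simp only [val_pushBases]
  refine .comp cheap_pushLast ?_
  simp only [val_pushLast]
  refine .comp cheap_pushIm ?_
  simp only [val_pushIm]
  refine .comp cheap_pushRe ?_
  simp only [val_pushRe]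
  exact cheap_pushZip

lemma val_digitsP (h : Sized) : digitsP.val (encEnv h.m h.T h.G h.vs) = h.env :=
  Prog.val_digitsP _ _ _ _

lemma dom_pairs : Dom (fun h : Sized => h.pairs.length *
    (softMul (2 * h.T + h.κ + h.m + 4) + 1)) fun h => softMul h.U := by
  refine .mono (fun h => ?_) (Dom.const_mul 2 (.of_le fun h => le_rfl))
  have : 2 ^ h.m * (2 * h.T + h.κ + h.m + 4) ≤ h.U := by
    have := h.le
    grind
  have h1 := mul_softMul_le this
  have h2 := h.two_pow_le
  have h3 := le_softMul h.one_le
  rw [length_pairs, mul_add]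
  omega

lemma intLen_index {h : Sized} {l1 l2 : List (ℤ × ℤ)} (hl : h.pairs = l1 ++ l2) {x : ℕ}
    (hx : x ≤ max l1.length l2.length) : intLen x ≤ h.m + 2 := by
  have h1 := congrArg List.length hl
  rw [length_pairs, length_append] at h1
  exact intLen_le_of_le_two_pow (by omega)

lemma bdd_count {h : Sized} {l1 l2 : List (ℤ × ℤ)} (hl : h.pairs = l1 ++ l2) :
    (foldState countStep (l1.map encPair) (.int 0)).Bdd (h.m + 2) := by
  rw [foldState_countStep, zero_add]
  exact intLen_index hl (List.countP_le_length.trans (le_max_left _ _))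

lemma cheap_count : Cheap W (foldE (var 7) (var 0) (const 0) countStep) env := by
  refine .foldE (c := fun h => 2 ^ h.m) (l := pairs) (f := encPair) (fun _ => rfl)
    (fun _ => rfl) .plain .plain .plain dom_two_pow (Cheap.loopFree (S := fun j : Split pairs =>
      2 * j.i.T + j.i.κ + j.i.m + 4) ⟨1, fun j => ?_⟩) (dom_pairs.trans dom_softMul)
  have h1 := j.i.intLen_pairs j.mem
  rw [one_mul]
  exact ⟨⟨h1.1.trans (by omega), h1.2.trans (by omega)⟩, (bdd_count j.eq).mono (by omega)⟩

lemma bdd_val_count (h : Sized) :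
    ((foldE (var 7) (var 0) (const 0) countStep).val h.env).Bdd h.U := by
  rw [val_foldE (c := 2 ^ h.m) (l := h.pairs.map encPair) rfl rfl
    (by rw [length_map, length_pairs])]
  refine (bdd_count (l2 := []) (append_nil h.pairs).symm).mono ?_
  have := h.two_pow_le
  have := lt_two_pow_self (n := h.m)
  omega

lemma multiplier_pos' : 0 < multiplier h.T := multiplier_pos _

lemma bdd_env : h.env.Bdd h.U := by
  refine ⟨(bdd_encList h.one_le).2 fun x hx => ?_, h.bdd_dig true, h.bdd_dig false, h.bdd_lastData,
    h.bdd_encBases⟩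
  obtain ⟨z, hz, rfl⟩ := mem_map.1 hx
  have := h.add_le
  exact ⟨(h.intLen_pairs hz).1.trans (by omega), (h.intLen_pairs hz).2.trans (by omega)⟩

lemma cheap_flagP : Cheap W flagP env := by
  have hi : ∀ h : Sized, (leP (foldE (var 7) (var 0) (const 0) countStep) (var 8) △ const 1 △ var 6 △
      var 7 △ var 5 △ var 1 △ var 2).val h.env = .int _ & .int 1 & .int h.m & .int (2 ^ h.m : ℕ) &
      .int (multiplier h.T) & encInts (h.dig true) & encInts (h.dig false) := fun h => by
    simp only [val_pair, val_leP]; rfl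
  choose fl hfl using fun j : Split fun h : Sized => h.vs => foldState_checkStep
    j.i.multiplier_pos' (j.i.length_dig true) (j.i.length_dig false) le_rfl j.l1 _ 1
  refine .comp (.foldE (c := fun h => 2 * h.T) (l := fun h => h.vs) (f := encGauss)
    (K := fun h => (h.m + 1) * softMul (3 * h.U)) (fun _ => rfl) (fun _ => rfl) (.sized bdd_env) .plain
      (.pair (.comp (.pair cheap_count .plain) (.sized fun h => ⟨bdd_val_count h,
        h.bdd_env.right.right.right.right.right.right.right.right.left⟩)) (.sized bdd_env))
          (.mono (fun h => by have := h.add_le; omega) dom_U)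
          (.congr (fun j => by rw [hi, (hfl j).1]) (cheap_checkStep (v := Split.y)
              (fl := fl) (y := fun j => 2 ^ j.l1.length * 1) (m := fun j => j.i.m) (L := fun j =>
              multiplier j.i.T) (a := fun j => j.i.dig true) (b := fun j => j.i.dig false)
              (s := fun j => 2 * j.i.T + 2) (e := fun j => 2 * j.i.T + j.i.κ)
              (S := fun j => 3 * j.i.U) (fun j => (j.i.bdd _ j.mem).mono (by omega)) (fun j => ?_)
              (fun j => j.i.intLen_multiplier.trans (by omega)) (fun j => j.i.intLen_dig _)
              (fun j => j.i.intLen_dig _) (fun j => j.i.length_dig _) (fun j => j.i.length_dig _)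
              fun j => ?_)) ?_) .plain
  · grind [j.i.len, mul_one, intLen_two_pow, j.length]
  · have := j.i.le
    grind
  · refine .trans (g := fun h : Sized => 4 * (h.T * (h.m + 1) * softMul (3 * h.U))) (.of_le fun h => ?_) (.const_mul 4
      (.trans ⟨_, fun h => (Nat.mul_le_mul_left _ (softMul_mul_le 3 h.one_le)).trans ((mul_left_comm _ _ _).le.trans
        (Nat.mul_le_mul_left _ (le_succ _)))⟩ (.of_le (f := fun h : Sized => h.T * (h.m + 1) * softMul h.U) fun h => ?_)))
    · have := le_softMul (show 1 ≤ 3 * h.U by have := h.one_le; omega)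
      have := h.one_le
      have := h.len
      have : 1 ≤ (h.m + 1) * softMul (3 * h.U) := Nat.mul_pos (by omega) (by omega)
      have := Nat.mul_le_mul_left h.T this
      simp only [h.len]
      rw [mul_assoc]
      nlinarith
    · rw [W, mul_assoc]; gcongr; omega

lemma cheap_outP : Cheap W outP env := by
  have hl : ∀ j : Split pairs, j.l1.length ≤ 2 ^ j.i.m := fun j => by
    grind [length_pairs, j.length]
  have hst : ∀ j : Split pairs, foldState outStep (j.l1.map encPair) (.int (2 ^ j.i.m : ℕ) &
      .int (multiplier j.i.T) & .int 0) = .int (2 ^ j.i.m - j.l1.length : ℕ) &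
      .int (multiplier j.i.T) & encUPoly (outList (multiplier j.i.T)
        (2 ^ j.i.m - j.l1.length) j.l1.reverse) := fun j => by
    have := foldState_outStep j.i.multiplier_pos' (2 ^ j.i.m - j.l1.length) j.l1.reverse
    simp_all
  refine .comp (.foldE (c := fun h => 2 ^ h.m) (l := pairs) (f := encPair)
    (K := fun h => (h.T + 1) * softMul (2 * h.T + h.κ + h.m + 4)) (fun _ => rfl)
      (fun _ => rfl) .plain .plain .plain dom_two_pow (.congr (fun j => congrArg (Data.pair _) (hst j))
        (.trans (cheap_outStep (S := fun j => 2 * j.i.T + j.i.κ + j.i.m + 4)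
          (fun j => j.i.multiplier_pos') (fun j => (j.i.intLen_pairs j.mem).1.trans (by omega))
            (fun j => (j.i.intLen_pairs j.mem).2.trans (by omega)) (fun j => ?_) (fun j =>
              (intLen_le_of_le_two_pow (sub_le _ _)).trans (by omega)) fun j => by omega)
                (.of_le fun j => ?_))) (.trans (g := fun h : Sized => (h.T + 1) * (h.pairs.length *
    (softMul (2 * h.T + h.κ + h.m + 4) + 1))) (.of_le fun h => ?_) ?_)) .plain
  · grind [j.i.multiplier_le', intLen_natCast_le]
  · exact Nat.mul_le_mul_right _ (succ_le_succ j.i.multiplier_le')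
  · grind
  · obtain ⟨c, hc⟩ := dom_pairs
    refine .mono (fun h => Nat.mul_le_mul_left _ (hc h)) (.trans (g := fun h : Sized => 2 * c * ((h.T + 1) * softMul h.U)) (.of_le fun h => ?_) (.const_mul _ (.of_le fun h => h.softMul_le_W.2.1)))
    have := le_softMul h.one_le
    have := h.one_le
    have : c * (softMul h.U + 1) ≤ c * (2 * softMul h.U) := Nat.mul_le_mul_left _ (by omega)
    have := Nat.mul_le_mul_left (h.T + 1) this
    linarith

end Sized

namespace Prog

/-! ### Costs of the general program -/

lemma loopB_foldE_of_loopFree {m : ℕ} {cnt lst init step : Prog} {x : Data}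
    (h1 : cnt.LoopFree = true) (h2 : lst.LoopFree = true) (h3 : init.LoopFree = true)
    (h4 : step.LoopFree = true) (h : (cnt.val x).toInt.toNat ≤ m) :
    LoopB m (foldE cnt lst init step) x :=
  ⟨⟨LoopFree.loopB h1 m x, LoopFree.loopB h2 m x, LoopFree.loopB h3 m x⟩, ⟨h, fun _ _ =>
    LoopFree.loopB (P := foldBody step) (by simp [foldBody, LoopFree, h4]) m _⟩, trivial⟩

lemma loopB_innerP {m : ℕ} {x : Data} (h : x.left.toInt.toNat ≤ m) : LoopB m innerP x :=
  ⟨loopB_foldE_of_loopFree rfl rfl rfl rfl h, trivial⟩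

lemma loopB_combP {m : ℕ} {x : Data} (h : x.left.toInt.toNat ≤ m) : LoopB m combP x :=
  ⟨⟨trivial, ⟨loopB_foldE_of_loopFree rfl rfl rfl rfl h, LoopFree.loopB rfl _ _⟩, trivial⟩,
    ⟨h, fun _ _ => LoopFree.loopB rfl _ _⟩, trivial⟩

lemma loopB_gsStep {m T : ℕ} (hT : 2 * T + 1 ≤ m) (y w : Data) :
    LoopB m gsStep (y & .int T & w) := by
  have h1 : (Data.int (T : ℤ)).toInt.toNat ≤ m := by simp; omega
  refine ⟨LoopFree.loopB rfl _ _, ⟨LoopFree.loopB rfl _ _, ⟨LoopFree.loopB rfl _ _,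
    loopB_innerP h1⟩, ⟨LoopFree.loopB rfl _ _, loopB_innerP h1⟩, LoopFree.loopB rfl _ _⟩,
    loopB_combP (?_ : (Data.int (2 * (T : ℤ) + 1)).toInt.toNat ≤ m)⟩
  rw [Data.toInt_int]; omega

lemma exists_foldState_gsStep (T : ℕ) (l : List Data) (w : Data) :
    ∃ w', foldState gsStep l (.int T & w) = .int T & w' := by
  induction l generalizing w with
  | nil => exact ⟨w, rfl⟩
  | cons y l ih => exact ih _

lemma loopB_gsBody {m T : ℕ} (hT : 2 * T + 1 ≤ m) (s : GSState) :
    LoopB m gsBody (encGS T s) := by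
  refine ⟨LoopFree.loopB rfl _ _, fun _ => trivial, fun _ => ⟨⟨⟨?_, LoopFree.loopB rfl _ _⟩,
    trivial⟩, ⟨LoopFree.loopB rfl _ _, loopB_innerP (?_ : (Data.int (T : ℤ)).toInt.toNat ≤ m)⟩,
    fun _ => LoopFree.loopB rfl _ _, fun _ => LoopFree.loopB rfl _ _⟩⟩
  · refine loopB_foldE (c := T) (l := s.2.2.2.map encVec) rfl rfl (by omega)
      (LoopFree.loopB rfl _ _) (LoopFree.loopB rfl _ _) (LoopFree.loopB rfl _ _) fun l1 y l2 _ => ?_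
    obtain ⟨w', hw⟩ := exists_foldState_gsStep T l1 (encVec s.2.2.1)
    exact (congrArg (fun d => LoopB m gsStep (y & d)) hw).mpr (loopB_gsStep hT y w')
  · rw [Data.toInt_int]; omega

lemma loopB_gsP {m T : ℕ} (hT : 2 * T + 1 ≤ m) {A : List (ℤ × ℤ × ℤ)}
    (hA : A.length ≤ 2 * T + 1) : LoopB m gsP (.int T & encVec A) := by
  refine ⟨LoopFree.loopB rfl _ _, ⟨(?_ : ((T : ℤ) + 1).toNat ≤ m), fun i hi => ?_⟩,
    LoopFree.loopB rfl _ _⟩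
  · omega
  · have hi' : i < ((T : ℤ) + 1).toNat := hi
    exact (congrArg (LoopB m gsBody) (iterate_gsBody hA i (by omega)).1).mpr (loopB_gsBody hT _)

lemma Cheap.ite_left {ι : Type*} {W : ι → ℕ} {r p q : Prog} {x : ι → Data}
    (h : ∀ i, (r.val (x i)).toInt ≠ 0) (hr : Cheap W r x) (hp : Cheap W p x) :
    Cheap W (Prog.ite r p q) x :=
  Dom.mono (fun i => by rw [cost_ite, if_pos (h i)]) ((Dom.add hr hp).add (.const 1))

lemma cheap_fracP {ι : Type*} {S c : ι → ℕ} {N D : ι → ℤ} (hD : ∀ i, D i ≠ 0)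
    (hN : ∀ i, intLen (N i) ≤ S i) (hDS : ∀ i, intLen (D i) ≤ S i)
    (hd : ∀ i, intLen (((N i : ℚ) / D i).den : ℤ) ≤ S i) (hc : ∀ i, ((N i : ℚ) / D i).den ≤ c i)
    (h2 : ∀ i, 2 ≤ S i) : Cheap (fun i => c i + ((N i : ℚ) / D i).den * softMul (S i)) fracP
      fun i => .int (c i) & .int (N i) & .int (D i) := by
  have e := fun i => val_redP_of_le (N := N i) (hD i) (hc i)
  refine .comp (.pair (cheap_redP hD hN hDS hd) .plain) (.ite_left (fun i => ?_) .plain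
    (.comp .plain (.congr e (Dom.trans (cheap_redOut hN hDS hd h2) (.of_le fun i => ?_)))))
  · rw [val_pair, e]; exact one_ne_zero
  · exact (le_mul_of_pos_left _ (Rat.den_pos _)).trans (Nat.le_add_left _ _)

lemma cheap_binPowP {ι : Type*} {m e : ι → ℕ} (he : ∀ i, e i < 2 ^ m i) :
    Cheap (fun i => (m i + 1) * softMul (2 ^ m i + 3)) binPowP
      fun i => .int (m i) & .int (e i) := by
  refine .comp .plain (.comp (.loop (c := m) (K := fun i => softMul (2 ^ m i + 3)) (fun _ => rfl)
    (.congr (fun j => iterate_binPowBody j.1.2 _ 2 1) (.loopFree ⟨1, fun j => ?_⟩))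
    (Dom.mono (fun i => ?_) (Dom.const_mul 2 (.of_le fun i => le_rfl)))) .plain)
  · have h2 : 2 ^ j.1.2 ≤ 2 ^ m j.1.1 := pow_le_pow_right (by norm_num) j.2.le
    have h4 := intLen_natCast_le (e j.1.1 / 2 ^ j.1.2)
    have h3 := Nat.div_le_self (e j.1.1) (2 ^ j.1.2)
    have h5 : e j.1.1 % 2 ^ j.1.2 < 2 ^ j.1.2 := mod_lt _ (by positivity)
    have := he j.1.1
    rw [one_mul, one_mul]
    exact ⟨show intLen _ ≤ _ by omega, (intLen_two_pow _).trans (by omega),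
      (intLen_two_pow _).trans (by omega)⟩
  · have := le_mul_of_pos_right (m i + 1) ((Nat.le_add_left 1 _).trans
      (le_softMul (S := 2 ^ m i + 3) (Nat.le_add_left 1 _)))
    rw [mul_add]; rw [add_mul] at this ⊢; omega

lemma foldState_scanStep_left (l : List Data) (i : ℤ) (s : Data) :
    (foldState scanStep l (.int i & s)).left = .int (i + l.length) := by
  induction l generalizing i s with
  | nil => simp [foldState]
  | cons y l ih =>
    rw [foldState_cons]
    have : ∃ s', scanStep.val (y & .int i & s) = .int (i + 1) & s' := by
      rw [scanStep, val_ite]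
      split
      · exact ⟨_, rfl⟩
      · exact ⟨_, rfl⟩
    grind

lemma cheap_scanStep {ι : Type*} {y s : ι → Data} {i W : ι → ℕ}
    (hs : ∀ j, (s j).left = .int (i j)) (hi : ∀ j, intLen (i j) ≤ W j) :
    Cheap W scanStep fun j => y j & s j := by
  have h : Cheap W (addP (var 1) (const 1)) fun j => y j & s j :=
    .comp (.pair .plain .plain) ((Dom.add (.of_le hi) (.const 2)).mono fun j => by
      show intLen (s j).left.toInt + intLen 1 ≤ _; rw [hs, intLen_one, Data.toInt_int])
  exact .ite .plain (.pair h .plain) (.pair h .plain)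

end Prog

/-- The inputs of the general program with few terms, with bounded denominators. -/
structure SlowCase (M L0 : ℕ) extends Sized where
  g : ℕ →₀ ℂ
  card : g.support.card ≤ T
  lt_two_pow : ∀ e ∈ g.support, e < 2 ^ m
  eq : ∀ j, (hj : j < vs.length) → powerSum g j = toComplex vs[j]
  rat : ∀ e, ∃ v, toComplex v = g e ∧ v.1.den ≤ L0 ∧ v.2.den ≤ L0
  T_le : T ≤ M
  le_G : L0 ≤ G
  G_le : G ≤ 2 ^ m

namespace SlowCase

variable {M L0 : ℕ} (h : SlowCase M L0)

abbrev W (h : SlowCase M L0) : ℕ := h.toSized.W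
abbrev D (h : SlowCase M L0) : ℕ := denProd h.vs
abbrev A (h : SlowCase M L0) : List (ℤ × ℤ × ℤ) := triples h.D h.T 0 h.vs
abbrev w (h : SlowCase M L0) : List (ℤ × ℤ × ℤ) :=
  ((gsPass h.T)^[h.T + 1] (false, [], h.A, [])).2.1
abbrev es (h : SlowCase M L0) : List ℕ := (h.g.support.sort fun x y => x ≤ y).reverse

abbrev x1 (h : SlowCase M L0) : Data := .int h.D & encEnv h.m h.T h.G h.vs
abbrev x2 (h : SlowCase M L0) : Data := encVec h.A & h.x1
abbrev x3 (h : SlowCase M L0) : Data := encVec h.w & h.x2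
abbrev x4 (h : SlowCase M L0) : Data := encNats h.es & h.x3
abbrev x5 (h : SlowCase M L0) : Data :=
  encSlow (h.A.take h.T).reverse h.w h.A h.es h.D h.m h.T h.G h.vs

lemma dom_softMul : Dom (fun h : SlowCase M L0 => softMul h.U) W :=
  Sized.dom_softMul.comp toSized

lemma dom_U : Dom (fun h : SlowCase M L0 => h.U) W := Sized.dom_U.comp toSized

lemma dom_two_pow : Dom (fun h : SlowCase M L0 => 2 ^ h.m) W := Sized.dom_two_pow.comp toSized

lemma dom_mul {f : SlowCase M L0 → ℕ} (hf : Dom f fun h => h.U) :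
    Dom (fun h => (h.m + 1) * softMul (f h)) W := by
  obtain ⟨c, hc⟩ := hf.softMul fun h => h.one_le
  refine ⟨2 * c, fun h => (Nat.mul_le_mul_left _ (hc h)).trans ?_⟩
  have := h.toSized.softMul_le_W.1
  have := Nat.mul_le_mul_left (h.m + 1) (h.one_le.trans (le_softMul h.one_le))
  rw [mul_left_comm, mul_comm 2, mul_assoc c]
  exact Nat.mul_le_mul_left c (by
    show (h.m + 1) * (softMul h.U + 1) ≤ 2 * (h.toSized.W + 1); rw [mul_add]; omega)

lemma length_A : h.A.length ≤ 2 * h.T + 1 := by rw [A, length_triples, h.len]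

lemma isVec_A {k : ℕ} (hk : k ≤ h.T) : IsVec h.T h.D h.g (h.A.drop k) (Polynomial.X ^ k) :=
  isVec_drop_triples h.pos h.len h.eq (fun _ hv => dvd_denProd hv) hk

lemma exists_isVec_w : ∃ c, c ≠ 0 ∧ IsVec h.T h.D h.g h.w (Polynomial.C c * rootPoly h.g) := by
  obtain ⟨w, cur, ws, c, h1, hc, hw⟩ := iterate_gsPass_last (denProd_pos h.vs) h.card
    (A := h.A) fun k hk => h.isVec_A hk
  grind

lemma loopB_pushDen : LoopB (2 * M + 1) pushDen (encEnv h.m h.T h.G h.vs) := by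
  have := h.T_le
  refine ⟨loopB_foldE_of_loopFree rfl rfl rfl rfl (?_ : (2 * (h.T : ℤ)).toNat ≤ _), trivial⟩
  omega

lemma loopB_pushTriples : LoopB (2 * M + 1) pushTriples h.x1 := by
  have := h.T_le
  have h1 : (2 * (h.T : ℤ)).toNat ≤ 2 * M + 1 := by omega
  exact ⟨⟨LoopFree.loopB rfl _ _, ⟨trivial, ⟨loopB_foldE_of_loopFree rfl rfl rfl rfl h1,
    LoopFree.loopB rfl _ _⟩, LoopFree.loopB rfl _ _⟩, ⟨h1, fun _ _ => LoopFree.loopB rfl _ _⟩,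
    trivial⟩, trivial⟩

lemma loopB_pushRel : LoopB (2 * M + 1) pushRel h.x2 := by
  have := h.T_le
  exact ⟨⟨LoopFree.loopB rfl _ _, loopB_gsP (by omega) h.length_A⟩, trivial⟩

lemma bdd₀ : ∃ c, ∀ h : SlowCase M L0, (encEnv h.m h.T h.G h.vs).Bdd (c * h.U) :=
  ⟨1, fun h => by rw [one_mul]; exact h.bdd_encEnv⟩

lemma bdd₁ : ∃ c, ∀ h : SlowCase M L0, h.x1.Bdd (c * h.U) := by
  have := bdd_val (2 * M + 1) (S := fun h : SlowCase M L0 => h.U) bdd₀ loopB_pushDen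
  simpa only [val_pushDen (Sized.len _)] using this

lemma bdd₂ : ∃ c, ∀ h : SlowCase M L0, h.x2.Bdd (c * h.U) := by
  have := bdd_val (2 * M + 1) (S := fun h : SlowCase M L0 => h.U) bdd₁ loopB_pushTriples
  simpa only [val_pushTriples _ (Sized.len _)] using this

lemma bdd₃ : ∃ c, ∀ h : SlowCase M L0, h.x3.Bdd (c * h.U) := by
  have := bdd_val (2 * M + 1) (S := fun h : SlowCase M L0 => h.U) bdd₂ loopB_pushRel
  simpa only [val_pushRel _ (length_A _)] using this

lemma bdd₄ : ∃ c, ∀ h : SlowCase M L0, h.x4.Bdd (c * h.U) := by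
  obtain ⟨c, hc⟩ := bdd₃ (M := M) (L0 := L0)
  refine ⟨c + 1, fun h => ⟨(bdd_encList ?_).2 fun x hx => ?_, (hc h).mono (by gcongr; omega)⟩⟩
  · exact h.one_le.trans (le_mul_of_pos_left _ (by omega))
  · obtain ⟨e, he, rfl⟩ := mem_map.1 hx
    have h1 := h.lt_two_pow e (by simpa using he)
    have h2 := intLen_natCast_le e
    have h3 := h.two_pow_le
    exact (show intLen e ≤ h.U by omega).trans (le_mul_of_pos_left _ (by omega))

lemma loopB_pushRev : LoopB (2 * M + 1) pushRev h.x4 := by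
  have := h.T_le
  refine ⟨loopB_foldE_of_loopFree rfl rfl rfl rfl (?_ : (h.T : ℤ).toNat ≤ _), trivial⟩
  omega

lemma bdd₅ : ∃ c, ∀ h : SlowCase M L0, h.x5.Bdd (c * h.U) := by
  have := bdd_val (2 * M + 1) (S := fun h : SlowCase M L0 => h.U) bdd₄ loopB_pushRev
  simpa only [val_pushRev] using this

lemma cheap_bitsP : Cheap W bitsP (x3 (M := M) (L0 := L0)) := by
  have hU : ∀ h : SlowCase M L0, 2 ^ h.m * (2 + (h.m + 1) + 4) ≤ h.U := fun h => by
    have := h.le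
    have := h.pos
    have : (h.m + 1) * (2 ^ h.m * 7) ≤ (h.m + 1) * (2 ^ h.m * (2 * h.T + h.κ + 5)) := by
      gcongr; omega
    nlinarith [Nat.zero_le (h.m * 2 ^ h.m)]
  have hx : ∀ h : SlowCase M L0, (var 3 △ var 4 △ const 0 △ (var 3 △ const 2) ▷ squaresP △ (var 5 △ var 0) ▷ dropP ▷ sumPowP △ const 0).val h.x3 = .int h.m & .int (2 ^ h.m : ℕ) & .int 0 & encInts (squares 2 h.m) & .int (∑ e ∈ h.g.support, 2 ^ e) & .int 0 := by
    intro h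
    obtain ⟨c, hc, hw⟩ := h.exists_isVec_w
    obtain ⟨h0, h1, h2⟩ := sum_two_pow_eq hc h.card hw
    have h3 : ((var 5 △ var 0) ▷ dropP ▷ sumPowP).val h.x3 =
        .int (∑ e ∈ h.g.support, 2 ^ e) := by
      rw [val_comp, val_comp, show (var 5 △ var 0).val h.x3 = .int h.T & encVec h.w
        from rfl, val_dropP h0 h1 (by have := h.card; omega), val_sumPowP, h2]
    have h5 : ((var 3 △ const 2) ▷ squaresP).val h.x3 = encInts (squares 2 h.m) := by
      rw [val_comp, ← val_squaresP]; rfl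
    rw [val_pair, val_pair, val_pair, val_pair, val_pair, h3, h5]
    rfl
  have hdrop := fun h : SlowCase M L0 => (⟨LoopFree.loopB rfl _ _, (by
    have := h.T_le; show (h.T : ℤ).toNat ≤ M + 1; omega), fun _ _ => LoopFree.loopB rfl _ _⟩ :
      LoopB (M + 1) ((var 5 △ var 0) ▷ dropP) h.x3)
  refine .comp (.pair .plain (.pair .plain (.pair .plain (.pair (.comp .plain ?_) (.pair (.comp
    (Dom.trans (Cheap.loopB _ bdd₃ hdrop) dom_softMul) (Dom.trans (Cheap.loopFree (bdd_val _ bdd₃ hdrop))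
      dom_softMul)) .plain))))) (.congr hx ?_)
  · refine Dom.trans (cheap_squaresP (y := fun _ => 2) (b := fun _ => 2) (fun _ => by norm_num)
      fun _ => by norm_num) (Dom.mono (fun h => ?_) ((dom_mul (f := fun h => 2 * (2 ^ h.m * 2 + 1))
        (Dom.mono (fun h => ?_) (Dom.const_mul 2 (Dom.of_le fun h => le_rfl)))).const_mul 2))
    · have := le_softMul (S := 2 * (2 ^ h.m * 2 + 1)) (by omega)
      rw [mul_left_comm]
      exact Nat.mul_le_mul (le_succ _) (by omega)
    · have := h.two_pow_le; have := one_le_two_pow (n := h.m); omega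
  · refine Dom.trans (Prog.cheap_splitAllP (b := fun _ => 2) (K := fun _ => 1) (y := fun _ => 2)
      (κ := fun h => h.m + 1) (fun _ => le_rfl) (by norm_num) (fun _ => .inl rfl) (fun h => ?_)
        fun h => ?_) (dom_mul (Dom.of_le hU))
    · rw [Nat.cast_one, mul_one, abs_of_nonneg (Finset.sum_nonneg fun e _ => by positivity)]
      have h1 := Finset.sum_le_sum_of_subset (f := fun e : ℕ => 2 ^ e) (M := ℕ)
        (show h.g.support ⊆ Finset.range (2 ^ h.m) from
          fun e he => mem_range.2 (h.lt_two_pow e he))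
      have h2 := Nat.geomSum_lt (m := 2) (n := 2 ^ h.m) le_rfl (s := Finset.range (2 ^ h.m))
        fun k hk => mem_range.1 hk
      exact_mod_cast h1.trans h2.le
    · have := lt_two_pow_self (n := h.m); rw [pow_succ]; omega

lemma cheap_pushExps : Cheap W pushExps (x3 (M := M) (L0 := L0)) := by
  refine .pair (.comp (.foldE (c := fun h => 2 ^ h.m) (K := fun h => h.m + 2) (f := Data.int)
    (l := fun h => (range (2 ^ h.m)).map fun e => if e ∈ h.g.support then (1 : ℤ) else 0)
    (fun _ => rfl) (fun h => ?_) .plain cheap_bitsP .plain dom_two_pow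
    (cheap_scanStep (i := fun j => j.l1.length) (fun j => ?_) fun j => ?_)
      (Dom.trans (.of_le fun h => ?_) dom_U)) .plain) .plain
  · obtain ⟨c, hc, hw⟩ := h.exists_isVec_w
    exact val_bitsP h.card h.lt_two_pow hc hw
  · rw [show ((const 0 △ const 0).val j.i.x3) = .int 0 & .int 0 from rfl,
      foldState_scanStep_left, length_map, zero_add]
  · have h1 := j.length
    rw [length_map, length_range] at h1
    exact intLen_le_of_le_two_pow (by omega)
  · rw [length_map, length_range]
    have := Nat.mul_le_mul_left (h.m + 1) (show 5 ≤ 2 * h.T + h.κ + 5 by omega)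
    refine le_trans ?_ h.le
    rw [mul_left_comm]
    exact Nat.mul_le_mul_left _ (by omega)

/-- The steps in which the terms of the result are computed. -/
structure Idx (M L0 : ℕ) extends SlowCase M L0 where
  e : ℕ
  acc : Data
  mem : e ∈ g.support

abbrev Idx.x (i : Idx M L0) : Data := .int i.e & i.acc & i.x5
abbrev Idx.y (i : Idx M L0) : Data := .int i.T & encVec i.w & .int (2 ^ i.e) &
  encVec (i.A.take i.T).reverse & .int 0 & .int 0 & .int 0 & .int 0

lemma cheap_slowOutStep : Cheap (fun i => i.W) slowOutStep (Idx.x (M := M) (L0 := L0)) := by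
  obtain ⟨c5, hc5⟩ := bdd₅ (M := M) (L0 := L0)
  have hin : ∃ c, ∀ i : Idx M L0, i.y.Bdd (c * i.U) := by
    refine ⟨c5 + 1, fun i => ?_⟩
    have hm : ∀ {x : Data}, x.Bdd (c5 * i.U) → x.Bdd ((c5 + 1) * i.U) := fun hx =>
      hx.mono (Nat.mul_le_mul_right _ (le_succ _))
    have hb := hc5 i.toSlowCase
    have hU : i.U ≤ (c5 + 1) * i.U := le_mul_of_pos_left _ (succ_pos _)
    have h0 : intLen 0 ≤ (c5 + 1) * i.U := i.one_le.trans hU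
    have h1 := intLen_natCast_le i.T
    have h2 := i.add_le
    have h3 := i.lt_two_pow _ i.mem
    have h4 := i.two_pow_le
    exact ⟨(show intLen i.T ≤ i.U by omega).trans hU, hm hb.2.2.1,
      (intLen_two_pow _).trans (le_trans (by omega) hU), hm hb.1, h0, h0, h0, h0⟩
  have hval : ∀ i : Idx M L0, (var 9 △ var 4 △ (var 7 △ var 0) ▷ binPowP △ var 2 △ const 0 △
      const 0 △ const 0 △ const 0).val i.x = i.y := fun i => by
    rw [val_pair, val_pair, val_pair, val_comp, show (var 7 △ var 0).val i.x = .int i.m & .int i.e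
      from rfl, val_binPowP (i.lt_two_pow _ i.mem)]; rfl
  have hl : ∀ i : Idx M L0, LoopB (M + 1) (foldP hornerStep) i.y := fun i =>
    ⟨⟨(by have := i.T_le; show (i.T : ℤ).toNat ≤ M + 1; omega), fun _ _ =>
      LoopFree.loopB rfl _ _⟩, trivial⟩
  have hcoef : Cheap (fun i => i.W) coefP (Idx.x (M := M) (L0 := L0)) := by
    have hfold : Cheap (fun i => i.W) (foldP hornerStep) (Idx.y (M := M) (L0 := L0)) :=
      Dom.trans (Cheap.loopB (S := fun i : Idx M L0 => i.U) _ hin hl)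
        (dom_softMul.comp Idx.toSlowCase)
    refine .comp (.pair .plain (.pair .plain (.pair (.comp .plain ?_) .plain))) (.congr hval hfold)
    refine Dom.trans (cheap_binPowP (m := fun i : Idx M L0 => i.m) (e := Idx.e) fun i => i.lt_two_pow _ i.mem) (Dom.comp
      (dom_mul (f := fun h => 2 ^ h.m + 3) (Dom.of_le fun h => ?_)) Idx.toSlowCase)
    have := h.two_pow_le
    have : 1 ≤ 2 ^ h.m := one_le_two_pow
    omega
  obtain ⟨c, hc⟩ := bdd_val (M + 1) hin hl
  have hfrac : ∀ i : Idx M L0, ∃ (y : Data) (b d s s' : ℤ) (v : ℚ × ℚ),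
      coefP.val i.x = .int (2 ^ i.e) & y & .int b & .int d & .int s & .int s' ∧
      ((i.D : ℤ) * d) ≠ 0 ∧ (s : ℚ) / (((i.D : ℤ) * d : ℤ) : ℚ) = v.1 ∧
      (s' : ℚ) / (((i.D : ℤ) * d : ℤ) : ℚ) = v.2 ∧ v.1.den ≤ L0 ∧ v.2.den ≤ L0 ∧
      intLen d ≤ c * i.U ∧ intLen s ≤ c * i.U ∧ intLen s' ≤ c * i.U := by
    intro i
    obtain ⟨a, ha, hw⟩ := i.exists_isVec_w
    obtain ⟨v, hv, hv1, hv2⟩ := i.rat i.e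
    obtain ⟨y, b, d, s, s', h1, h2, h3, h4⟩ := exists_val_coefP (es := i.es) (A := i.A) (G := i.G)
      (vs := i.vs) (denProd_pos i.vs) i.card ha hw (i.isVec_A (Nat.zero_le _)) i.mem
      (i.lt_two_pow _ i.mem) hv i.acc
    have h5 := hc i
    have h6 : coefP.val i.x = (foldP hornerStep).val _ := congrArg (foldP hornerStep).val (hval i)
    rw [← h6, h1] at h5
    exact ⟨y, b, d, s, s', v, h1, h2, h3, h4, hv1, hv2, h5.2.2.2⟩
  choose y b d s s' v hv hne hs hs' hd1 hd2 hd hsl hsl' using hfrac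
  have hD : ∀ i : Idx M L0, intLen i.D ≤ c5 * i.U := fun i => (hc5 i.toSlowCase).2.2.2.2.1
  have hU : ∀ k, Dom (fun i : Idx M L0 => softMul (k * i.U)) fun i => i.W := fun k =>
    Dom.trans (Dom.softMul (S := fun h : Idx M L0 => h.U) (Dom.const_mul k (Dom.of_le fun h =>
      le_rfl)) fun h => h.one_le) (dom_softMul.comp Idx.toSlowCase)
  have hfr : ∀ (N : Idx M L0 → ℤ) (q : Idx M L0 → ℚ),
      (∀ i, (N i : ℚ) / (((i.D : ℤ) * d i : ℤ) : ℚ) = q i) → (∀ i, (q i).den ≤ L0) →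
      (∀ i, intLen (N i) ≤ c * i.U) → Cheap (fun i => i.W) fracP
        fun i => .int i.G & .int (N i) & .int (i.D * d i) := by
    intro N q hN hq hNl
    have e : ∀ i : Idx M L0, c * i.U + c5 * i.U + (L0 + 2) ≤ (c + c5 + L0 + 2) * i.U := fun i => by
      have := le_mul_of_pos_right (L0 + 2) i.one_le
      rw [add_assoc (c + c5), add_mul, add_mul]; omega
    have hden := fun i => intLen_natCast_le (q i).den
    have hmul := fun i => intLen_mul_le i.D (d i)
    refine Dom.trans (cheap_fracP (S := fun i => (c + c5 + L0 + 2) * i.U) hne (fun i => ?_)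
      (fun i => ?_) (fun i => ?_) (fun i => ?_) fun i => ?_) (Dom.mono (fun i => ?_)
        ((dom_two_pow.comp Idx.toSlowCase).add ((hU (c + c5 + L0 + 2)).const_mul L0)))
    all_goals
      have := e i; have := hden i; have := hmul i; have := hD i; have := hd i; have := hNl i
      have := hq i; have := i.le_G
    · omega
    · omega
    · rw [hN]; omega
    · rw [hN]; omega
    · omega
    · rw [hN]; exact Nat.add_le_add i.G_le (Nat.mul_le_mul_right _ (hq i))
  have hmul : Cheap (fun i => i.W) (mulP (var 7) (var 0 ▷ var 3)) fun i : Idx M L0 =>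
      (.int (2 ^ i.e) & y i & .int (b i) & .int (d i) & .int (s i) & .int (s' i)) & i.x :=
    .mulP .plain .plain (Dom.mono (fun i => softMul_mono ((Nat.add_le_add (hD i) (hd i)).trans
      (add_mul c5 c _).ge)) (hU _))
  exact .pair (.pair (.pair .plain (.comp (.pair hcoef .plain) (.congr (fun i => by
    rw [val_pair, hv, val_id]) (.pair (.comp (.pair .plain (.pair .plain hmul))
      (hfr s (fun i => (v i).1) hs hd1 hsl)) (.comp (.pair .plain (.pair .plain hmul))
        (hfr s' (fun i => (v i).2) hs' hd2 hsl')))))) .plain) .plain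

lemma cheap_slowP : Cheap W slowP fun h : SlowCase M L0 => encEnv h.m h.T h.G h.vs := by
  refine .comp (Dom.trans (Cheap.loopB _ bdd₀ loopB_pushDen) dom_softMul) (.congr (fun h =>
    val_pushDen h.len) (.comp (Dom.trans (Cheap.loopB _ bdd₁ loopB_pushTriples) dom_softMul)
    (.congr (fun h => val_pushTriples _ h.len) (.comp (Dom.trans (Cheap.loopB _ bdd₂ loopB_pushRel)
    dom_softMul) (.congr (fun h => val_pushRel _ h.length_A) (.comp cheap_pushExps (.congr (fun h => ?_)
    (.comp (Dom.trans (Cheap.loopB _ bdd₄ loopB_pushRev) dom_softMul) (.congr (fun h =>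
    val_pushRev ..) (.comp (.foldE (c := fun h => h.T) (l := fun h => h.es) (f := fun e : ℕ => .int e)
    (K := W) (fun _ => rfl) (fun _ => rfl) .plain .plain .plain (dom_U.mono fun h => by
      have := h.add_le; omega) ?_ ?_) .plain))))))))))
  · obtain ⟨c, hc, hw⟩ := h.exists_isVec_w
    exact val_pushExps h.card h.lt_two_pow hc hw
  · have he : ∀ j : Split fun h : SlowCase M L0 => h.es, ∀ e' ∈ j.l1 ++ j.y :: j.l2,
        e' ∈ j.i.g.support := fun j e' he' => by
      rw [← j.eq] at he'; simpa using he'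
    refine .congr (fun j => ?_) (Dom.comp cheap_slowOutStep fun j : Split fun h : SlowCase M L0 =>
      h.es => ⟨j.i, j.y, (foldState slowOutStep (j.l1.map fun e : ℕ => .int e)
        (.int 0 & j.i.x5)).left, he j _ (by simp)⟩)
    obtain ⟨a, ha, hw⟩ := j.i.exists_isVec_w
    have h2 := foldState_slowOutStep (es := j.i.es) (G := j.i.G) (vs := j.i.vs) (denProd_pos j.i.vs)
      j.i.card ha hw (j.i.isVec_A (Nat.zero_le _)) j.i.lt_two_pow (fun e => (j.i.rat e).imp
        fun v hv => hv.1) j.l1 (fun e' he' => he j e' (by simp [he'])) []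
    show Data.int _ & foldState _ _ (_ & j.i.x5) = .int _ & (foldState _ _ _).left & j.i.x5
    exact congrArg _ (h2.trans (congrArg (fun d : Data => d.left & j.i.x5) h2).symm)
  · refine ⟨M, fun h => Nat.mul_le_mul_right _ ?_⟩
    rw [length_reverse, Finset.length_sort]
    exact h.card.trans h.T_le

end SlowCase

/-- The coded input of the program. -/
def encInput (T G : ℕ) (vs : List (ℚ × ℚ)) : Data :=
  .int T & .int G & encList (vs.map encGauss)

/-- The bounds for the sizes, with the correct number of digits. -/
abbrev Exact := {h : Sized // h.m = clog 2 h.G}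

lemma Exact.cheap_envP : Cheap (fun h => h.1.W) envP
    fun h : Exact => encInput h.1.T h.1.G h.1.vs := by
  have hG : ∀ h : Exact, h.1.G ≤ 2 ^ h.1.m := fun h => by
    rw [h.2]; exact le_pow_clog (by norm_num) _
  refine .comp (.pair (.comp .plain (.comp .plain (.comp (.loop (c := fun h => h.1.G)
    (K := fun h => softMul (h.1.m + 4)) (fun _ => rfl) (.congr (fun j => iterate_sizeBody j.1.1.1.G _)
      (Cheap.loopFree (S := fun j : {j : Exact × ℕ // j.2 < j.1.1.G} => j.1.1.1.m + 4)
        ⟨1, fun j => ?_⟩)) ?_) .plain))) .plain) .plain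
  · have h := j.1.1.2
    rw [one_mul]
    refine ⟨(intLen_le_of_le_two_pow (hG j.1.1)).trans (by omega), (intLen_natCast_le _).trans (by omega),
      (intLen_le_of_le_two_pow (m := j.1.1.1.m) (pow_le_pow_right (by norm_num)
        (by omega))).trans (by omega)⟩
  · refine Dom.mono (fun h => ?_) (Dom.const_mul 2 (Sized.dom_softMul.comp Subtype.val))
    have h1 : 2 ^ h.1.m * (h.1.m + 4) ≤ h.1.U := by
      refine le_trans ?_ h.1.le
      rw [mul_left_comm]
      have := Nat.mul_le_mul_left (h.1.m + 1) (show 5 ≤ 2 * h.1.T + h.1.κ + 5 by omega)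
      exact Nat.mul_le_mul_left _ (by omega)
    have h3 := le_softMul (show 1 ≤ h.1.m + 4 by omega)
    refine (Nat.mul_le_mul (hG h) (show _ ≤ 2 * softMul (h.1.m + 4) by omega)).trans ?_
    rw [mul_left_comm]
    exact Nat.mul_le_mul_left 2 (mul_softMul_le h1)

lemma Exact.cheap_interpP : Cheap (fun h => h.1.W + if (flagP.val h.1.env).toInt ≠ 0 then 0 else
    slowP.cost (encEnv h.1.m h.1.T h.1.G h.1.vs)) interpP
      fun h : Exact => encInput h.1.T h.1.G h.1.vs := by
  have lift : ∀ {f : Sized → ℕ}, Dom f Sized.W → Dom (fun h : Exact => f h.1) fun h => h.1.W +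
      if (flagP.val h.1.env).toInt ≠ 0 then 0 else slowP.cost (encEnv h.1.m h.1.T h.1.G h.1.vs) :=
    fun hf => (hf.comp Subtype.val).trans (.of_le fun h => Nat.le_add_right _ _)
  refine .ite_left (fun h => ?_) .plain (.comp (Dom.trans cheap_envP (lift Sized.dom_W))
    (.congr (fun h => ?_) (.comp (lift Sized.cheap_digitsP) (.congr (fun h => h.1.val_digitsP)
      (Dom.mono (fun h => ?_) ((Dom.add (lift Sized.cheap_flagP) (lift Sized.cheap_outP)).add
        ((Dom.of_le fun h => le_rfl).add (.const 20))))))))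
  · have := h.1.pos
    show (h.1.T : ℤ) ≠ 0
    omega
  · show _ = encEnv h.1.m _ _ _
    rw [h.2]; exact val_envP _ _ _
  · show _ ≤ flagP.cost h.1.env + outP.cost h.1.env + (h.1.W + (if _ then _ else _) + 20)
    show (Prog.ite flagP outP (rest 6 ▷ slowP)).cost h.1.env ≤ _
    rw [cost_ite]
    split_ifs
    · omega
    · have : (rest 6 ▷ slowP).cost h.1.env = 14 + slowP.cost (encEnv h.1.m h.1.T h.1.G h.1.vs) := by
        rw [cost_comp, show (rest 6).val h.1.env = encEnv h.1.m h.1.T h.1.G h.1.vs from rfl,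
          show (rest 6).cost h.1.env = 13 from rfl]; omega
      omega

/-- The inputs of the program: the coefficients have the denominator `L0`, and `T * A` is a bound
for the numerators. -/
structure ProgInput (L0 A : ℕ) where
  (T G : ℕ)
  c : ℕ → ℤ × ℤ
  g : ℕ →₀ ℂ
  vs : List (ℚ × ℚ)
  one_le : 1 ≤ T
  one_le' : 1 ≤ G
  digits : HasDigits g L0 G c
  small : ∀ e, |(c e).1| ≤ (T * A : ℕ) ∧ |(c e).2| ≤ (T * A : ℕ)
  card : g.support.card ≤ T
  len : vs.length = 2 * T
  eq : ∀ j, (hj : j < vs.length) → powerSum g j = toComplex vs[j]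

lemma natAbs_num_le {N : ℤ} {L : ℕ} (hL : 0 < L) {q : ℚ} (hq : q = (N : ℚ) / (L : ℤ)) :
    |q.num| ≤ |N| ∧ q.den ≤ L := by
  have hL' : (L : ℤ) ≠ 0 := by omega
  rw [← Rat.divInt_eq_div] at hq
  subst hq
  refine ⟨?_, le_of_dvd hL (by exact_mod_cast Rat.den_dvd N L)⟩
  rcases eq_or_ne N 0 with rfl | h
  · simp
  · exact Int.le_of_dvd (abs_pos.2 h) ((abs_dvd_abs _ _).2 (Rat.num_dvd N hL'))

lemma abs_polyEval_le {c : ℕ → ℤ} {B y : ℤ} (hc : ∀ e, |c e| ≤ B) (hy : 1 ≤ y) (M : ℕ) :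
    |polyEval y ((range M).map c)| ≤ M * B * y ^ M := by
  rw [polyEval_map_range, mul_assoc, ← nsmul_eq_mul]
  refine (Finset.abs_sum_le_sum_abs _ _).trans ((sum_le_card_nsmul _ _ (B * y ^ M)
    fun i hi => ?_).trans_eq (by rw [card_range]))
  rw [abs_mul, abs_of_nonneg (by positivity : 0 ≤ y ^ i)]
  exact mul_le_mul (hc i) (pow_le_pow_right₀ hy (mem_range.1 hi).le) (by positivity)
    ((abs_nonneg _).trans (hc i))

lemma Dom.le_mul {ι : Type*} {f W : ι → ℕ} (hW : ∀ i, 1 ≤ W i) :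
    Dom f W → ∃ c, ∀ i, f i ≤ c * W i := fun ⟨c, hc⟩ => ⟨2 * c, fun i => (hc i).trans (by
  have := hW i; rw [mul_comm 2, mul_assoc]; gcongr; omega)⟩

lemma Dom.mul {ι : Type*} {f g F G : ι → ℕ} (hF : ∀ i, 1 ≤ F i) (hG : ∀ i, 1 ≤ G i) :
    Dom f F → Dom g G → Dom (fun i => f i * g i) fun i => F i * G i := fun h h' => by
  obtain ⟨⟨a, ha⟩, b, hb⟩ := And.intro (h.le_mul hF) (h'.le_mul hG)
  exact ⟨a * b, fun i => (Nat.mul_le_mul (ha i) (hb i)).trans (by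
    rw [mul_mul_mul_comm]; exact Nat.mul_le_mul_left _ (le_succ _))⟩

namespace ProgInput

variable {L0 A : ℕ} (h : ProgInput L0 A)

lemma digits' {M : ℕ} (hM : h.G ≤ M) : HasDigits h.g L0 M h.c :=
  ⟨fun e he => (h.digits.lt e he).trans_le hM, h.digits.eq⟩

lemma getElem_vs {M : ℕ} (hM : h.G ≤ M) (j : ℕ) (hj : j < h.vs.length) : h.vs[j] =
    ((polyEval (2 ^ j) ((range M).map fun e => (h.c e).1) : ℚ) / (L0 : ℤ),
      (polyEval (2 ^ j) ((range M).map fun e => (h.c e).2) : ℚ) / (L0 : ℤ)) := by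
  rw [← toComplex_inj, ← h.eq j hj, (h.digits' hM).powerSum_eq]

/-- The logarithmic factor. -/
def lam (h : ProgInput L0 A) : ℕ := size (h.T * h.G)

lemma one_le_mul : 1 ≤ h.T * h.G := Nat.mul_pos h.one_le h.one_le'

lemma one_le_lam : 1 ≤ h.lam := size_pos.2 h.one_le_mul

def m (h : ProgInput L0 A) : ℕ := clog 2 h.G
def K (h : ProgInput L0 A) : ℕ := h.T * (h.G * (h.T * A))
def κ (h : ProgInput L0 A) : ℕ := size (h.K + h.m)
def U (h : ProgInput L0 A) : ℕ := (h.m + 1) * (2 ^ h.m * (2 * h.T + h.κ + 5)) + (L0 + 1)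

lemma G_le : h.G ≤ 2 ^ h.m := le_pow_clog (by norm_num) _

lemma abs_num_le (hL : 0 < L0) (j : ℕ) (hj : j < h.vs.length) :
    (|(h.vs[j]).1.num| ≤ (h.G * (h.T * A) : ℕ) * (2 ^ (2 * h.T - 1)) ^ 2 ^ h.m ∧
      (h.vs[j]).1.den ≤ L0) ∧ |(h.vs[j]).2.num| ≤ (h.G * (h.T * A) : ℕ) * (2 ^ (2 * h.T - 1)) ^ 2 ^ h.m ∧
      (h.vs[j]).2.den ≤ L0 := by
  have hlen := h.len
  have key : ∀ c : ℕ → ℤ, (∀ e, |c e| ≤ (h.T * A : ℕ)) →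
      |polyEval (2 ^ j) ((range h.G).map c)| ≤
        (h.G * (h.T * A) : ℕ) * (2 ^ (2 * h.T - 1)) ^ 2 ^ h.m := fun c hc => by
    refine (abs_polyEval_le hc (one_le_pow₀ (by norm_num)) h.G).trans ?_
    rw [cast_mul]
    refine mul_le_mul_of_nonneg_left (le_trans ?_ (pow_le_pow_right₀ (one_le_pow₀ (by norm_num))
      h.G_le)) (by positivity)
    exact pow_le_pow_left₀ (by positivity) (pow_le_pow_right₀ (by norm_num) (by omega)) _
  have h1 := natAbs_num_le hL (congrArg Prod.fst (h.getElem_vs le_rfl j hj))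
  have h2 := natAbs_num_le hL (congrArg Prod.snd (h.getElem_vs le_rfl j hj))
  exact ⟨⟨h1.1.trans (key _ fun e => (h.small e).1), h1.2⟩,
    h2.1.trans (key _ fun e => (h.small e).2), h2.2⟩

lemma abs_scaled_le {q : ℚ} (hq : |q.num| ≤ (h.G * (h.T * A) : ℕ) * (2 ^ (2 * h.T - 1)) ^ 2 ^ h.m) :
    |scaled (multiplier h.T) (encRat q)| ≤ (2 ^ (2 * h.T - 1)) ^ 2 ^ h.m * h.K := by
  refine (Int.abs_ediv_le_abs _ _).trans ?_
  have h1 : multiplier h.T ≤ h.T := (multiplier_le h.T).trans (by simp [h.one_le])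
  rw [abs_mul, abs_cast, K, cast_mul h.T, mul_comm ((2 ^ _ : ℤ) ^ _), mul_assoc]
  exact mul_le_mul (by exact_mod_cast h1) hq (abs_nonneg _) (by positivity)

/-- The bounds for the sizes. -/
def sized (hL : 0 < L0) : Sized where
  U := h.U
  κ := h.κ
  K := h.K
  m := h.m
  T := h.T
  G := h.G
  vs := h.vs
  pos := h.one_le
  len := h.len
  bdd v hv := by
    obtain ⟨j, hj, rfl⟩ := List.mem_iff_getElem.1 hv
    have key : ∀ q : ℚ, |q.num| ≤ (h.G * (h.T * A) : ℕ) * (2 ^ (2 * h.T - 1)) ^ 2 ^ h.m →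
        q.den ≤ L0 → (encRat q).Bdd h.U := fun q h1 h2 => by
      have h3 := intLen_natCast_le q.den
      have hU : h.U = (h.m + 1) * (2 ^ h.m * (2 * h.T + h.κ + 5)) + (L0 + 1) := rfl
      refine ⟨(intLen_le_of_abs_le (k := h.κ + (2 * h.T - 1) * 2 ^ h.m) h1 ?_).trans ?_,
        show intLen q.den ≤ h.U by omega⟩
      · rw [pow_add, pow_mul]
        refine mul_lt_mul_of_pos_right ?_ (by positivity)
        have h4 : h.K + h.m < 2 ^ h.κ := lt_size_self _
        have h5 : h.G * (h.T * A) ≤ h.K := le_mul_of_pos_left _ h.one_le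
        exact_mod_cast (by omega : h.G * (h.T * A) < 2 ^ h.κ)
      · have h4 : 2 ^ h.m * (2 * h.T + h.κ + 5) ≤ (h.m + 1) * (2 ^ h.m * (2 * h.T + h.κ + 5)) :=
          le_mul_of_pos_left _ (by omega)
        have h5 : h.κ ≤ 2 ^ h.m * h.κ := le_mul_of_pos_left _ (by positivity)
        have h6 : 2 ^ h.m * (2 * h.T + h.κ + 5) = 2 ^ h.m * (2 * h.T) + 2 ^ h.m * h.κ + 2 ^ h.m * 5 := by
          ring
        have h7 : (2 * h.T - 1) * 2 ^ h.m ≤ 2 ^ h.m * (2 * h.T) := by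
          rw [mul_comm]; gcongr; omega
        omega
    obtain ⟨⟨h1, h2⟩, h3, h4⟩ := h.abs_num_le hL j hj
    exact ⟨key _ h1 h2, key _ h3 h4⟩
  intLen_le := by
    have h1 := intLen_natCast_le h.G
    have h2 := h.G_le
    have h3 : 2 ^ h.m * 1 ≤ (h.m + 1) * (2 ^ h.m * (2 * h.T + h.κ + 5)) :=
      le_trans (Nat.mul_le_mul_left _ (by omega)) (le_mul_of_pos_left _ (by omega))
    exact h1.trans (le_trans (by omega) (Nat.add_le_add h3 (Nat.le_add_left 1 L0)))
  le := Nat.le_add_right _ _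
  re := by
    rw [lastData_eq h.one_le h.len]
    exact h.abs_scaled_le (h.abs_num_le hL _ _).1.1
  im := by
    rw [lastData_eq h.one_le h.len]
    exact h.abs_scaled_le (h.abs_num_le hL _ _).2.1
  lt := lt_size_self _

/-- The budget. -/
def V (h : ProgInput L0 A) : ℕ := h.T ^ 2 * h.G * h.lam ^ 5

lemma one_le_V : 1 ≤ h.V := by
  have := h.one_le
  have := h.one_le'
  have := h.one_le_lam
  exact Nat.mul_pos (Nat.mul_pos (by positivity) h.one_le') (by positivity)

lemma size_le_self (x : ℕ) : size x ≤ x := size_le.2 lt_two_pow_self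

lemma dom_W (hL : 0 < L0) : Dom (fun h : ProgInput L0 A => (h.sized hL).W) V := by
  have hm : Dom (fun h : ProgInput L0 A => h.m + 1) lam := by
    refine ⟨1, fun h => ?_⟩
    have h1 : h.m ≤ size h.G := Nat.clog_le_of_le_pow (lt_size_self _).le
    have h2 : size h.G ≤ h.lam := size_le_size (le_mul_of_pos_left _ h.one_le)
    show h.m + 1 ≤ _
    omega
  have hG : Dom (fun h : ProgInput L0 A => 2 ^ h.m) G := by
    refine ⟨2, fun h => (?_ : 2 ^ h.m ≤ _)⟩
    rcases h.one_le'.eq_or_lt with h1 | h1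
    · have : h.m = 0 := by rw [m, ← h1, Nat.clog_one_right]
      rw [this]; omega
    · have h2 : 2 ^ (h.m).pred < h.G := Nat.pow_pred_clog_lt_self one_lt_two h1
      have h3 : h.m = (h.m).pred + 1 :=
        (Nat.succ_pred_eq_of_pos (Nat.clog_pos one_lt_two h1)).symm
      rw [h3, pow_succ]; omega
  have hκ : Dom (fun h : ProgInput L0 A => h.κ) lam := by
    refine ⟨2 + size (A + 1), fun h => ?_⟩
    have h1 : h.K + h.m ≤ h.T * h.G * (h.T * h.G) * (A + 1) := by
      have h2 : h.m ≤ h.G := clog_two_le h.G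
      have h3 := h.one_le_mul
      have h4 := h.one_le
      calc h.K + h.m ≤ h.T * (h.G * (h.T * A)) * h.G + h.G * 1 := by
            gcongr
            · exact le_mul_of_pos_right _ h.one_le'
            · omega
        _ ≤ h.T * (h.G * (h.T * A)) * h.G + (h.T * h.G) * (h.T * h.G) := by
            gcongr; exact le_mul_of_pos_left _ h.one_le
        _ = _ := by ring
    have h2 := size_le_size h1
    have h3 := size_mul_le (h.T * h.G * (h.T * h.G)) (A + 1)
    have h4 := size_mul_le (h.T * h.G) (h.T * h.G)
    have h5 : size (A + 1) ≤ size (A + 1) * h.lam := le_mul_of_pos_right _ h.one_le_lam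
    have h6 : size (h.T * h.G) = h.lam := rfl
    rw [mul_add, add_mul]
    show size (h.K + h.m) ≤ _
    omega
  have hS : ∀ h : ProgInput L0 A, 1 ≤ h.lam * (h.G * (h.T * h.lam)) := fun h =>
    Nat.mul_pos h.one_le_lam (Nat.mul_pos h.one_le' (Nat.mul_pos h.one_le h.one_le_lam))
  have hT : ∀ h : ProgInput L0 A, 1 ≤ h.T * h.lam := fun h => Nat.mul_pos h.one_le h.one_le_lam
  have hU : Dom (fun h : ProgInput L0 A => h.U) fun h => h.lam * (h.G * (h.T * h.lam)) :=
    (hm.mul one_le_lam (fun h => Nat.mul_pos h.one_le' (hT h)) (hG.mul one_le' hT (((Dom.const_mul 2 (Dom.of_le fun h => le_mul_of_pos_right _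
      h.one_le_lam)).add (hκ.trans (Dom.of_le fun h => le_mul_of_pos_left _ h.one_le))).add
        (Dom.const 5)))).add (Dom.const (L0 + 1))
  have hsm : Dom (fun h : ProgInput L0 A => softMul (h.lam * (h.G * (h.T * h.lam))))
      fun h => h.lam * (h.G * (h.T * h.lam)) * h.lam ^ 2 := by
    refine ⟨9, fun h => ?_⟩
    have e : h.lam * (h.G * (h.T * h.lam)) = h.lam * h.lam * (h.T * h.G) := by ring
    have h1 := size_mul_le (h.lam * h.lam) (h.T * h.G)
    have h2 := size_mul_le h.lam h.lam
    have h3 := size_le_self h.lam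
    have h4 : size (h.T * h.G) = h.lam := rfl
    show softMul _ ≤ _
    rw [e]
    calc h.lam * h.lam * (h.T * h.G) * size (h.lam * h.lam * (h.T * h.G)) ^ 2
        ≤ h.lam * h.lam * (h.T * h.G) * (3 * h.lam) ^ 2 := by gcongr; omega
      _ = h.lam * h.lam * (h.T * h.G) * h.lam ^ 2 * 9 := by ring
      _ ≤ _ := by rw [mul_comm, ← e]; exact Nat.mul_le_mul_left 9 (le_succ _)
  exact Dom.trans (.mul (fun h => h.one_le) (fun h => Nat.mul_pos h.one_le_lam (Nat.mul_pos (hS h)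
    (pow_pos h.one_le_lam 2))) ⟨1, fun h => (one_mul _).ge⟩ (hm.mul one_le_lam (fun h =>
      Nat.mul_pos (hS h) (pow_pos h.one_le_lam 2)) ((hU.softMul hS).trans hsm)))
        (Dom.of_le fun h => (by rw [V]; ring : _ = _).le)

lemma pow_three_le : ∀ T : ℕ, T ^ 3 ≤ 2 ^ (2 * T - 1)
  | 0 => by norm_num
  | 1 => by norm_num
  | 2 => by norm_num
  | T + 3 => by
    have h := pow_three_le (T + 2)
    have : 2 * (T + 3) - 1 = 2 * (T + 2) - 1 + 2 := by omega
    rw [this, pow_add]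
    refine le_trans ?_ (Nat.mul_le_mul_right (2 ^ 2) h)
    nlinarith [Nat.zero_le (T ^ 3), Nat.zero_le (T ^ 2)]

lemma flag (hL : 0 < L0) (h1 : L0.factorial ≤ h.T) (h2 : 2 * A + 1 ≤ h.T) :
    (flagP.val (h.sized hL).env).toInt ≠ 0 := by
  obtain ⟨k, hk⟩ := dvd_multiplier hL h1
  have hk0 : 0 < k := Nat.pos_of_ne_zero fun h0 => by
    have := multiplier_pos h.T
    rw [hk, h0] at this; omega
  have hkT : k ≤ h.T := by
    have h3 : multiplier h.T ≤ h.T := (multiplier_le h.T).trans (by simp [h.one_le])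
    exact (le_mul_of_pos_left k hL).trans (hk ▸ h3)
  have hd : HasDigits h.g (multiplier h.T) (2 ^ h.m) fun e => (k * (h.c e).1, k * (h.c e).2) := by
    refine ⟨(h.digits' h.G_le).lt, fun e => ?_⟩
    have hk' : (k : ℚ) ≠ 0 := by positivity
    have hL' : (L0 : ℚ) ≠ 0 := by positivity
    rw [h.digits.eq e, digitCoeff, digitCoeff, hk]
    push_cast
    congr 2 <;> field_simp
  have key : ∀ x : ℤ, |x| ≤ (h.T * A : ℕ) → 2 * |(k : ℤ) * x| + 1 ≤ 2 ^ (2 * h.T - 1) := fun x hx => by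
    have h3 : |(k : ℤ) * x| ≤ (h.T * (h.T * A) : ℕ) := by
      rw [abs_mul, abs_cast, cast_mul h.T]
      exact mul_le_mul (by exact_mod_cast hkT) hx (abs_nonneg _) (by positivity)
    have h4 := pow_three_le h.T
    have h5 : 2 * (h.T * (h.T * A)) + 1 ≤ h.T ^ 3 := by
      calc 2 * (h.T * (h.T * A)) + 1 ≤ 2 * (h.T * (h.T * A)) + h.T * h.T := by
            have := Nat.mul_pos h.one_le h.one_le; omega
        _ = h.T * h.T * (2 * A + 1) := by ring
        _ ≤ h.T * h.T * h.T := by gcongr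
        _ = _ := by ring
    have h6 : ((2 * (h.T * (h.T * A)) + 1 : ℕ) : ℤ) ≤ ((2 ^ (2 * h.T - 1) : ℕ) : ℤ) :=
      Int.ofNat_le.2 (h5.trans h4)
    push_cast at h6 h3
    linarith
  have := (hd.flag (G := h.G) h.one_le h.card (fun e => ⟨key _ (h.small e).1, key _ (h.small e).2⟩)
    h.len h.eq).2.2
  rwa [show digitsP.val (encEnv h.m h.T h.G h.vs) = (h.sized hL).env from
    (h.sized hL).val_digitsP] at this

lemma exists_cost_le_of_small (M L0 A : ℕ) :
    ∃ C, ∀ h : ProgInput L0 A, h.T ≤ M → h.G ≤ L0 → interpP.cost (encInput h.T h.G h.vs) ≤ C := by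
  set B : ℤ := ((M * A : ℕ) : ℤ)
  set v : ℕ → (ℕ → ℤ × ℤ) → List (ℚ × ℚ) := fun T c => (range (2 * T)).map fun j =>
    ((polyEval (2 ^ j) ((range L0).map fun e => (c e).1) : ℚ) / (L0 : ℤ),
      (polyEval (2 ^ j) ((range L0).map fun e => (c e).2) : ℚ) / (L0 : ℤ)) with hv
  have hfin : ((fun z : ℕ × ℕ × (Fin L0 → ℤ × ℤ) => interpP.cost (encInput z.1 z.2.1 (v z.1 fun e =>
      if he : e < L0 then z.2.2 ⟨e, he⟩ else 0))) '' Set.Iic M ×ˢ Set.Iic L0 ×ˢ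
        Set.Icc (fun _ => (-B, -B)) fun _ => (B, B)).Finite :=
    ((Set.finite_Iic _).prod ((Set.finite_Iic _).prod (Set.finite_Icc _ _))).image _
  obtain ⟨C, hC⟩ := hfin.bddAbove
  refine ⟨C, fun h hT hG => ?_⟩
  have hB : ((h.T * A : ℕ) : ℤ) ≤ B := Int.ofNat_le.2 (Nat.mul_le_mul_right A hT)
  refine hC ⟨(h.T, h.G, fun e => h.c e), ⟨hT, hG, ?_, ?_⟩, ?_⟩
  · exact fun e => ⟨(abs_le.1 ((h.small e).1.trans hB)).1,
      (abs_le.1 ((h.small e).2.trans hB)).1⟩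
  · exact fun e => ⟨(abs_le.1 ((h.small e).1.trans hB)).2,
      (abs_le.1 ((h.small e).2.trans hB)).2⟩
  · have : h.vs = v h.T h.c := ext_getElem (by simp [hv, h.len]) fun j h1 h2 => by
      rw [h.getElem_vs hG j h1]; simp [hv]
    simp only [this]
    refine congrArg (fun w => interpP.cost (encInput h.T h.G w)) ?_
    refine map_congr_left fun j _ => ?_
    congr 4 <;>
    · refine map_congr_left fun e he => ?_
      dsimp only
      rw [dif_pos (List.mem_range.1 he)]

/-- The cost of Ben-Or and Tiwari's algorithm. -/
lemma dom_cost (hL : 0 < L0) (A : ℕ) : Dom (fun h : ProgInput L0 A =>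
    interpP.cost (encInput h.T h.G h.vs)) V := by
  set M := max L0.factorial (2 * A + 1)
  obtain ⟨a, ha⟩ := Exact.cheap_interpP
  obtain ⟨b, hb⟩ := (Dom.add (dom_W (A := A) hL) (.const 1)).const_mul a
  obtain ⟨s, hs⟩ := SlowCase.cheap_slowP (M := M) (L0 := L0)
  obtain ⟨d, hd⟩ := (Dom.add (dom_W (A := A) hL) (.const 1)).const_mul (a * s)
  obtain ⟨C, hC⟩ := exists_cost_le_of_small M L0 A
  refine ⟨b + d + C, fun h => ?_⟩
  have h1 : interpP.cost (encInput h.T h.G h.vs) ≤ a * ((h.sized hL).W + (if (flagP.val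
    (h.sized hL).env).toInt ≠ 0 then 0 else slowP.cost (encEnv h.m h.T h.G h.vs)) + 1) :=
      ha ⟨h.sized hL, rfl⟩
  have h2 : a * ((h.sized hL).W + 1) ≤ _ := hb h
  have h3 : a * s * ((h.sized hL).W + 1) ≤ _ := hd h
  rw [add_mul, add_mul]
  rcases le_or_gt M h.T with hT | hT
  · rw [if_pos (h.flag hL ((le_max_left _ _).trans hT) ((le_max_right _ _).trans hT))] at h1
    rw [add_zero] at h1
    exact h1.trans (by omega)
  rcases le_or_gt h.G L0 with hG | hG
  · have := le_mul_of_pos_right C (show 0 < h.V + 1 by omega)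
    exact (hC h hT.le hG).trans (by omega)
  · have h6 := hs
      { h.sized hL with
        g := h.g
        card := h.card
        lt_two_pow := (h.digits' h.G_le).lt
        eq := h.eq
        rat := fun e => ⟨digitCoeff L0 (h.c e), (h.digits.eq e).symm,
          (natAbs_num_le (N := (h.c e).1) hL rfl).2, (natAbs_num_le (N := (h.c e).2) hL rfl).2⟩
        T_le := hT.le
        le_G := hG.le
        G_le := h.G_le }
    have h7 : (if (flagP.val (h.sized hL).env).toInt ≠ 0 then 0 else
        slowP.cost (encEnv h.m h.T h.G h.vs)) ≤ s * ((h.sized hL).W + 1) := by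
      split_ifs
      · exact Nat.zero_le _
      · exact h6
    refine h1.trans ((Nat.mul_le_mul_left a (Nat.add_le_add_right (Nat.add_le_add_left h7 _) 1)).trans ?_)
    rw [add_right_comm, mul_add a, ← mul_assoc a s]
    omega

end ProgInput

end

section

open Comp Prog

noncomputable section

open SparseInterp.Comp

namespace Comp

variable {α β : Type}

/-- The computation `x` costs at most `K` bit operations, and its result satisfies `p`. -/
def Within (x : Comp α) (K : ℕ) (p : α → Prop) : Prop := x.bits ≤ K ∧ p x.val

variable {x : Comp α} {f : α → Comp β} {K L k : ℕ} {p : α → Prop} {q : β → Prop} {l : List α}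

lemma Within.mono (h : Within x K p) (hK : K ≤ L) : Within x L p := ⟨h.1.trans hK, h.2⟩

lemma Within.imp {p' : α → Prop} (h : Within x K p) (hp : ∀ a, p a → p' a) : Within x K p' :=
  ⟨h.1, hp _ h.2⟩

lemma Within.bind (h : Within x K p) (hf : ∀ a, p a → Within (f a) L q) :
    Within (x >>= f) (K + L) q :=
  ⟨Nat.add_le_add h.1 (hf _ h.2).1, (hf _ h.2).2⟩

lemma Within.bind_eq {a : α} (h : x.bits ≤ K) (ha : x.val = a) (hf : Within (f a) L q) :
    Within (x >>= f) (K + L) q := by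
  subst ha; exact ⟨Nat.add_le_add h hf.1, hf.2⟩

lemma Within.charge {a : α} (hk : k ≤ K) (ha : p a) : Within (charge k a) K p := ⟨hk, ha⟩

lemma Within.ite {c : Prop} [Decidable c] {y : Comp α} (hx : c → Within x K p)
    (hy : ¬ c → Within y K p) : Within (if c then x else y) K p := by
  split_ifs with h
  exacts [hx h, hy h]

lemma bits_mapList_le (h : ∀ a ∈ l, (f a).bits ≤ K) :
    (mapList f l).bits ≤ l.length * (K + 1) + 1 := by
  induction l with
  | nil => exact le_of_eq (by simp [mapList])
  | cons a l ih =>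
    grind [mapList, bits_bind, bits_charge, length_cons, add_mul, one_mul]

lemma Within.filterMapList {f : α → Comp (Option β)}
    (h : ∀ a ∈ l, Within (f a) K fun o => ∀ b ∈ o, q b) :
    Within (filterMapList f l) (l.length * (K + 1) + 1) fun r =>
      r.length ≤ l.length ∧ ∀ b ∈ r, q b := by
  refine ⟨?_, ?_⟩
  · induction l with
    | nil => exact le_of_eq (by simp [Comp.filterMapList])
    | cons a l ih =>
      have h1 := (h a (by simp)).1
      have h2 := ih fun b hb => h b (by simp [hb])
      simp only [Comp.filterMapList, bits_bind, length_cons, add_mul, one_mul] at h2 ⊢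
      cases (f a).val <;> (simp only [bits_charge]; omega)
  · rw [val_filterMapList]
    refine ⟨List.length_filterMap_le _ _, fun b hb => ?_⟩
    obtain ⟨a, ha, hb⟩ := mem_filterMap.1 hb
    exact (h a ha).2 b hb

lemma Within.filterList {f : α → Comp Bool} (h : ∀ a ∈ l, (f a).bits ≤ K) :
    Within (filterList f l) (l.length * (K + 1) + 1) fun r => r.Sublist l := by
  refine ⟨?_, by rw [val_filterList]; exact List.filter_sublist⟩
  induction l with
  | nil => exact le_of_eq (by simp [Comp.filterList])
  | cons a l ih =>
    grind [Comp.filterList, bits_bind, bits_charge, length_cons, add_mul, one_mul]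

lemma Within.foldList {f : β → α → Comp β} {Inv : ℕ → β → Prop} {s : β} (hs : Inv k s)
    (h : ∀ i b, ∀ a ∈ l, i < k + l.length → Inv i b → Within (f b a) K (Inv (i + 1))) :
    Within (foldList f s l) (l.length * (K + 1) + 1) (Inv (k + l.length)) := by
  induction l generalizing s k with
  | nil => exact ⟨le_of_eq (by simp [Comp.foldList]), hs⟩
  | cons a l ih =>
    have h1 := h k s a (by simp) (by simp) hs
    have h2 := ih (k := k + 1) h1.2 fun i b c hc hi =>
      h i b c (by simp [hc]) (by rw [length_cons]; omega)
    rw [length_cons, show k + (l.length + 1) = k + 1 + l.length by omega]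
    refine ⟨?_, h2.2⟩
    have h3 := h1.1
    have h4 := h2.1
    simp [Comp.foldList, bits_bind, bits_charge, add_mul, one_mul]; omega

end Comp

/-- The complex number `z` has the common denominator `L0`, and `B` bounds the numerators. -/
def Lat (L0 B : ℕ) (z : ℂ) : Prop :=
  ∃ v : ℤ × ℤ, |v.1| ≤ B ∧ |v.2| ≤ B ∧ z = toComplex (digitCoeff L0 v)

lemma Lat.zero (L0 B : ℕ) : Lat L0 B 0 :=
  ⟨0, by simp, by simp, by simp [toComplex, digitCoeff, ext_iff]⟩

lemma Lat.mono {L0 B B' : ℕ} {z : ℂ} (h : B ≤ B') : Lat L0 B z → Lat L0 B' z :=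
  fun ⟨v, h1, h2, hv⟩ => ⟨v, h1.trans (by exact_mod_cast h), h2.trans (by exact_mod_cast h), hv⟩

lemma Lat.add {L0 B B' : ℕ} {z w : ℂ} : Lat L0 B z → Lat L0 B' w → Lat L0 (B + B') (z + w) := by
  rintro ⟨v, h1, h2, rfl⟩ ⟨u, h3, h4, rfl⟩
  refine ⟨v + u, (abs_add_le _ _).trans (by push_cast; exact add_le_add h1 h3),
    (abs_add_le _ _).trans (by push_cast; exact add_le_add h2 h4), ?_⟩
  simp [toComplex, digitCoeff, ext_iff, add_div]

lemma Lat.neg {L0 B : ℕ} {z : ℂ} : Lat L0 B z → Lat L0 B (-z) := by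
  rintro ⟨v, h1, h2, rfl⟩
  refine ⟨-v, by simpa using h1, by simpa using h2, ?_⟩
  simp [toComplex, digitCoeff, ext_iff, neg_div]

/-- Bounds for the numbers that occur: natural numbers up to `Q`, and coefficients with the common
denominator `L0` and numerators up to `B`, have size at most `S`. -/
structure Sizes (L0 B : ℕ) where
  (Q S : ℕ)
  one_le : 1 ≤ Q
  nat : ∀ a ≤ Q, bitLen a ≤ S
  coef : ∀ z, Lat L0 B z → 2 * bitSize z + 1 ≤ S

/-- The polynomial has at most `ℓ` terms, of degree at most `X`, with numerators up to `B`. -/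
def Fine (L0 X B ℓ : ℕ) (g : UPoly) : Prop := (∀ t ∈ g, t.1 ≤ X ∧ Lat L0 B t.2) ∧ g.length ≤ ℓ

lemma Fine.mono {L0 X B ℓ X' B' ℓ' : ℕ} {g : UPoly} (h : Fine L0 X B ℓ g) (hX : X ≤ X')
    (hB : B ≤ B') (hℓ : ℓ ≤ ℓ') : Fine L0 X' B' ℓ' g :=
  ⟨fun t ht => ⟨(h.1 t ht).1.trans hX, (h.1 t ht).2.mono hB⟩, h.2.trans hℓ⟩

namespace Sizes

variable {L0 B : ℕ} (z : Sizes L0 B)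

/-- Bound for the cost of one operation. -/
def e : ℕ := 2 * z.S ^ 2

lemma one_le_S : 1 ≤ z.S := by have := z.nat 0 (Nat.zero_le _); simpa [bitLen] using this

lemma S_le_e : 2 * z.S ≤ z.e :=
  Nat.mul_le_mul_left 2 (Nat.le_self_pow two_ne_zero _)

lemma one_le_e : 2 ≤ z.e := by have := z.S_le_e; have := z.one_le_S; omega

variable {a b : ℕ}

lemma cost_le (ha : a ≤ z.Q) (hb : b ≤ z.Q) :
    bitLen a + bitLen b ≤ z.e ∧ bitLen a * bitLen b ≤ z.e := by
  have h1 := z.nat a ha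
  have h2 := z.nat b hb
  have := z.S_le_e
  exact ⟨by omega, (Nat.mul_le_mul h1 h2).trans (by rw [e, sq]; omega)⟩

lemma addN (ha : a ≤ z.Q) (hb : b ≤ z.Q) : Within (addN a b) z.e (· = a + b) :=
  ⟨(z.cost_le ha hb).1, rfl⟩
lemma subN (ha : a ≤ z.Q) (hb : b ≤ z.Q) : Within (subN a b) z.e (· = a - b) :=
  ⟨(z.cost_le ha hb).1, rfl⟩
lemma mulN (ha : a ≤ z.Q) (hb : b ≤ z.Q) : Within (mulN a b) z.e (· = a * b) :=
  ⟨(z.cost_le ha hb).2, rfl⟩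
lemma divN (ha : a ≤ z.Q) (hb : b ≤ z.Q) : Within (divN a b) z.e (· = a / b) :=
  ⟨(z.cost_le ha hb).2, rfl⟩
lemma modN (ha : a ≤ z.Q) (hb : b ≤ z.Q) : Within (modN a b) z.e (· = a % b) :=
  ⟨(z.cost_le ha hb).2, rfl⟩
lemma maxN (ha : a ≤ z.Q) (hb : b ≤ z.Q) : Within (maxN a b) z.e (· = max a b) :=
  ⟨(z.cost_le ha hb).1, rfl⟩
lemma ltN (ha : a ≤ z.Q) (hb : b ≤ z.Q) : Within (ltN a b) z.e fun _ => True :=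
  ⟨(z.cost_le ha hb).1, trivial⟩
lemma eqN (ha : a ≤ z.Q) (hb : b ≤ z.Q) : Within (eqN a b) z.e fun _ => True :=
  ⟨(z.cost_le ha hb).1, trivial⟩

lemma cost_le' {c d : ℂ} (hc : Lat L0 B c) (hd : Lat L0 B d) :
    (bitSize c + bitSize d + 1) ^ 2 ≤ z.e := by
  have h1 := z.coef c hc
  have h2 := z.coef d hd
  exact (pow_le_pow_left (by omega : _ ≤ z.S) 2).trans (le_mul_of_pos_left _ two_pos)

lemma addC {c d : ℂ} (hc : Lat L0 B c) (hd : Lat L0 B d) : Within (addC c d) z.e (· = c + d) :=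
  ⟨z.cost_le' hc hd, rfl⟩
lemma eqC {c d : ℂ} (hc : Lat L0 B c) (hd : Lat L0 B d) : Within (eqC c d) z.e fun _ => True :=
  ⟨z.cost_le' hc hd, trivial⟩
lemma negC {c : ℂ} (hc : Lat L0 B c) : Within (negC c) z.e (· = -c) :=
  ⟨(pow_le_pow_left (by omega) 2).trans (z.cost_le' hc hc), rfl⟩

/-! ### Primes and vectors -/

lemma isPrimeC {c : ℕ} (hc : 2 ≤ c) (hQ : c ≤ z.Q) : (isPrimeC c).bits ≤ 4 * (c * z.e) := by
  have h1 : Within (SparseInterp.isPrimeC c) ((range' 2 (c - 2)).length * (z.e + z.e + 1) + 1 + (c + z.e))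
      fun _ => True := by
    refine .bind (Within.filterList (K := z.e + z.e) fun k hk => ?_)
      fun r hr => .bind (p := fun m => m ≤ z.Q) (K := c) ?_ fun m hm => z.eqN hm (Nat.zero_le _)
    · rw [mem_range'_1] at hk
      exact ((z.modN hQ (by omega)).bind fun m hm => z.eqN (hm ▸ (mod_le _ _).trans hQ)
        (Nat.zero_le _)).1
    · have hr := hr.length_le
      rw [length_range'] at hr
      exact ⟨show r.length + 1 ≤ c by omega, show r.length ≤ z.Q by omega⟩
  have h2 := z.one_le_e
  obtain ⟨c, rfl⟩ := Nat.exists_eq_add_of_le' hc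
  have h3 := Nat.mul_le_mul_left c z.one_le_e
  refine h1.1.trans ?_
  grind

lemma findPrime {q : ℕ} (hq : q ≤ z.Q) (fuel : ℕ) {c : ℕ} (hc : 2 ≤ c) :
    c ≤ (findPrime fuel c).val ∧ ((findPrime fuel c).val ≤ q →
      (findPrime fuel c).bits ≤ (q + 1 - c) * (6 * (q * z.e))) := by
  have he := z.one_le_e
  have hcq : ∀ {a : ℕ}, c ≤ q → a ≤ 4 * (q * z.e) + 2 * (q * z.e) → a ≤
      (q + 1 - c) * (6 * (q * z.e)) := fun h ha =>
    (ha.trans (by omega)).trans (le_mul_of_pos_left _ (by omega))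
  induction fuel generalizing c with
  | zero =>
    refine ⟨le_rfl, fun h => hcq h ?_⟩
    have := Nat.mul_le_mul (hc.trans h) he
    show 1 ≤ _
    omega
  | succ fuel ih =>
    simp only [SparseInterp.findPrime, val_bind, bits_bind]
    split_ifs with hp
    · refine ⟨le_rfl, fun h => hcq h ?_⟩
      have := z.isPrimeC hc (h.trans hq)
      have := Nat.mul_le_mul_right z.e (show c ≤ q from h)
      have := Nat.mul_le_mul (hc.trans h) he
      simp only [bits_charge]
      omega
    · simp only [val_bind, bits_bind, val_addN]
      obtain ⟨h1, h2⟩ := ih (c := c + 1) (by omega) fun {a} h ha =>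
        (ha.trans (by omega)).trans (le_mul_of_pos_left _ (by omega))
      refine ⟨by omega, fun h => ?_⟩
      have h3 := h2 h
      have h4 := z.isPrimeC hc (by omega)
      have h5 := Nat.mul_le_mul_right z.e (show c ≤ q by omega)
      have h6 := (z.addN (a := c) (b := 1) (by omega) z.one_le).1
      have h7 : z.e ≤ q * z.e := le_mul_of_pos_left _ (by omega)
      rw [show q + 1 - c = q + 1 - (c + 1) + 1 by omega, add_mul, one_mul]
      omega

lemma powersMod {d p : ℕ} (hdp : p * d ≤ z.Q) (hd : d ≤ z.Q) (hp : p ≤ z.Q) (m : ℕ) {c : ℕ}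
    (hc : c < p) : (powersMod d p m c).bits ≤ m * (3 * z.e) + 1 := by
  induction m generalizing c with
  | zero => exact le_of_eq (by simp [SparseInterp.powersMod])
  | succ m ih =>
    have he := z.one_le_e
    have h1 := (z.mulN (a := c) (b := d) (hc.le.trans hp) hd).1
    have h2 : c * d ≤ z.Q := (Nat.mul_le_mul_right d hc.le).trans hdp
    have h3 := (z.modN h2 hp).1
    grind [SparseInterp.powersMod, bits_bind, val_mulN, val_modN, bits_charge, add_mul, mod_lt]

lemma substVector {n d p : ℕ} (hn : 1 ≤ n) (hdp : p * d ≤ z.Q) (hd : d ≤ z.Q) (hp : p ≤ z.Q)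
    (h1 : 1 < p) : (substVector n d p).bits ≤ 5 * (n * z.e) := by
  have h2 := (z.modN (a := 1) z.one_le hp).1
  have h3 := z.powersMod hdp hd hp n (c := 1 % p) (mod_lt _ (by omega))
  have h4 : z.e ≤ n * z.e := le_mul_of_pos_left _ hn
  grind [SparseInterp.substVector, bits_bind, val_modN, z.one_le_e]

lemma addAt {p : ℕ} (hp : p ≤ z.Q) (k : ℕ) {l : List ℕ} (hl : ∀ x ∈ l, x ≤ z.Q) :
    (addAt p k l).bits ≤ (l.length + 1) * z.e := by
  have he := z.one_le_e
  induction l generalizing k with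
  | nil => cases k <;> simpa [SparseInterp.addAt] using (by omega : 1 ≤ z.e)
  | cons x l ih =>
    rw [length_cons, add_mul, one_mul]
    cases k with
    | zero =>
      have := (z.addN (hl x (by simp)) hp).1
      have h1 : z.e ≤ (l.length + 1) * z.e := le_mul_of_pos_left _ (by simp)
      grind [SparseInterp.addAt, bits_bind, bits_charge]
    | succ k =>
      grind [SparseInterp.addAt, bits_bind, bits_charge]

lemma dot {x y : ℕ} (hx : x ≤ z.Q) (hy : y ≤ z.Q) {l s : List ℕ} (hl : ∀ i ∈ l, i ≤ x)
    (hs : ∀ i ∈ s, i ≤ y) (hQ : l.length * (x * y) ≤ z.Q) :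
    Within (dot l s) (l.length * (2 * z.e) + 1) (· ≤ l.length * (x * y)) := by
  induction l generalizing s with
  | nil => cases s <;> exact ⟨by simp [SparseInterp.dot], by simp [SparseInterp.dot]⟩
  | cons i l ih =>
    cases s with
    | nil => exact ⟨by simp [SparseInterp.dot], by simp [SparseInterp.dot]⟩
    | cons j s =>
      rw [length_cons, add_mul, one_mul] at hQ
      have h1 : i * j ≤ x * y := Nat.mul_le_mul (hl i (by simp)) (hs j (by simp))
      rw [length_cons]
      refine ((ih (s := s) (fun k hk => hl k (by simp [hk])) (fun k hk => hs k (by simp [hk]))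
        (by omega)).bind fun r hr => (z.mulN ((hl i (by simp)).trans hx)
          ((hs j (by simp)).trans hy)).bind fun m hm => ((z.addN (b := r) (hm ▸ by omega)
            (by omega)).imp fun s hs => ?_)).mono (by ring_nf; omega)
      subst hm hs
      rw [add_mul, one_mul]
      omega

lemma sumN {x : ℕ} {l : List ℕ} (hl : ∀ i ∈ l, i ≤ x) (hx : x ≤ z.Q) (hQ : l.length * x ≤ z.Q) :
    Within (sumN l) (l.length * (z.e + 1) + 1) (· ≤ z.Q) := by
  refine (Within.foldList (k := 0) (Inv := fun i s => s ≤ i * x) (Nat.zero_le _)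
    fun i s a ha hi hs => (z.addN (hs.trans (le_trans (Nat.mul_le_mul_right x (by omega)) hQ))
      ((hl a ha).trans hx)).imp fun b hb => ?_).imp fun b hb => ?_
  · grind
  · exact hb.trans (by rwa [zero_add])

/-! ### Sparse polynomials -/

lemma addTerm {e B1 b ℓ : ℕ} {c : ℂ} (he : e ≤ z.Q) (hc : Lat L0 b c) (hB : B1 + b ≤ B)
    {g : UPoly} (hg : Fine L0 z.Q B1 ℓ g) :
    Within (addTerm e c g) ((ℓ + 1) * (4 * z.e)) (Fine L0 z.Q (B1 + b) (ℓ + 1)) := by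
  have h2 := z.one_le_e
  have h0 := Lat.zero L0 B
  have hc' : Lat L0 (B1 + b) c := hc.mono (by omega)
  induction g generalizing ℓ with
  | nil =>
    refine Within.mono (K := z.e + 1) ((z.eqC (hc'.mono hB) h0).bind fun _ _ => .ite
      (fun _ => .charge le_rfl ⟨by simp, by simp⟩) fun _ => .charge le_rfl
        ⟨by simpa using ⟨he, hc'⟩, by simp⟩) ?_
    nlinarith
  | cons t g ih =>
    obtain ⟨e', c'⟩ := t
    obtain ⟨ℓ, rfl⟩ : ∃ k, ℓ = k + 1 := ⟨ℓ - 1, by have := hg.2; rw [length_cons] at this; omega⟩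
    have ht := hg.1 (e', c') (by simp)
    have hg' : Fine L0 z.Q B1 ℓ g := ⟨fun t ht => hg.1 t (by simp [ht]), by simpa using hg.2⟩
    have hg'' := hg'.mono le_rfl (Nat.le_add_right B1 b) le_rfl
    have cons : ∀ {e c} {g : UPoly} {k : ℕ}, e ≤ z.Q → Lat L0 (B1 + b) c →
        Fine L0 z.Q (B1 + b) k g → Fine L0 z.Q (B1 + b) (k + 1) ((e, c) :: g) := fun he hc hg =>
      ⟨fun t ht => (mem_cons.1 ht).elim (fun h => h ▸ ⟨he, hc⟩) (hg.1 t), by simpa using hg.2⟩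
    have hcc := ht.2.add hc
    have hg2 := cons ht.1 (ht.2.mono (Nat.le_add_right _ _)) hg''
    have hK : 3 * z.e + 1 ≤ (ℓ + 1) * (4 * z.e) + z.e + 1 := by nlinarith
    refine Within.mono (K := z.e + ((ℓ + 1) * (4 * z.e) + z.e + 1)) ((z.eqN he ht.1).bind fun _ _ =>
      .ite (fun _ => ?_) fun _ => ?_) (by nlinarith)
    · refine Within.mono (K := z.e + (z.e + 1)) ((z.addC (ht.2.mono (by omega)) (hc'.mono hB)).bind
        fun s hs => (z.eqC (by subst hs; exact hcc.mono hB) h0).bind fun _ _ => .ite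
          (fun _ => .charge le_rfl (hg''.mono le_rfl le_rfl (by omega))) fun _ => .charge le_rfl
            ((cons ht.1 (hs ▸ hcc) hg'').mono le_rfl le_rfl (by omega))) (by omega)
    · refine Within.mono (K := z.e + ((ℓ + 1) * (4 * z.e) + 1)) ((z.ltN he ht.1).bind fun _ _ => .ite
        (fun _ => ?_) fun _ => ?_) (by omega)
      · exact Within.mono (K := z.e + 1) ((z.eqC (hc'.mono hB) h0).bind fun _ _ => .ite
          (fun _ => .charge le_rfl (hg2.mono le_rfl le_rfl (by omega))) fun _ => .charge le_rfl
            (cons he hc' hg2)) (by nlinarith)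
      · exact (ih hg').bind fun g' hg' => .charge le_rfl
          (cons ht.1 (ht.2.mono (Nat.le_add_right _ _)) hg')

lemma reduceMod {p B1 ℓ : ℕ} {g : UPoly} (hp : p ≤ z.Q) (hB : ℓ * B1 ≤ B)
    (hg : Fine L0 z.Q B1 ℓ g) : (reduceMod p g).bits ≤ 6 * ((ℓ + 1) ^ 2 * z.e) := by
  have he := z.one_le_e
  have hl := hg.2
  have h : Within (SparseInterp.reduceMod p g) (g.length * (z.e + (ℓ + 1) * (4 * z.e) + 1) + 1)
      fun _ => True := by
    refine (Within.foldList (k := 0) (Inv := fun i r => Fine L0 z.Q (i * B1) i r)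
      ⟨by simp, by simp⟩ fun i r t ht hi hr => ?_).imp fun _ _ => trivial
    have ht' := hg.1 t ht
    refine (z.modN ht'.1 hp).bind fun m hm => ?_
    have h1 := z.addTerm (e := m) (hm ▸ (mod_le _ _).trans ht'.1) ht'.2
      (le_trans (le_of_eq (by ring)) ((Nat.mul_le_mul_right B1 (by omega : i + 1 ≤ ℓ)).trans hB)) hr
    rw [show i * B1 + B1 = (i + 1) * B1 by ring] at h1
    exact h1.mono (by gcongr; omega)
  refine h.1.trans ?_
  have h3 := Nat.mul_le_mul_right (z.e + (ℓ + 1) * (4 * z.e) + 1) hl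
  nlinarith

/-- The term has `n` exponents that are at most `X`, and numerators up to `b`. -/
def _root_.SparseInterp.TermFine (L0 n X b : ℕ) (u : Term) : Prop := u.1.length = n ∧ (∀ x ∈ u.1, x ≤ X) ∧ Lat L0 b u.2

section

variable {n T X p B1 b ℓ : ℕ} {s : List ℕ} {g : UPoly} {u : Term}

lemma subTerms (hX : X ≤ z.Q) (hp : p ≤ z.Q) (hs : ∀ x ∈ s, x ≤ p) (hQ : n * (X * p) ≤ z.Q)
    (hB : B1 + b ≤ B) (hℓ : ℓ ≤ 2 * T) (hT : 1 ≤ T) (hn : 1 ≤ n) (q : ℕ) (hq : q ≤ z.Q)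
    (hg : Fine L0 z.Q B1 ℓ g) (hu : TermFine L0 n X b u) :
    Within (subTerm s g u) (16 * ((n + T) * z.e)) (Fine L0 z.Q (B1 + b) (ℓ + 1)) ∧
    Within (subTermMod q s g u) (16 * ((n + T) * z.e)) (Fine L0 z.Q (B1 + b) (ℓ + 1)) := by
  obtain ⟨h1, h2, h3⟩ := hu
  have he := z.one_le_e
  have h4 := z.dot hX hp h2 hs (by rwa [h1])
  rw [h1] at h4
  have h5 : (ℓ + 1) * (4 * z.e) ≤ 8 * (T * z.e) + 4 * z.e := by
    calc _ ≤ (2 * T + 1) * (4 * z.e) := by gcongr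
      _ = _ := by ring
  have h6 : z.e ≤ n * z.e := le_mul_of_pos_left _ hn
  have h7 : z.e ≤ T * z.e := le_mul_of_pos_left _ hT
  have h8 : n * (2 * z.e) = 2 * (n * z.e) := by ring
  have h9 : 16 * ((n + T) * z.e) = 16 * (n * z.e) + 16 * (T * z.e) := by ring
  refine ⟨(h4.bind fun d hd => (z.negC (h3.mono (by omega))).bind fun c hc =>
    z.addTerm (hd.trans hQ) (hc ▸ h3.neg) hB hg).mono (by omega),
    (h4.bind fun d hd => (z.modN (hd.trans hQ) hq).bind fun m hm => (z.negC (h3.mono (by omega))).bind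
      fun c hc => z.addTerm (hm ▸ (mod_le _ _).trans (hd.trans hQ)) (hc ▸ h3.neg) hB hg).mono
        (by omega)⟩

lemma foldSub {h : List Term} (hX : X ≤ z.Q) (hp : p ≤ z.Q) (hs : ∀ x ∈ s, x ≤ p)
    (hQ : n * (X * p) ≤ z.Q) (hB : B1 + T * b ≤ B) (hT : 1 ≤ T) (hn : 1 ≤ n) (q : ℕ) (hq : q ≤ z.Q)
    (hg : Fine L0 z.Q B1 T g) (hu : ∀ u ∈ h, TermFine L0 n X b u) (hh : h.length ≤ T) :
    (foldList (subTerm s) g h).bits ≤ 18 * (T * ((n + T) * z.e)) ∧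
    (foldList (subTermMod q s) g h).bits ≤ 18 * (T * ((n + T) * z.e)) := by
  have h1 : ∀ i < h.length, B1 + i * b + b ≤ B := fun i hi => by
    have := Nat.mul_le_mul_right b (show i + 1 ≤ T by omega)
    rw [add_mul, one_mul] at this
    omega
  have hfin : h.length * (16 * ((n + T) * z.e) + 1) + 1 ≤ 18 * (T * ((n + T) * z.e)) := by
    have h2 : 2 ≤ (n + T) * z.e := z.one_le_e.trans (le_mul_of_pos_left _ (by omega))
    nlinarith
  have h0 : Fine L0 z.Q (B1 + 0 * b) (T + 0) g := by simpa using hg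
  have step : ∀ i u g, u ∈ h → i < 0 + h.length → Fine L0 z.Q (B1 + i * b) (T + i) g → _ :=
    fun i u g hmem hi hI => z.subTerms (T := T) hX hp hs hQ (h1 i (by omega)) (by omega) hT hn q hq hI
      (hu u hmem)
  have e : ∀ i, B1 + i * b + b = B1 + (i + 1) * b := fun i => by ring
  exact ⟨(Within.foldList (k := 0) (Inv := fun i => Fine L0 z.Q (B1 + i * b) (T + i)) h0
      fun i g u hm hi hI => e i ▸ (step i u g hm hi hI).1).1.trans hfin,
    (Within.foldList (k := 0) (Inv := fun i => Fine L0 z.Q (B1 + i * b) (T + i)) h0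
      fun i g u hm hi hI => e i ▸ (step i u g hm hi hI).2).1.trans hfin⟩

/-! ### Candidates -/

lemma classTerm {r : ℕ} {a : ℂ} (hX : X ≤ z.Q) (hp : p ≤ z.Q) (hr : r ≤ z.Q) (hB : B1 ≤ B)
    (ha : Lat L0 B a) (hT : 1 ≤ T) (hg : Fine L0 X B1 T g) :
    Within (classTerm p r a g) (5 * (T * z.e)) fun o => ∀ x ∈ o, x ≤ X := by
  have he := z.one_le_e
  have h1 : Within (SparseInterp.classTerm p r a g) (g.length * (z.e + z.e + 1) + 1 + (z.e + 1))
      fun o => ∀ x ∈ o, x ≤ X := by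
    refine (Within.filterList (K := z.e + z.e) fun t ht => ((z.modN ((hg.1 t ht).1.trans hX) hp).bind
      fun m hm => z.eqN (hm ▸ (mod_le _ _).trans ((hg.1 t ht).1.trans hX)) hr).1).bind fun l hl => ?_
    split
    · rename_i e c
      have ht := hg.1 _ (hl.subset (List.mem_singleton.2 rfl))
      exact (z.eqC (ht.2.mono hB) ha).bind fun _ _ => .ite
        (fun _ => .charge le_rfl (by simpa using ht.1)) fun _ => .charge le_rfl (by simp)
    · exact .charge (by omega) (by simp)
  refine h1.mono ?_
  have h3 := Nat.mul_le_mul_right (z.e + z.e + 1) hg.2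
  nlinarith

lemma termExponents {r γ : ℕ} {a : ℂ} (hX : X ≤ z.Q) (hp : p ≤ z.Q) (hr : r ≤ z.Q) (hB : B1 ≤ B)
    (ha : Lat L0 B a) (hT : 1 ≤ T) (hγ : γ ≤ X) {gs : List UPoly}
    (hgs : ∀ g ∈ gs, Fine L0 X B1 T g) :
    Within (termExponents p r a γ gs) (gs.length * (11 * (T * z.e)) + 1) fun o =>
      ∀ l ∈ o, l.length = gs.length ∧ ∀ x ∈ l, x ≤ X := by
  have he := z.one_le_e
  have hTe : z.e ≤ T * z.e := le_mul_of_pos_left _ hT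
  induction gs with
  | nil => exact .charge (by simp) (by simp)
  | cons g gs ih =>
    have ih := ih fun g hg => hgs g (by simp [hg])
    rw [length_cons]
    refine Within.mono (K := 5 * (T * z.e) + (z.e + (z.e + (z.e + z.e + (z.e +
      (gs.length * (11 * (T * z.e)) + 1 + 1)))))) ((z.classTerm hX hp hr hB ha hT
        (hgs g (by simp))).bind fun o ho => ?_) (by rw [add_mul, one_mul]; omega)
    cases o with
    | none => exact .charge (by omega) (by simp)
    | some β =>
      have hβ : β ≤ X := ho β rfl
      refine (z.ltN (hβ.trans hX) (hγ.trans hX)).bind fun _ _ => .ite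
        (fun _ => .charge (by omega) (by simp)) fun _ => (z.subN (hβ.trans hX) (hγ.trans hX)).bind
          fun δ hδ => ?_
      have hδ : δ ≤ X := hδ ▸ (sub_le _ _).trans hβ
      refine Within.mono (K := z.e + (z.e + (z.e + (gs.length * (11 * (T * z.e)) + 1 + 1))))
        ((z.modN (hδ.trans hX) hp).bind fun m hm => (z.eqN (hm ▸ (mod_le _ _).trans
        (hδ.trans hX)) (Nat.zero_le _)).bind fun _ _ => .ite (fun _ => (z.divN (hδ.trans hX) hp).bind
          fun e he' => ih.bind fun o ho => ?_) fun _ => .charge (by omega) (by simp)) (by omega)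
      cases o with
      | none => exact .charge le_rfl (by simp)
      | some l =>
        have := ho l rfl
        refine .charge le_rfl ?_
        rintro _ ⟨⟩
        refine ⟨by simp [this.1], fun x hx => (mem_cons.1 hx).elim (fun h => ?_) (this.2 x)⟩
        rw [h, he']
        exact (Nat.div_le_self _ _).trans hδ

lemma tsTerm {y D : ℕ} {t : ℕ × ℂ} (hX : X ≤ z.Q) (hp : p ≤ z.Q) (hy : y ≤ z.Q) (hB : B1 ≤ B)
    (hT : 1 ≤ T) (hn : 1 ≤ n) (hs : ∀ x ∈ s, x ≤ y) (hQ : n * (X * y) ≤ z.Q) (hQ' : n * X ≤ z.Q)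
    (hD : D ≤ z.Q) (ht : t.1 ≤ z.Q ∧ Lat L0 B1 t.2) (hg : Fine L0 X B1 T g) {gs : List UPoly}
    (hgs : ∀ g ∈ gs, Fine L0 X B1 T g) (hlen : gs.length = n) :
    Within (tsTerm p D s g gs t) (26 * (n * (T * z.e))) fun o => ∀ u ∈ o, TermFine L0 n X B1 u := by
  have he := z.one_le_e
  have hTe : z.e ≤ T * z.e := le_mul_of_pos_left _ hT
  have hnT : T * z.e ≤ n * (T * z.e) := le_mul_of_pos_left _ hn
  have hne : n * z.e ≤ n * (T * z.e) := Nat.mul_le_mul_left n hTe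
  have hn' : n ≤ n * z.e := le_mul_of_pos_right _ (by omega)
  refine Within.mono (K := 5 * (T * z.e) + (n * (11 * (T * z.e)) + 1 + (n * (2 * z.e) + 1 + (z.e +
    (n * (z.e + 1) + 1 + (z.e + 1)))))) ((z.classTerm hX hp ht.1 hB (ht.2.mono hB) hT hg).bind
      fun o ho => ?_) (by
    have e1 : n * (11 * (T * z.e)) = 11 * (n * (T * z.e)) := by ring
    have e2 : n * (2 * z.e) = 2 * (n * z.e) := by ring
    rw [e1, e2, mul_add, mul_one]; omega)
  cases o with
  | none => exact .charge (by omega) (by simp)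
  | some γ =>
    refine (hlen ▸ z.termExponents hX hp ht.1 hB (ht.2.mono hB) hT (ho γ rfl) hgs).bind fun o ho' => ?_
    cases o with
    | none => exact .charge (by omega) (by simp)
    | some l =>
      obtain ⟨h1, h2⟩ := ho' l rfl
      subst h1
      exact (z.dot hX hy h2 hs hQ).bind fun d hd => (z.eqN (hd.trans hQ) ((ho γ rfl).trans hX)).bind
        fun _ _ => .ite (fun _ => (z.sumN h2 hX hQ').bind fun m hm => (z.ltN hm hD).bind fun _ _ => .ite
          (fun _ => .charge le_rfl (by rintro _ ⟨⟩; exact ⟨rfl, h2, ht.2⟩))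
            fun _ => .charge le_rfl (by simp)) fun _ => .charge (by omega) (by simp)

end

end Sizes

end

lemma Lat.sum {ι : Type*} {L0 A : ℕ} (s : Finset ι) {f : ι → ℂ} (h : ∀ i ∈ s, Lat L0 A (f i)) :
    Lat L0 (s.card * A) (∑ i ∈ s, f i) := by
  classical
  induction s using Finset.induction_on with
  | empty => exact .zero _ _
  | insert i s hi ih =>
    rw [Finset.sum_insert hi, Finset.card_insert_of_notMem hi, add_mul, one_mul,
      add_comm (f i)]
    exact (ih fun j hj => h j (by simp [hj])).add (h i (by simp))

lemma lat_mapDomain {M : Type*} {L0 A T : ℕ} (φ : M → ℕ) {F : M →₀ ℂ} (h : ∀ m, Lat L0 A (F m))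
    (hT : F.support.card ≤ T) (e : ℕ) : Lat L0 (T * A) (mapDomain φ F e) := by
  rw [mapDomain, Finsupp.sum_apply]
  refine (Lat.sum _ fun m _ => ?_).mono (Nat.mul_le_mul_right A hT)
  simp only [single_apply]
  split_ifs
  exacts [h m, .zero _ _]

lemma Rep.fine {M : Type*} {L0 A X T : ℕ} {φ : M → ℕ} {F : M →₀ ℂ} {g : UPoly}
    (hg : Rep g (mapDomain φ F)) (hX : ∀ m ∈ F.support, φ m ≤ X)
    (h : ∀ m, Lat L0 A (F m)) (hT : F.support.card ≤ T) : Fine L0 X (T * A) T g := by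
  classical
  refine ⟨fun t ht => ?_, ?_⟩
  · obtain ⟨h1, h2⟩ := (hg.mem_iff t.1 t.2).1 ht
    rw [← h2] at h1 ⊢
    obtain ⟨m, hm, h3⟩ := mem_image.1 (mapDomain_support
      (mem_support_iff.2 h1))
    exact ⟨h3 ▸ hX m hm, lat_mapDomain φ h hT _⟩
  · rw [hg.length_eq]
    exact (card_le_card mapDomain_support).trans (Finset.card_image_le.trans hT)

/-- The data of a run with bounded coefficients. -/
structure CostSetup {n : ℕ} (f : MvPolynomial (Fin n) ℂ) (T0 D p L0 A : ℕ) extends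
    Setup f T0 D p where
  z : Sizes L0 (2 * (T0 * (T0 * A)))
  lat : ∀ m, Lat L0 A (f.coeff m)
  n_pos : 1 ≤ n
  T_pos : 1 ≤ T0
  D_pos : 1 ≤ D
  le_Q : 4 * (n * (T0 * (D * (p * p)))) ≤ z.Q
  I : ℕ
  P : Prog
  bits_interpolate : ∀ G s, 2 * T0 * (2 * p) ≤ z.Q → s.length = n → (∀ x ∈ s, x ≤ 2 * p) → G ≤ 2 * D * p → 1 ≤ G →
    (∀ m ∈ f.support, weight s m < G) →
      (interpolate P (fun x => eval x f) T0 G s).bits ≤ I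

namespace CostSetup

variable {n T0 D p L0 A T : ℕ} {f : MvPolynomial (Fin n) ℂ} (c : CostSetup f T0 D p L0 A)
  {rows : List Row} {h : List Term} {row : Row}

abbrev R (c : CostSetup f T0 D p L0 A) : ℕ := (n + T0) * c.z.e
/-- The cost of one pass, without the interpolations. -/
abbrev Y (c : CostSetup f T0 D p L0 A) : ℕ := n * (T0 * (T0 * c.R))
abbrev B1 (_ : CostSetup f T0 D p L0 A) : ℕ := T0 * A

include c in
lemma pos : 1 ≤ n ∧ 1 ≤ T0 ∧ 1 ≤ D ∧ 2 ≤ p ∧ 2 ≤ c.z.e :=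
  ⟨c.n_pos, c.T_pos, c.D_pos, c.prime.two_le, c.z.one_le_e⟩

lemma Q_facts : n * (2 * D * p * (2 * p)) ≤ c.z.Q ∧ 2 * T0 * (2 * p) ≤ c.z.Q ∧ p * p ≤ c.z.Q ∧
    8 * (n * T0) ≤ c.z.Q ∧ 2 * D * p ≤ c.z.Q ∧ n * (2 * D * p) ≤ c.z.Q ∧ p ≤ c.z.Q := by
  obtain ⟨hn, hT, hD, hp, -⟩ := c.pos
  have key : ∀ {a b d e x : ℕ}, a ≤ n → b ≤ T0 → d ≤ D → e ≤ p * p → x = 4 * (a * (b * (d * e))) →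
      x ≤ c.z.Q := fun ha hb hd he hx => hx.le.trans (le_trans (by gcongr) c.le_Q)
  have h1 : 2 * p ≤ p * p := Nat.mul_le_mul_right p hp
  have h2 := key hn hT hD le_rfl rfl
  have h3 := key hn hT le_rfl h1 rfl
  have h4 := key le_rfl hT le_rfl h1 rfl
  refine ⟨key le_rfl hT le_rfl le_rfl (by ring), key hn le_rfl hD (show p ≤ _ by omega) (by ring),
    by omega, key le_rfl le_rfl hD (show 2 ≤ _ by omega) (by ring), ?_, ?_, by omega⟩ <;> linarith

lemma R_facts : T0 ≤ c.R ∧ n ≤ c.R ∧ c.z.e ≤ c.R ∧ T0 ≤ n * T0 ∧ c.R ≤ T0 * c.R ∧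
    T0 * c.R ≤ n * (T0 * c.R) ∧ n * (T0 * c.R) ≤ c.Y ∧ T0 * (T0 * c.R) ≤ c.Y ∧
    c.B1 + T0 * A ≤ 2 * (T0 * (T0 * A)) := by
  obtain ⟨hn, hT, -, -, he⟩ := c.pos
  have h1 : n + T0 ≤ c.R := le_mul_of_pos_right _ (by omega)
  have h2 : c.R ≤ T0 * c.R := le_mul_of_pos_left _ hT
  have h3 : 1 * (T0 * A) ≤ T0 * (T0 * A) := Nat.mul_le_mul_right _ hT
  exact ⟨by omega, by omega, le_mul_of_pos_left _ (by omega), le_mul_of_pos_left _ hn, h2,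
    le_mul_of_pos_left _ hn, Nat.mul_le_mul_left n (Nat.mul_le_mul_left T0 h2),
    le_mul_of_pos_left _ hn, by rw [B1]; omega⟩

lemma bits_params {n T Q : ℕ} {L B : ℕ} (z : Sizes L B) (hQ : z.Q = Q) (h : 8 * (n * T) ≤ Q)
    (hn : 1 ≤ n) (hT : 1 ≤ T) {T' : ℕ} (hT' : T' ≤ T) : (params n T').bits ≤ 10 * z.e := by
  subst hQ
  have h1 : (n - 1) * (T' - 1) ≤ n * T := Nat.mul_le_mul (by omega) (by omega)
  have h2 : (n - 1) * T' ≤ n * T := Nat.mul_le_mul (by omega) hT'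
  have h3 : n ≤ n * T := le_mul_of_pos_right _ hT
  have h4 : T ≤ n * T := le_mul_of_pos_left _ hn
  have he := z.one_le_e
  have : Within (params n T') (z.e + (z.e + (z.e + (z.e + (z.e + (z.e + (z.e + (z.e +
      (z.e + 1))))))))) fun _ => True :=
    (z.subN (by omega) (by omega)).bind fun m hm => (z.subN (by omega) (by omega)).bind fun k hk =>
      (z.mulN (by omega) (by omega)).bind fun a ha => (z.mulN (by omega) (by omega)).bind fun b hb =>
        by
          subst hm hk ha hb
          exact (z.mulN (by omega) (by omega)).bind fun x hx => (z.addN (by omega) (by omega)).bind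
            fun y hy => (z.addN (by omega) (by omega)).bind fun v hv =>
              (z.addN (by omega) (by omega)).bind fun w hw => (z.maxN (by omega) (by omega)).bind
                fun N _ => .charge le_rfl trivial
  exact this.1.trans (by omega)

/-- The rows of `f - h` have few terms, small exponents and small coefficients. -/
structure RowFine (c : CostSetup f T0 D p L0 A) (row : Row) : Prop where
  vec : ∀ x ∈ row.vec, x ≤ p
  length : row.vec.length = n
  poly : Fine L0 (2 * D * p) c.B1 T0 row.poly
  polyMod : Fine L0 (2 * D * p) c.B1 T0 row.polyMod

include c in
lemma lat_sub (hf : Found (coeffFun f) h) (m : Fin n →₀ ℕ) :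
    Lat L0 A ((coeffFun f - termSum n h) m) := by
  rw [hf.sub_apply]
  split_ifs
  exacts [.zero _ _, c.lat m]

lemma support_sub (hf : Found (coeffFun f) h) :
    (coeffFun f - termSum n h).support ⊆ f.support := by
  simp [hf.support_sub, support_coeffFun]

lemma rowFine (hI : LoopInv f p T rows h) (hr : row ∈ rows) : c.RowFine row := by
  obtain ⟨d, -, hd⟩ := hI.rows.exists_base hr
  have hp := c.prime.pos
  have hvec : ∀ x ∈ row.vec, x ≤ p := by
    rw [hd]; exact fun x hx => le_of_mem_baseVec hp hx
  have hcard := (card_le_card (support_sub hI.found)).trans c.card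
  refine ⟨hvec, by rw [hd, length_baseVec], (hI.rows.poly row hr).fine (fun m hm => ?_)
    (c.lat_sub hI.found) hcard, (hI.rows.polyMod row hr).fine (fun m hm => ?_)
    (c.lat_sub hI.found) hcard⟩
  · have := c.toSetup.weight_lt hp hvec (support_sub hI.found hm)
    nlinarith
  · have := mod_lt (weight row.vec m) hp
    have := c.D_pos
    nlinarith

include c in
lemma termFine (hf : Found (coeffFun f) h) {u : Term} (hu : u ∈ h) :
    TermFine L0 n (2 * D * p) A u := by
  have h1 := hf.length u hu
  have h2 := hf.coeff u hu
  have h3 : expVec n u.1 ∈ f.support := by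
    rw [← support_coeffFun, mem_support_iff, h2]; exact hf.ne_zero u hu
  refine ⟨h1, fun x hx => ?_, h2 ▸ c.lat _⟩
  have h4 := c.degree _ h3
  rw [sum_expVec h1] at h4
  have h5 := List.single_le_sum (fun _ _ => Nat.zero_le _) x hx
  have := c.prime.pos
  nlinarith

lemma bits_bestRow (hrows : ∀ r ∈ rows, c.RowFine r) :
    (bestRow rows).bits ≤ rows.length * (4 * c.R) + 1 := by
  obtain ⟨hTR, -, heR, hTn, -⟩ := c.R_facts
  obtain ⟨-, -, -, h8, -⟩ := c.Q_facts
  have hQ : T0 ≤ c.z.Q := by omega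
  have h1 := (Within.foldList (l := rows) (k := 0) (s := (0, (⟨[], [], []⟩ : Row)))
    (Inv := fun _ b => b.1 ≤ T0) (K := T0 + 1 + (c.z.e + 1)) (Nat.zero_le _)
    (f := fun best row => lengthList row.polyMod >>= fun m => ltN best.1 m >>= fun b =>
      if b then charge 1 (m, row) else charge 1 best) fun i b r hr _ hb => by
    have hl := (hrows r hr).polyMod.2
    refine Within.bind (p := fun m => m ≤ T0) ⟨succ_le_succ hl, hl⟩ fun m hm =>
      (c.z.ltN (hb.trans hQ) (hm.trans hQ)).bind fun x _ => ?_
    cases x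
    exacts [⟨le_rfl, hb⟩, ⟨le_rfl, hm⟩]).1
  refine (show (bestRow rows).bits ≤ _ from h1).trans ?_
  have := c.z.one_le_e
  gcongr; omega

lemma bits_testTerm (hrows : ∀ r ∈ rows, c.RowFine r) {u : Term}
    (hu : TermFine L0 n (2 * D * p) c.B1 u) (hlen : rows.length ≤ 4 * (n * T0)) {δ₁ δ₂ : ℕ}
    (hδ : δ₁ + δ₂ + 1 ≤ 4 * (n * T0)) :
    (testTerm p δ₁ δ₂ rows u).bits ≤ 140 * (n * (T0 * c.R)) := by
  obtain ⟨hn, hT, -, -, he⟩ := c.pos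
  obtain ⟨hQ, -, -, h8, hQ3, -, hp⟩ := c.Q_facts
  obtain ⟨hTR, -, heR, hTQ, h2, h3, -, -, hB⟩ := c.R_facts
  have h1 : Within (testTerm p δ₁ δ₂ rows u) (4 * (n * T0) + 1 + (4 * (n * T0) *
      (16 * c.R + (2 * T0 + 1 + (T0 + 1 + c.z.e)) + 1) + 1 + (4 * (n * T0) + 1 + c.z.e)))
      fun _ => True := by
    refine .bind (p := fun l => l.Sublist rows) (K := 4 * (n * T0) + 1) ⟨show δ₁ + δ₂ + 1 + 1 ≤ _ by
      omega, List.take_sublist _ _⟩ fun l hl => .bind (p := fun r => r.length ≤ 4 * (n * T0))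
        (K := 4 * (n * T0) * (16 * c.R + (2 * T0 + 1 + (T0 + 1 + c.z.e)) + 1) + 1) ?_ fun r hr =>
          .bind (p := fun m => m ≤ 4 * (n * T0)) (K := 4 * (n * T0) + 1) ⟨succ_le_succ hr, hr⟩
            fun m hm => c.z.ltN (by omega) (by omega)
    refine ((Within.filterList (K := 16 * c.R + (2 * T0 + 1 + (T0 + 1 + c.z.e))) fun row hr => ?_).imp
      fun r hr => hr.length_le.trans (hl.length_le.trans hlen)).mono (by
        have := hl.length_le.trans hlen; gcongr)
    have hf := hrows row (hl.subset hr)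
    exact ((c.z.subTerms (X := 2 * D * p) hQ3 hp hf.vec (le_trans (by gcongr; omega) hQ)
      hB (by omega : T0 ≤ 2 * T0) hT hn p hp (hf.polyMod.mono hQ3 le_rfl le_rfl)
        hu).2.bind fun g hg => .bind (p := fun m => m ≤ T0 + 1) (K := 2 * T0 + 1)
          ⟨show g.length + 1 ≤ _ by have := hg.2; omega, hg.2⟩ fun m hm => .bind (p := fun m => m ≤ T0)
            (K := T0 + 1) ⟨succ_le_succ hf.polyMod.2, hf.polyMod.2⟩ fun k hk =>
              c.z.ltN (by omega) (by omega)).1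
  refine h1.1.trans ?_
  have h6 : n * T0 ≤ n * (T0 * c.R) := Nat.mul_le_mul_left n (le_mul_of_pos_right _ (by omega))
  have h4 : 4 * (n * T0) * (16 * c.R + (2 * T0 + 1 + (T0 + 1 + c.z.e)) + 1) ≤
      4 * (n * T0) * (23 * c.R) := by gcongr; omega
  have h5 : 4 * (n * T0) * (23 * c.R) = 92 * (n * (T0 * c.R)) := by ring
  omega

lemma bits_updateRow {s : List Term} (hf : c.RowFine row)
    (hs : ∀ u ∈ s, TermFine L0 n (2 * D * p) A u) (hlen : s.length ≤ T0) :
    (updateRow p s row).bits ≤ 37 * (T0 * c.R) := by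
  obtain ⟨hn, hT, -, -, he⟩ := c.pos
  obtain ⟨hQ, -, -, -, hQ3, -, hp⟩ := c.Q_facts
  obtain ⟨-, -, heR, -, h3, -, -, -, hB⟩ := c.R_facts
  have key := fun g (hg : Fine L0 (2 * D * p) c.B1 T0 g) => c.z.foldSub hQ3 hp hf.vec
    (le_trans (by gcongr; omega) hQ) hB hT hn p hp (hg.mono hQ3 le_rfl le_rfl) hs hlen
  have h1 := (key _ hf.poly).1
  have h2 := (key _ hf.polyMod).2
  simp only [updateRow, bits_bind, bits_charge]
  rw [R] at heR h3 ⊢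
  omega

/-- The costs of the images of `f` under one of the shifted substitutions. -/
lemma bits_shifted (hf : Found (coeffFun f) h) (hr : c.RowFine row) (hlen : h.length ≤ T0) {k : ℕ}
    : (SparseInterp.addAt p k row.vec >>= fun v => interpolate c.P
        (fun x => eval x f) T0 (2 * D * p) v >>= fun g =>
          foldList (subTerm v) g h).bits ≤ c.I + 20 * (T0 * c.R) := by
  obtain ⟨hn, hT, hD, hp0, -⟩ := c.pos
  obtain ⟨hQ, hQ1, hQ2, -, hQ3, -, hp⟩ := c.Q_facts
  have hB := c.R_facts.2.2.2.2.2.2.2.2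
  have hp2 : 2 * p ≤ c.z.Q := (Nat.mul_le_mul_right p hp0).trans hQ2
  have hv : ∀ x ∈ row.vec.modify k (· + p), x ≤ 2 * p := fun x => le_of_mem_modify hr.vec
  have hw : ∀ m ∈ f.support, weight (row.vec.modify k (· + p)) m < 2 * D * p := fun m hm => by
    have := c.toSetup.weight_lt (by omega) hv hm
    linarith
  have h1 := c.z.addAt hp k fun x hx => (hr.vec x hx).trans hp
  have h2 := c.bits_interpolate _ _ hQ1 (by rw [List.length_modify, hr.length]) hv le_rfl
    (Nat.mul_pos (by omega) (by omega)) hw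
  have h3 : Fine L0 (2 * D * p) c.B1 T0 _ := Rep.fine (F := coeffFun f) (Rep.sparseList _)
    (fun m hm => (hw m (by rwa [support_coeffFun] at hm)).le) c.lat (by rw [support_coeffFun]; exact c.card)
  have h4 := (c.z.foldSub hQ3 hp2 hv hQ hB hT hn p hp (h3.mono hQ3 le_rfl le_rfl)
    (fun u hu => c.termFine hf hu) hlen).1
  have h5 : (n + 1) * c.z.e ≤ T0 * c.R := (Nat.mul_le_mul_right c.z.e (by omega : n + 1 ≤ n + T0)).trans
    (le_mul_of_pos_left _ hT)
  rw [hr.length] at h1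
  simp only [bits_bind, val_addAt, val_interpolate _ f (row.vec.modify k (· + p)) c.card hw]
  rw [R] at h5 ⊢
  omega

set_option maxHeartbeats 800000 in
lemma bits_pass (hI : LoopInv f p T rows h) (hT : T ≤ T0) (hrow : row ∈ rows) :
    (pass c.P (fun x => eval x f) p D T0 T rows h row).bits ≤ n * c.I + 500 * c.Y := by
  obtain ⟨hn, hT0, hD0, hp0, he⟩ := c.pos
  obtain ⟨hQ, hQ1, hQ2, h8, hQ3, hQ4, hp⟩ := c.Q_facts
  obtain ⟨hTR, hnR, hR, hTn, hRR, hnT', hnT, -, hB⟩ := c.R_facts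
  have hr := c.rowFine hI hrow
  have hrows : ∀ r ∈ rows, c.RowFine r := fun r hr => c.rowFine hI hr
  have hD : 2 * D ≤ c.z.Q := le_trans (le_mul_of_pos_right _ (by omega)) hQ3
  have hh : h.length ≤ T0 := by
    grind [support_coeffFun, hI.found.card_support_sub, c.card]
  have hgs : ∀ g ∈ (range n).map (shiftedImage c.P f p D T0 h row.vec),
      Fine L0 (2 * D * p) c.B1 T0 g := by
    intro g hg
    obtain ⟨k, -, rfl⟩ := mem_map.1 hg
    refine Rep.fine (c.toSetup.rep_shiftedImage c.P hr.vec hI.found.length k) (fun m hm => ?_)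
      (c.lat_sub hI.found) ((card_le_card (support_sub hI.found)).trans c.card)
    have := c.toSetup.weight_lt (b := 2 * p) (by omega) (fun x hx => le_of_mem_modify (k := k) hr.vec hx)
      (support_sub hI.found hm)
    linarith
  have hk := found_keptTerms c.toSetup hI hT c.P hrow
  set S := keptTerms c.P f p D T0 T rows h row
  have hts := Within.filterMapList (l := row.polyMod) fun t ht => c.z.tsTerm (n := n) (T := T0)
    (p := p) (y := p) (D := D) hQ3 hp hp (le_of_add_le_left hB) hT0 hn hr.vec
    (le_trans (by gcongr; omega) hQ) hQ4 (by omega)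
    ⟨(hr.polyMod.1 t ht).1.trans hQ3, (hr.polyMod.1 t ht).2⟩ hr.poly hgs (by simp)
  have hlen := hI.rows.length_eq
  have hN := numBases_le hn hT0
  have hNT := numBases_mono n hT
  have hδ := le_numBases n T
  have hl1 := hts.2.1.trans hr.polyMod.2
  have hfl := Within.filterList (f := testTerm p ((n - 1) * (T - 1)) ((n - 1) * T) rows)
    fun u hu => c.bits_testTerm hrows (hts.2.2 u hu) (by omega)
      (δ₁ := (n - 1) * (T - 1)) (δ₂ := (n - 1) * T) (by omega)
  have hl2 : S.length ≤ T0 := (List.length_filter_le _ _).trans hl1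
  have hsh := bits_mapList_le (l := range n) fun k _ => c.bits_shifted hI.found hr hh (k := k)
  have hup := bits_mapList_le (l := rows.take (numBases n (T - S.length))) fun r hr' =>
    c.bits_updateRow (hrows r (List.mem_of_mem_take hr')) (fun u hu => c.termFine (hI.found.append hk)
      (List.mem_append_right h hu)) hl2
  have hp1 := bits_params c.z rfl h8 hn hT0 hT
  have hS := (sub_le T S.length).trans hT
  have hp2 := bits_params c.z rfl h8 hn hT0 hS
  have hrow1 : (rows.take (numBases n (T - S.length))).length ≤ 4 * (n * T0) :=
    (List.length_take_le' _ _).trans (by omega)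
  have hnum := numBases_mono n hS
  rw [length_range] at hsh
  have h : Within (pass c.P (fun x => eval x f) p D T0 T rows h row) _ fun _ => True :=
    .bind_eq (c.z.mulN (by omega) (by omega)).1 rfl (.bind_eq (c.z.mulN hD hp).1 rfl (.bind_eq hsh
      (a := (range n).map (shiftedImage c.P f p D T0 h row.vec)) (by
        rw [val_mapList]; simp only [val_bind, val_addAt, val_foldList]; rfl) (.bind_eq
    (hts.1.trans (Nat.add_le_add_right (Nat.mul_le_mul_right _ hr.polyMod.2) 1)) rfl (.bind_eq hp1
    (val_params n T) (.bind_eq (hfl.1.trans (Nat.add_le_add_right (Nat.mul_le_mul_right _ hl1) 1))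
    (val_filterList _ _) (.bind_eq (succ_le_succ hh) rfl (.bind_eq (a := S.length) (succ_le_succ hl2) rfl (.bind_eq
    (a := T - S.length) (c.z.subN (by omega) (by omega)).1 rfl (.bind_eq hp2 (val_params _ _) (.bind_eq
    (K := 4 * (n * T0) + 1) (succ_le_succ (by omega)) rfl (.bind_eq (hup.trans (Nat.add_le_add_right
    (Nat.mul_le_mul_right _ hrow1) 1)) rfl (K := _) (L := 0) ⟨le_rfl, trivial⟩)))))))))))
  refine h.1.trans ?_
  have e1 : n * (c.I + 20 * (T0 * c.R) + 1) = n * c.I + 20 * (n * (T0 * c.R)) + n := by ring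
  have e2 : T0 * (26 * (n * (T0 * c.z.e)) + 1) ≤ 26 * c.Y + T0 := by
    calc _ = 26 * (n * (T0 * (T0 * c.z.e))) + T0 := by ring
      _ ≤ _ := by rw [Y]; gcongr
  have e3 : T0 * (140 * (n * (T0 * c.R)) + 1) = 140 * c.Y + T0 := by rw [Y]; ring
  have e4 : 4 * (n * T0) * (37 * (T0 * c.R) + 1) = 148 * c.Y + 4 * (n * T0) := by rw [Y]; ring
  have e5 : n * T0 ≤ n * (T0 * c.R) :=
    Nat.mul_le_mul_left n (le_mul_of_pos_right _ (by omega))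
  omega

end CostSetup

namespace CostSetup

variable {n T0 D p L0 A T : ℕ} {f : MvPolynomial (Fin n) ℂ} (c : CostSetup f T0 D p L0 A)
  {rows : List Row} {h : List Term}

lemma bits_bestRow_add (hI : LoopInv f p T rows h) (hT : T ≤ T0) :
    (bestRow rows).bits + (eqN (bestRow rows).val.1 0).bits ≤ 18 * c.Y := by
  obtain ⟨hn, hT0, -, -, he⟩ := c.pos
  obtain ⟨-, -, h1, hTn, h2, h3, h4, -⟩ := c.R_facts
  obtain ⟨-, -, -, h8, -⟩ := c.Q_facts
  have hrows : ∀ r ∈ rows, c.RowFine r := fun r hr => c.rowFine hI hr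
  have h5 := c.bits_bestRow hrows
  have h6 := Nat.mul_le_mul_right (4 * c.R) (hI.rows.length_eq.le.trans ((numBases_mono n hT).trans
    (numBases_le hn hT0)))
  have h7 : 4 * (n * T0) * (4 * c.R) = 16 * (n * (T0 * c.R)) := by ring
  have h9 := (c.z.eqN (a := (bestRow rows).val.1) (b := 0) (by
    obtain ⟨-, hb | ⟨hb, hb'⟩⟩ := bestRow_spec rows
    · omega
    · have := (hrows _ hb).polyMod.2
      omega) (Nat.zero_le _)).1
  omega

lemma bits_mainLoop (hI : LoopInv f p T rows h) (hT : T ≤ T0) (fuel : ℕ) :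
    (mainLoop c.P (fun x => eval x f) p D T0 fuel T rows h).bits ≤
      (fuel + 1) * (n * c.I + 520 * c.Y) := by
  have he : 1 ≤ c.Y := by
    have := c.R_facts; have := c.pos; omega
  induction fuel generalizing T rows h with
  | zero =>
    have h1 := c.bits_bestRow_add hI hT
    grind [mainLoop_zero, bits_bind, bits_charge]
  | succ fuel ih =>
    have h1 := c.bits_bestRow_add hI hT
    rw [mainLoop_succ, add_mul, one_mul]
    simp only [bits_bind, val_eqN, decide_eq_true_eq]
    split_ifs with h0
    · simp only [bits_charge]; omega
    · obtain ⟨h2, h3⟩ := hI.pass c.toSetup hT c.P h0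
      have h4 := c.bits_pass hI hT ((bestRow_spec rows).2.resolve_left h0).1
      grind [bits_bind]

lemma bits_initRow {d : ℕ} (hd : d ≤ p) :
    (initRow c.P (fun x => eval x f) T0 (D * p) p d).bits ≤ c.I + 30 * (T0 * c.R) := by
  obtain ⟨-, hT, -, -, he⟩ := c.pos
  obtain ⟨-, -, h1, -, h2, -⟩ := c.R_facts
  obtain ⟨-, hQ1, hQ2, -, hQ3, -, hp⟩ := c.Q_facts
  have hp0 := c.prime.pos
  have hvec : ∀ x ∈ baseVec n p d, x ≤ p := fun x hx => le_of_mem_baseVec hp0 hx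
  have hw : ∀ m ∈ f.support, weight (baseVec n p d) m < D * p := fun m hm =>
    c.toSetup.weight_lt hp0 hvec hm
  have h3 := c.z.substVector c.n_pos ((Nat.mul_le_mul_left p hd).trans hQ2) (hd.trans hp) hp
    c.prime.one_lt
  have h4 := c.bits_interpolate (D * p) (baseVec n p d) hQ1 (length_baseVec d)
    (fun x hx => (hvec x hx).trans (by omega)) (Nat.mul_le_mul_right p (by omega))
    (Nat.mul_pos c.D_pos hp0) hw
  have h5 : Fine L0 (D * p) (T0 * A) T0 _ := Rep.fine (F := coeffFun f) (Rep.sparseList _)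
    (fun m hm => (hw m (by rwa [support_coeffFun] at hm)).le) c.lat (by rw [support_coeffFun]; exact c.card)
  have h6 := c.z.reduceMod hp (by omega) (h5.mono (le_trans (Nat.mul_le_mul_right p (by omega)) hQ3)
    le_rfl le_rfl)
  simp only [initRow, bits_bind, val_substVector c.prime.one_lt, bits_charge,
    val_interpolate_baseVec c.toSetup]
  have h7 : 6 * ((T0 + 1) ^ 2 * c.z.e) ≤ 24 * (T0 * c.R) := by
    calc _ ≤ 6 * ((T0 + T0) ^ 2 * c.z.e) := by gcongr
      _ = 24 * (T0 * (T0 * c.z.e)) := by ring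
      _ ≤ _ := by rw [R]; gcongr; omega
  grind

end CostSetup

lemma bits_miPolyBase {n T D L0 A p : ℕ} {f : MvPolynomial (Fin n) ℂ} (c : CostSetup f T D p L0 A)
    (hp : p = thePrime n T D) : (miPolyBase c.P (fun x => eval x f) T D).bits ≤
      6 * (n * T * c.I) + 6 * (p * (p * c.z.e)) + 2000 * (T * c.Y) := by
  have hS := c.toSetup
  have hpdef := hp
  obtain ⟨hn, hT, -, hp0, he⟩ := c.pos
  obtain ⟨-, -, h1, -, h2, h3, h4, h5, -⟩ := c.R_facts
  obtain ⟨-, -, -, h8, -, -, hp⟩ := c.Q_facts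
  have hN := numBases_le hn hT
  have hpar := CostSetup.bits_params c.z rfl h8 hn hT le_rfl
  have h10 : max n (max (numBases n T) D) ≤ p := hpdef ▸ (val_primeAtLeast _).2.1
  have hb := c.bases
  have hD := c.le_prime
  have hn1 : n ≤ n * T := le_mul_of_pos_right _ hT
  have hm1 := (c.z.maxN (a := numBases n T) (b := D) (hb.trans hp) (hD.trans hp)).1
  have hm2 := (c.z.maxN (a := n) (b := max (numBases n T) D) (by omega) (by omega)).1
  have hm3 := (c.z.maxN (a := max n (max (numBases n T) D)) (b := 2) (by omega) (by
    have := c.prime.two_le; omega)).1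
  have hm4 := (c.z.mulN (a := D) (b := p) (hD.trans hp) hp).1
  have hf := (c.z.findPrime hp (max (max n (max (numBases n T) D)) 2 + 1)
    (c := max (max n (max (numBases n T) D)) 2) (le_max_right _ _)).2 hpdef.ge
  have hf' : (p + 1 - max (max n (max (numBases n T) D)) 2) * (6 * (p * c.z.e)) ≤
      6 * (p * (p * c.z.e)) := by
    calc _ ≤ p * (6 * (p * c.z.e)) := by gcongr; omega
      _ = _ := by ring
  have hinit := bits_mapList_le (l := range' 1 (numBases n T))
    (f := initRow c.P (fun x => eval x f) T (D * p) p) fun d hd => c.bits_initRow (by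
      rw [mem_range'_1] at hd; omega)
  have hloop := c.bits_mainLoop (loopInv_init hS c.P) le_rfl T
  rw [length_range'] at hinit
  have hinit' := Nat.mul_le_mul_right (c.I + 30 * (T * c.R) + 1) hN
  have e1 : 4 * (n * T) * (c.I + 30 * (T * c.R) + 1) = 4 * (n * T * c.I) + 120 * c.Y + 4 * (n * T) := by
    ring
  have e2 : n * T ≤ n * (T * c.R) := Nat.mul_le_mul_left n (le_mul_of_pos_right _ (by omega))
  have e3 : c.Y ≤ T * c.Y := le_mul_of_pos_left _ hT
  have e4 : (T + 1) * (n * c.I + 520 * c.Y) = n * T * c.I + n * c.I + 520 * (T * c.Y) + 520 * c.Y := by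
    ring
  have e5 : n * c.I ≤ n * T * c.I := Nat.mul_le_mul_right _ hn1
  have hprime : (primeAtLeast (max n (max (numBases n T) D))).bits ≤
      c.z.e + 6 * (p * (p * c.z.e)) := Nat.add_le_add hm3 (hf.trans hf')
  rw [miPolyBase_eq]
  simp only [bits_bind, val_params, val_maxN, val_mulN, val_mapList]
  rw [← thePrime, ← hpdef]
  omega

lemma Lat.bitSize_le {L0 B : ℕ} (hL : 0 < L0) {z : ℂ} (h : Lat L0 B z) :
    bitSize z ≤ 2 * (size B + size L0) := by
  obtain ⟨v, h1, h2, rfl⟩ := h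
  have key : ∀ N : ℤ, |N| ≤ B → ratSize ((N : ℚ) / (L0 : ℤ)) ≤ size B + size L0 := fun N hN => by
    obtain ⟨h3, h4⟩ := natAbs_num_le (N := N) hL rfl
    refine Nat.add_le_add (size_le_size ?_) (size_le_size h4)
    grind
  grind [bitSize, toComplex, toRat_cast, digitCoeff]

lemma Lat.of_bitSize_le {H : ℕ} {z : ℂ} (hz : IsGaussRat z) (h : bitSize z ≤ H) :
    Lat (2 ^ H).factorial (2 ^ H * (2 ^ H).factorial) z := by
  obtain ⟨⟨q, r⟩, rfl⟩ := hz.exists_toComplex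
  simp only [bitSize, toComplex, toRat_cast, ratSize] at h
  have key : ∀ q : ℚ, size q.num.natAbs ≤ H → size q.den ≤ H → ∃ N : ℤ,
      |N| ≤ ((2 ^ H * (2 ^ H).factorial : ℕ) : ℤ) ∧ q = (N : ℚ) / (((2 ^ H).factorial : ℕ) : ℤ) := by
    intro q h1 h2
    obtain ⟨k, hk⟩ := Nat.dvd_factorial q.den_pos (size_le.1 h2).le
    have hk0 : 0 < k := Nat.pos_of_ne_zero fun h0 => by
      grind
    refine ⟨q.num * k, ?_, ?_⟩
    · rw [abs_mul, abs_cast, Int.abs_eq_natAbs]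
      have h3 : q.num.natAbs * k ≤ 2 ^ H * (2 ^ H).factorial := Nat.mul_le_mul
        (size_le.1 h1).le (hk ▸ le_mul_of_pos_left k q.den_pos)
      exact_mod_cast h3
    · have : (k : ℚ) ≠ 0 := by positivity
      have h4 : (q.den : ℚ) ≠ 0 := by exact_mod_cast q.den_ne_zero
      rw [hk]
      push_cast
      grind [Rat.num_div_den]
  obtain ⟨N, h1, h2⟩ := key q (by omega) (by omega)
  obtain ⟨M, h3, h4⟩ := key r (by omega) (by omega)
  exact ⟨(N, M), h1, h3, by rw [digitCoeff, ← h2, ← h4]⟩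

lemma Lat.isGaussRat {L0 B : ℕ} {z : ℂ} (h : Lat L0 B z) : IsGaussRat z := by
  obtain ⟨v, -, -, rfl⟩ := h
  exact ⟨⟨_, rfl⟩, ⟨_, rfl⟩⟩

/-- The cost of the interpolation. -/
lemma exists_bits_interpolate {L0 : ℕ} (hL : 0 < L0) (A : ℕ) : ∃ c, ∀ {B n T G y : ℕ}
    {f : MvPolynomial (Fin n) ℂ} {s : List ℕ} (z : Sizes L0 B), (∀ m, Lat L0 A (f.coeff m)) →
    f.support.card ≤ T → 1 ≤ n → 1 ≤ T → 1 ≤ G → s.length = n → (∀ x ∈ s, x ≤ y) →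
    2 * T * y ≤ z.Q → y ≤ z.Q → 2 * T ≤ z.Q → (∀ m ∈ f.support, weight s m < G) →
      (interpolate interpP (fun x => eval x f) T G s).bits ≤
        11 * (n * (T * z.e)) + c * (T ^ 2 * G * size (T * G) ^ 5) := by
  classical
  obtain ⟨a, ha⟩ := (ProgInput.dom_cost hL A).le_mul fun h => h.one_le_V
  obtain ⟨b, hb⟩ := (ProgInput.dom_W (A := A) hL).le_mul fun h => h.one_le_V
  refine ⟨a + 8 * b, fun {B n T G y f s} z hlat hcard hn hT hG hs hy hQ hyQ hTQ hw => ?_⟩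
  set g := mapDomain (weight s) (coeffFun f) with hg
  have hl : ∀ e, Lat L0 (T * A) (g e) := lat_mapDomain _ hlat (by rwa [support_coeffFun])
  choose c hc1 hc2 hc3 using hl
  obtain ⟨vs, h1, h2, h3⟩ := exists_values (fun e => Lat.isGaussRat ⟨c e, hc1 e, hc2 e, hc3 e⟩) T
  let h : ProgInput L0 A :=
    { T := T, G := G, c := c, g := g, vs := vs, one_le := hT, one_le' := hG
      digits := ⟨fun e he => by
        obtain ⟨m, hm, rfl⟩ := mem_image.1 (mapDomain_support he)
        exact hw m (by rwa [support_coeffFun] at hm), hc3⟩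
      small := fun e => ⟨hc1 e, hc2 e⟩
      card := (card_le_card mapDomain_support).trans (Finset.card_image_le.trans (by
        rwa [support_coeffFun]))
      len := h1
      eq := h2 }
  have h4 : interpP.cost (encInput T G vs) ≤ a * (T ^ 2 * G * size (T * G) ^ 5) := ha h
  have h5 : (h.sized hL).W ≤ b * (T ^ 2 * G * size (T * G) ^ 5) := hb h
  have h6 : T * h.U ≤ (h.sized hL).W :=
    (Nat.mul_le_mul (le_succ T) (le_softMul (h.sized hL).one_le)).trans
      (h.sized hL).softMul_le_W.2.1
  have hv : ∀ j, j < 2 * T → bitSize (powerSum g j) ≤ 4 * h.U := fun j hj => by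
    have hj' : j < vs.length := h1 ▸ hj
    have h7 := (h.sized hL).bdd vs[j] (getElem_mem hj')
    rw [h2 j hj', bitSize, toComplex, toRat_cast, toRat_cast, ratSize, ratSize]
    obtain ⟨⟨h8, h9⟩, h10, h11⟩ := h7
    have e1 : ∀ k : ℕ, intLen (k : ℤ) = size k + 1 := fun k => by rw [intLen, Int.natAbs_natCast]
    change intLen _ ≤ h.U at h8 h9 h10 h11
    rw [e1] at h9 h11
    rw [intLen] at h8 h10
    omega
  have he := z.one_le_e
  have hSe := z.S_le_e
  have hq : ∀ j ∈ range (2 * T), (mapList (mulN j) s >>= fun E => query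
      (fun x => eval x f) E).bits ≤ 4 * (n * z.e) + 4 * h.U := fun j hj => by
    have hj' := List.mem_range.1 hj
    have e1 := bits_mapList_le (l := s) (f := mulN j) fun x hx => (z.mulN (a := j) (b := x)
      (hj'.le.trans hTQ) ((hy x hx).trans hyQ)).1
    have e2 : ((s.map (j * ·)).map bitLen).sum ≤ n * z.S := by
      rw [map_map, ← hs, ← length_map (f := bitLen ∘ (j * ·)), ← smul_eq_mul]
      refine List.sum_le_card_nsmul _ _ fun x hx => ?_
      obtain ⟨k, hk, rfl⟩ := mem_map.1 hx
      exact z.nat _ ((Nat.mul_le_mul hj'.le (hy k hk)).trans hQ)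
    have e3 := hv j hj'
    have e4 : eval (fun i : Fin n => (2 : ℂ) ^ (s.map (j * ·)).getD i 0) f = powerSum g j :=
      eval_two_pow f s j
    simp only [bits_bind, val_mapList, val_mulN]
    change _ + (_ + _ + 1) ≤ _
    simp only [e4]
    rw [hs] at e1
    have e5 : n * z.S ≤ n * z.e := Nat.mul_le_mul_left n (by omega)
    have e6 : n * 2 ≤ n * z.e := Nat.mul_le_mul_left n he
    rw [mul_add, mul_one] at e1
    omega
  have h7 := bits_mapList_le hq
  have h8 : (interpP.run (BenOrTiwari.input T G ((range (2 * T)).map (powerSum g)))).2 ≤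
      a * (T ^ 2 * G * size (T * G) ^ 5) := by
    rw [BenOrTiwari.input, h3]; exact h4
  rw [length_range] at h7
  have e1 : 2 * T * (4 * (n * z.e) + 4 * h.U + 1) = 8 * (n * (T * z.e)) + 8 * (T * h.U) + 2 * T := by
    ring
  have e2 : T * 2 ≤ T * z.e := Nat.mul_le_mul_left T he
  have e3 : T * z.e ≤ n * (T * z.e) := le_mul_of_pos_left _ hn
  have e4 : (a + 8 * b) * (T ^ 2 * G * size (T * G) ^ 5) = a * (T ^ 2 * G * size (T * G) ^ 5) +
    8 * (b * (T ^ 2 * G * size (T * G) ^ 5)) := by ring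
  have e5 : (mapList (fun j => mapList (mulN j) s >>= fun E => query
      (fun x => eval x f) E) (range (2 * T))).val =
      (range (2 * T)).map (powerSum g) := by
    simp only [val_mapList, val_bind, val_mulN, query, eval_two_pow, ← hg]
  rw [← e5] at h8
  refine (Nat.add_le_add h7 h8 : (interpolate _ _ T G s).bits ≤ _).trans ?_
  omega

lemma thePrime_le {n T D : ℕ} (hn : 1 ≤ n) (hT : 1 ≤ T) : thePrime n T D ≤ 8 * max (n * T) D := by
  obtain ⟨-, -, h⟩ := val_primeAtLeast (max n (max (numBases n T) D))
  have h1 := numBases_le hn hT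
  have h2 : n ≤ n * T := le_mul_of_pos_right _ hT
  rw [thePrime]
  omega

/-- The cost of MIPolyBase for coefficients of bounded size. -/
lemma exists_bits_miPolyBase (H : ℕ) : ∃ C, ∀ {n T D : ℕ} {f : MvPolynomial (Fin n) ℂ}, 1 ≤ n →
    1 ≤ T → f.totalDegree < D → f.support.card ≤ T →
    (∀ m, IsGaussRat (f.coeff m) ∧ bitSize (f.coeff m) ≤ H) →
      (miPolyBase interpP (fun x => eval x f) T D).bits ≤
        C * (mainBound n T D * size (mainBound n T D) ^ 5) := by
  obtain ⟨L0, A, hL, hlat⟩ : ∃ L0 A : ℕ, 0 < L0 ∧ ∀ z : ℂ, IsGaussRat z → bitSize z ≤ H → Lat L0 A z :=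
    ⟨_, _, Nat.factorial_pos _, fun z => Lat.of_bitSize_le⟩
  obtain ⟨a, ha⟩ := exists_bits_interpolate hL A
  set s0 := 20 + 4 * size A + 4 * size L0 with hs0
  refine ⟨4450 * (2 * s0 ^ 2) + 96 * 6 ^ 5 * a, fun {n T D f} hn hT hD hcard hc => ?_⟩
  set X := mainBound n T D with hX
  set M := max (n * T) D with hM
  have hD1 : 1 ≤ D := by omega
  have hXM : X = n * T ^ 3 * D * M := rfl
  have hnTM : n * T ≤ M := le_max_left _ _
  have hDM : D ≤ M := le_max_right _ _
  have hM1 : 1 ≤ M := hD1.trans hDM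
  have hT3 : T ≤ T ^ 3 := Nat.le_self_pow three_ne_zero T
  have hnTD : n * T * D ≤ n * T ^ 3 * D := by gcongr
  have hnTD1 : 1 ≤ n * T * D := Nat.mul_pos (Nat.mul_pos hn hT) hD1
  have hMX : M ≤ X := le_mul_of_pos_left M (hnTD1.trans hnTD)
  have hMM : M * M ≤ X := by
    rw [hXM]
    refine Nat.mul_le_mul_right M (le_trans ?_ hnTD)
    exact max_le (le_mul_of_pos_right _ hD1) (le_mul_of_pos_left _ (Nat.mul_pos hn hT))
  have hX1 : 1 ≤ X := hM1.trans hMX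
  have hTX : T ≤ X := (le_mul_of_pos_left T hn).trans (hnTM.trans hMX)
  set lam := size X with hlam
  have hlam1 : 1 ≤ lam := size_pos.2 hX1
  set p := thePrime n T D with hp
  have hp8 : p ≤ 8 * M := thePrime_le hn hT
  have hlat' : ∀ m, Lat L0 A (f.coeff m) := fun m => hlat _ (hc m).1 (hc m).2
  let z : Sizes L0 (2 * (T * (T * A))) :=
    { Q := 256 * (X * X)
      S := s0 * lam
      one_le := Nat.mul_pos (by norm_num) (Nat.mul_pos hX1 hX1)
      nat := fun b hb => by
        have h1 := size_le_size hb
        have h2 := size_mul_le 256 (X * X)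
        have h3 := size_mul_le X X
        have h4 : size 256 = 9 := by decide
        have h5 : 20 * lam ≤ s0 * lam := Nat.mul_le_mul_right _ (by omega)
        rw [bitLen]
        omega
      coef := fun w hw => by
        have h1 := hw.bitSize_le hL
        have h2 := size_mul_le 2 (T * (T * A))
        have h3 := size_mul_le T (T * A)
        have h4 := size_mul_le T A
        have h5 := size_le_size hTX
        have h6 : size 2 = 2 := by decide
        have h7 : s0 * lam = 20 * lam + 4 * (size A * lam) + 4 * (size L0 * lam) := by
          rw [hs0]; ring
        have h8 : size A ≤ size A * lam := le_mul_of_pos_right _ hlam1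
        have h9 : size L0 ≤ size L0 * lam := le_mul_of_pos_right _ hlam1
        omega }
  have hQ : 4 * (n * (T * (D * (p * p)))) ≤ z.Q := by
    calc 4 * (n * (T * (D * (p * p)))) ≤ 4 * (n * (T ^ 3 * (D * (8 * M * (8 * M))))) := by gcongr
      _ = 256 * (X * M) := by rw [hXM]; ring
      _ ≤ 256 * (X * X) := by gcongr
  let c : CostSetup f T D p L0 A :=
    { setup_thePrime hD hcard with
      z := z
      lat := hlat'
      n_pos := hn
      T_pos := hT
      D_pos := hD1
      le_Q := hQ
      P := interpP
      I := 11 * (n * (T * z.e)) + a * (T ^ 2 * (16 * (D * M)) * (6 * lam) ^ 5)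
      bits_interpolate := fun G s h2 hs hy hG hG1 hw => by
        have hG' : G ≤ 16 * (D * M) := by
          calc G ≤ 2 * D * (8 * M) := hG.trans (Nat.mul_le_mul_left _ hp8)
            _ = _ := by ring
        refine (ha z hlat' hcard hn hT hG1 hs hy h2 (le_trans (le_mul_of_pos_left _ (by omega)) h2)
          (le_trans (le_mul_of_pos_right _ (by
            have := (setup_thePrime hD hcard).prime.pos; omega)) h2) hw).trans
          (Nat.add_le_add_left (Nat.mul_le_mul_left a (Nat.mul_le_mul (Nat.mul_le_mul_left _ hG')
            (pow_le_pow_left ?_ 5))) _)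
        have h3 : T * G ≤ 16 * X := by
          calc T * G ≤ T * (16 * (D * M)) := Nat.mul_le_mul_left T hG'
            _ = 16 * (1 * T * D * M) := by ring
            _ ≤ 16 * (n * T ^ 3 * D * M) := by gcongr
        have h4 := size_le_size h3
        have h5 := size_mul_le 16 X
        have h6 : size 16 = 5 := by decide
        omega }
  have h := bits_miPolyBase c hp
  have e0 : z.e = 2 * s0 ^ 2 * lam ^ 2 := by
    show 2 * (s0 * lam) ^ 2 = _
    ring
  have e1 : z.e ≤ 2 * s0 ^ 2 * lam ^ 5 := by
    rw [e0]; exact Nat.mul_le_mul_left _ (pow_le_pow_right hlam1 (by norm_num))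
  have e2 : n * T * (n * T) ≤ X := (Nat.mul_le_mul hnTM hnTM).trans hMM
  have e3 : p * p ≤ 64 * X := (Nat.mul_le_mul hp8 hp8).trans (by linarith)
  have e4 : T * (n * (T * (T * (n + T)))) ≤ 2 * X := by
    calc T * (n * (T * (T * (n + T)))) = n * T ^ 3 * 1 * (n * 1 + 1 * T) := by ring
      _ ≤ n * T ^ 3 * D * (n * T + n * T) := by gcongr
      _ ≤ n * T ^ 3 * D * (M + M) := by gcongr
      _ = 2 * X := by rw [hXM]; ring
  refine h.trans ?_
  show 6 * (n * T * (11 * (n * (T * z.e)) + a * (T ^ 2 * (16 * (D * M)) * (6 * lam) ^ 5))) +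
    6 * (p * (p * z.e)) + 2000 * (T * (n * (T * (T * ((n + T) * z.e))))) ≤ _
  calc _ = 66 * (n * T * (n * T)) * z.e + 96 * 6 ^ 5 * a * (n * T ^ 3 * D * M * lam ^ 5) +
        6 * (p * p) * z.e + 2000 * (T * (n * (T * (T * (n + T))))) * z.e := by ring
    _ ≤ 66 * X * (2 * s0 ^ 2 * lam ^ 5) + 96 * 6 ^ 5 * a * (X * lam ^ 5) +
        6 * (64 * X) * (2 * s0 ^ 2 * lam ^ 5) + 2000 * (2 * X) * (2 * s0 ^ 2 * lam ^ 5) := by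
      rw [← hXM]; gcongr
    _ = _ := by ring

lemma size_le_log {X : ℕ} : (size X : ℝ) ≤ 4 * Real.log (2 + X) := by
  have h0 : (1 : ℝ) / 2 ≤ Real.log 2 := by have := Real.log_two_gt_d9; linarith
  have h1 : Real.log 2 ≤ Real.log (2 + X) := Real.log_le_log (by norm_num) (by simp)
  rcases Nat.eq_zero_or_pos (size X) with h | h
  · rw [h]; push_cast; linarith
  have h2 : 2 ^ (size X - 1) ≤ X := Nat.lt_size.1 (by omega)
  have h3 : ((size X - 1 : ℕ) : ℝ) * Real.log 2 ≤ Real.log (2 + X) := by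
    rw [← Real.log_pow]
    refine Real.log_le_log (by positivity) ?_
    have : ((2 ^ (size X - 1) : ℕ) : ℝ) ≤ X := by exact_mod_cast h2
    push_cast at this
    linarith
  rw [Nat.cast_sub h] at h3
  push_cast at h3
  nlinarith

end

end

end SparseInterp

open SparseInterp in
theorem corollary3p7 :
    (∃ C : ℕ, ∀ (P : Prog) (n T D : ℕ) (f : MvPolynomial (Fin n) ℂ),
      1 ≤ n → 1 ≤ T → f.totalDegree < D → f.support.card ≤ T →
        (∃ L : List Term,
          (miPolyBase P (fun x => MvPolynomial.eval x f) T D).val = some L ∧ IsSparseForm L f) ∧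
        (miPolyBase P (fun x => MvPolynomial.eval x f) T D).queries ≤ C * (n * T ^ 2)) ∧
    ∃ P : Prog, BenOrTiwari.IsImplementation P ∧
      ∃ k : ℕ, ∀ H : ℕ, ∃ C : ℝ, ∀ (n T D : ℕ) (f : MvPolynomial (Fin n) ℂ),
        1 ≤ n → 1 ≤ T → f.totalDegree < D → f.support.card ≤ T →
        (∀ m, IsGaussRat (f.coeff m) ∧ bitSize (f.coeff m) ≤ H) →
          ((miPolyBase P (fun x => MvPolynomial.eval x f) T D).bits : ℝ) ≤
            C * (mainBound n T D : ℝ) * Real.log (2 + (mainBound n T D : ℝ)) ^ k := by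
  refine ⟨⟨10, fun P n T D f hn hT hD hc => miPolyBase_correct P hn hT hD hc⟩, Prog.interpP,
    isImplementation_interpP, 5, fun H => ?_⟩
  obtain ⟨C, hC⟩ := exists_bits_miPolyBase H
  refine ⟨C * 4 ^ 5, fun n T D f hn hT hD hc hH => ?_⟩
  have h1 : ((miPolyBase Prog.interpP (fun x => MvPolynomial.eval x f) T D).bits : ℝ) ≤
      C * (mainBound n T D * Nat.size (mainBound n T D) ^ 5) := by
    exact_mod_cast hC hn hT hD hc hH
  have h2 : (Nat.size (mainBound n T D) : ℝ) ^ 5 ≤ (4 * Real.log (2 + mainBound n T D)) ^ 5 :=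
    pow_le_pow_left₀ (Nat.cast_nonneg _) size_le_log 5
  calc _ ≤ (C : ℝ) * (mainBound n T D * (4 * Real.log (2 + mainBound n T D)) ^ 5) := by
        refine h1.trans ?_; gcongr
    _ = _ := by ring
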